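/- **Setting.** Let $d\in\mathbb N$ and let $\Omega$ be a second countable smooth $d$-dimensional manifold (boundary allowed) with a distance $|x-y|$ inducing its topology and a Borel measure $dx$ such that every point has a neighbourhood in a chart on which the distance and $dx$ are comparable, up to positive constants, with the Euclidean distance and Lebesgue measure of the chart. (Examples: a bounded open set $\Omega\subset\mathbb R^d$; a Riemannian manifold with its intrinsic distance and volume.) Let $h:\Omega\times\Omega\to\mathbb R$ be continuous and symmetric, $C_X(x,y)=\log|x-y|^{-1}+h(x,y)$, and let $X$ be a log-correlated Gaussian field with covariance $C_X$: a random linear functional $f\mapsto\langle X,f\rangle$ on $C_c^\infty(\Omega)$ such that $\langle X,f\rangle$ is centered Gaussian with variance $\iint C_X(x,y)f(x)f(y)\,dx\,dy$. Let $(\delta,x,u)\mapsto\rho_{\delta,x}(u)\ge0$ be continuous on $(0,1]\times\Omega\times\Omega$ with $\rho_{\delta,x}(u)\,du\to\boldsymbol\delta_x$ vaguely as $\delta\to0$, for every $x\in\Omega$. For each $N$ let $X_N$ be a jointly measurable real random function on $\Omega$, defined on a probability space $(\mathcal S_N,\mathbb P_N)$, almost surely locally integrable for $N\ge1$, such that $\langle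 X_N,f\rangle=\int fX_N\,dx\to\langle X,f\rangle$ in distribution for every $f\in C_c^\infty(\Omega)$ and such that, for $N\ge 1$, $\delta\in(0,1]$, $x\in\Omega$, the integral $X_{N,\delta}(x)=\int X_N(u)\rho_{\delta,x}(u)\,du$ converges absolutely almost surely. Put $$\mathcal D_\infty=\{\zeta\in\mathbb C:0\le\operatorname{Re}\zeta\le\sqrt{2d}\},\qquad \mathcal D_R=\{\zeta\in\mathcal D_\infty:|\operatorname{Im}\zeta|\le R\}.$$ **Assumption 1.** The integrals $C_{X,\delta}(x,z)=\int C_X(u,z)\rho_{\delta,x}(u)\,du$ and $C_{X,\delta,\epsilon}(x,z)=\iint C_X(u,v)\rho_{\delta,x}(u)\rho_{\epsilon,z}(v)\,du\,dv$ converge absolutely for all $\delta,\epsilon\in(0,1]$ and $x,z\in\Omega$, and for every compact $K\subset\Omega$ there is $c_K\in(0,1]$ such that both equal $-\log(|x-z|\vee\delta)+O(1)$ uniformly for $x,z\in K$ and $0<\epsilon\le\delta\le c_K$. For $N\ge1$, $q\in\mathbb N_0$, $\xi\in\mathbb R^q$, $\delta\in(0,1]^q$, $z\in\Omega^q$, $\zeta_1,\zeta_2\in\mathcal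 D_\infty$ and $x_1\ne x_2$ in $\Omega$, let $f_{\delta,z}=\sum_j\xi_j\rho_{\delta_j,z_j}$ and define $\Psi_N=\Psi_{N,\delta}^{(\zeta_1,\zeta_2,\xi)}(x_1,x_2;z)$ by $$\mathbb E_N\Big[e^{\zeta_1X_N(x_1)+\zeta_2X_N(x_2)+\sum_j\xi_jX_{N,\delta_j}(z_j)}\Big]=\Psi_N\,e^{\frac{\zeta_1^2+\zeta_2^2}2\log N}\,e^{\zeta_1\zeta_2C_X(x_1,x_2)+\sum_{i=1}^2\zeta_i\int C_X(x_i,u)f_{\delta,z}(u)du+\frac12\iint C_X(u,v)f_{\delta,z}(u)f_{\delta,z}(v)\,du\,dv},$$ where the exponential moments on the left are assumed to exist. **Assumption 2.** For every $q$: (1) $(\zeta_1,\zeta_2)\mapsto\Psi_{N,\delta}^{(\zeta_1,\zeta_2,\xi)}(x_1,x_2;z)$ is analytic in $\mathcal D_\infty^2$ (i.e. continuous on $\mathcal D_\infty^2$ and analytic in its interior). (2) There is a continuous $\Psi:\mathcal D_\infty\times\Omega\to\mathbb C$, the same for all $q$, with $\Psi(0,x)=1$ and $\Psi(t,x)>0$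 for $t\in[0,\sqrt{2d}]$, $x\in\Omega$, such that for every compact $K\subset\Omega$, all $\eta,R>0$ and every fixed $\xi\in\mathbb R^q$, $$\Psi_{N,\delta}^{(\zeta_1,\zeta_2,\xi)}(x_1,x_2;z)=\Psi(\zeta_1,x_1)\Psi(\zeta_2,x_2)(1+o(1))\quad(N\to\infty)$$ uniformly for $\zeta_1,\zeta_2\in\mathcal D_R$, $x_1,x_2\in K$ with $|x_1-x_2|\ge N^{\eta-1}$, $z\in K^q$ and $\delta\in[N^{-1+\eta},1]^q$. **Assumption 3.** (1) For all sufficiently small $\eta>0$, all $c>0$, every compact $K\subset\Omega$, every $q$ and all fixed $\xi\in\mathbb R^q$, $\delta\in(0,1]^q$, $z\in\Omega^q$, the same asymptotics hold uniformly for $\zeta_1,\zeta_2\in\mathcal D_{(\log N)^\eta}$ and $x_1,x_2\in K$ with $|x_1-x_2|\ge c$. (2) For every compact $K\subset\Omega$ there are constants $C,\varkappa$ with $|\Psi(\zeta,x)|\le Ce^{|\zeta|^\varkappa}$ for $\zeta\in\mathcal D_\infty$, $x\in K$. **Statement.** Let $\gamma\in(0,\sqrt{2d})$, let $g:\Omega\to\mathbb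 R$ be continuous, and let $$\mu_N(dx)=\frac{e^{\gamma X_N(x)}}{\mathbb E_N[e^{\gamma X_N(x)}]}\,dx,\qquad \nu_N(dx)=\frac{\mathbf 1\{X_N(x)\ge\gamma\log N+g(x)\}}{\mathbb P_N(X_N(x)\ge\gamma\log N)}\,dx,$$ where $\nu_N$ is assumed to be almost surely a Radon (locally finite) measure for all large $N$. Let $\mu_{X,\gamma}$ be a random Radon measure on $\Omega$ (in the main case the Gaussian multiplicative chaos of $X$; only its being the limit of $\mu_N$ is used). Under Assumptions 1, 2 and 3: 1. if $\mu_N\to\mu_{X,\gamma}$ in distribution as $N\to\infty$, with respect to the vague topology on Radon measures, then $\nu_N\to e^{-\gamma g}\mu_{X,\gamma}$ in distribution with respect to the vague topology; 2. if all the $X_N$ and $\mu_{X,\gamma}$ are realized on a common probability space and $\mu_N\to\mu_{X,\gamma}$ in probability with respect to the vague topology, then $\nu_N\to e^{-\gamma g}\mu_{X,\gamma}$ in probability with respect to the vague topology. -/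

import Mathlib

open MeasureTheory ProbabilityTheory Filter Topology Set
open scoped Manifold ContDiff NNReal CompactlySupported

noncomputable section

namespace ThickPoints

/-! ### The space on which the fields live -/

section Space

variable {d : ℕ} {H : Type*} [TopologicalSpace H]
  {Ω : Type*} [MetricSpace Ω] [MeasurableSpace Ω] [ChartedSpace H Ω]

/-- `Ω` is a `d`-dimensional manifold (boundary allowed) with chart model `I`, equipped with a
distance and a volume measure that are, locally in charts, comparable with the Euclidean distance
and with Lebesgue measure.  Bounded open subsets of `ℝ^d` (Euclidean distance, Lebesgue measure)
and Riemannian manifolds (intrinsic distance, Riemannian volume, whose metric tensor `G` satisfies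
`c_K ≤ G ≤ C_K` on compact sets) are of this kind. -/
structure IsLocallyEuclidean (I : ModelWithCorners ℝ (EuclideanSpace ℝ (Fin d)) H)
    (vol : Measure Ω) : Prop where
  comparable : ∀ x₀ : Ω, ∃ U ∈ 𝓝 x₀, ∃ a > (0 : ℝ), ∃ b > (0 : ℝ),
    U ⊆ (extChartAt I x₀).source ∧
    (∀ x ∈ U, ∀ y ∈ U,
      a * dist (extChartAt I x₀ x) (extChartAt I x₀ y) ≤ dist x y ∧
      dist x y ≤ b * dist (extChartAt I x₀ x) (extChartAt I x₀ y)) ∧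
    (∀ A ⊆ U, MeasurableSet A →
      ENNReal.ofReal a * volume (extChartAt I x₀ '' A) ≤ vol A ∧
      vol A ≤ ENNReal.ofReal b * volume (extChartAt I x₀ '' A))

/-- Smooth compactly supported real functions on `Ω`. -/
def IsTestFunction (I : ModelWithCorners ℝ (EuclideanSpace ℝ (Fin d)) H) (f : Ω → ℝ) : Prop :=
  ContMDiff I 𝓘(ℝ, ℝ) ∞ f ∧ HasCompactSupport f

end Space

/-! ### Random Radon measures and the vague topology -/

section Vague

variable (Ω : Type*) [TopologicalSpace Ω] [MeasurableSpace Ω]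

/-- Locally finite Borel measures (on the spaces considered here these are the Radon measures). -/
def RadonMeasure : Type _ := {m : Measure Ω // IsLocallyFiniteMeasure m}

variable {Ω}

/-- The vague topology: the coarsest one making `m ↦ ∫ f dm` continuous for every continuous
compactly supported `f`. -/
instance : TopologicalSpace (RadonMeasure Ω) :=
  TopologicalSpace.induced (fun (m : RadonMeasure Ω) (f : C_c(Ω, ℝ)) => ∫ x, f x ∂m.1)
    inferInstance

instance : MeasurableSpace (RadonMeasure Ω) := borel _

instance : BorelSpace (RadonMeasure Ω) := ⟨rfl⟩

open Classical in
/-- A locally finite measure as an element of `RadonMeasure`.  The default value `0` is only used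
for measures that are not locally finite. -/
def toRadon (m : Measure Ω) : RadonMeasure Ω :=
  if hm : IsLocallyFiniteMeasure m then ⟨m, hm⟩ else ⟨0, inferInstance⟩

/-- The measure `e^{-γ g} m`. -/
def RadonMeasure.tilt [OpensMeasurableSpace Ω] (m : RadonMeasure Ω) (γ : ℝ) {g : Ω → ℝ}
    (hg : Continuous g) : RadonMeasure Ω :=
  ⟨m.1.withDensity (fun x => ENNReal.ofReal (Real.exp (-γ * g x))), by
    have := m.2
    exact IsLocallyFiniteMeasure.withDensity_ofReal
      (Real.continuous_exp.comp (continuous_const.mul hg))⟩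

/-- Convergence in probability of random Radon measures with respect to the (uniform structure of
the) vague topology: `∫ f dm_N → ∫ f dm` in probability for all continuous compactly supported
`f`. -/
def TendstoInProbabilityVaguely {S : Type*} [MeasurableSpace S] (Q : Measure S)
    (m : ℕ → S → RadonMeasure Ω) (M : S → RadonMeasure Ω) : Prop :=
  ∀ f : C_c(Ω, ℝ),
    TendstoInMeasure Q (fun N s => ∫ x, f x ∂(m N s).1) atTop (fun s => ∫ x, f x ∂(M s).1)

end Vague

/-! ### Log-correlated fields and their regularizations -/

section Fields

variable {Ω : Type*} [MetricSpace Ω] [MeasurableSpace Ω]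

/-- The covariance kernel `C_X(x,y) = log (1 / dist(x,y)) + h(x,y)`. -/
def cov (h : Ω → Ω → ℝ) (x y : Ω) : ℝ := -Real.log (dist x y) + h x y

/-- `∬ C_X(u,v) f(u) f(v) du dv`, which is `E⟨X,f⟩²`. -/
def covForm (vol : Measure Ω) (h : Ω → Ω → ℝ) (f : Ω → ℝ) : ℝ :=
  ∫ p : Ω × Ω, cov h p.1 p.2 * f p.1 * f p.2 ∂(vol.prod vol)

/-- A log-correlated Gaussian field with covariance kernel `cov h`, as a random linear functional
`f ↦ ⟨X,f⟩` on test functions. -/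
structure IsLogCorrelatedField {d : ℕ} {H : Type*} [TopologicalSpace H] [ChartedSpace H Ω]
    (I : ModelWithCorners ℝ (EuclideanSpace ℝ (Fin d)) H) (vol : Measure Ω) (h : Ω → Ω → ℝ)
    {S : Type*} [MeasurableSpace S] (Q : Measure S) (X : (Ω → ℝ) → S → ℝ) : Prop where
  linear : ∀ f₁ f₂ : Ω → ℝ, IsTestFunction I f₁ → IsTestFunction I f₂ → ∀ a b : ℝ,
    X (fun x => a * f₁ x + b * f₂ x) =ᵐ[Q] fun s => a * X f₁ s + b * X f₂ s
  gaussian : ∀ f : Ω → ℝ, IsTestFunction I f →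
    ∃ v : ℝ≥0, (v : ℝ) = covForm vol h f ∧ HasLaw (X f) (gaussianReal 0 v) Q

/-- `ρ δ x` is a continuous approximation of the identity: `ρ_{δ,x} ≥ 0` and `ρ_{δ,x} → δ_x`
vaguely as `δ → 0`. -/
structure IsApproximateIdentity (vol : Measure Ω) (ρ : ℝ → Ω → Ω → ℝ) : Prop where
  continuousOn : ContinuousOn (fun p : ℝ × Ω × Ω => ρ p.1 p.2.1 p.2.2) (Ioc 0 1 ×ˢ univ)
  nonneg : ∀ δ ∈ Ioc (0 : ℝ) 1, ∀ x u, 0 ≤ ρ δ x u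
  tendsto_dirac : ∀ (x : Ω) (f : C_c(Ω, ℝ)),
    Tendsto (fun δ => ∫ u, f u * ρ δ x u ∂vol) (𝓝[>] 0) (𝓝 (f x))

/-- `C_{X,δ}(x,z) = ∫ C_X(u,z) ρ_{δ,x}(u) du`. -/
def cov₁ (vol : Measure Ω) (h : Ω → Ω → ℝ) (ρ : ℝ → Ω → Ω → ℝ) (δ : ℝ) (x z : Ω) : ℝ :=
  ∫ u, cov h u z * ρ δ x u ∂vol

/-- `C_{X,δ,ε}(x,z) = ∬ C_X(u,v) ρ_{δ,x}(u) ρ_{ε,z}(v) du dv`. -/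
def cov₂ (vol : Measure Ω) (h : Ω → Ω → ℝ) (ρ : ℝ → Ω → Ω → ℝ) (δ ε : ℝ) (x z : Ω) : ℝ :=
  ∫ p : Ω × Ω, cov h p.1 p.2 * ρ δ x p.1 * ρ ε z p.2 ∂(vol.prod vol)

/-- Assumption on the smoothing kernels: the regularized covariances are well defined and equal
`-log (dist(x,z) ∨ δ) + O(1)`, uniformly on compact sets and for `0 < ε ≤ δ ≤ c_K`. -/
structure CovarianceAssumption (vol : Measure Ω) (h : Ω → Ω → ℝ) (ρ : ℝ → Ω → Ω → ℝ) : Prop where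
  integrable₁ : ∀ δ ∈ Ioc (0 : ℝ) 1, ∀ x z : Ω, Integrable (fun u => cov h u z * ρ δ x u) vol
  integrable₂ : ∀ δ ∈ Ioc (0 : ℝ) 1, ∀ ε ∈ Ioc (0 : ℝ) 1, ∀ x z : Ω,
    Integrable (fun p : Ω × Ω => cov h p.1 p.2 * ρ δ x p.1 * ρ ε z p.2) (vol.prod vol)
  bound : ∀ K : Set Ω, IsCompact K → ∃ c ∈ Ioc (0 : ℝ) 1, ∃ B : ℝ,
    ∀ x ∈ K, ∀ z ∈ K, ∀ δ ε : ℝ, 0 < ε → ε ≤ δ → δ ≤ c →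
      |cov₁ vol h ρ δ x z + Real.log (max (dist x z) δ)| ≤ B ∧
      |cov₂ vol h ρ δ ε x z + Real.log (max (dist x z) δ)| ≤ B

end Fields

/-! ### The approximating fields and their exponential moments -/

section Moments

variable {Ω : Type*} [MetricSpace Ω] [MeasurableSpace Ω]

/-- The smoothed field `X_{N,δ}(x) = ⟨X_N, ρ_{δ,x}⟩`. -/
def smoothed {S : Type*} (vol : Measure Ω) (ρ : ℝ → Ω → Ω → ℝ) (X : S → Ω → ℝ) (δ : ℝ) (x : Ω)
    (s : S) : ℝ :=
  ∫ u, X s u * ρ δ x u ∂vol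

/-- `X_N`, `N ∈ ℕ`, are (jointly measurable) random functions on `Ω`, possibly on different
probability spaces, whose pairings with test functions converge in distribution to those of `X`,
and whose smoothings are well defined. -/
structure IsApproximation {d : ℕ} {H : Type*} [TopologicalSpace H] [ChartedSpace H Ω]
    (I : ModelWithCorners ℝ (EuclideanSpace ℝ (Fin d)) H) (vol : Measure Ω) (ρ : ℝ → Ω → Ω → ℝ)
    {S : ℕ → Type*} [∀ N, MeasurableSpace (S N)] (P : ∀ N, Measure (S N))
    [∀ N, IsProbabilityMeasure (P N)] (XN : ∀ N, S N → Ω → ℝ)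
    {S' : Type*} [MeasurableSpace S'] (Q : Measure S') [IsProbabilityMeasure Q]
    (X : (Ω → ℝ) → S' → ℝ) : Prop where
  measurable : ∀ N, Measurable (fun p : S N × Ω => XN N p.1 p.2)
  locallyIntegrable : ∀ N ≥ 1, ∀ᵐ s ∂(P N), LocallyIntegrable (XN N s) vol
  smoothed_integrable : ∀ N ≥ 1, ∀ δ ∈ Ioc (0 : ℝ) 1, ∀ x : Ω,
    ∀ᵐ s ∂(P N), Integrable (fun u => XN N s u * ρ δ x u) vol
  tendsto : ∀ f : Ω → ℝ, IsTestFunction I f →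
    TendstoInDistribution (fun N s => ∫ x, f x * XN N s x ∂vol) atTop (X f) P Q

/-- The closed strip `𝒟_∞ = {0 ≤ Re ζ ≤ √(2d)}`. -/
def strip (d : ℕ) : Set ℂ := {ζ | 0 ≤ ζ.re ∧ ζ.re ≤ √(2 * d)}

/-- The box `𝒟_R = {ζ ∈ 𝒟_∞ : |Im ζ| ≤ R}`. -/
def box (d : ℕ) (R : ℝ) : Set ℂ := {ζ | ζ ∈ strip d ∧ |ζ.im| ≤ R}

/-- `f_{δ,z} = ∑_j ξ_j ρ_{δ_j,z_j}`. -/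
def mollifierSum (ρ : ℝ → Ω → Ω → ℝ) {q : ℕ} (ξ δ : Fin q → ℝ) (z : Fin q → Ω) (u : Ω) : ℝ :=
  ∑ j, ξ j * ρ (δ j) (z j) u

/-- The random variable
`exp (ζ₁ X_N(x₁) + ζ₂ X_N(x₂) + ∑_j ξ_j X_{N,δ_j}(z_j))`. -/
def expField {S : Type*} (vol : Measure Ω) (ρ : ℝ → Ω → Ω → ℝ) (X : S → Ω → ℝ) (ζ : ℂ × ℂ)
    (x₁ x₂ : Ω) {q : ℕ} (ξ δ : Fin q → ℝ) (z : Fin q → Ω) (s : S) : ℂ :=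
  Complex.exp (ζ.1 * (X s x₁ : ℂ) + ζ.2 * (X s x₂ : ℂ) +
    ((∑ j, ξ j * smoothed vol ρ X (δ j) (z j) s : ℝ) : ℂ))

/-- The Gaussian prediction for the expectation of `expField`. -/
def gaussianFactor (vol : Measure Ω) (h : Ω → Ω → ℝ) (ρ : ℝ → Ω → Ω → ℝ) (N : ℕ) (ζ : ℂ × ℂ)
    (x₁ x₂ : Ω) {q : ℕ} (ξ δ : Fin q → ℝ) (z : Fin q → Ω) : ℂ :=
  Complex.exp ((ζ.1 ^ 2 + ζ.2 ^ 2) / 2 * (Real.log N : ℂ)) *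
  Complex.exp (ζ.1 * ζ.2 * (cov h x₁ x₂ : ℂ)
    + ζ.1 * ((∫ u, cov h x₁ u * mollifierSum ρ ξ δ z u ∂vol : ℝ) : ℂ)
    + ζ.2 * ((∫ u, cov h x₂ u * mollifierSum ρ ξ δ z u ∂vol : ℝ) : ℂ)
    + 1 / 2 * (covForm vol h (mollifierSum ρ ξ δ z) : ℂ))

/-- `Ψ_{N,δ}^{(ζ₁,ζ₂,ξ)}(x₁,x₂;z)`, defined by
`E_N[expField] = Ψ_{N,δ}^{(ζ₁,ζ₂,ξ)}(x₁,x₂;z) * gaussianFactor`. -/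
def PsiN {S : Type*} [MeasurableSpace S] (P : Measure S) (vol : Measure Ω) (h : Ω → Ω → ℝ)
    (ρ : ℝ → Ω → Ω → ℝ) (X : S → Ω → ℝ) (N : ℕ) (ζ : ℂ × ℂ) (x₁ x₂ : Ω) {q : ℕ}
    (ξ δ : Fin q → ℝ) (z : Fin q → Ω) : ℂ :=
  (∫ s, expField vol ρ X ζ x₁ x₂ ξ δ z s ∂P) / gaussianFactor vol h ρ N ζ x₁ x₂ ξ δ z

/-- Assumption on the exponential moments down to mesoscopic scales.  The number `q` of smoothed
fields and their weights `ξ` are fixed (arbitrarily) as `N → ∞`; the relative error is uniform in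
all other parameters. -/
structure MesoscopicAssumption (d : ℕ) {S : ℕ → Type*} [∀ N, MeasurableSpace (S N)]
    (P : ∀ N, Measure (S N)) (vol : Measure Ω) (h : Ω → Ω → ℝ) (ρ : ℝ → Ω → Ω → ℝ)
    (XN : ∀ N, S N → Ω → ℝ) (Ψ : ℂ → Ω → ℂ) : Prop where
  /-- the exponential moments defining `Ψ_N` exist -/
  integrable : ∀ N ≥ 1, ∀ ζ ∈ strip d ×ˢ strip d, ∀ x₁ x₂ : Ω, x₁ ≠ x₂ →
    ∀ (q : ℕ) (ξ δ : Fin q → ℝ) (z : Fin q → Ω), (∀ j, δ j ∈ Ioc (0 : ℝ) 1) →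
      Integrable (expField vol ρ (XN N) ζ x₁ x₂ ξ δ z) (P N)
  /-- `Ψ_N` is analytic in `𝒟_∞²` (inside the closed strips, continuous up to the boundary) -/
  analytic : ∀ N ≥ 1, ∀ x₁ x₂ : Ω, x₁ ≠ x₂ →
    ∀ (q : ℕ) (ξ δ : Fin q → ℝ) (z : Fin q → Ω), (∀ j, δ j ∈ Ioc (0 : ℝ) 1) →
      ContinuousOn (fun ζ => PsiN (P N) vol h ρ (XN N) N ζ x₁ x₂ ξ δ z) (strip d ×ˢ strip d) ∧
      AnalyticOnNhd ℂ (fun ζ => PsiN (P N) vol h ρ (XN N) N ζ x₁ x₂ ξ δ z)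
        (interior (strip d ×ˢ strip d))
  continuousOn : ContinuousOn (fun p : ℂ × Ω => Ψ p.1 p.2) (strip d ×ˢ univ)
  at_zero : ∀ x, Ψ 0 x = 1
  pos : ∀ t : ℝ, 0 ≤ t → t ≤ √(2 * d) → ∀ x, ∃ r : ℝ, 0 < r ∧ Ψ (t : ℂ) x = (r : ℂ)
  asymptotics : ∀ K : Set Ω, IsCompact K → ∀ η > (0 : ℝ), ∀ R > (0 : ℝ),
    ∀ (q : ℕ) (ξ : Fin q → ℝ), ∀ ε > (0 : ℝ), ∀ᶠ N : ℕ in atTop,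
      ∀ ζ₁ ∈ box d R, ∀ ζ₂ ∈ box d R,
      ∀ x₁ ∈ K, ∀ x₂ ∈ K, (N : ℝ) ^ (η - 1) ≤ dist x₁ x₂ →
      ∀ z : Fin q → Ω, (∀ j, z j ∈ K) →
      ∀ δ : Fin q → ℝ, (∀ j, δ j ∈ Ioc (0 : ℝ) 1 ∧ (N : ℝ) ^ (-1 + η) ≤ δ j) →
        ‖PsiN (P N) vol h ρ (XN N) N (ζ₁, ζ₂) x₁ x₂ ξ δ z - Ψ ζ₁ x₁ * Ψ ζ₂ x₂‖
          ≤ ε * ‖Ψ ζ₁ x₁ * Ψ ζ₂ x₂‖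

/-- Assumption on the exponential moments at macroscopically separated points: here the imaginary
parts of `ζ₁, ζ₂` may grow like `(log N)^η` for all small `η > 0`. -/
structure MacroscopicAssumption (d : ℕ) {S : ℕ → Type*} [∀ N, MeasurableSpace (S N)]
    (P : ∀ N, Measure (S N)) (vol : Measure Ω) (h : Ω → Ω → ℝ) (ρ : ℝ → Ω → Ω → ℝ)
    (XN : ∀ N, S N → Ω → ℝ) (Ψ : ℂ → Ω → ℂ) : Prop where
  asymptotics : ∃ η₀ > (0 : ℝ), ∀ η ∈ Ioo 0 η₀, ∀ c > (0 : ℝ), ∀ K : Set Ω, IsCompact K →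
    ∀ (q : ℕ) (ξ δ : Fin q → ℝ) (z : Fin q → Ω), (∀ j, δ j ∈ Ioc (0 : ℝ) 1) →
    ∀ ε > (0 : ℝ), ∀ᶠ N : ℕ in atTop,
      ∀ ζ₁ ∈ box d (Real.log N ^ η), ∀ ζ₂ ∈ box d (Real.log N ^ η),
      ∀ x₁ ∈ K, ∀ x₂ ∈ K, c ≤ dist x₁ x₂ →
        ‖PsiN (P N) vol h ρ (XN N) N (ζ₁, ζ₂) x₁ x₂ ξ δ z - Ψ ζ₁ x₁ * Ψ ζ₂ x₂‖
          ≤ ε * ‖Ψ ζ₁ x₁ * Ψ ζ₂ x₂‖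
  growth : ∀ K : Set Ω, IsCompact K → ∃ C ϰ : ℝ, ∀ ζ ∈ strip d, ∀ x ∈ K,
    ‖Ψ ζ x‖ ≤ C * Real.exp (‖ζ‖ ^ ϰ)

/-! ### The exponential measures and the measures of thick points -/

/-- `μ_N(dx) = e^{γ X_N(x)} / E_N[e^{γ X_N(x)}] dx`. -/
def exponentialMeasure {S : Type*} [MeasurableSpace S] (P : Measure S) (vol : Measure Ω)
    (X : S → Ω → ℝ) (γ : ℝ) (s : S) : Measure Ω :=
  vol.withDensity fun x =>
    ENNReal.ofReal (Real.exp (γ * X s x)) / ∫⁻ s', ENNReal.ofReal (Real.exp (γ * X s' x)) ∂P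

/-- `ν_N(dx) = 1{X_N(x) ≥ γ log N + g(x)} / P_N(X_N(x) ≥ γ log N) dx`. -/
def thickMeasure {S : Type*} [MeasurableSpace S] (P : Measure S) (vol : Measure Ω)
    (X : S → Ω → ℝ) (γ : ℝ) (g : Ω → ℝ) (N : ℕ) (s : S) : Measure Ω :=
  vol.withDensity fun x =>
    {y | γ * Real.log N + g y ≤ X s y}.indicator 1 x / P {s' | γ * Real.log N ≤ X s' x}

end Moments

end ThickPoints

end

open ThickPoints

set_option linter.unusedSectionVars false

noncomputable section

namespace ThickPoints

/-! Write Y = X_N(x) − γ log N, σ = √(log N), w = e^{γ X_N(x)} / E[e^{γ X_N(x)}] and κ(y) = e^{-γy}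
1{y ≥ 0}. On the event that x is thick one can write 1 = e^{γX} e^{-γX}, so the density of ν_N is
exactly e^{-γg} w · σκ(Y − g)/t with t = σ E[w κ(Y)] (`indicator_div_measure_thick`). Since w is the
density of μ_N, everything follows once ∫ F w (σκ(Y − g)/t − 1) dx tends to 0 in L¹ for bounded F of
compact support (`MesoscopicAssumption.tendsto_lintegral_thick`). Slutsky's theorem in the vague
topology and the continuity of m ↦ e^{-γg} m then transfer the limit from μ_N to ν_N.

Under the tilted law w dP the variable Y/σ is asymptotically standard Gaussian. As κ lives on scale
1, it only sees the Gaussian density at 0, so the mean of σκ(Y − g)/t tends to 1 whatever g is. The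
fluctuations disappear after integration in x because Y(x₁)/σ and Y(x₂)/σ become independent for x₁
≠ x₂. This is a second moment argument with two obstacles.

First, the exponential moments are controlled for ζ with bounded imaginary part, that is, for
frequencies up to Rσ of Y/σ, whereas κ has a jump. Up to a small error in L¹(w dP), κ is replaced by
a multiple of a function p with compactly supported Fourier transform, and the constant 1 by the
slowly varying Fejér cutoff F(εY/σ). The multiple is chosen so that both terms have the same
Gaussian mass (`MesoscopicAssumption.exists_kernel_approx`). For the resulting D = σp(Y − g) −
F(εY/σ), Fubini reduces every moment to the given exponential moments, and E[w₁w₂D₁D₂] tends to 0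
pointwise.

Second, E[w₁w₂] is of order |x₁ − x₂|^{-γ²}, which need not be integrable. So the smoothed fields at
the scales e^{-k} are forced by a smooth barrier to stay within order βk of their tilted mean γk,
and Y is capped at β log N. By Girsanov and Markov the barrier factor at scale k costs e^{-β²k/2},
so starting at a large k₀ it changes little in L¹ (`MesoscopicAssumption.one_point_removal`). With
the barrier the exponent falls from γ² to γ²/2 + 2βγ < d at distances above N^{η−1}
(`MesoscopicAssumption.two_point_barrier_bound`). Below that distance the cap bounds the second
moment by N^{γ²/2+γβ} up to powers of σ, and this loses against the volume N^{-(1−η)d} of the near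
diagonal.

The barrier must not spoil the pointwise limit. Finitely many barrier factors are smooth compactly
supported functions of finitely many smoothed fields. The real exponential moments of those fields
against w₁w₂D₁D₂ tend to 0; Taylor series carry this over to imaginary exponents, and Fourier
inversion to test functions (`tendsto_integral_mul_prod_of_tendsto_exp`). The remaining factors are
removed as above. Dominated convergence then gives the vanishing of the second moment
(`lintegral_pair_tendsto`). -/

/-! ### Band limited functions -/

/-- `p` is a real function whose Fourier transform is the continuous compactly supported `φ`. -/
structure BandLimited (p : ℝ → ℝ) (φ : ℝ → ℂ) : Prop where
  continuous : Continuous φ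
  compact : HasCompactSupport φ
  eq : ∀ y, (p y : ℂ) = ∫ t : ℝ, φ t * Complex.exp (t * y * Complex.I)

lemma norm_cexp_mul_I (t y : ℝ) : ‖Complex.exp (t * y * Complex.I)‖ = 1 := by
  rw [← Complex.ofReal_mul, Complex.norm_exp_ofReal_mul_I]

lemma integrable_mul_char {φ : ℝ → ℂ} (h : Integrable φ) (y : ℝ) :
    Integrable (fun t : ℝ => φ t * Complex.exp (t * y * Complex.I)) := by
  refine h.mul_bdd (c := 1) (by fun_prop) (ae_of_all _ fun t => ?_)
  rw [norm_cexp_mul_I]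

lemma BandLimited.integrable {p : ℝ → ℝ} {φ : ℝ → ℂ} (h : BandLimited p φ) : Integrable φ :=
  h.continuous.integrable_of_hasCompactSupport h.compact

lemma BandLimited.bounded {p : ℝ → ℝ} {φ : ℝ → ℂ} (h : BandLimited p φ) :
    ∃ C R : ℝ, 0 < C ∧ 0 < R ∧ (∀ t, ‖φ t‖ ≤ C) ∧ ∀ t, R < |t| → φ t = 0 := by
  obtain ⟨C, hC⟩ := h.continuous.bounded_above_of_compact_support h.compact
  obtain ⟨R, hR⟩ := h.compact.isCompact.isBounded.subset_closedBall 0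
  refine ⟨max C 1, max R 1, by positivity, by positivity,
    fun t => (hC t).trans (le_max_left _ _), fun t ht => ?_⟩
  by_contra hne
  have := hR (subset_tsupport _ hne)
  simp only [Metric.mem_closedBall, dist_zero_right, Real.norm_eq_abs] at this
  exact absurd (this.trans (le_max_left _ _)) (not_le.2 ht)

lemma BandLimited.add {p₁ p₂ : ℝ → ℝ} {φ₁ φ₂ : ℝ → ℂ} (h₁ : BandLimited p₁ φ₁)
    (h₂ : BandLimited p₂ φ₂) :
    BandLimited (fun y => p₁ y + p₂ y) (fun t => φ₁ t + φ₂ t) where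
  continuous := h₁.continuous.add h₂.continuous
  compact := h₁.compact.add h₂.compact
  eq y := by
    simp only [add_mul]
    rw [integral_add (integrable_mul_char h₁.integrable y) (integrable_mul_char h₂.integrable y),
      ← h₁.eq, ← h₂.eq]
    push_cast; ring

lemma BandLimited.const_mul {p : ℝ → ℝ} {φ : ℝ → ℂ} (h : BandLimited p φ) (c : ℝ) :
    BandLimited (fun y => c * p y) (fun t => c * φ t) where
  continuous := continuous_const.mul h.continuous
  compact := h.compact.mul_left
  eq y := by
    simp only [mul_assoc]
    rw [integral_const_mul]
    push_cast
    rw [h.eq]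
    simp only [mul_assoc]

lemma BandLimited.shift {p : ℝ → ℝ} {φ : ℝ → ℂ} (h : BandLimited p φ) (b : ℝ) :
    BandLimited (fun y => p (y + b)) (fun t => φ t * Complex.exp (t * b * Complex.I)) where
  continuous := h.continuous.mul (by fun_prop)
  compact := h.compact.mul_right
  eq y := by
    rw [h.eq]
    refine integral_congr_ae (ae_of_all _ fun t => ?_)
    simp only [mul_assoc]
    rw [← Complex.exp_add]
    push_cast
    ring_nf

/-- Conjugating the integral and substituting −t for t shows that taking the real part symmetrizes
the transform. -/
lemma bandLimited_re {φ : ℝ → ℂ} (hc : Continuous φ) (hs : HasCompactSupport φ) :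
    BandLimited (fun y => (∫ t : ℝ, φ t * Complex.exp (t * y * Complex.I)).re)
      (fun t => (φ t + (starRingEnd ℂ) (φ (-t))) / 2) := by
  have hi : Integrable φ := hc.integrable_of_hasCompactSupport hs
  have hc' : Continuous fun t => (starRingEnd ℂ) (φ (-t)) :=
    Complex.continuous_conj.comp (hc.comp continuous_neg)
  have hs' : HasCompactSupport fun t => (starRingEnd ℂ) (φ (-t)) :=
    (hs.comp_homeomorph (Homeomorph.neg ℝ)).comp_left (g := starRingEnd ℂ) (map_zero _)
  refine ⟨(hc.add hc').div_const _, ?_, fun y => ?_⟩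
  · simp only [div_eq_mul_inv]
    exact (hs.add hs').mul_right
  · rw [Complex.re_eq_add_conj, ← integral_conj]
    have h2 : ∫ t : ℝ, (starRingEnd ℂ) (φ t * Complex.exp (t * y * Complex.I)) =
        ∫ t : ℝ, (starRingEnd ℂ) (φ (-t)) * Complex.exp (t * y * Complex.I) := by
      rw [← integral_neg_eq_self]
      refine integral_congr_ae (ae_of_all _ fun t => ?_)
      simp only [map_mul, ← Complex.exp_conj, Complex.conj_ofReal, Complex.conj_I]
      push_cast
      ring_nf
    rw [h2, ← integral_add (integrable_mul_char hi y)
      (integrable_mul_char (hc'.integrable_of_hasCompactSupport hs') y), ← integral_div]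
    refine integral_congr_ae (ae_of_all _ fun t => ?_)
    ring

/-- A compactly supported φ has all moments, so its Fourier transform, of which p is a rescaling, is
smooth. -/
lemma BandLimited.continuous_self {p : ℝ → ℝ} {φ : ℝ → ℂ} (h : BandLimited p φ) :
    ContDiff ℝ ∞ p := by
  have h1 : ContDiff ℝ ∞ (FourierTransform.fourier φ) := by
    refine Real.contDiff_fourier (N := ⊤) fun n _ => ?_
    exact ((continuous_norm.pow n).mul h.continuous.norm).integrable_of_hasCompactSupport
      h.compact.norm.mul_left
  have h2 : p = fun y => Complex.reCLM (FourierTransform.fourier φ (-y / (2 * Real.pi))) := by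
    ext y
    rw [Real.fourier_real_eq_integral_exp_smul]
    have := congrArg Complex.re (h.eq y)
    rw [Complex.ofReal_re] at this
    rw [this, Complex.reCLM_apply]
    congr 1
    refine integral_congr_ae (ae_of_all _ fun t => ?_)
    simp only [smul_eq_mul]
    rw [mul_comm]
    have hpi : (Real.pi : ℂ) ≠ 0 := by exact_mod_cast Real.pi_pos.ne'
    congr 2
    push_cast
    field_simp
  rw [h2]
  exact Complex.reCLM.contDiff.comp (h1.comp (contDiff_neg.div_const _))

/-- Fourier inversion at 0. The local limit theorem sees p only through φ(0), and this identity
reads that number as the mass of p. -/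
lemma BandLimited.integral_eq {p : ℝ → ℝ} {φ : ℝ → ℂ} (h : BandLimited p φ) (hp : Integrable p) :
    2 * Real.pi * φ 0 = ((∫ y, p y : ℝ) : ℂ) := by
  have key : FourierTransform.fourier φ = fun w => (p (-(2 * Real.pi) * w) : ℂ) := by
    ext w
    rw [Real.fourier_real_eq_integral_exp_smul, h.eq]
    refine integral_congr_ae (ae_of_all _ fun t => ?_)
    simp only [smul_eq_mul]
    rw [mul_comm]
    congr 2
    push_cast; ring
  have hpi : (-(2 * Real.pi)) ≠ 0 := by have := Real.pi_pos; linarith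
  have hint : Integrable (FourierTransform.fourier φ) := by
    rw [key]
    exact (hp.comp_mul_left' hpi).ofReal
  have hinv := congrFun (Continuous.fourierInv_fourier_eq h.continuous h.integrable hint) 0
  rw [Real.fourierInv_eq', key] at hinv
  simp only [inner_zero_right, mul_zero, Complex.ofReal_zero, zero_mul, Complex.exp_zero,
    one_smul] at hinv
  rw [← hinv, integral_complex_ofReal, Measure.integral_comp_mul_left p]
  rw [abs_inv, abs_neg, abs_of_pos (by positivity : 0 < 2 * Real.pi)]
  have := Real.pi_pos.ne'
  simp only [smul_eq_mul]
  push_cast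
  have h3 : (Real.pi : ℂ) ≠ 0 := by exact_mod_cast this
  field_simp

/-! ### The Fejér kernel -/

/-- The triangle function. -/
def tri (t : ℝ) : ℝ := max 0 (1 - |t|)

lemma continuous_tri : Continuous tri := by unfold tri; fun_prop

lemma tri_nonneg (t : ℝ) : 0 ≤ tri t := le_max_left _ _

lemma tri_le_one (t : ℝ) : tri t ≤ 1 := max_le zero_le_one (by linarith [abs_nonneg t])

lemma tri_eq_zero {t : ℝ} (h : 1 ≤ |t|) : tri t = 0 := max_eq_left (by linarith)

lemma tri_neg (t : ℝ) : tri (-t) = tri t := by simp [tri]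

lemma hasCompactSupport_tri : HasCompactSupport tri := by
  refine HasCompactSupport.intro (isCompact_Icc (a := -1) (b := 1)) fun t ht => tri_eq_zero ?_
  by_contra hlt
  exact ht (abs_le.1 (not_le.1 hlt).le)

lemma integrable_tri : Integrable tri :=
  continuous_tri.integrable_of_hasCompactSupport hasCompactSupport_tri

/-- The Fejér kernel. -/
def fejer (y : ℝ) : ℝ := if y = 0 then 1 else 2 * (1 - Real.cos y) / y ^ 2

lemma fejer_nonneg (y : ℝ) : 0 ≤ fejer y := by
  unfold fejer
  split_ifs
  · exact zero_le_one
  · have := Real.cos_le_one y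
    exact div_nonneg (by linarith) (by positivity)

lemma fejer_le_one (y : ℝ) : fejer y ≤ 1 := by
  unfold fejer
  split_ifs with h
  · exact le_rfl
  · rw [div_le_one (by positivity)]
    have := Real.one_sub_sq_div_two_le_cos (x := y)
    linarith

lemma integral_even_eq {f : ℝ → ℝ} (hf : ∀ t, f (-t) = f t) (h0 : ∀ t, 1 ≤ |t| → f t = 0)
    (hi : Integrable f) : ∫ t, f t = 2 * ∫ t in (0:ℝ)..1, f t := by
  have h1 : ∫ t, f t = ∫ t in (-1:ℝ)..1, f t := by
    rw [intervalIntegral.integral_eq_integral_of_support_subset]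
    intro t ht
    by_contra hn
    refine ht (h0 t ?_)
    by_contra hlt
    have := abs_lt.1 (not_le.1 hlt)
    exact hn ⟨this.1, this.2.le⟩
  have h2 : ∫ t in (-1:ℝ)..0, f t = ∫ t in (0:ℝ)..1, f t := by
    have := intervalIntegral.integral_comp_neg (a := 0) (b := 1) f
    simp only [hf, neg_zero] at this
    exact this.symm
  rw [h1, ← intervalIntegral.integral_add_adjacent_intervals (b := 0) hi.intervalIntegrable
    hi.intervalIntegrable, h2]
  ring

lemma integral_tri_cos (y : ℝ) : ∫ t, tri t * Real.cos (t * y) = fejer y := by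
  have hi : Integrable fun t => tri t * Real.cos (t * y) :=
    (continuous_tri.mul (by fun_prop)).integrable_of_hasCompactSupport hasCompactSupport_tri.mul_right
  rw [integral_even_eq (fun t => by rw [tri_neg]; simp) (fun t ht => by rw [tri_eq_zero ht, zero_mul])
    hi]
  have h1 : ∫ t in (0:ℝ)..1, tri t * Real.cos (t * y) =
      ∫ t in (0:ℝ)..1, (1 - t) * Real.cos (t * y) := by
    refine intervalIntegral.integral_congr fun t ht => ?_
    rw [uIcc_of_le zero_le_one] at ht
    simp only [tri, abs_of_nonneg ht.1]
    rw [max_eq_right (by linarith [ht.2])]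
  rw [h1]
  unfold fejer
  split_ifs with hy
  · subst hy
    simp only [mul_zero, Real.cos_zero, mul_one]
    rw [intervalIntegral.integral_sub (by simp) (by simp)]
    simp
    norm_num
  -- An explicit antiderivative, obtained from one integration by parts.
  · have : ∀ t ∈ uIcc (0:ℝ) 1, HasDerivAt
        (fun t => (1 - t) * Real.sin (t * y) / y - Real.cos (t * y) / y ^ 2)
        ((1 - t) * Real.cos (t * y)) t := by
      intro t _
      have h1 : HasDerivAt (fun t : ℝ => t * y) y t := by simpa using (hasDerivAt_id t).mul_const y
      have h2 := ((hasDerivAt_id t).const_sub 1).mul h1.sin |>.div_const y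
      have h3 := h1.cos.div_const (y ^ 2)
      refine (h2.sub h3).congr_deriv ?_
      simp only [id]
      field_simp
      ring
    rw [intervalIntegral.integral_eq_sub_of_hasDerivAt this
      (by apply Continuous.intervalIntegrable; fun_prop)]
    simp
    field_simp
    ring

lemma bandLimited_fejer : BandLimited fejer (fun t => (tri t : ℂ)) where
  continuous := Complex.continuous_ofReal.comp continuous_tri
  compact := hasCompactSupport_tri.comp_left Complex.ofReal_zero
  eq y := by
    have h : ∀ t : ℝ, (tri t : ℂ) * Complex.exp (t * y * Complex.I) =
        ((tri t * Real.cos (t * y) : ℝ) : ℂ) + ((tri t * Real.sin (t * y) : ℝ) : ℂ) * Complex.I := by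
      intro t
      rw [Complex.exp_mul_I]
      push_cast
      ring
    simp only [h]
    have i1 : Integrable fun t => tri t * Real.cos (t * y) :=
      (continuous_tri.mul (by fun_prop)).integrable_of_hasCompactSupport hasCompactSupport_tri.mul_right
    have i2 : Integrable fun t => tri t * Real.sin (t * y) :=
      (continuous_tri.mul (by fun_prop)).integrable_of_hasCompactSupport hasCompactSupport_tri.mul_right
    have h0 : ∫ t, tri t * Real.sin (t * y) = 0 := by
      have := integral_neg_eq_self (fun t => tri t * Real.sin (t * y)) volume
      simp only [tri_neg, neg_mul, Real.sin_neg, mul_neg] at this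
      rw [integral_neg] at this
      linarith
    rw [integral_add i1.ofReal (i2.ofReal.mul_const _), integral_mul_const, integral_complex_ofReal,
      integral_complex_ofReal, h0, integral_tri_cos]
    simp

/-- A positive band limited weight. -/
def wgt (y : ℝ) : ℝ := fejer y + fejer (y + Real.pi)

/-- The Fourier transform of `wgt`. -/
def wgtHat (t : ℝ) : ℂ := tri t + tri t * Complex.exp (t * Real.pi * Complex.I)

lemma bandLimited_wgt : BandLimited wgt wgtHat :=
  bandLimited_fejer.add (bandLimited_fejer.shift Real.pi)

lemma wgt_nonneg (y : ℝ) : 0 ≤ wgt y := add_nonneg (fejer_nonneg _) (fejer_nonneg _)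

lemma wgt_le_two (y : ℝ) : wgt y ≤ 2 := by
  have := fejer_le_one y; have := fejer_le_one (y + Real.pi); unfold wgt; linarith

/-- The Fejér kernel has zeros, but shifting by π changes the numerator 2(1 − cos y) into 2(1 + cos
y), and the two add up to 4. So the weight never vanishes and decays no faster than quadratically,
which makes division by it harmless. The two cases treated first are those where one summand takes
its value 1 at the origin. -/
lemma wgt_ge (y : ℝ) : 4 / (|y| + Real.pi) ^ 2 ≤ wgt y := by
  have hpi := Real.pi_gt_three
  by_cases h0 : y = 0
  · have h1 : (1 : ℝ) ≤ wgt y := by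
      have := fejer_nonneg (y + Real.pi)
      have h2 : fejer y = 1 := by simp [fejer, h0]
      unfold wgt; linarith
    refine le_trans ?_ h1
    rw [div_le_one (by positivity)]
    have := abs_nonneg y
    nlinarith
  by_cases h1 : y + Real.pi = 0
  · have h1 : (1 : ℝ) ≤ wgt y := by
      have := fejer_nonneg y
      have h2 : fejer (y + Real.pi) = 1 := by simp [fejer, h1]
      unfold wgt; linarith
    refine le_trans ?_ h1
    rw [div_le_one (by positivity)]
    have := abs_nonneg y
    nlinarith
  · have e1 : 2 * (1 - Real.cos y) / (|y| + Real.pi) ^ 2 ≤ fejer y := by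
      simp only [fejer, h0, if_false]
      have := Real.cos_le_one y
      refine div_le_div_of_nonneg_left (by linarith) (by positivity) ?_
      rw [← sq_abs y]
      gcongr
      linarith
    have e2 : 2 * (1 + Real.cos y) / (|y| + Real.pi) ^ 2 ≤ fejer (y + Real.pi) := by
      simp only [fejer, h1, if_false, Real.cos_add_pi, sub_neg_eq_add]
      have := Real.neg_one_le_cos y
      refine div_le_div_of_nonneg_left (by linarith) (by positivity) ?_
      rw [← sq_abs (y + Real.pi)]
      gcongr
      refine (abs_add_le _ _).trans ?_
      rw [abs_of_pos Real.pi_pos]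
    have : 4 / (|y| + Real.pi) ^ 2 = 2 * (1 - Real.cos y) / (|y| + Real.pi) ^ 2 +
        2 * (1 + Real.cos y) / (|y| + Real.pi) ^ 2 := by ring
    rw [this]
    exact add_le_add e1 e2

lemma wgt_pos (y : ℝ) : 0 < wgt y :=
  lt_of_lt_of_le (by have := Real.pi_pos; positivity) (wgt_ge y)

lemma contDiff_wgt : ContDiff ℝ ∞ wgt := bandLimited_wgt.continuous_self

lemma fejer_le (y : ℝ) : fejer y ≤ 5 * (1 + y ^ 2)⁻¹ := by
  rw [← div_eq_mul_inv, le_div_iff₀ (by positivity)]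
  have h1 := fejer_le_one y
  have h2 : fejer y * y ^ 2 ≤ 4 := by
    unfold fejer
    split_ifs with h
    · simp [h]
    · rw [div_mul_cancel₀ _ (by positivity)]
      linarith [Real.neg_one_le_cos y]
  linarith

lemma integrable_fejer : Integrable fejer := by
  refine (integrable_inv_one_add_sq.const_mul 5).mono'
    bandLimited_fejer.continuous_self.continuous.aestronglyMeasurable (ae_of_all _ fun y => ?_)
  rw [Real.norm_of_nonneg (fejer_nonneg y)]
  exact fejer_le y

lemma integrable_wgt : Integrable wgt :=
  integrable_fejer.add (integrable_fejer.comp_add_right Real.pi)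

/-- A test function is Schwartz, so its Fourier transform is integrable and inversion applies. The
rescaling by 2π passes to the convention e^{iay}. -/
lemma exists_fourier_repr {ψ : ℝ → ℝ} (h : ContDiff ℝ ∞ ψ) (hs : HasCompactSupport ψ) :
    ∃ c : ℝ → ℂ, Continuous c ∧ Integrable c ∧
      ∀ y : ℝ, (ψ y : ℂ) = ∫ a : ℝ, c a * Complex.exp (a * y * Complex.I) := by
  have hf : ContDiff ℝ ∞ (fun y => (ψ y : ℂ)) := Complex.ofRealCLM.contDiff.comp h
  have hfs : HasCompactSupport (fun y => (ψ y : ℂ)) := hs.comp_left Complex.ofReal_zero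
  have hcoe := SchwartzMap.fourier_coe (hfs.toSchwartzMap hf)
  have hfc : Continuous (FourierTransform.fourier (fun y => (ψ y : ℂ))) := by
    have := (FourierTransform.fourier (hfs.toSchwartzMap hf)).continuous
    rwa [hcoe] at this
  have hfi : Integrable (FourierTransform.fourier (fun y => (ψ y : ℂ))) := by
    have := (FourierTransform.fourier (hfs.toSchwartzMap hf)).integrable (μ := volume)
    rwa [hcoe] at this
  have hinv := Continuous.fourierInv_fourier_eq hf.continuous
    (hf.continuous.integrable_of_hasCompactSupport hfs) hfi
  have hpi := Real.pi_pos
  set G := FourierTransform.fourier (fun y => (ψ y : ℂ)) with hG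
  refine ⟨fun a => ((2 * Real.pi)⁻¹ : ℝ) * G ((2 * Real.pi)⁻¹ * a), by fun_prop,
    (hfi.comp_mul_left' (by positivity)).const_mul _, fun y => ?_⟩
  have h1 := congrFun hinv y
  rw [Real.fourierInv_eq'] at h1
  rw [← h1]
  have h2 := Measure.integral_comp_mul_left
    (fun a : ℝ => Complex.exp (((2 * Real.pi * a * y : ℝ) : ℂ) * Complex.I) * G a) ((2 * Real.pi)⁻¹)
  rw [inv_inv, abs_of_pos (by positivity)] at h2
  have h3 : ∫ a : ℝ, Complex.exp (((2 * Real.pi * a * y : ℝ) : ℂ) * Complex.I) * G a =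
      ((2 * Real.pi)⁻¹ : ℝ) * ∫ x : ℝ, Complex.exp (((2 * Real.pi * ((2 * Real.pi)⁻¹ * x) * y : ℝ) : ℂ) *
        Complex.I) * G ((2 * Real.pi)⁻¹ * x) := by
    rw [h2, Complex.real_smul, ← mul_assoc, ← Complex.ofReal_mul,
      inv_mul_cancel₀ (by positivity), Complex.ofReal_one, one_mul]
  calc _ = ∫ a : ℝ, Complex.exp (((2 * Real.pi * a * y : ℝ) : ℂ) * Complex.I) * G a := by
        refine integral_congr_ae (ae_of_all _ fun a => ?_)
        simp only [smul_eq_mul, RCLike.inner_apply, conj_trivial]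
        congr 4
        ring
    _ = _ := by
        rw [h3, ← integral_const_mul]
        refine integral_congr_ae (ae_of_all _ fun a => ?_)
        have : 2 * Real.pi * ((2 * Real.pi)⁻¹ * a) * y = a * y := by field_simp
        simp only [this]
        push_cast
        ring

lemma wgtHat_eq_zero {t : ℝ} (h : 1 ≤ |t|) : wgtHat t = 0 := by
  simp [wgtHat, tri_eq_zero h]

/-- The transform of the product is the convolution of `wgtHat`, which vanishes outside [−1, 1],
with c restricted to [−R, R], hence it is supported in [−(R+1), R+1]. The real part is taken because
truncating c need not leave a real function. -/
lemma bandLimited_wgt_mul {c : ℝ → ℂ} (hc : Continuous c) {R : ℝ} (hR : 0 ≤ R) :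
    ∃ φ, BandLimited
      (fun y => ((wgt y : ℂ) * ∫ a in -R..R, c a * Complex.exp (a * y * Complex.I)).re) φ := by
  have hW := bandLimited_wgt
  set φ₀ : ℝ → ℂ := fun t => ∫ a in -R..R, c a * wgtHat (t - a) with hφ₀
  have hcont : Continuous φ₀ := by
    refine intervalIntegral.continuous_parametric_intervalIntegral_of_continuous' ?_ _ _
    have := hW.continuous
    simp only [Function.uncurry_def]
    exact (hc.comp continuous_snd).mul (this.comp (continuous_fst.sub continuous_snd))
  have hsupp : HasCompactSupport φ₀ := by
    refine HasCompactSupport.intro (isCompact_Icc (a := -(R + 1)) (b := R + 1)) fun t ht => ?_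
    have ht' : R + 1 < |t| := by
      by_contra hlt
      exact ht (abs_le.1 (not_lt.1 hlt))
    rw [hφ₀]
    refine (intervalIntegral.integral_congr (g := fun _ => 0) fun a ha => ?_).trans (by simp)
    rw [uIcc_of_le (by linarith)] at ha
    have ha' : |a| ≤ R := abs_le.2 ha
    have : 1 ≤ |t - a| := by
      have := abs_sub_abs_le_abs_sub t a
      linarith
    simp [wgtHat_eq_zero this]
  have key : ∀ y : ℝ, ∫ t : ℝ, φ₀ t * Complex.exp (t * y * Complex.I) =
      (wgt y : ℂ) * ∫ a in -R..R, c a * Complex.exp (a * y * Complex.I) := by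
    intro y
    simp only [hφ₀]
    simp_rw [intervalIntegral.integral_of_le (by linarith : -R ≤ R)]
    have hci : Integrable c (volume.restrict (Ioc (-R) R)) :=
      (hc.integrableOn_Icc (a := -R) (b := R)).mono_set Ioc_subset_Icc_self
    have hint : Integrable (fun q : ℝ × ℝ => c q.2 * wgtHat (q.1 - q.2) *
        Complex.exp (q.1 * y * Complex.I)) (volume.prod (volume.restrict (Ioc (-R) R))) := by
      have := hci.convolution_integrand (ContinuousLinearMap.mul ℝ ℂ) hW.integrable
      refine Integrable.mul_bdd (c := 1) this (by fun_prop) (ae_of_all _ fun q => ?_)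
      rw [norm_cexp_mul_I]
    simp_rw [← integral_mul_const]
    rw [integral_integral_swap hint, ← integral_const_mul]
    refine integral_congr_ae (ae_of_all _ fun a => ?_)
    simp only [mul_assoc]
    rw [integral_const_mul, hW.eq y]
    have hshift := integral_add_right_eq_self (μ := (volume : Measure ℝ))
      (fun t : ℝ => wgtHat (t - a) * Complex.exp (t * (y * Complex.I))) a
    simp only [add_sub_cancel_right] at hshift
    rw [← hshift]
    have hmul : ∫ t : ℝ, wgtHat t * Complex.exp ((t + a : ℝ) * (y * Complex.I)) =
        (∫ t : ℝ, wgtHat t * Complex.exp (t * y * Complex.I)) *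
          Complex.exp (a * (y * Complex.I)) := by
      rw [← integral_mul_const]
      refine integral_congr_ae (ae_of_all _ fun t => ?_)
      simp only
      rw [mul_assoc, ← Complex.exp_add]
      congr 2
      push_cast
      ring
    rw [hmul]
    ring
  have := bandLimited_re hcont hsupp
  simp only [key] at this
  exact ⟨_, this⟩

/-- Cutting the Fourier integral of ψ at a frequency R beyond which |c| has mass below ε gives a
uniform error ε. Multiplication by the band limited weight turns it into an integrable error, still
with compactly supported transform. -/
lemma exists_bandLimited_near {ψ : ℝ → ℝ} (h : ContDiff ℝ ∞ ψ) (hs : HasCompactSupport ψ) {ε : ℝ}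
    (hε : 0 < ε) : ∃ p φ, BandLimited p φ ∧ ∀ y, |p y - wgt y * ψ y| ≤ ε * wgt y := by
  obtain ⟨c, hc, hci, hrep⟩ := exists_fourier_repr h hs
  have hlim := intervalIntegral_tendsto_integral hci.norm tendsto_neg_atTop_atBot
    (tendsto_id (α := ℝ) (x := atTop))
  obtain ⟨R, hR, hR0⟩ := ((hlim.eventually (lt_mem_nhds (sub_lt_self _ hε))).and
    (eventually_ge_atTop 0)).exists
  simp only [id] at hR
  obtain ⟨φ, hφ⟩ := bandLimited_wgt_mul hc hR0
  refine ⟨_, φ, hφ, fun y => ?_⟩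
  have hle : ‖(ψ y : ℂ) - ∫ a in -R..R, c a * Complex.exp (a * y * Complex.I)‖ ≤ ε := by
    have hi := integrable_mul_char hci y
    rw [hrep, intervalIntegral.integral_of_le (by linarith),
      ← integral_add_compl (measurableSet_Ioc (a := -R) (b := R)) hi, add_sub_cancel_left]
    refine (norm_integral_le_integral_norm _).trans ?_
    simp only [norm_mul, norm_cexp_mul_I, mul_one]
    have := integral_add_compl (measurableSet_Ioc (a := -R) (b := R)) hci.norm
    rw [intervalIntegral.integral_of_le (by linarith)] at hR
    linarith
  have : (((wgt y : ℂ) * ∫ a in -R..R, c a * Complex.exp (a * y * Complex.I)).re - wgt y * ψ y) =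
      -(wgt y * ((ψ y : ℂ) - ∫ a in -R..R, c a * Complex.exp (a * y * Complex.I)).re) := by
    simp only [Complex.re_ofReal_mul, Complex.sub_re, Complex.ofReal_re]
    ring
  rw [this, abs_neg, abs_mul, abs_of_nonneg (wgt_nonneg y), mul_comm]
  gcongr
  · exact wgt_nonneg y
  · exact (Complex.abs_re_le_norm _).trans hle

/-! ### Approximating the one-sided exponential -/

/-- The function `e^{-γ y} 1{y ≥ 0}`. -/
def expTail (γ y : ℝ) : ℝ := if 0 ≤ y then Real.exp (-γ * y) else 0

lemma expTail_nonneg (γ y : ℝ) : 0 ≤ expTail γ y := by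
  unfold expTail; split_ifs <;> positivity

lemma measurable_expTail (γ : ℝ) : Measurable (expTail γ) :=
  Measurable.ite measurableSet_Ici (by fun_prop) measurable_const

lemma integrable_expTail {γ : ℝ} (hγ : 0 < γ) : Integrable (expTail γ) := by
  have : expTail γ = (Ici 0).indicator fun y => Real.exp (-γ * y) := by
    ext y; simp [expTail, indicator]
  rw [this, integrable_indicator_iff measurableSet_Ici, integrableOn_Ici_iff_integrableOn_Ioi]
  exact exp_neg_integrableOn_Ioi 0 hγ

lemma integral_expTail {γ : ℝ} (hγ : 0 < γ) : ∫ y, expTail γ y = 1 / γ := by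
  have : expTail γ = (Ici 0).indicator fun y => Real.exp (-γ * y) := by
    ext y; simp [expTail, indicator]
  rw [this, integral_indicator measurableSet_Ici, integral_Ici_eq_integral_Ioi,
    integral_exp_mul_Ioi (by linarith)]
  simp

lemma exists_exp_le_wgt {γ ε : ℝ} (hγ : 0 < γ) (hε : 0 < ε) :
    ∃ T : ℝ, 0 ≤ T ∧ ∀ y, T < y → Real.exp (-γ * y) ≤ ε * wgt y := by
  have h1 : Tendsto (fun y : ℝ => (y + Real.pi) ^ 2 * Real.exp (-γ * y)) atTop (𝓝 0) := by
    have e : ∀ n : ℕ, Tendsto (fun y : ℝ => y ^ n * Real.exp (-γ * y)) atTop (𝓝 0) := fun n => by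
      have := tendsto_rpow_mul_exp_neg_mul_atTop_nhds_zero (n : ℝ) γ hγ
      simpa only [Real.rpow_natCast] using this
    have := ((e 2).add ((e 1).const_mul (2 * Real.pi))).add ((e 0).const_mul (Real.pi ^ 2))
    simp only [mul_zero, add_zero] at this
    refine this.congr fun y => ?_
    ring
  obtain ⟨T, hT⟩ := eventually_atTop.1 (h1.eventually (gt_mem_nhds (by positivity : 0 < 4 * ε)))
  refine ⟨max T 0, le_max_right _ _, fun y hy => ?_⟩
  have hy0 : 0 < y := (le_max_right _ _).trans_lt hy
  have h2 := hT y ((le_max_left _ _).trans hy.le)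
  have h3 := wgt_ge y
  rw [abs_of_pos hy0] at h3
  have hp : 0 < (y + Real.pi) ^ 2 := by have := Real.pi_pos; positivity
  rw [div_le_iff₀ hp] at h3
  have : Real.exp (-γ * y) * (y + Real.pi) ^ 2 ≤ ε * wgt y * (y + Real.pi) ^ 2 := by
    nlinarith
  exact le_of_mul_le_mul_right this hp

/-- The jump of κ is sandwiched between two smooth compactly supported functions that differ only on
a window of width 2θ around 0, up to an exponential tail absorbed by the weight. Each is divided by
the weight, approximated by a truncated Fourier integral and multiplied back. The majorant P of the
error is band limited too, so the expectation of the error can itself be computed from exponential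
moments; its mass b is small. -/
lemma exists_bandLimited_expTail {γ τ : ℝ} (hγ : 0 < γ) (hτ : 0 < τ) :
    ∃ (p : ℝ → ℝ) (φ : ℝ → ℂ) (P : ℝ → ℝ) (Φ : ℝ → ℂ) (C a b : ℝ),
      BandLimited p φ ∧ BandLimited P Φ ∧ (∀ y, |expTail γ y - p y| ≤ P y) ∧ 0 < C ∧
      (∀ y, |p y| ≤ C * wgt y) ∧ 2 * Real.pi * φ 0 = a ∧ 2 * Real.pi * Φ 0 = b ∧
      |a - 1 / γ| ≤ τ ∧ b ≤ τ := by
  set I := ∫ y, wgt y with hI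
  have hI0 : 0 ≤ I := integral_nonneg wgt_nonneg
  -- The budget τ is shared between the term 6ε `wgt` in the bound on P and the mass 2θe^{γθ} of the
  -- window [−θ, θ].
  obtain ⟨ε, hε, hεI⟩ : ∃ ε > 0, 6 * ε * I ≤ τ / 2 := by
    refine ⟨τ / (12 * (I + 1)), by positivity, ?_⟩
    rw [mul_div_assoc', div_mul_eq_mul_div, div_le_div_iff₀ (by positivity) (by positivity)]
    nlinarith
  obtain ⟨θ, hθ, hθτ⟩ : ∃ θ > 0, 2 * θ * Real.exp (γ * θ) ≤ τ / 2 := by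
    refine ⟨min 1 (τ / (4 * Real.exp γ)), by positivity, ?_⟩
    have h1 : Real.exp (γ * min 1 (τ / (4 * Real.exp γ))) ≤ Real.exp γ :=
      Real.exp_le_exp.2 (by nlinarith [min_le_left 1 (τ / (4 * Real.exp γ))])
    calc _ ≤ 2 * (τ / (4 * Real.exp γ)) * Real.exp γ := by gcongr; exact min_le_right _ _
      _ = τ / 2 := by field_simp; ring
  obtain ⟨T, hT0, hT⟩ := exists_exp_le_wgt hγ hε
  let σ := Real.smoothTransition
  have σ0 : ∀ x, 0 ≤ σ x := Real.smoothTransition.nonneg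
  have σ1 : ∀ x, σ x ≤ 1 := Real.smoothTransition.le_one
  -- For a = 0 the left ramp occupies [0, θ] and u lies below κ; for a = 1 it occupies [−θ, 0] and u
  -- lies above κ as far as T.
  let u : ℝ → ℝ → ℝ := fun a y => Real.exp (-γ * y) * σ (a + y / θ) * σ (T + 1 - y)
  have hu0 : ∀ a y, 0 ≤ u a y := fun a y => by
    have := σ0 (a + y / θ); have := σ0 (T + 1 - y); positivity
  have hu_smooth : ∀ a, ContDiff ℝ ∞ (u a) := fun a => by
    have hσ : ContDiff ℝ ∞ σ := Real.smoothTransition.contDiff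
    refine ((Real.contDiff_exp.comp (contDiff_const.mul contDiff_id)).mul
      (hσ.comp (contDiff_const.add (contDiff_id.div_const _)))).mul
      (hσ.comp (contDiff_const.sub contDiff_id))
  have hu_supp : ∀ a, HasCompactSupport (u a) := fun a => by
    refine HasCompactSupport.intro (isCompact_Icc (a := -a * θ) (b := T + 1)) fun y hy => ?_
    rw [mem_Icc, not_and_or, not_le, not_le] at hy
    rcases hy with hy | hy
    · have : σ (a + y / θ) = 0 := Real.smoothTransition.zero_of_nonpos (by
        have : y / θ < -a := by rwa [div_lt_iff₀ hθ]
        linarith)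
      simp [u, this]
    · have : σ (T + 1 - y) = 0 := Real.smoothTransition.zero_of_nonpos (by linarith)
      simp [u, this]
  let ψ : ℝ → ℝ → ℝ := fun a y => u a y * (wgt y)⁻¹
  have hψ : ∀ a y, wgt y * ψ a y = u a y := fun a y => by
    have := (wgt_pos y).ne'
    simp only [ψ]; field_simp
  have hψ_smooth : ∀ a, ContDiff ℝ ∞ (ψ a) := fun a =>
    (hu_smooth a).mul (contDiff_wgt.inv fun y => (wgt_pos y).ne')
  have hψ_supp : ∀ a, HasCompactSupport (ψ a) := fun a => (hu_supp a).mul_right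
  obtain ⟨p, φ, hp, hpψ⟩ := exists_bandLimited_near (hψ_smooth 0) (hψ_supp 0) hε
  obtain ⟨p', φ', hp', hpψ'⟩ := exists_bandLimited_near (hψ_smooth 1) (hψ_supp 1) hε
  simp only [hψ] at hpψ hpψ'
  obtain ⟨Cψ, hCψ⟩ := (hψ_smooth 0).continuous.bounded_above_of_compact_support (hψ_supp 0)
  have hCψ0 : 0 ≤ Cψ := (norm_nonneg _).trans (hCψ 0)
  have hlow : ∀ y, u 0 y ≤ expTail γ y := by
    intro y
    unfold expTail
    split_ifs with hy
    · have := mul_le_one₀ (σ1 (0 + y / θ)) (σ0 (T + 1 - y)) (σ1 (T + 1 - y))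
      simp only [u, mul_assoc]
      exact mul_le_of_le_one_right (Real.exp_pos _).le this
    · have : σ (0 + y / θ) = 0 := Real.smoothTransition.zero_of_nonpos (by
        rw [zero_add]; exact div_nonpos_of_nonpos_of_nonneg (by linarith) hθ.le)
      simp only [u, this]
      simp
  have hupp : ∀ y, expTail γ y ≤ u 1 y + ε * wgt y := by
    intro y
    have hw := wgt_nonneg y
    have hεw : 0 ≤ ε * wgt y := by positivity
    unfold expTail
    split_ifs with hy
    · rcases le_or_gt y T with hyT | hyT
      · have e1 : σ (1 + y / θ) = 1 := Real.smoothTransition.one_of_one_le (by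
          have : 0 ≤ y / θ := by positivity
          linarith)
        have e2 : σ (T + 1 - y) = 1 := Real.smoothTransition.one_of_one_le (by linarith)
        simp only [u, e1, e2]
        linarith
      · linarith [hT y hyT, hu0 1 y]
    · linarith [hu0 1 y]
  have hdiff : ∀ y, u 1 y - u 0 y ≤ (Icc (-θ) θ).indicator (fun _ => Real.exp (γ * θ)) y := by
    intro y
    by_cases hy : y ∈ Icc (-θ) θ
    · rw [indicator_of_mem hy]
      have h1 := mul_le_one₀ (σ1 (1 + y / θ)) (σ0 (T + 1 - y)) (σ1 (T + 1 - y))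
      have h2 : u 1 y ≤ Real.exp (-γ * y) := by
        simp only [u, mul_assoc]
        exact mul_le_of_le_one_right (Real.exp_pos _).le h1
      have h3 : Real.exp (-γ * y) ≤ Real.exp (γ * θ) :=
        Real.exp_le_exp.2 (by nlinarith [hy.1])
      linarith [hu0 0 y]
    · rw [indicator_of_notMem hy]
      rw [mem_Icc, not_and_or, not_le, not_le] at hy
      rcases hy with hy | hy
      · have : σ (1 + y / θ) = 0 := Real.smoothTransition.zero_of_nonpos (by
          have : y / θ < -1 := by rw [div_lt_iff₀ hθ]; linarith
          linarith)
        have h4 : u 1 y = 0 := by simp [u, this]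
        linarith [hu0 0 y]
      · have hyθ : 1 ≤ y / θ := by rw [le_div_iff₀ hθ]; linarith
        have e1 : σ (1 + y / θ) = 1 := Real.smoothTransition.one_of_one_le (by linarith)
        have e0 : σ (0 + y / θ) = 1 := Real.smoothTransition.one_of_one_le (by linarith)
        simp only [u, e1, e0]
        linarith
  -- The term 4ε `wgt` pays for both approximation errors and for the tail of κ beyond T, on
  -- whichever side the deviation occurs.
  have hP : BandLimited (fun y => (p' y + (-1) * p y) + 4 * ε * wgt y)
      (fun t => (φ' t + ((-1 : ℝ) : ℂ) * φ t) + ((4 * ε : ℝ) : ℂ) * wgtHat t) :=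
    (hp'.add (hp.const_mul (-1))).add (bandLimited_wgt.const_mul (4 * ε))
  set P : ℝ → ℝ := fun y => (p' y + (-1) * p y) + 4 * ε * wgt y with hPdef
  have hlow2 : ∀ y, u 0 y ≤ u 1 y := by
    intro y
    simp only [u]
    have hmono : σ (0 + y / θ) ≤ σ (1 + y / θ) := Real.smoothTransition.monotone (by linarith)
    have := σ0 (T + 1 - y)
    gcongr
  have habs : ∀ y, |expTail γ y - p y| ≤ P y := by
    intro y
    have h1 := abs_le.1 (hpψ y)
    have h2 := abs_le.1 (hpψ' y)
    have h3 := hlow y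
    have h4 := hupp y
    have h5 := hlow2 y
    have h6 : 0 ≤ ε * wgt y := mul_nonneg hε.le (wgt_nonneg y)
    simp only [hPdef]
    rw [abs_le]
    constructor <;> linarith [h1.1, h1.2, h2.1, h2.2]
  have hpC : ∀ y, |p y| ≤ (Cψ + ε) * wgt y := by
    intro y
    have h1 := abs_le.1 (hpψ y)
    have h2 : |u 0 y| ≤ Cψ * wgt y := by
      rw [← hψ 0 y, abs_mul, abs_of_nonneg (wgt_nonneg y), mul_comm]
      gcongr
      · exact wgt_nonneg y
      · exact hCψ y
    have h3 := abs_le.1 h2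
    rw [abs_le]
    constructor <;> linarith [h1.1, h1.2, h3.1, h3.2]
  have hpi : Integrable p := by
    refine (integrable_wgt.const_mul (Cψ + ε)).mono'
      hp.continuous_self.continuous.aestronglyMeasurable (ae_of_all _ hpC)
  have hPbound : ∀ y, P y ≤ (Icc (-θ) θ).indicator (fun _ => Real.exp (γ * θ)) y + 6 * ε * wgt y := by
    intro y
    have h1 := abs_le.1 (hpψ y)
    have h2 := abs_le.1 (hpψ' y)
    have h3 := hdiff y
    simp only [hPdef]
    linarith [h1.1, h2.2]
  have hmaj : Integrable (fun y => (Icc (-θ) θ).indicator (fun _ => Real.exp (γ * θ)) y +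
      6 * ε * wgt y) := by
    refine Integrable.add ?_ (integrable_wgt.const_mul _)
    rw [integrable_indicator_iff measurableSet_Icc]
    exact integrableOn_const (by simp)
  have hP0 : ∀ y, 0 ≤ P y := fun y => (abs_nonneg _).trans (habs y)
  have hPi : Integrable P := by
    refine hmaj.mono' hP.continuous_self.continuous.aestronglyMeasurable (ae_of_all _ fun y => ?_)
    rw [Real.norm_of_nonneg (hP0 y)]
    exact hPbound y
  have hPint : ∫ y, P y ≤ τ := by
    calc ∫ y, P y ≤ ∫ y, ((Icc (-θ) θ).indicator (fun _ => Real.exp (γ * θ)) y + 6 * ε * wgt y) :=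
          integral_mono hPi hmaj hPbound
      _ = 2 * θ * Real.exp (γ * θ) + 6 * ε * I := by
          rw [integral_add _ (integrable_wgt.const_mul _), integral_const_mul,
            integral_indicator measurableSet_Icc]
          · simp only [integral_const, MeasurableSet.univ, measureReal_restrict_apply, univ_inter,
              smul_eq_mul]
            rw [Real.volume_real_Icc_of_le (by linarith)]
            ring
          · rw [integrable_indicator_iff measurableSet_Icc]
            exact integrableOn_const (by simp)
      _ ≤ τ := by linarith
  refine ⟨p, φ, P, _, Cψ + ε, _, _, hp, hP, habs, by positivity, hpC, hp.integral_eq hpi,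
    hP.integral_eq hPi, ?_, hPint⟩
  rw [← integral_expTail hγ, ← integral_sub hpi (integrable_expTail hγ), ← Real.norm_eq_abs]
  refine (norm_integral_le_integral_norm _).trans (le_trans (integral_mono
    (hpi.sub (integrable_expTail hγ)).norm hPi fun y => ?_) hPint)
  simp only [Real.norm_eq_abs]
  rw [abs_sub_comm]
  exact habs y

/-! ### From real exponential moments to smooth test functions -/

/-- Induction on n: subtract the coefficients already known to vanish and divide by s^n. By the
geometric bound the terms after the n-th contribute at most Cs, uniformly in N. -/
lemma tendsto_zero_of_powerSeries {a : ℕ → ℕ → ℝ} {C : ℝ} (hC : 0 ≤ C)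
    (hb : ∀ᶠ N in atTop, ∀ n, |a N n| ≤ C * (1 / 2) ^ n)
    (hs : ∀ s ∈ Ioc (0 : ℝ) 1, Tendsto (fun N => ∑' n, a N n * s ^ n) atTop (𝓝 0)) (n : ℕ) :
    Tendsto (fun N => a N n) atTop (𝓝 0) := by
  induction n using Nat.strong_induction_on with
  | _ n ih =>
    rw [Metric.tendsto_atTop']
    intro ε hε
    -- s is fixed before N: it makes the remainder small, and then N makes the value of the series
    -- at this s small.
    obtain ⟨s, hs0, hs1, hsC⟩ : ∃ s : ℝ, 0 < s ∧ s ≤ 1 ∧ C * s < ε / 2 := by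
      refine ⟨min 1 (ε / (4 * (C + 1))), by positivity, min_le_left _ _, ?_⟩
      calc C * min 1 (ε / (4 * (C + 1))) ≤ C * (ε / (4 * (C + 1))) := by
            gcongr; exact min_le_right _ _
        _ < ε / 2 := by
            rw [mul_div_assoc', div_lt_div_iff₀ (by positivity) (by positivity)]
            nlinarith
    have h1 : Tendsto (fun N => (s ^ n)⁻¹ * ((∑' n, a N n * s ^ n) -
        ∑ m ∈ Finset.range n, a N m * s ^ m)) atTop (𝓝 0) := by
      have h2 : Tendsto (fun N => ∑ m ∈ Finset.range n, a N m * s ^ m) atTop (𝓝 0) := by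
        have := tendsto_finsetSum (Finset.range n)
          (fun m hm => (ih m (Finset.mem_range.1 hm)).mul_const (s ^ m))
        simpa using this
      simpa using ((hs s ⟨hs0, hs1⟩).sub h2).const_mul ((s ^ n)⁻¹)
    have h3 := h1.eventually (Metric.ball_mem_nhds 0 (half_pos hε))
    obtain ⟨N₀, hN₀⟩ := eventually_atTop.1 (h3.and hb)
    refine ⟨N₀, fun N hN => ?_⟩
    obtain ⟨h4, h5⟩ := hN₀ N hN.le
    have hterm : ∀ m, ‖a N m * s ^ m‖ ≤ C * (1 / 2) ^ m := fun m => by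
      rw [norm_mul, Real.norm_eq_abs, norm_pow, Real.norm_of_nonneg hs0.le]
      exact (mul_le_of_le_one_right (abs_nonneg _) (pow_le_one₀ hs0.le hs1)).trans (h5 m)
    have hgeo : Summable fun m : ℕ => C * (1 / 2 : ℝ) ^ m :=
      (summable_geometric_of_lt_one (by norm_num) (by norm_num)).mul_left C
    have hsum : Summable fun m => a N m * s ^ m := hgeo.of_norm_bounded hterm
    have hsplit := hsum.sum_add_tsum_nat_add (n + 1)
    rw [Finset.sum_range_succ] at hsplit
    have hrest : ‖∑' m, a N (m + (n + 1)) * s ^ (m + (n + 1))‖ ≤ C * s ^ (n + 1) := by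
      have hg2 : HasSum (fun m : ℕ => C * s ^ (n + 1) * (1 / 2) ^ (n + 1) * (1 / 2 : ℝ) ^ m)
          (C * s ^ (n + 1) * (1 / 2) ^ (n + 1) * 2) := by
        exact hasSum_geometric_two.mul_left (C * s ^ (n + 1) * (1 / 2) ^ (n + 1))
      refine (tsum_of_norm_bounded hg2 fun m => ?_).trans ?_
      · rw [norm_mul, Real.norm_eq_abs, norm_pow, Real.norm_of_nonneg hs0.le, pow_add s]
        have h6 := h5 (m + (n + 1))
        have h7 : s ^ m ≤ 1 := pow_le_one₀ hs0.le hs1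
        calc |a N (m + (n + 1))| * (s ^ m * s ^ (n + 1))
            ≤ (C * (1 / 2) ^ (m + (n + 1))) * (1 * s ^ (n + 1)) := by gcongr
          _ = _ := by rw [pow_add]; ring
      · rw [mul_assoc, pow_succ (1 / 2 : ℝ)]
        refine mul_le_of_le_one_right (by positivity) ?_
        have : (1 / 2 : ℝ) ^ n ≤ 1 := pow_le_one₀ (by norm_num) (by norm_num)
        linarith
    have hsn : 0 < s ^ n := by positivity
    have heq : a N n = (s ^ n)⁻¹ * ((∑' n, a N n * s ^ n) -
        ∑ m ∈ Finset.range n, a N m * s ^ m) -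
        (s ^ n)⁻¹ * ∑' m, a N (m + (n + 1)) * s ^ (m + (n + 1)) := by
      rw [← hsplit]
      field_simp
      ring
    rw [dist_zero_right] at h4 ⊢
    rw [heq]
    refine (norm_sub_le _ _).trans_lt ?_
    have : ‖(s ^ n)⁻¹ * ∑' m, a N (m + (n + 1)) * s ^ (m + (n + 1))‖ ≤ C * s := by
      rw [norm_mul, norm_inv, Real.norm_of_nonneg hsn.le, inv_mul_le_iff₀ hsn]
      refine hrest.trans (le_of_eq ?_)
      ring
    linarith

section Laplace

variable {S : ℕ → Type*} [∀ N, MeasurableSpace (S N)] {P : ∀ N, Measure (S N)}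

/-- Using exponential moments at ±2 rather than ±1 buys the factor 2^{-n}, so that the Taylor series
of E[D e^{sZ}] converges with a margin on |s| ≤ 1. -/
lemma pow_abs_div_factorial_le (z : ℝ) (n : ℕ) :
    |z| ^ n / n.factorial ≤ (1 / 2) ^ n * (Real.exp (2 * z) + Real.exp (-2 * z)) := by
  have h1 : (2 * |z|) ^ n / n.factorial ≤ Real.exp (2 * |z|) :=
    Real.pow_div_factorial_le_exp _ (by positivity) n
  have h2 : Real.exp (2 * |z|) ≤ Real.exp (2 * z) + Real.exp (-2 * z) := by
    rcases abs_cases z with ⟨h, _⟩ | ⟨h, _⟩ <;> rw [h]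
    · linarith [Real.exp_pos (-2 * z)]
    · rw [show 2 * -z = -2 * z by ring]; linarith [Real.exp_pos (2 * z)]
  calc |z| ^ n / n.factorial = (1 / 2) ^ n * ((2 * |z|) ^ n / n.factorial) := by
        rw [mul_pow, mul_div_assoc, ← mul_assoc, ← mul_pow]; norm_num
    _ ≤ _ := by gcongr; exact h1.trans h2

/-- Vanishing of the exponential moments `E[D e^{sZ}]` for real `s` implies vanishing of
`E[D e^{iZ}]`. -/
lemma tendsto_char_of_tendsto_exp {D Z : ∀ N, S N → ℝ} (hZ : ∀ N, AEStronglyMeasurable (Z N) (P N))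
    (hint : ∀ᶠ N in atTop, ∀ s : ℝ, Integrable (fun w => D N w * Real.exp (s * Z N w)) (P N))
    (hbd : ∀ s : ℝ, ∃ C, ∀ᶠ N in atTop, ∫ w, |D N w| * Real.exp (s * Z N w) ∂(P N) ≤ C)
    (hlim : ∀ s : ℝ, Tendsto (fun N => ∫ w, D N w * Real.exp (s * Z N w) ∂(P N)) atTop (𝓝 0)) :
    Tendsto (fun N => ∫ w, (D N w : ℂ) * Complex.exp (Z N w * Complex.I) ∂(P N)) atTop (𝓝 0) := by
  obtain ⟨C₁, hC₁⟩ := hbd 2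
  obtain ⟨C₂, hC₂⟩ := hbd (-2)
  set C := max (C₁ + C₂) 0
  have hC0 : 0 ≤ C := le_max_right _ _
  let a : ℕ → ℕ → ℝ := fun N n => ∫ w, D N w * (Z N w ^ n / n.factorial) ∂(P N)
  have hmaj : ∀ᶠ N in atTop, ∀ n,
      Integrable (fun w => D N w * (Z N w ^ n / n.factorial)) (P N) ∧
      ∫ w, ‖D N w * (Z N w ^ n / n.factorial)‖ ∂(P N) ≤ C * (1 / 2) ^ n := by
    filter_upwards [hint, hC₁, hC₂] with N hN h1 h2 n
    have hD : AEStronglyMeasurable (D N) (P N) := by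
      have := (hN 0).aestronglyMeasurable
      simpa using this
    have i1 : ∀ s, Integrable (fun w => |D N w| * Real.exp (s * Z N w)) (P N) := fun s => by
      have := (hN s).norm
      simpa [norm_mul, Real.norm_eq_abs, abs_of_pos (Real.exp_pos _)] using this
    have hle : ∀ w, ‖D N w * (Z N w ^ n / n.factorial)‖ ≤
        (1 / 2) ^ n * (|D N w| * Real.exp (2 * Z N w) + |D N w| * Real.exp (-2 * Z N w)) := by
      intro w
      rw [norm_mul, Real.norm_eq_abs, norm_div, norm_pow, Real.norm_eq_abs, Real.norm_natCast]
      have := pow_abs_div_factorial_le (Z N w) n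
      calc |D N w| * (|Z N w| ^ n / n.factorial)
          ≤ |D N w| * ((1 / 2) ^ n * (Real.exp (2 * Z N w) + Real.exp (-2 * Z N w))) := by gcongr
        _ = _ := by ring
    have hi : Integrable (fun w => D N w * (Z N w ^ n / n.factorial)) (P N) := by
      refine Integrable.mono' (((i1 2).add (i1 (-2))).const_mul ((1 / 2) ^ n))
        (hD.mul (by
          simpa only [div_eq_mul_inv, Pi.pow_apply] using ((hZ N).pow n).mul_const _)) (ae_of_all _ hle)
    refine ⟨hi, (integral_mono hi.norm (((i1 2).add (i1 (-2))).const_mul _) hle).trans ?_⟩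
    rw [integral_const_mul]
    simp only [Pi.add_apply]
    rw [integral_add (i1 2) (i1 (-2)), mul_comm]
    gcongr
    exact (add_le_add h1 h2).trans (le_max_left _ _)
  have hgeo : Summable fun m : ℕ => C * (1 / 2 : ℝ) ^ m :=
    (summable_geometric_of_lt_one (by norm_num) (by norm_num)).mul_left C
  -- One expansion serves real s in (0, 1], where the sums are known to vanish in the limit, and s =
  -- i, where they are wanted.
  have hser : ∀ᶠ N in atTop, ∀ s : ℂ, ‖s‖ ≤ 1 →
      ∫ w, (D N w : ℂ) * Complex.exp (s * Z N w) ∂(P N) = ∑' n, (a N n : ℂ) * s ^ n := by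
    filter_upwards [hmaj] with N hN s hs
    have hpt : ∀ w, (D N w : ℂ) * Complex.exp (s * Z N w) =
        ∑' n : ℕ, ((D N w * (Z N w ^ n / n.factorial) : ℝ) : ℂ) * s ^ n := by
      intro w
      rw [Complex.exp_eq_exp_ℂ, NormedSpace.exp_eq_tsum_div, ← tsum_mul_left]
      refine tsum_congr fun n => ?_
      push_cast
      rw [mul_pow]
      ring
    simp_rw [hpt]
    rw [← integral_tsum_of_summable_integral_norm]
    · refine tsum_congr fun n => ?_
      rw [integral_mul_const, integral_complex_ofReal]
    · intro n
      exact (hN n).1.ofReal.mul_const _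
    · refine hgeo.of_nonneg_of_le (fun n => integral_nonneg fun _ => norm_nonneg _) fun n => ?_
      refine le_trans (integral_mono ((hN n).1.ofReal.mul_const _).norm (hN n).1.norm fun w => ?_)
        (hN n).2
      simp only [norm_mul, norm_pow, Complex.norm_real]
      exact mul_le_of_le_one_right (by positivity) (pow_le_one₀ (norm_nonneg _) hs)
  have hab : ∀ᶠ N in atTop, ∀ n, |a N n| ≤ C * (1 / 2) ^ n := by
    filter_upwards [hmaj] with N hN n
    exact (norm_integral_le_integral_norm _).trans (hN n).2
  have ha0 := tendsto_zero_of_powerSeries hC0 hab fun s hs => by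
    refine (hlim s).congr' ?_
    filter_upwards [hser] with N hN
    have h1 := hN s (by rw [Complex.norm_real, Real.norm_of_nonneg hs.1.le]; exact hs.2)
    have h2 : ∫ w, (D N w : ℂ) * Complex.exp (s * Z N w) ∂(P N) =
        ((∫ w, D N w * Real.exp (s * Z N w) ∂(P N) : ℝ) : ℂ) := by
      rw [← integral_complex_ofReal]
      refine integral_congr_ae (ae_of_all _ fun w => ?_)
      push_cast; rfl
    rw [h2] at h1
    have h3 : (((∑' n, a N n * s ^ n : ℝ)) : ℂ) = ∑' n, (a N n : ℂ) * (s : ℂ) ^ n := by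
      rw [Complex.ofReal_tsum]; push_cast; rfl
    rw [← h3] at h1
    exact_mod_cast h1
  have hlimI : Tendsto (fun N => ∑' n, (a N n : ℂ) * Complex.I ^ n) atTop (𝓝 (∑' _ : ℕ, (0 : ℂ))) := by
    refine tendsto_tsum_of_dominated_convergence hgeo (fun n => ?_) ?_
    · have := (Complex.continuous_ofReal.tendsto 0).comp (ha0 n)
      simpa using this.mul_const (Complex.I ^ n)
    · filter_upwards [hab] with N hN n
      rw [norm_mul, norm_pow, Complex.norm_I, one_pow, mul_one, Complex.norm_real]
      exact hN n
  rw [tsum_zero] at hlimI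
  refine hlimI.congr' ?_
  filter_upwards [hser] with N hN
  rw [← hN Complex.I (by simp)]
  simp_rw [mul_comm Complex.I]

/-- Each b_j is a superposition of characters with integrable coefficients. By Fubini the
expectation is an integral of characteristic functions E[D e^{i∑x_j Z_j}]. These vanish for every x
by the previous lemma applied to the linear combination of the Z_j, and are dominated by a bound on
E|D|. D may change sign, so no limiting law is involved. -/
lemma tendsto_integral_mul_prod_of_tendsto_exp {q : ℕ} {D : ∀ N, S N → ℝ}
    [∀ N, SFinite (P N)]
    {Z : ∀ N, Fin q → S N → ℝ} (hZ : ∀ N j, Measurable (Z N j))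
    (hint : ∀ᶠ N in atTop, ∀ ξ : Fin q → ℝ,
      Integrable (fun w => D N w * Real.exp (∑ j, ξ j * Z N j w)) (P N))
    (hbd : ∀ ξ : Fin q → ℝ, ∃ C, ∀ᶠ N in atTop,
      ∫ w, |D N w| * Real.exp (∑ j, ξ j * Z N j w) ∂(P N) ≤ C)
    (hlim : ∀ ξ : Fin q → ℝ, Tendsto
      (fun N => ∫ w, D N w * Real.exp (∑ j, ξ j * Z N j w) ∂(P N)) atTop (𝓝 0))
    {b : Fin q → ℝ → ℝ} (hb : ∀ j, ContDiff ℝ ∞ (b j)) (hbs : ∀ j, HasCompactSupport (b j)) :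
    Tendsto (fun N => ∫ w, D N w * ∏ j, b j (Z N j w) ∂(P N)) atTop (𝓝 0) := by
  choose c hc hci hrep using fun j => exists_fourier_repr (hb j) (hbs j)
  have hprodi : Integrable (fun x : Fin q → ℝ => ∏ j, c j (x j)) := Integrable.fintype_prod hci
  obtain ⟨C, hC⟩ := hbd 0
  simp only [Pi.zero_apply, zero_mul, Finset.sum_const_zero, Real.exp_zero, mul_one] at hC
  have hchar : ∀ x : Fin q → ℝ, Tendsto (fun N => ∫ w, (D N w : ℂ) *
      Complex.exp ((∑ j, x j * Z N j w : ℝ) * Complex.I) ∂(P N)) atTop (𝓝 0) := by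
    intro x
    have hlin : ∀ (s : ℝ) N w, s * ∑ j, x j * Z N j w = ∑ j, (s * x j) * Z N j w := by
      intro s N w
      rw [Finset.mul_sum]
      simp only [mul_assoc]
    refine tendsto_char_of_tendsto_exp (Z := fun N w => ∑ j, x j * Z N j w)
      (fun N => ?_) ?_ (fun s => ?_) (fun s => ?_)
    · exact (Finset.measurable_fun_sum _ fun j _ => (hZ N j).const_mul _).aestronglyMeasurable
    · filter_upwards [hint] with N hN s
      simp only [hlin]
      exact hN _
    · simp only [hlin]
      exact hbd _
    · simp only [hlin]
      exact hlim _
  have hlimc : Tendsto (fun N => ∫ x : Fin q → ℝ, (∏ j, c j (x j)) * ∫ w, (D N w : ℂ) *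
      Complex.exp ((∑ j, x j * Z N j w : ℝ) * Complex.I) ∂(P N)) atTop
      (𝓝 (∫ x : Fin q → ℝ, (∏ j, c j (x j)) * 0)) := by
    refine tendsto_integral_filter_of_dominated_convergence
      (fun x => ‖∏ j, c j (x j)‖ * C) ?_ ?_ (hprodi.norm.mul_const _) ?_
    · filter_upwards [hint] with N hN
      have hD : AEStronglyMeasurable (D N) (P N) := by
        have := (hN 0).aestronglyMeasurable
        simpa using this
      refine hprodi.aestronglyMeasurable.mul ?_
      refine AEStronglyMeasurable.integral_prod_right' (f := fun p : (Fin q → ℝ) × S N =>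
        (D N p.2 : ℂ) * Complex.exp ((∑ j, p.1 j * Z N j p.2 : ℝ) * Complex.I)) ?_
      refine AEStronglyMeasurable.mul (Complex.continuous_ofReal.comp_aestronglyMeasurable
        hD.comp_snd) ?_
      refine Measurable.aestronglyMeasurable ?_
      have : Measurable fun p : (Fin q → ℝ) × S N => (∑ j, p.1 j * Z N j p.2) :=
        Finset.measurable_fun_sum _ fun j _ =>
          ((measurable_pi_apply j).comp measurable_fst).mul ((hZ N j).comp measurable_snd)
      exact Complex.measurable_exp.comp ((Complex.measurable_ofReal.comp this).mul_const _)
    · filter_upwards [hC] with N hN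
      refine ae_of_all _ fun x => ?_
      rw [norm_mul]
      gcongr
      refine (norm_integral_le_integral_norm _).trans (le_trans (le_of_eq ?_) hN)
      refine integral_congr_ae (ae_of_all _ fun w => ?_)
      simp only [norm_mul, Complex.norm_exp_ofReal_mul_I, mul_one, Complex.norm_real,
        Real.norm_eq_abs]
    · exact ae_of_all _ fun x => (hchar x).const_mul _
  simp only [mul_zero, integral_zero] at hlimc
  have hre := (Complex.continuous_re.tendsto 0).comp hlimc
  rw [Complex.zero_re] at hre
  refine hre.congr' ?_
  filter_upwards [hint] with N hN
  have hD : Integrable (D N) (P N) := by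
    have := hN 0
    simpa using this
  simp only [Function.comp]
  have h1 : ∫ x : Fin q → ℝ, (∏ j, c j (x j)) * ∫ w, (D N w : ℂ) *
      Complex.exp ((∑ j, x j * Z N j w : ℝ) * Complex.I) ∂(P N) =
      ∫ w, ((D N w * ∏ j, b j (Z N j w) : ℝ) : ℂ) ∂(P N) := by
    simp_rw [← integral_const_mul]
    rw [integral_integral_swap]
    · refine integral_congr_ae (ae_of_all _ fun w => ?_)
      simp only
      push_cast
      simp_rw [hrep]
      rw [← integral_fintype_prod_volume_eq_prod (fun j (a : ℝ) =>
        c j a * Complex.exp (a * Z N j w * Complex.I)), ← integral_const_mul]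
      refine integral_congr_ae (ae_of_all _ fun x => ?_)
      simp only
      rw [Finset.prod_mul_distrib, ← Complex.exp_sum, ← Finset.sum_mul]
      ring
    · have h2 := hprodi.mul_prod (hD.ofReal (𝕜 := ℂ))
      have hm : Measurable fun p : (Fin q → ℝ) × S N => (∑ j, p.1 j * Z N j p.2) :=
        Finset.measurable_fun_sum _ fun j _ =>
          ((measurable_pi_apply j).comp measurable_fst).mul ((hZ N j).comp measurable_snd)
      have h3 := h2.mul_bdd (c := 1)
        (g := fun p : (Fin q → ℝ) × S N => Complex.exp ((∑ j, p.1 j * Z N j p.2 : ℝ) * Complex.I))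
        (Complex.measurable_exp.comp ((Complex.measurable_ofReal.comp
          hm).mul_const _)).aestronglyMeasurable
        (ae_of_all _ fun p => by rw [Complex.norm_exp_ofReal_mul_I])
      refine h3.congr (ae_of_all _ fun p => ?_)
      simp only [Function.uncurry, mul_assoc]
      rfl
  rw [h1, integral_complex_ofReal, Complex.ofReal_re]

end Laplace

/-! ### Band limited kernels on the scale `σ` -/

/-- `V(y) = ∫ k(u) e^{iuy/σ} du` with `k` bounded by `C` and supported in `[-Rσ, Rσ]`. -/
structure IsKernel (σ : ℝ) (k : ℝ → ℂ) (V : ℝ → ℝ) (C R : ℝ) : Prop where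
  measurable : Measurable k
  bound : ∀ u, ‖k u‖ ≤ C
  support : ∀ u, R * σ < |u| → k u = 0
  eq : ∀ y, (V y : ℂ) = ∫ u : ℝ, k u * Complex.exp (u * (y / σ : ℝ) * Complex.I)

lemma IsKernel.integrable {σ : ℝ} {k : ℝ → ℂ} {V : ℝ → ℝ} {C R : ℝ} (hk : IsKernel σ k V C R) :
    Integrable k := by
  have h0 : k = (Icc (-(R * σ)) (R * σ)).indicator k := by
    ext u
    by_cases hu : u ∈ Icc (-(R * σ)) (R * σ)
    · rw [indicator_of_mem hu]
    · rw [indicator_of_notMem hu]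
      refine hk.support u (not_le.1 fun hle => hu (abs_le.1 hle))
  rw [h0, integrable_indicator_iff measurableSet_Icc]
  exact Measure.integrableOn_of_bounded (by simp) hk.measurable.aestronglyMeasurable
    (ae_of_all _ hk.bound)

lemma IsKernel.norm_le {σ : ℝ} {k : ℝ → ℂ} {V : ℝ → ℝ} {C R : ℝ} (hk : IsKernel σ k V C R) (y : ℝ) :
    |V y| ≤ ∫ u, ‖k u‖ := by
  rw [← Real.norm_eq_abs, ← Complex.norm_real, hk.eq]
  refine (norm_integral_le_integral_norm _).trans (le_of_eq ?_)
  simp only [norm_mul, norm_cexp_mul_I, mul_one]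

lemma IsKernel.add {σ : ℝ} {k k' : ℝ → ℂ} {V V' : ℝ → ℝ} {C C' R R' : ℝ} (hσ : 0 < σ)
    (hk : IsKernel σ k V C R) (hk' : IsKernel σ k' V' C' R') :
    IsKernel σ (fun u => k u + k' u) (fun y => V y + V' y) (C + C') (max R R') where
  measurable := hk.measurable.add hk'.measurable
  bound u := (norm_add_le _ _).trans (add_le_add (hk.bound u) (hk'.bound u))
  support u hu := by
    rw [hk.support u, hk'.support u, add_zero]
    · exact lt_of_le_of_lt (by gcongr; exact le_max_right _ _) hu
    · exact lt_of_le_of_lt (by gcongr; exact le_max_left _ _) hu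
  eq y := by
    simp only [add_mul]
    rw [integral_add (integrable_mul_char hk.integrable _) (integrable_mul_char hk'.integrable _),
      ← hk.eq, ← hk'.eq]
    push_cast; rfl

lemma IsKernel.continuous {σ : ℝ} {k : ℝ → ℂ} {V : ℝ → ℝ} {C R : ℝ} (hk : IsKernel σ k V C R) :
    Continuous V := by
  have : Continuous fun y => ∫ u : ℝ, k u * Complex.exp (u * (y / σ : ℝ) * Complex.I) := by
    refine continuous_of_dominated (bound := fun u => ‖k u‖) (fun y => ?_) (fun y => ?_)
      hk.integrable.norm (ae_of_all _ fun u => by fun_prop)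
    · exact (integrable_mul_char hk.integrable _).aestronglyMeasurable
    · exact ae_of_all _ fun u => by rw [norm_mul, norm_cexp_mul_I, mul_one]
  have h2 : V = fun y => (∫ u : ℝ, k u * Complex.exp (u * (y / σ : ℝ) * Complex.I)).re := by
    ext y; rw [← hk.eq, Complex.ofReal_re]
  rw [h2]
  exact Complex.continuous_re.comp this

/-- The kernel of `y ↦ σ p(y - b)` for a band limited `p`. -/
lemma BandLimited.isKernel_local {p : ℝ → ℝ} {φ : ℝ → ℂ} (h : BandLimited p φ) {C R : ℝ}
    (hC : ∀ t, ‖φ t‖ ≤ C) (hR : ∀ t, R < |t| → φ t = 0) {σ : ℝ} (hσ : 0 < σ) (b : ℝ) :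
    IsKernel σ (fun u => φ (u / σ) * Complex.exp ((u / σ : ℝ) * (-b : ℝ) * Complex.I))
      (fun y => σ * p (y - b)) C R where
  measurable := by
    have := h.continuous.measurable
    fun_prop
  bound u := by rw [norm_mul, norm_cexp_mul_I, mul_one]; exact hC _
  support u hu := by
    rw [hR, zero_mul]
    rw [abs_div, abs_of_pos hσ, lt_div_iff₀ hσ]
    exact hu
  eq y := by
    have h1 := (h.shift (-b)).eq y
    simp only [← sub_eq_add_neg] at h1
    rw [Complex.ofReal_mul, h1]
    have h2 := Measure.integral_comp_div (fun t : ℝ => φ t * Complex.exp (t * (-b : ℝ) * Complex.I) *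
      Complex.exp (t * y * Complex.I)) σ
    rw [abs_of_pos hσ, Complex.real_smul] at h2
    rw [← h2]
    refine integral_congr_ae (ae_of_all _ fun u => ?_)
    simp only
    congr 3
    push_cast
    ring

/-- The kernel of the global cutoff `y ↦ F(ε y / σ)`. -/
lemma isKernel_global {ε : ℝ} (hε : 0 < ε) {σ : ℝ} (hσ : 1 ≤ σ) :
    IsKernel σ (fun u => ((tri (u / ε) / ε : ℝ) : ℂ)) (fun y => fejer (ε * y / σ)) (1 / ε) ε where
  measurable := by
    have := continuous_tri.measurable
    fun_prop
  bound u := by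
    rw [Complex.norm_real, Real.norm_of_nonneg (div_nonneg (tri_nonneg _) hε.le)]
    gcongr
    exact tri_le_one _
  -- The support is [−ε, ε] independently of σ; the hypothesis σ ≥ 1 places it inside [−εσ, εσ], as
  -- the definition of a kernel requires.
  support u hu := by
    rw [tri_eq_zero, zero_div, Complex.ofReal_zero]
    rw [abs_div, abs_of_pos hε, le_div_iff₀ hε]
    nlinarith
  eq y := by
    have h1 := bandLimited_fejer.eq (ε * y / σ)
    rw [h1]
    have h2 := Measure.integral_comp_div (fun t : ℝ => (tri t : ℂ) *
      Complex.exp (t * (ε * y / σ : ℝ) * Complex.I)) ε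
    rw [abs_of_pos hε, Complex.real_smul] at h2
    have hε' : (ε : ℂ) ≠ 0 := by exact_mod_cast hε.ne'
    rw [← mul_right_inj' hε', ← h2, ← integral_const_mul]
    refine integral_congr_ae (ae_of_all _ fun u => ?_)
    simp only
    rw [← mul_assoc]
    congr 1
    · push_cast
      field_simp
    · congr 2
      push_cast
      field_simp

/-- Fubini. Expectations of kernels of Y become integrals of the weighted characteristic function of
Y/σ over |u| ≤ Rσ, the range where the imaginary part u/σ of the exponent stays bounded. -/
lemma integral_mul_kernel {S : Type*} [MeasurableSpace S] {P : Measure S} [SFinite P]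
    {σ : ℝ} {k : ℝ → ℂ} {V : ℝ → ℝ} {C R : ℝ} (hk : IsKernel σ k V C R)
    {G : S → ℂ} (hG : Integrable G P) {Y : S → ℝ} (hY : Measurable Y) :
    ∫ s, G s * V (Y s) ∂P =
      ∫ u : ℝ, k u * ∫ s, G s * Complex.exp (u * (Y s / σ : ℝ) * Complex.I) ∂P := by
  simp_rw [← integral_const_mul]
  rw [integral_integral_swap]
  · refine integral_congr_ae (ae_of_all _ fun s => ?_)
    simp only
    rw [hk.eq, ← integral_const_mul]
    refine integral_congr_ae (ae_of_all _ fun u => ?_)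
    simp only
    ring
  · have h1 := hk.integrable.mul_prod hG
    have h2 := h1.mul_bdd (c := 1)
      (g := fun p : ℝ × S => Complex.exp (p.1 * (Y p.2 / σ : ℝ) * Complex.I))
      (Measurable.aestronglyMeasurable (by fun_prop))
      (ae_of_all _ fun p => by rw [norm_cexp_mul_I])
    refine h2.congr (ae_of_all _ fun p => ?_)
    simp only [Function.uncurry, mul_assoc]

lemma integrable_mul_kernel {S : Type*} [MeasurableSpace S] {P : Measure S}
    {σ : ℝ} {k : ℝ → ℂ} {V : ℝ → ℝ} {C R : ℝ} (hk : IsKernel σ k V C R)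
    {G : S → ℂ} (hG : Integrable G P) {Y : S → ℝ} (hY : Measurable Y) :
    Integrable (fun s => G s * V (Y s)) P :=
  hG.mul_bdd (c := ∫ u, ‖k u‖) (Complex.continuous_ofReal.measurable.comp
    (hk.continuous.measurable.comp hY)).aestronglyMeasurable
    (ae_of_all _ fun s => by rw [Complex.norm_real]; exact hk.norm_le _)

lemma integrable_gaussian_half {η : ℝ} (hη : 0 < η) :
    Integrable fun u : ℝ => Real.exp (-η * u ^ 2 / 2) := by
  have := integrable_exp_neg_mul_sq (half_pos hη)
  refine this.congr (ae_of_all _ fun u => ?_)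
  simp only
  ring_nf

/-- The Gaussian bound is needed only where k lives, and it makes the u-integral finite
independently of σ. -/
lemma norm_integral_mul_kernel_le {S : Type*} [MeasurableSpace S] {P : Measure S} [SFinite P]
    {σ : ℝ} {k : ℝ → ℂ} {V : ℝ → ℝ} {C R : ℝ} (hk : IsKernel σ k V C R)
    {G : S → ℂ} (hG : Integrable G P) {Y : S → ℝ} (hY : Measurable Y) {η M : ℝ} (hη : 0 < η)
    (hM : 0 ≤ M) (hC : 0 ≤ C)
    (hH : ∀ u : ℝ, |u| ≤ R * σ → ‖∫ s, G s * Complex.exp (u * (Y s / σ : ℝ) * Complex.I) ∂P‖ ≤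
      M * Real.exp (-η * u ^ 2 / 2)) :
    ‖∫ s, G s * V (Y s) ∂P‖ ≤ C * M * ∫ u : ℝ, Real.exp (-η * u ^ 2 / 2) := by
  rw [integral_mul_kernel hk hG hY, ← integral_const_mul]
  refine norm_integral_le_of_norm_le ((integrable_gaussian_half hη).const_mul _)
    (ae_of_all _ fun u => ?_)
  rcases le_or_gt |u| (R * σ) with hu | hu
  · rw [norm_mul, mul_assoc]
    gcongr
    · exact hk.bound u
    · exact hH u hu
  · rw [hk.support u hu, zero_mul, norm_zero]
    positivity

/-- Dominated convergence in the frequency u. The general filter allows uniformity in x to be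
encoded in `atTop ×ˢ 𝓟 K`. -/
lemma tendsto_integral_mul_kernel {ι : Type*} {l : Filter ι} [l.IsCountablyGenerated]
    {S : ι → Type*} [∀ i, MeasurableSpace (S i)] {P : ∀ i, Measure (S i)} [∀ i, SFinite (P i)]
    {σ : ι → ℝ} {k : ι → ℝ → ℂ} {V : ι → ℝ → ℝ} {C R : ℝ} (hC : 0 ≤ C)
    (hk : ∀ᶠ i in l, IsKernel (σ i) (k i) (V i) C R)
    {G : ∀ i, S i → ℂ} (hG : ∀ᶠ i in l, Integrable (G i) (P i))
    {Y : ∀ i, S i → ℝ} (hY : ∀ i, Measurable (Y i)) {η M : ℝ} (hη : 0 < η) (hM : 0 ≤ M)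
    (hH : ∀ᶠ i in l, ∀ u : ℝ, |u| ≤ R * σ i →
      ‖∫ s, G i s * Complex.exp (u * (Y i s / σ i : ℝ) * Complex.I) ∂(P i)‖ ≤
      M * Real.exp (-η * u ^ 2 / 2))
    {k' : ℝ → ℂ} (hk' : ∀ u, Tendsto (fun i => k i u) l (𝓝 (k' u))) {c : ℂ}
    (hlim : ∀ u : ℝ, Tendsto (fun i => ∫ s, G i s *
      Complex.exp (u * (Y i s / σ i : ℝ) * Complex.I) ∂(P i)) l
        (𝓝 (c * Real.exp (-u ^ 2 / 2)))) :
    Tendsto (fun i => ∫ s, G i s * V i (Y i s) ∂(P i)) l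
      (𝓝 (c * ∫ u : ℝ, k' u * Real.exp (-u ^ 2 / 2))) := by
  have key : Tendsto (fun i => ∫ u : ℝ, k i u * ∫ s, G i s *
      Complex.exp (u * (Y i s / σ i : ℝ) * Complex.I) ∂(P i)) l
      (𝓝 (∫ u : ℝ, k' u * (c * Real.exp (-u ^ 2 / 2)))) := by
    refine tendsto_integral_filter_of_dominated_convergence
      (fun u => C * M * Real.exp (-η * u ^ 2 / 2)) ?_ ?_
      ((integrable_gaussian_half hη).const_mul _) (ae_of_all _ fun u => (hk' u).mul (hlim u))
    · filter_upwards [hk, hG] with i hki hGi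
      refine hki.measurable.aestronglyMeasurable.mul ?_
      refine AEStronglyMeasurable.integral_prod_right' (f := fun p : ℝ × S i =>
        G i p.2 * Complex.exp (p.1 * (Y i p.2 / σ i : ℝ) * Complex.I)) ?_
      have := hY i
      exact hGi.aestronglyMeasurable.comp_snd.mul
        (Measurable.aestronglyMeasurable (by fun_prop))
    · filter_upwards [hk, hH] with i hki hHi
      refine ae_of_all _ fun u => ?_
      rcases le_or_gt |u| (R * σ i) with hu | hu
      · rw [norm_mul, mul_assoc]
        gcongr
        · exact hki.bound u
        · exact hHi u hu
      · rw [hki.support u hu, zero_mul, norm_zero]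
        positivity
  refine (key.congr' ?_).trans (le_of_eq ?_)
  · filter_upwards [hk, hG] with i hki hGi
    rw [integral_mul_kernel hki hGi (hY i)]
  · rw [← integral_const_mul]
    congr 2
    ext u
    ring

/-! ### Consequences of the mesoscopic assumption -/

section MomentBounds

variable {d : ℕ} {Ω : Type*} [MetricSpace Ω] [MeasurableSpace Ω] {vol : Measure Ω}
  {h : Ω → Ω → ℝ} {ρ : ℝ → Ω → Ω → ℝ} {S : ℕ → Type*} [∀ N, MeasurableSpace (S N)]
  {P : ∀ N, Measure (S N)} {XN : ∀ N, S N → Ω → ℝ} {Ψ : ℂ → Ω → ℂ}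

/-- The covariance of `X(x)` with `∑_j ξ_j X_{δ_j}(z_j)`. -/
def covLin (vol : Measure Ω) (h : Ω → Ω → ℝ) (ρ : ℝ → Ω → Ω → ℝ) {q : ℕ} (ξ δ : Fin q → ℝ)
    (z : Fin q → Ω) (x : Ω) : ℝ :=
  ∫ u, cov h x u * mollifierSum ρ ξ δ z u ∂vol

/-- `exp (γ₁ X(x₁) + γ₂ X(x₂) + ∑_j ξ_j X_{δ_j}(z_j))`. -/
def expWeight {S : Type*} (vol : Measure Ω) (ρ : ℝ → Ω → Ω → ℝ) (X : S → Ω → ℝ) (γ₁ γ₂ : ℝ)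
    (x₁ x₂ : Ω) {q : ℕ} (ξ δ : Fin q → ℝ) (z : Fin q → Ω) (s : S) : ℝ :=
  Real.exp (γ₁ * X s x₁ + γ₂ * X s x₂ + ∑ j, ξ j * smoothed vol ρ X (δ j) (z j) s)

lemma isCompact_box (d : ℕ) (R : ℝ) : IsCompact (box d R) := by
  have : box d R = (Icc 0 √(2 * d)) ×ℂ (Icc (-R) R) := by
    ext ζ
    simp only [box, strip, mem_ofPred_eq, Complex.mem_reProdIm, mem_Icc, abs_le]
  rw [this]
  exact isCompact_Icc.reProdIm isCompact_Icc

lemma mem_box {d : ℕ} {R a t : ℝ} (ha : a ∈ Icc 0 √(2 * d)) (ht : |t| ≤ R) :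
    (a : ℂ) + t * Complex.I ∈ box d R := by
  have hre : ((a : ℂ) + t * Complex.I).re = a := by simp
  have him : ((a : ℂ) + t * Complex.I).im = t := by simp
  refine ⟨⟨?_, ?_⟩, ?_⟩
  · rw [hre]; exact ha.1
  · rw [hre]; exact ha.2
  · rw [him]; exact ht

lemma ofReal_mem_strip {d : ℕ} {a : ℝ} (ha : a ∈ Icc 0 √(2 * d)) : (a : ℂ) ∈ strip d :=
  ⟨by rw [Complex.ofReal_re]; exact ha.1, by rw [Complex.ofReal_re]; exact ha.2⟩

lemma MesoscopicAssumption.norm_Psi_le (hm : MesoscopicAssumption d P vol h ρ XN Ψ) {K : Set Ω}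
    (hK : IsCompact K) (R : ℝ) : ∃ B > 0, ∀ ζ ∈ box d R, ∀ x ∈ K, ‖Ψ ζ x‖ ≤ B := by
  have hc : ContinuousOn (fun p : ℂ × Ω => Ψ p.1 p.2) (box d R ×ˢ K) :=
    hm.continuousOn.mono (prod_mono (fun ζ hζ => hζ.1) (subset_univ _))
  obtain ⟨B, hB⟩ := ((isCompact_box d R).prod hK).exists_bound_of_continuousOn hc
  exact ⟨max B 1, by positivity, fun ζ hζ x hx => (hB (ζ, x) ⟨hζ, hx⟩).trans (le_max_left _ _)⟩

lemma MesoscopicAssumption.le_norm_Psi (hm : MesoscopicAssumption d P vol h ρ XN Ψ) {K : Set Ω}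
    (hK : IsCompact K) {t : ℝ} (ht : t ∈ Icc 0 √(2 * d)) : ∃ c > 0, ∀ x ∈ K, c ≤ ‖Ψ t x‖ := by
  rcases K.eq_empty_or_nonempty with rfl | hne
  · exact ⟨1, one_pos, by simp⟩
  have hmem : (t : ℂ) ∈ strip d := ofReal_mem_strip ht
  have hc : ContinuousOn (fun x : Ω => ‖Ψ t x‖) K :=
    (hm.continuousOn.comp (f := fun x => ((t : ℂ), x)) (by fun_prop)
      (fun x _ => ⟨hmem, mem_univ _⟩)).norm
  obtain ⟨x₀, _, hmin⟩ := hK.exists_isMinOn hne hc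
  refine ⟨‖Ψ t x₀‖, ?_, fun x hx => hmin hx⟩
  obtain ⟨r, hr, hr'⟩ := hm.pos t ht.1 ht.2 x₀
  rw [hr', Complex.norm_real]
  exact norm_pos_iff.2 hr.ne'

lemma norm_gaussianFactor (N : ℕ) (γ₁ γ₂ t₁ t₂ : ℝ) (x₁ x₂ : Ω) {q : ℕ} (ξ δ : Fin q → ℝ)
    (z : Fin q → Ω) :
    ‖gaussianFactor vol h ρ N ((γ₁ : ℂ) + t₁ * Complex.I, (γ₂ : ℂ) + t₂ * Complex.I)
      x₁ x₂ ξ δ z‖ =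
      Real.exp ((γ₁ ^ 2 + γ₂ ^ 2 - t₁ ^ 2 - t₂ ^ 2) / 2 * Real.log N +
        ((γ₁ * γ₂ - t₁ * t₂) * cov h x₁ x₂ + γ₁ * covLin vol h ρ ξ δ z x₁ +
          γ₂ * covLin vol h ρ ξ δ z x₂ + 1 / 2 * covForm vol h (mollifierSum ρ ξ δ z))) := by
  unfold gaussianFactor
  rw [norm_mul, Complex.norm_exp, Complex.norm_exp, ← Real.exp_add]
  congr 1
  simp only [Complex.add_re, Complex.mul_re, Complex.ofReal_re,
    Complex.ofReal_im, Complex.I_re, Complex.I_im, Complex.add_im, Complex.mul_im, pow_two,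
    Complex.div_ofNat_re, covLin, Complex.one_re, Complex.one_im, Complex.div_ofNat_im]
  ring

lemma gaussianFactor_ne_zero (N : ℕ) (ζ : ℂ × ℂ) (x₁ x₂ : Ω) {q : ℕ} (ξ δ : Fin q → ℝ)
    (z : Fin q → Ω) : gaussianFactor vol h ρ N ζ x₁ x₂ ξ δ z ≠ 0 :=
  mul_ne_zero (Complex.exp_ne_zero _) (Complex.exp_ne_zero _)

lemma integral_expField_eq {N : ℕ} (ζ : ℂ × ℂ) (x₁ x₂ : Ω) {q : ℕ} (ξ δ : Fin q → ℝ)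
    (z : Fin q → Ω) :
    ∫ s, expField vol ρ (XN N) ζ x₁ x₂ ξ δ z s ∂(P N) =
      PsiN (P N) vol h ρ (XN N) N ζ x₁ x₂ ξ δ z * gaussianFactor vol h ρ N ζ x₁ x₂ ξ δ z := by
  rw [PsiN, div_mul_cancel₀ _ (gaussianFactor_ne_zero _ _ _ _ _ _ _)]

lemma expWeight_mul_char {S : Type*} (X : S → Ω → ℝ) (γ₁ γ₂ c₁ c₂ σ u₁ u₂ : ℝ) (x₁ x₂ : Ω)
    {q : ℕ} (ξ δ : Fin q → ℝ) (z : Fin q → Ω) (s : S) :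
    (expWeight vol ρ X γ₁ γ₂ x₁ x₂ ξ δ z s : ℂ) *
      Complex.exp (u₂ * (((X s x₂ - c₂) / σ : ℝ) : ℂ) * Complex.I) *
      Complex.exp (u₁ * (((X s x₁ - c₁) / σ : ℝ) : ℂ) * Complex.I) =
    Complex.exp (((-(u₁ / σ * c₁ + u₂ / σ * c₂) : ℝ) : ℂ) * Complex.I) *
      expField vol ρ X ((γ₁ : ℂ) + (u₁ / σ : ℝ) * Complex.I, (γ₂ : ℂ) + (u₂ / σ : ℝ) * Complex.I)
        x₁ x₂ ξ δ z s := by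
  unfold expWeight expField
  rw [Complex.ofReal_exp, ← Complex.exp_add, ← Complex.exp_add, ← Complex.exp_add]
  congr 1
  push_cast
  ring

lemma eventually_rpow_pos : ∀ᶠ N : ℕ in atTop, ∀ a : ℝ, 0 < (N : ℝ) ^ a := by
  filter_upwards [eventually_gt_atTop 0] with N hN a
  exact Real.rpow_pos_of_pos (by exact_mod_cast hN) a

lemma exists_abs_cov_le (h_cont : Continuous (fun p : Ω × Ω => h p.1 p.2)) {K : Set Ω}
    (hK : IsCompact K) : ∃ B ≥ 0, ∀ x₁ ∈ K, ∀ x₂ ∈ K, ∀ r : ℝ, 0 < r → r ≤ 1 → r ≤ dist x₁ x₂ →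
      |cov h x₁ x₂| ≤ -Real.log r + B := by
  obtain ⟨B₁, hB₁⟩ := (hK.prod hK).exists_bound_of_continuousOn h_cont.continuousOn
  obtain ⟨B₂, hB₂⟩ := Metric.isBounded_iff.1 hK.isBounded
  refine ⟨|B₁| + |B₂|, by positivity, fun x₁ h₁ x₂ h₂ r hr0 hr1 hr => ?_⟩
  have e1 : |h x₁ x₂| ≤ |B₁| := (hB₁ (x₁, x₂) ⟨h₁, h₂⟩).trans (le_abs_self _)
  have hd : 0 < dist x₁ x₂ := hr0.trans_le hr
  have e2 : Real.log (dist x₁ x₂) ≤ |B₂| := by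
    have := Real.log_le_sub_one_of_pos hd
    have := hB₂ h₁ h₂
    linarith [le_abs_self B₂]
  have e3 : Real.log r ≤ Real.log (dist x₁ x₂) := Real.log_le_log hr0 hr
  have e4 : Real.log r ≤ 0 := Real.log_nonpos hr0.le hr1
  rw [cov, abs_le]
  have := abs_le.1 e1
  constructor <;> linarith [abs_nonneg B₁, abs_nonneg B₂]

/-- The characteristic function of a pair, under an exponential tilt. -/
lemma MesoscopicAssumption.norm_char_le (hm : MesoscopicAssumption d P vol h ρ XN Ψ)
    (h_cont : Continuous (fun p : Ω × Ω => h p.1 p.2)) {K : Set Ω} (hK : IsCompact K)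
    {η R : ℝ} (hη : 0 < η) (hη1 : η < 1) (hR : 0 < R) {q : ℕ} (ξ : Fin q → ℝ)
    {γ₁ γ₂ : ℝ} (hγ₁ : γ₁ ∈ Icc 0 √(2 * d)) (hγ₂ : γ₂ ∈ Icc 0 √(2 * d)) :
    ∃ A > 0, ∀ᶠ N : ℕ in atTop, ∀ x₁ ∈ K, ∀ x₂ ∈ K, (N : ℝ) ^ (η - 1) ≤ dist x₁ x₂ →
      ∀ z : Fin q → Ω, (∀ j, z j ∈ K) →
      ∀ δ : Fin q → ℝ, (∀ j, δ j ∈ Ioc (0 : ℝ) 1 ∧ (N : ℝ) ^ (-1 + η) ≤ δ j) →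
      ∀ c₁ c₂ u₁ u₂ : ℝ, |u₁| ≤ R * √(Real.log N) → |u₂| ≤ R * √(Real.log N) →
      ‖∫ s, (expWeight vol ρ (XN N) γ₁ γ₂ x₁ x₂ ξ δ z s : ℂ) *
        Complex.exp (u₂ * (((XN N s x₂ - c₂) / √(Real.log N) : ℝ) : ℂ) * Complex.I) *
        Complex.exp (u₁ * (((XN N s x₁ - c₁) / √(Real.log N) : ℝ) : ℂ) * Complex.I) ∂(P N)‖ ≤
      A * Real.exp ((γ₁ ^ 2 + γ₂ ^ 2) / 2 * Real.log N + γ₁ * γ₂ * cov h x₁ x₂ +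
        γ₁ * covLin vol h ρ ξ δ z x₁ + γ₂ * covLin vol h ρ ξ δ z x₂ +
        1 / 2 * covForm vol h (mollifierSum ρ ξ δ z)) *
        Real.exp (-η * u₂ ^ 2 / 2) * Real.exp (-η * u₁ ^ 2 / 2) := by
  obtain ⟨B, hB0, hB⟩ := hm.norm_Psi_le hK R
  obtain ⟨B', hB'0, hB'⟩ := exists_abs_cov_le h_cont hK
  -- With relative error 1 the ratio Ψ_N is at most 2B² in modulus; the exponential pays for the
  -- bounded part of the covariance.
  refine ⟨2 * B ^ 2 * Real.exp (R ^ 2 * B'), by positivity, ?_⟩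
  filter_upwards [hm.asymptotics K hK η hη R hR q ξ 1 one_pos, eventually_rpow_pos,
    eventually_gt_atTop 1] with N hN hpos hN1 x₁ hx₁ x₂ hx₂ hdist z hz δ hδ c₁ c₂ u₁ u₂ hu₁ hu₂
  have hNr : (1 : ℝ) < N := by exact_mod_cast hN1
  have hL : 0 < Real.log N := Real.log_pos hNr
  set L := Real.log N with hLdef
  set σ := √L with hσdef
  have hσ : 0 < σ := Real.sqrt_pos.2 hL
  have hσ2 : σ ^ 2 = L := Real.sq_sqrt hL.le
  have ht₁ : |u₁ / σ| ≤ R := by rw [abs_div, abs_of_pos hσ, div_le_iff₀ hσ]; exact hu₁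
  have ht₂ : |u₂ / σ| ≤ R := by rw [abs_div, abs_of_pos hσ, div_le_iff₀ hσ]; exact hu₂
  simp_rw [expWeight_mul_char]
  rw [integral_const_mul, norm_mul, Complex.norm_exp_ofReal_mul_I, one_mul, integral_expField_eq
    (h := h), norm_mul, norm_gaussianFactor]
  have h1 := hN _ (mem_box hγ₁ ht₁) _ (mem_box hγ₂ ht₂) x₁ hx₁ x₂ hx₂ hdist z hz δ hδ
  have h2 : ‖Ψ ((γ₁ : ℂ) + (u₁ / σ : ℝ) * Complex.I) x₁ *
      Ψ ((γ₂ : ℂ) + (u₂ / σ : ℝ) * Complex.I) x₂‖ ≤ B ^ 2 := by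
    rw [norm_mul, pow_two]
    exact mul_le_mul (hB _ (mem_box hγ₁ ht₁) _ hx₁) (hB _ (mem_box hγ₂ ht₂) _ hx₂)
      (norm_nonneg _) hB0.le
  have h3 := (norm_le_norm_add_norm_sub' _ _).trans (add_le_add h2 (h1.trans
    (mul_le_mul_of_nonneg_left h2 zero_le_one)))
  have hcov := hB' x₁ hx₁ x₂ hx₂ _ (hpos _)
    (Real.rpow_le_one_of_one_le_of_nonpos hNr.le (by linarith)) hdist
  rw [Real.log_rpow (by linarith), ← hLdef] at hcov
  -- At distance at least N^{η−1} the covariance is at most (1 − η) log N + B', and |u₁u₂| ≤ (u₁² +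
  -- u₂²)/2. So the cross term uses up only a fraction 1 − η of the Gaussian decay and leaves
  -- e^{-η(u₁²+u₂²)/2}.
  have hprod : |u₁ / σ * (u₂ / σ) * cov h x₁ x₂| ≤
      (1 - η) * (u₁ ^ 2 + u₂ ^ 2) / 2 + R ^ 2 * B' := by
    rw [abs_mul]
    have e1 : |u₁ / σ * (u₂ / σ)| ≤ R ^ 2 := by
      rw [abs_mul, pow_two]; exact mul_le_mul ht₁ ht₂ (abs_nonneg _) hR.le
    have e2 : |u₁ / σ * (u₂ / σ)| * L ≤ (u₁ ^ 2 + u₂ ^ 2) / 2 := by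
      have : |u₁ / σ * (u₂ / σ)| * L = |u₁| * |u₂| := by
        rw [abs_mul, abs_div, abs_div, abs_of_pos hσ, ← hσ2]
        field_simp
      rw [this]
      nlinarith [sq_nonneg (|u₁| - |u₂|), sq_abs u₁, sq_abs u₂]
    have e3 : 0 ≤ |u₁ / σ * (u₂ / σ)| := abs_nonneg _
    calc _ ≤ |u₁ / σ * (u₂ / σ)| * (-((η - 1) * L) + B') := by gcongr
      _ = (1 - η) * (|u₁ / σ * (u₂ / σ)| * L) + |u₁ / σ * (u₂ / σ)| * B' := by ring
      _ ≤ (1 - η) * ((u₁ ^ 2 + u₂ ^ 2) / 2) + R ^ 2 * B' := by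
          gcongr
      _ = _ := by ring
  have hsq : ((u₁ / σ) ^ 2 + (u₂ / σ) ^ 2) * L = u₁ ^ 2 + u₂ ^ 2 := by
    rw [← hσ2]; field_simp
  have hexp := (abs_le.1 hprod).1
  calc _ ≤ (B ^ 2 + 1 * B ^ 2) * Real.exp ((((γ₁ ^ 2 + γ₂ ^ 2) / 2 * L + γ₁ * γ₂ * cov h x₁ x₂ +
        γ₁ * covLin vol h ρ ξ δ z x₁ + γ₂ * covLin vol h ρ ξ δ z x₂ +
        1 / 2 * covForm vol h (mollifierSum ρ ξ δ z)) + R ^ 2 * B') + -η * u₂ ^ 2 / 2 +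
          -η * u₁ ^ 2 / 2) := by
        refine mul_le_mul h3 (Real.exp_le_exp.2 ?_) (Real.exp_pos _).le (by positivity)
        nlinarith
    _ = _ := by
        rw [Real.exp_add, Real.exp_add, Real.exp_add _ (R ^ 2 * B')]
        ring

lemma MesoscopicAssumption.integrable_expWeight (hm : MesoscopicAssumption d P vol h ρ XN Ψ)
    {N : ℕ} (hN : 1 ≤ N) {γ₁ γ₂ : ℝ} (hγ₁ : γ₁ ∈ Icc 0 √(2 * d)) (hγ₂ : γ₂ ∈ Icc 0 √(2 * d))
    {x₁ x₂ : Ω} (hx : x₁ ≠ x₂) {q : ℕ} (ξ δ : Fin q → ℝ) (z : Fin q → Ω)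
    (hδ : ∀ j, δ j ∈ Ioc (0 : ℝ) 1) :
    Integrable (expWeight vol ρ (XN N) γ₁ γ₂ x₁ x₂ ξ δ z) (P N) := by
  have h1 := (hm.integrable N hN ((γ₁ : ℂ), (γ₂ : ℂ))
    ⟨ofReal_mem_strip hγ₁, ofReal_mem_strip hγ₂⟩ x₁ x₂ hx q ξ δ z hδ).re
  refine h1.congr (ae_of_all _ fun s => ?_)
  simp only [expField, expWeight]
  have := Complex.exp_ofReal_re (γ₁ * XN N s x₁ + γ₂ * XN N s x₂ +
    ∑ j, ξ j * smoothed vol ρ (XN N) (δ j) (z j) s)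
  push_cast at this ⊢
  exact this

end MomentBounds

/-! ### One-point exponential moments and the tilted characteristic function. -/

section OnePoint

variable {d : ℕ} {Ω : Type*} [MetricSpace Ω] [MeasurableSpace Ω] {vol : Measure Ω}
  {h : Ω → Ω → ℝ} {ρ : ℝ → Ω → Ω → ℝ} {S : ℕ → Type*} [∀ N, MeasurableSpace (S N)]
  {P : ∀ N, Measure (S N)} {XN : ∀ N, S N → Ω → ℝ} {Ψ : ℂ → Ω → ℂ} {γ : ℝ}

/-- `E[e^{γ X(x)}]`. -/
def expMean {S : Type*} [MeasurableSpace S] (P : Measure S) (X : S → Ω → ℝ) (γ : ℝ) (x : Ω) : ℝ :=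
  ∫ s, Real.exp (γ * X s x) ∂P

/-- The weight `e^{γ X(x)} / E[e^{γ X(x)}]`. -/
def wt {S : Type*} [MeasurableSpace S] (P : Measure S) (X : S → Ω → ℝ) (γ : ℝ) (x : Ω) (s : S) : ℝ :=
  Real.exp (γ * X s x) / expMean P X γ x

/-- One-point statements are two-point statements with ζ₂ = 0, but the assumptions ask for separated
points. Of two fixed points, at least one lies at distance at least half their separation from x. -/
lemma exists_aux [Nontrivial Ω] {K : Set Ω} (hK : IsCompact K) :
    ∃ (K' : Set Ω) (aux : Ω → Ω) (r : ℝ), IsCompact K' ∧ K ⊆ K' ∧ 0 < r ∧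
      (∀ x, aux x ∈ K') ∧ ∀ x, r ≤ dist x (aux x) := by
  obtain ⟨a, b, hab⟩ := exists_pair_ne Ω
  have key : ∀ x : Ω, ∃ y ∈ ({a, b} : Set Ω), dist a b / 2 ≤ dist x y := by
    intro x
    by_contra! hcon
    have h1 := hcon a (by simp)
    have h2 := hcon b (by simp)
    have := dist_triangle_left a b x
    linarith
  choose aux h1 h2 using key
  exact ⟨K ∪ {a, b}, aux, dist a b / 2, hK.union (toFinite _).isCompact, subset_union_left,
    half_pos (dist_pos.2 hab), fun x => Or.inr (h1 x), h2⟩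

lemma eventually_rpow_le {η r : ℝ} (hη : η < 1) (hr : 0 < r) :
    ∀ᶠ N : ℕ in atTop, (N : ℝ) ^ (η - 1) ≤ r := by
  have h1 := (tendsto_rpow_neg_atTop (y := 1 - η) (by linarith)).comp
    (tendsto_natCast_atTop_atTop (R := ℝ))
  have := h1.eventually (ge_mem_nhds hr)
  filter_upwards [this] with N hN
  simpa [neg_sub] using hN

lemma tendsto_sqrt_log : Tendsto (fun N : ℕ => √(Real.log N)) atTop atTop :=
  Real.tendsto_sqrt_atTop.comp (Real.tendsto_log_atTop.comp tendsto_natCast_atTop_atTop)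

lemma mollifierSum_fin_zero (ξ δ : Fin 0 → ℝ) (z : Fin 0 → Ω) :
    mollifierSum ρ ξ δ z = fun _ => 0 := by
  ext u; simp [mollifierSum]

lemma covLin_fin_zero (ξ δ : Fin 0 → ℝ) (z : Fin 0 → Ω) (x : Ω) :
    covLin vol h ρ ξ δ z x = 0 := by
  simp [covLin, mollifierSum_fin_zero]

lemma covForm_fin_zero (ξ δ : Fin 0 → ℝ) (z : Fin 0 → Ω) :
    covForm vol h (mollifierSum ρ ξ δ z) = 0 := by
  simp [covForm, mollifierSum_fin_zero]

lemma expWeight_zero_right {S : Type*} (X : S → Ω → ℝ) (γ : ℝ) (x x₂ x₂' : Ω) {q : ℕ}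
    (ξ δ : Fin q → ℝ) (z : Fin q → Ω) (s : S) :
    expWeight vol ρ X γ 0 x x₂ ξ δ z s = expWeight vol ρ X γ 0 x x₂' ξ δ z s := by
  simp [expWeight]

lemma MesoscopicAssumption.norm_char_one_le [Nontrivial Ω]
    (hm : MesoscopicAssumption d P vol h ρ XN Ψ)
    (h_cont : Continuous (fun p : Ω × Ω => h p.1 p.2)) {K : Set Ω} (hK : IsCompact K)
    {η R : ℝ} (hη : 0 < η) (hη1 : η < 1) (hR : 0 < R) {q : ℕ} (ξ : Fin q → ℝ)
    {γ₁ : ℝ} (hγ₁ : γ₁ ∈ Icc 0 √(2 * d)) :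
    ∃ A > 0, ∀ᶠ N : ℕ in atTop, ∀ x ∈ K,
      ∀ z : Fin q → Ω, (∀ j, z j ∈ K) →
      ∀ δ : Fin q → ℝ, (∀ j, δ j ∈ Ioc (0 : ℝ) 1 ∧ (N : ℝ) ^ (-1 + η) ≤ δ j) →
      ∀ c u : ℝ, |u| ≤ R * √(Real.log N) →
      ‖∫ s, (expWeight vol ρ (XN N) γ₁ 0 x x ξ δ z s : ℂ) *
        Complex.exp (u * (((XN N s x - c) / √(Real.log N) : ℝ) : ℂ) * Complex.I) ∂(P N)‖ ≤
      A * Real.exp (γ₁ ^ 2 / 2 * Real.log N + γ₁ * covLin vol h ρ ξ δ z x +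
        1 / 2 * covForm vol h (mollifierSum ρ ξ δ z)) * Real.exp (-η * u ^ 2 / 2) := by
  obtain ⟨K', aux, r, hK', hKK', hr, haux, hdist⟩ := exists_aux hK
  obtain ⟨A, hA, hev⟩ := hm.norm_char_le h_cont hK' hη hη1 hR ξ hγ₁
    (⟨le_rfl, Real.sqrt_nonneg _⟩ : (0 : ℝ) ∈ Icc 0 √(2 * d))
  refine ⟨A, hA, ?_⟩
  filter_upwards [hev, eventually_rpow_le hη1 hr] with N hN hNr x hx z hz δ hδ c u hu
  have := hN x (hKK' hx) (aux x) (haux x) (hNr.trans (hdist x)) z (fun j => hKK' (hz j)) δ hδ c 0 u 0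
    hu (by simpa using by positivity)
  simp only [Complex.ofReal_zero, zero_mul, Complex.exp_zero, mul_one, mul_zero, add_zero, ne_eq,
    OfNat.ofNat_ne_zero, not_false_eq_true, zero_pow, zero_div, Real.exp_zero] at this
  simp_rw [expWeight_zero_right (vol := vol) (ρ := ρ) (XN N) γ₁ x (aux x) x ξ δ z] at this
  exact this

lemma MesoscopicAssumption.integrable_expWeight_one [Nontrivial Ω]
    (hm : MesoscopicAssumption d P vol h ρ XN Ψ)
    {N : ℕ} (hN : 1 ≤ N) {γ₁ : ℝ} (hγ₁ : γ₁ ∈ Icc 0 √(2 * d))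
    (x : Ω) {q : ℕ} (ξ δ : Fin q → ℝ) (z : Fin q → Ω)
    (hδ : ∀ j, δ j ∈ Ioc (0 : ℝ) 1) :
    Integrable (expWeight vol ρ (XN N) γ₁ 0 x x ξ δ z) (P N) := by
  obtain ⟨x₂, hx₂⟩ := exists_ne x
  have := hm.integrable_expWeight hN hγ₁
    (⟨le_rfl, Real.sqrt_nonneg _⟩ : (0 : ℝ) ∈ Icc 0 √(2 * d)) hx₂.symm ξ δ z hδ
  refine this.congr (ae_of_all _ fun s => ?_)
  rw [expWeight_zero_right]

lemma MesoscopicAssumption.integrable_exp [Nontrivial Ω]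
    (hm : MesoscopicAssumption d P vol h ρ XN Ψ)
    {N : ℕ} (hN : 1 ≤ N) (hγ : γ ∈ Icc 0 √(2 * d)) (x : Ω) :
    Integrable (fun s => Real.exp (γ * XN N s x)) (P N) := by
  refine (hm.integrable_expWeight_one hN hγ x (q := 0) 0 0 (fun _ => x)
    (fun j => j.elim0)).congr (ae_of_all _ fun s => ?_)
  simp [expWeight]

/-- The normalized one-point exponential moment. -/
def momentRatio {S : Type*} [MeasurableSpace S] (P : Measure S) (X : S → Ω → ℝ) (N : ℕ) (ζ : ℂ)
    (x : Ω) : ℂ :=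
  (∫ s, Complex.exp (ζ * X s x) ∂P) / Complex.exp (ζ ^ 2 / 2 * (Real.log N : ℂ))

/-- The case ζ₂ = 0, q = 0 with an auxiliary second point, where Ψ(0, ·) = 1. The relative error
becomes absolute because Ψ is bounded on the box times a compact set. -/
lemma MesoscopicAssumption.momentRatio_near [Nontrivial Ω]
    (hm : MesoscopicAssumption d P vol h ρ XN Ψ) {K : Set Ω} (hK : IsCompact K)
    {R : ℝ} (hR : 0 < R) {ε : ℝ} (hε : 0 < ε) :
    ∀ᶠ N : ℕ in atTop, ∀ ζ ∈ box d R, ∀ x ∈ K, ‖momentRatio (P N) (XN N) N ζ x - Ψ ζ x‖ ≤ ε := by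
  obtain ⟨K', aux, r, hK', hKK', hr, haux, hdist⟩ := exists_aux hK
  obtain ⟨B, hB0, hB⟩ := hm.norm_Psi_le hK' R
  have hη : (0 : ℝ) < 1 / 2 := by norm_num
  filter_upwards [hm.asymptotics K' hK' (1 / 2) hη R hR 0 0 (ε / B) (by positivity),
    eventually_rpow_le (by norm_num : (1 / 2 : ℝ) < 1) hr] with N hN hNr ζ hζ x hx
  have h0 : (0 : ℂ) ∈ box d R := ⟨⟨by simp, by simp⟩, by simpa using hR.le⟩
  have h1 := hN ζ hζ 0 h0 x (hKK' hx) (aux x) (haux x) (hNr.trans (hdist x)) (fun j => j.elim0)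
    (fun j => j.elim0) (fun j => j.elim0) (fun j => j.elim0)
  rw [hm.at_zero, mul_one] at h1
  have h2 : PsiN (P N) vol h ρ (XN N) N (ζ, 0) x (aux x) (0 : Fin 0 → ℝ) (fun j => j.elim0)
      (fun j => j.elim0) = momentRatio (P N) (XN N) N ζ x := by
    rw [PsiN, momentRatio]
    congr 1
    · refine integral_congr_ae (ae_of_all _ fun s => ?_)
      simp [expField]
    · simp [gaussianFactor, mollifierSum_fin_zero, covForm]
  rw [h2] at h1
  refine h1.trans ?_
  calc ε / B * ‖Ψ ζ x‖ ≤ ε / B * B := by gcongr; exact hB ζ hζ x (hKK' hx)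
    _ = ε := by field_simp

lemma MesoscopicAssumption.Psi_near (hm : MesoscopicAssumption d P vol h ρ XN Ψ) {K : Set Ω}
    (hK : IsCompact K) (hγ : γ ∈ Icc 0 √(2 * d)) (u : ℝ) {ε : ℝ} (hε : 0 < ε) :
    ∀ᶠ N : ℕ in atTop, ∀ x ∈ K,
      ‖Ψ ((γ : ℂ) + (u / √(Real.log N) : ℝ) * Complex.I) x - Ψ γ x‖ ≤ ε := by
  have hc : ContinuousOn (fun p : ℂ × Ω => Ψ p.1 p.2) (box d 1 ×ˢ K) :=
    hm.continuousOn.mono (prod_mono (fun ζ hζ => hζ.1) (subset_univ _))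
  have hu := ((isCompact_box d 1).prod hK).uniformContinuousOn_of_continuous hc
  rw [Metric.uniformContinuousOn_iff] at hu
  obtain ⟨θ, hθ, hu⟩ := hu ε hε
  have hlim : Tendsto (fun N : ℕ => u / √(Real.log N)) atTop (𝓝 0) :=
    tendsto_sqrt_log.const_div_atTop u
  filter_upwards [hlim.eventually (Metric.ball_mem_nhds 0 hθ),
    hlim.eventually (Metric.ball_mem_nhds 0 one_pos)] with N h1 h2 x hx
  rw [dist_zero_right, Real.norm_eq_abs] at h1 h2
  have h3 := hu (_, x) ⟨mem_box hγ h2.le, hx⟩ ((γ : ℂ), x)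
    ⟨⟨ofReal_mem_strip hγ, by simp⟩, hx⟩ (by
      rw [Prod.dist_eq, dist_self, max_eq_left dist_nonneg, dist_eq_norm, add_sub_cancel_left,
        norm_mul, Complex.norm_I, mul_one, Complex.norm_real]
      exact h1)
  rw [dist_eq_norm] at h3
  exact h3.le

lemma MesoscopicAssumption.momentRatio_near' [Nontrivial Ω]
    (hm : MesoscopicAssumption d P vol h ρ XN Ψ) {K : Set Ω} (hK : IsCompact K)
    (hγ : γ ∈ Icc 0 √(2 * d)) (u : ℝ) {ε : ℝ} (hε : 0 < ε) :
    ∀ᶠ N : ℕ in atTop, ∀ x ∈ K,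
      ‖momentRatio (P N) (XN N) N ((γ : ℂ) + (u / √(Real.log N) : ℝ) * Complex.I) x - Ψ γ x‖ ≤ ε := by
  have hlim : Tendsto (fun N : ℕ => u / √(Real.log N)) atTop (𝓝 0) :=
    tendsto_sqrt_log.const_div_atTop u
  filter_upwards [hlim.eventually (Metric.ball_mem_nhds 0 one_pos),
    hm.momentRatio_near hK one_pos (half_pos hε), hm.Psi_near hK hγ u (half_pos hε)]
    with N h1 h2 h3 x hx
  rw [dist_zero_right, Real.norm_eq_abs] at h1
  have := norm_sub_le_norm_sub_add_norm_sub
    (momentRatio (P N) (XN N) N ((γ : ℂ) + (u / √(Real.log N) : ℝ) * Complex.I) x)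
    (Ψ ((γ : ℂ) + (u / √(Real.log N) : ℝ) * Complex.I) x) (Ψ γ x)
  linarith [h2 _ (mem_box hγ h1.le) x hx, h3 x hx]

lemma momentRatio_ofReal {S : Type*} [MeasurableSpace S] (P : Measure S) (X : S → Ω → ℝ) (N : ℕ)
    (γ : ℝ) (x : Ω) :
    momentRatio P X N γ x = ((expMean P X γ x / Real.exp (γ ^ 2 / 2 * Real.log N) : ℝ) : ℂ) := by
  rw [momentRatio, expMean, Complex.ofReal_div, ← integral_complex_ofReal]
  push_cast
  rfl

lemma expMean_nonneg {S : Type*} [MeasurableSpace S] (P : Measure S) (X : S → Ω → ℝ) (γ : ℝ)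
    (x : Ω) : 0 ≤ expMean P X γ x := integral_nonneg fun _ => (Real.exp_pos _).le

/-- Ψ(γ, ·) is continuous and positive, hence bounded and bounded away from 0 on K, and the
normalized moment converges to it uniformly. -/
lemma MesoscopicAssumption.expMean_bounds [Nontrivial Ω]
    (hm : MesoscopicAssumption d P vol h ρ XN Ψ) {K : Set Ω} (hK : IsCompact K)
    (hγ : γ ∈ Icc 0 √(2 * d)) :
    ∃ c > 0, ∃ C > 0, ∀ᶠ N : ℕ in atTop, ∀ x ∈ K,
      c * Real.exp (γ ^ 2 / 2 * Real.log N) ≤ expMean (P N) (XN N) γ x ∧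
      expMean (P N) (XN N) γ x ≤ C * Real.exp (γ ^ 2 / 2 * Real.log N) := by
  obtain ⟨c, hc0, hc⟩ := hm.le_norm_Psi hK hγ
  obtain ⟨B, hB0, hB⟩ := hm.norm_Psi_le hK 1
  refine ⟨c / 2, half_pos hc0, B + c, by positivity, ?_⟩
  filter_upwards [hm.momentRatio_near hK one_pos (half_pos hc0)] with N hN x hx
  have h1 := hN γ ⟨ofReal_mem_strip hγ, by simp⟩ x hx
  rw [momentRatio_ofReal] at h1
  have h2 := norm_sub_norm_le (Ψ γ x)
    ((expMean (P N) (XN N) γ x / Real.exp (γ ^ 2 / 2 * Real.log N) : ℝ) : ℂ)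
  have h3 := norm_sub_norm_le ((expMean (P N) (XN N) γ x /
    Real.exp (γ ^ 2 / 2 * Real.log N) : ℝ) : ℂ) (Ψ γ x)
  rw [norm_sub_rev] at h2
  rw [Complex.norm_real, Real.norm_of_nonneg (div_nonneg (expMean_nonneg _ _ _ _)
    (Real.exp_pos _).le)] at h2 h3
  have h4 := hc x hx
  have h5 := hB γ ⟨ofReal_mem_strip hγ, by simp⟩ x hx
  have he := Real.exp_pos (γ ^ 2 / 2 * Real.log N)
  constructor
  · rw [← le_div_iff₀ he]; linarith
  · rw [← div_le_iff₀ he]; linarith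

lemma MesoscopicAssumption.expMean_pos [Nontrivial Ω]
    (hm : MesoscopicAssumption d P vol h ρ XN Ψ) [∀ N, NeZero (P N)] {N : ℕ} (hN : 1 ≤ N)
    (hγ : γ ∈ Icc 0 √(2 * d)) (x : Ω) : 0 < expMean (P N) (XN N) γ x :=
  integral_exp_pos (hm.integrable_exp hN hγ x)

/-- Completing the square: (γ + iu/σ)²σ²/2 = γ²σ²/2 + iγuσ − u²/2, and recentring by γ log N = γσ²
removes the middle term. -/
lemma exp_mul_char {S : Type*} [MeasurableSpace S] (P : Measure S) (X : S → Ω → ℝ) {N : ℕ}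
    (hN : 1 < N) (γ u : ℝ) (x : Ω) :
    ∫ s, (Real.exp (γ * X s x) : ℂ) * Complex.exp (u *
      (((X s x - γ * Real.log N) / √(Real.log N) : ℝ) : ℂ) * Complex.I) ∂P =
    momentRatio P X N ((γ : ℂ) + (u / √(Real.log N) : ℝ) * Complex.I) x *
      (Real.exp (γ ^ 2 / 2 * Real.log N) * Real.exp (-u ^ 2 / 2)) := by
  have hL : 0 < Real.log N := Real.log_pos (by exact_mod_cast hN)
  have hσ : 0 < √(Real.log N) := Real.sqrt_pos.2 hL
  have hσ2 : √(Real.log N) ^ 2 = Real.log N := Real.sq_sqrt hL.le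
  set σ := √(Real.log N)
  rw [← hσ2]
  have hσc : (σ : ℂ) ≠ 0 := by exact_mod_cast hσ.ne'
  rw [momentRatio, ← hσ2]
  have h1 : ∀ s, (Real.exp (γ * X s x) : ℂ) * Complex.exp (u *
      (((X s x - γ * σ ^ 2) / σ : ℝ) : ℂ) * Complex.I) =
      Complex.exp (-(γ * u * σ * Complex.I)) *
        Complex.exp (((γ : ℂ) + (u / σ : ℝ) * Complex.I) * X s x) := by
    intro s
    rw [Complex.ofReal_exp, ← Complex.exp_add, ← Complex.exp_add]
    congr 1
    push_cast
    field_simp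
    ring
  simp_rw [h1]
  rw [integral_const_mul, div_mul_eq_mul_div, eq_div_iff (Complex.exp_ne_zero _),
    mul_right_comm, mul_comm (∫ _, _ ∂_)]
  congr 1
  rw [Complex.ofReal_exp, Complex.ofReal_exp, ← Complex.exp_add, ← Complex.exp_add]
  congr 1
  push_cast
  field_simp
  ring_nf
  rw [Complex.I_sq]
  ring

/-- Under the tilted measure the recentred field is asymptotically Gaussian, uniformly on compact
sets. -/
lemma MesoscopicAssumption.tendsto_char_one [Nontrivial Ω]
    (hm : MesoscopicAssumption d P vol h ρ XN Ψ) {K : Set Ω} (hK : IsCompact K)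
    (hγ : γ ∈ Icc 0 √(2 * d)) (u : ℝ) :
    Tendsto (fun p : ℕ × Ω => ∫ s, (wt (P p.1) (XN p.1) γ p.2 s : ℂ) * Complex.exp (u *
      (((XN p.1 s p.2 - γ * Real.log p.1) / √(Real.log p.1) : ℝ) : ℂ) * Complex.I) ∂(P p.1))
      (atTop ×ˢ 𝓟 K) (𝓝 (1 * Real.exp (-u ^ 2 / 2))) := by
  obtain ⟨c, hc0, hc⟩ := hm.le_norm_Psi hK hγ
  have hratio : Tendsto (fun p : ℕ × Ω =>
      momentRatio (P p.1) (XN p.1) p.1 ((γ : ℂ) + (u / √(Real.log p.1) : ℝ) * Complex.I) p.2 /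
        momentRatio (P p.1) (XN p.1) p.1 γ p.2) (atTop ×ˢ 𝓟 K) (𝓝 1) := by
    rw [Metric.tendsto_nhds]
    intro ε hε
    -- The bound c/2 keeps the denominator above c/2, and εc/8, incurred in both numerator and
    -- denominator, keeps the quotient within ε of 1.
    have hε' : 0 < min (c / 2) (ε * c / 8) := by positivity
    rw [eventually_prod_principal_iff]
    filter_upwards [hm.momentRatio_near' hK hγ u hε', hm.momentRatio_near' hK hγ 0 hε'] with N h1 h2 x hx
    have e1 := h1 x hx
    have e2 := h2 x hx
    simp only [zero_div, Complex.ofReal_zero, zero_mul, add_zero] at e2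
    set a := momentRatio (P N) (XN N) N ((γ : ℂ) + (u / √(Real.log N) : ℝ) * Complex.I) x
    set b := momentRatio (P N) (XN N) N γ x
    have e3 := norm_sub_norm_le (Ψ γ x) b
    rw [norm_sub_rev] at e3
    have e4 := hc x hx
    have hb : c / 2 ≤ ‖b‖ := by linarith [min_le_left (c / 2) (ε * c / 8)]
    have hb0 : b ≠ 0 := norm_pos_iff.1 (by linarith)
    rw [dist_eq_norm, div_sub_one hb0, norm_div, div_lt_iff₀ (by linarith)]
    have e5 := norm_sub_le_norm_sub_add_norm_sub a (Ψ γ x) b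
    rw [norm_sub_rev (Ψ γ x)] at e5
    have : ε * (c / 2) ≤ ε * ‖b‖ := by gcongr
    have e6 := min_le_right (c / 2) (ε * c / 8)
    nlinarith
  refine (hratio.mul_const _).congr' ?_
  obtain ⟨c', hc'0, _, _, hmean⟩ := hm.expMean_bounds hK hγ
  rw [EventuallyEq, eventually_prod_principal_iff]
  filter_upwards [eventually_gt_atTop 1, hmean] with N hN hNm x hx
  have h1 : ∀ s, (wt (P N) (XN N) γ x s : ℂ) = (Real.exp (γ * XN N s x) : ℂ) *
      ((expMean (P N) (XN N) γ x : ℂ))⁻¹ := fun s => by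
    rw [wt, Complex.ofReal_div, div_eq_mul_inv]
  have hZ : (expMean (P N) (XN N) γ x : ℂ) ≠ 0 := by
    have := (hNm x hx).1
    exact_mod_cast (lt_of_lt_of_le (by positivity) this).ne'
  have h2 : ∀ s, (wt (P N) (XN N) γ x s : ℂ) * Complex.exp (u *
      (((XN N s x - γ * Real.log N) / √(Real.log N) : ℝ) : ℂ) * Complex.I) =
      (expMean (P N) (XN N) γ x : ℂ)⁻¹ * ((Real.exp (γ * XN N s x) : ℂ) * Complex.exp (u *
      (((XN N s x - γ * Real.log N) / √(Real.log N) : ℝ) : ℂ) * Complex.I)) := fun s => by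
    rw [h1]; ring
  simp_rw [h2]
  rw [integral_const_mul, exp_mul_char _ _ hN, momentRatio_ofReal]
  have : (Real.exp (γ ^ 2 / 2 * Real.log N) : ℂ) ≠ 0 := by exact_mod_cast (Real.exp_pos _).ne'
  have hE := Complex.ofReal_div (expMean (P N) (XN N) γ x) (Real.exp (γ ^ 2 / 2 * Real.log N))
  rw [hE]
  generalize (Real.exp (γ ^ 2 / 2 * Real.log N) : ℂ) = E at this
  generalize momentRatio (P N) (XN N) N _ x = m
  field_simp

end OnePoint

/-! ### Tilted moments of band limited kernels. -/

section KernelMoments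

variable {d : ℕ} {Ω : Type*} [MetricSpace Ω] [MeasurableSpace Ω] {vol : Measure Ω}
  {h : Ω → Ω → ℝ} {ρ : ℝ → Ω → Ω → ℝ} {S : ℕ → Type*} [∀ N, MeasurableSpace (S N)]
  {P : ∀ N, Measure (S N)} [∀ N, SFinite (P N)] {XN : ∀ N, S N → Ω → ℝ} {Ψ : ℂ → Ω → ℂ} {γ : ℝ}

/-- The total mass of the centred Gaussian with variance `1/η`, up to normalization. -/
def gaussMass (η : ℝ) : ℝ := ∫ u : ℝ, Real.exp (-η * u ^ 2 / 2)

lemma gaussMass_nonneg (η : ℝ) : 0 ≤ gaussMass η := integral_nonneg fun _ => (Real.exp_pos _).le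

/-- `e^{∑_j ξ_j X_{δ_j}(z_j)}`. -/
def smoothWeight {S : Type*} (vol : Measure Ω) (ρ : ℝ → Ω → Ω → ℝ) (X : S → Ω → ℝ) {q : ℕ}
    (ξ δ : Fin q → ℝ) (z : Fin q → Ω) (s : S) : ℝ :=
  Real.exp (∑ j, ξ j * smoothed vol ρ X (δ j) (z j) s)

lemma wt_mul_smoothWeight {S : Type*} [MeasurableSpace S] (P : Measure S) (X : S → Ω → ℝ) (γ : ℝ)
    (x : Ω) {q : ℕ} (ξ δ : Fin q → ℝ) (z : Fin q → Ω) (s : S) :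
    wt P X γ x s * smoothWeight vol ρ X ξ δ z s =
      (expMean P X γ x)⁻¹ * expWeight vol ρ X γ 0 x x ξ δ z s := by
  rw [wt, smoothWeight, expWeight, zero_mul, add_zero, Real.exp_add]
  ring

lemma wt_mul_wt_mul_smoothWeight {S : Type*} [MeasurableSpace S] (P : Measure S) (X : S → Ω → ℝ)
    (γ : ℝ) (x₁ x₂ : Ω) {q : ℕ} (ξ δ : Fin q → ℝ) (z : Fin q → Ω) (s : S) :
    wt P X γ x₁ s * wt P X γ x₂ s * smoothWeight vol ρ X ξ δ z s =
      ((expMean P X γ x₁)⁻¹ * (expMean P X γ x₂)⁻¹) * expWeight vol ρ X γ γ x₁ x₂ ξ δ z s := by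
  rw [wt, wt, smoothWeight, expWeight, Real.exp_add, Real.exp_add]
  ring

/-- The Gaussian bound on the tilted characteristic function is integrated against the kernel. The
factor e^{γ² log N / 2} cancels against E[e^{γX}], leaving only the covariances with the smoothed
fields. A depends neither on the kernel nor on the points and scales. -/
lemma MesoscopicAssumption.one_point_bound [Nontrivial Ω]
    (hm : MesoscopicAssumption d P vol h ρ XN Ψ)
    (hX : ∀ N x, Measurable fun s => XN N s x)
    (h_cont : Continuous (fun p : Ω × Ω => h p.1 p.2)) {K : Set Ω} (hK : IsCompact K)
    {η R : ℝ} (hη : 0 < η) (hη1 : η < 1) (hR : 0 < R) {q : ℕ} (ξ : Fin q → ℝ)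
    (hγ : γ ∈ Icc 0 √(2 * d)) :
    ∃ A > 0, ∀ᶠ N : ℕ in atTop, ∀ x ∈ K,
      ∀ z : Fin q → Ω, (∀ j, z j ∈ K) →
      ∀ δ : Fin q → ℝ, (∀ j, δ j ∈ Ioc (0 : ℝ) 1 ∧ (N : ℝ) ^ (-1 + η) ≤ δ j) →
      ∀ (k : ℝ → ℂ) (V : ℝ → ℝ) (C c : ℝ), 0 ≤ C → IsKernel √(Real.log N) k V C R →
      |∫ s, wt (P N) (XN N) γ x s * smoothWeight vol ρ (XN N) ξ δ z s * V (XN N s x - c) ∂(P N)| ≤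
      A * C * Real.exp (γ * covLin vol h ρ ξ δ z x +
        1 / 2 * covForm vol h (mollifierSum ρ ξ δ z)) := by
  obtain ⟨A, hA, hev⟩ := hm.norm_char_one_le h_cont hK hη hη1 hR ξ hγ
  obtain ⟨c₀, hc₀, _, _, hmean⟩ := hm.expMean_bounds hK hγ
  refine ⟨c₀⁻¹ * A * (gaussMass η + 1), by have := gaussMass_nonneg η; positivity, ?_⟩
  filter_upwards [hev, hmean, eventually_ge_atTop 1] with N hN hNm hN1 x hx z hz δ hδ k V C c hC hk
  simp_rw [wt_mul_smoothWeight]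
  set E := Real.exp (γ * covLin vol h ρ ξ δ z x + 1 / 2 * covForm vol h (mollifierSum ρ ξ δ z))
    with hE
  have hZ := (hNm x hx).1
  have hZ0 : 0 < expMean (P N) (XN N) γ x := lt_of_lt_of_le (by positivity) hZ
  have hG := hm.integrable_expWeight_one hN1 hγ x ξ δ z (fun j => (hδ j).1)
  have h1 := norm_integral_mul_kernel_le hk (hG.ofReal (𝕜 := ℂ)) ((hX N x).sub_const c) hη
    (M := A * Real.exp (γ ^ 2 / 2 * Real.log N + γ * covLin vol h ρ ξ δ z x +
        1 / 2 * covForm vol h (mollifierSum ρ ξ δ z))) (by positivity) hC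
    (fun u hu => hN x hx z hz δ hδ c u hu)
  have h2 : ∫ s, ((expWeight vol ρ (XN N) γ 0 x x ξ δ z s : ℝ) : ℂ) * (V (XN N s x - c) : ℂ) ∂(P N) =
      ((∫ s, expWeight vol ρ (XN N) γ 0 x x ξ δ z s * V (XN N s x - c) ∂(P N) : ℝ) : ℂ) := by
    rw [← integral_complex_ofReal]
    push_cast; rfl
  have h3 := h1
  erw [h2] at h3
  rw [Complex.norm_real, Real.norm_eq_abs] at h3
  simp_rw [mul_assoc]
  rw [integral_const_mul, abs_mul, abs_inv, abs_of_pos hZ0]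
  have hfinal : (expMean (P N) (XN N) γ x)⁻¹ ≤ c₀⁻¹ * (Real.exp (γ ^ 2 / 2 * Real.log N))⁻¹ := by
    rw [← mul_inv]
    exact inv_anti₀ (by positivity) hZ
  rw [add_assoc, Real.exp_add, ← hE] at h3
  calc _ ≤ (c₀⁻¹ * (Real.exp (γ ^ 2 / 2 * Real.log N))⁻¹) *
        (C * (A * (Real.exp (γ ^ 2 / 2 * Real.log N) * E)) * gaussMass η) := by
        gcongr
        exact h3
    _ = c₀⁻¹ * A * gaussMass η * C * E := by
        have := (Real.exp_pos (γ ^ 2 / 2 * Real.log N)).ne'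
        field_simp
    _ ≤ c₀⁻¹ * A * (gaussMass η + 1) * C * E := by
        gcongr
        linarith
    _ = _ := by ring

lemma MesoscopicAssumption.two_point_bound [Nontrivial Ω]
    (hm : MesoscopicAssumption d P vol h ρ XN Ψ)
    (hX : ∀ N x, Measurable fun s => XN N s x)
    (h_cont : Continuous (fun p : Ω × Ω => h p.1 p.2)) {K : Set Ω} (hK : IsCompact K)
    {η R : ℝ} (hη : 0 < η) (hη1 : η < 1) (hR : 0 < R) {q : ℕ} (ξ : Fin q → ℝ)
    (hγ : γ ∈ Icc 0 √(2 * d)) :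
    ∃ A > 0, ∀ᶠ N : ℕ in atTop, ∀ x₁ ∈ K, ∀ x₂ ∈ K, (N : ℝ) ^ (η - 1) ≤ dist x₁ x₂ →
      ∀ z : Fin q → Ω, (∀ j, z j ∈ K) →
      ∀ δ : Fin q → ℝ, (∀ j, δ j ∈ Ioc (0 : ℝ) 1 ∧ (N : ℝ) ^ (-1 + η) ≤ δ j) →
      ∀ (k₁ k₂ : ℝ → ℂ) (V₁ V₂ : ℝ → ℝ) (C₁ C₂ c₁ c₂ : ℝ), 0 ≤ C₁ → 0 ≤ C₂ →
      IsKernel √(Real.log N) k₁ V₁ C₁ R → IsKernel √(Real.log N) k₂ V₂ C₂ R →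
      |∫ s, wt (P N) (XN N) γ x₁ s * wt (P N) (XN N) γ x₂ s * smoothWeight vol ρ (XN N) ξ δ z s *
        V₁ (XN N s x₁ - c₁) * V₂ (XN N s x₂ - c₂) ∂(P N)| ≤
      A * (C₁ * C₂) * Real.exp (γ ^ 2 * cov h x₁ x₂ + γ * covLin vol h ρ ξ δ z x₁ +
        γ * covLin vol h ρ ξ δ z x₂ + 1 / 2 * covForm vol h (mollifierSum ρ ξ δ z)) := by
  obtain ⟨A, hA, hev⟩ := hm.norm_char_le h_cont hK hη hη1 hR ξ hγ hγ
  obtain ⟨c₀, hc₀, _, _, hmean⟩ := hm.expMean_bounds hK hγ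
  refine ⟨c₀⁻¹ ^ 2 * A * (gaussMass η + 1) ^ 2, by have := gaussMass_nonneg η; positivity, ?_⟩
  filter_upwards [hev, hmean, eventually_ge_atTop 1, eventually_rpow_pos]
    with N hN hNm hN1 hpos x₁ hx₁ x₂ hx₂ hdist z hz δ hδ k₁ k₂ V₁ V₂ C₁ C₂ c₁ c₂ hC₁ hC₂ hk₁ hk₂
  simp_rw [wt_mul_wt_mul_smoothWeight]
  set E := Real.exp (γ ^ 2 * cov h x₁ x₂ + γ * covLin vol h ρ ξ δ z x₁ +
    γ * covLin vol h ρ ξ δ z x₂ + 1 / 2 * covForm vol h (mollifierSum ρ ξ δ z)) with hE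
  have hne : x₁ ≠ x₂ := dist_pos.1 ((hpos _).trans_le hdist)
  have hZ₁ := (hNm x₁ hx₁).1
  have hZ₁0 : 0 < expMean (P N) (XN N) γ x₁ := lt_of_lt_of_le (by positivity) hZ₁
  have hZ₂ := (hNm x₂ hx₂).1
  have hZ₂0 : 0 < expMean (P N) (XN N) γ x₂ := lt_of_lt_of_le (by positivity) hZ₂
  have hG := (hm.integrable_expWeight hN1 hγ hγ hne ξ δ z (fun j => (hδ j).1)).ofReal (𝕜 := ℂ)
  set M := A * Real.exp ((γ ^ 2 + γ ^ 2) / 2 * Real.log N + γ * γ * cov h x₁ x₂ +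
        γ * covLin vol h ρ ξ δ z x₁ + γ * covLin vol h ρ ξ δ z x₂ +
        1 / 2 * covForm vol h (mollifierSum ρ ξ δ z)) with hM
  -- The two kernels are integrated one after the other. The kernel at x₁ is treated while x₂ still
  -- carries a character; the outcome keeps Gaussian decay in u, as the second application requires.
  have hstep : ∀ u : ℝ, |u| ≤ R * √(Real.log N) →
      ‖∫ s, ((expWeight vol ρ (XN N) γ γ x₁ x₂ ξ δ z s : ℝ) : ℂ) * (V₁ (XN N s x₁ - c₁) : ℂ) *
        Complex.exp (u * (((XN N s x₂ - c₂) / √(Real.log N) : ℝ) : ℂ) * Complex.I) ∂(P N)‖ ≤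
      C₁ * M * gaussMass η * Real.exp (-η * u ^ 2 / 2) := by
    intro u hu
    have hY := hX N x₂
    have hG2 : Integrable (fun s => ((expWeight vol ρ (XN N) γ γ x₁ x₂ ξ δ z s : ℝ) : ℂ) *
        Complex.exp (u * (((XN N s x₂ - c₂) / √(Real.log N) : ℝ) : ℂ) * Complex.I)) (P N) :=
      hG.mul_bdd (c := 1) (Measurable.aestronglyMeasurable (by fun_prop))
        (ae_of_all _ fun s => by rw [norm_cexp_mul_I])
    have h1 := norm_integral_mul_kernel_le hk₁ hG2 ((hX N x₁).sub_const c₁) hη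
      (M := M * Real.exp (-η * u ^ 2 / 2)) (by positivity) hC₁
      (fun u₁ hu₁ => (hN x₁ hx₁ x₂ hx₂ hdist z hz δ hδ c₁ c₂ u₁ u hu₁ hu))
    refine le_trans (le_of_eq ?_) (h1.trans (le_of_eq ?_))
    · congr 1
      refine integral_congr_ae (ae_of_all _ fun s => ?_)
      simp only
      ring
    · rw [gaussMass]; ring
  have h1 := norm_integral_mul_kernel_le hk₂ (integrable_mul_kernel hk₁ hG ((hX N x₁).sub_const c₁))
    ((hX N x₂).sub_const c₂) hη (by have := gaussMass_nonneg η; positivity) hC₂ hstep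
  have h2 : ∫ s, ((expWeight vol ρ (XN N) γ γ x₁ x₂ ξ δ z s : ℝ) : ℂ) * (V₁ (XN N s x₁ - c₁) : ℂ) *
      (V₂ (XN N s x₂ - c₂) : ℂ) ∂(P N) =
      ((∫ s, expWeight vol ρ (XN N) γ γ x₁ x₂ ξ δ z s * V₁ (XN N s x₁ - c₁) *
        V₂ (XN N s x₂ - c₂) ∂(P N) : ℝ) : ℂ) := by
    rw [← integral_complex_ofReal]
    push_cast; rfl
  have h3 := h1
  erw [h2] at h3
  rw [Complex.norm_real, Real.norm_eq_abs] at h3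
  have h4 : ∀ s, (expMean (P N) (XN N) γ x₁)⁻¹ * (expMean (P N) (XN N) γ x₂)⁻¹ *
      expWeight vol ρ (XN N) γ γ x₁ x₂ ξ δ z s * V₁ (XN N s x₁ - c₁) * V₂ (XN N s x₂ - c₂) =
      ((expMean (P N) (XN N) γ x₁)⁻¹ * (expMean (P N) (XN N) γ x₂)⁻¹) *
      (expWeight vol ρ (XN N) γ γ x₁ x₂ ξ δ z s * V₁ (XN N s x₁ - c₁) * V₂ (XN N s x₂ - c₂)) :=
    fun s => by ring
  simp_rw [h4]
  rw [integral_const_mul, abs_mul, abs_mul, abs_inv, abs_of_pos hZ₁0, abs_inv, abs_of_pos hZ₂0]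
  have hf₁ : (expMean (P N) (XN N) γ x₁)⁻¹ ≤ c₀⁻¹ * (Real.exp (γ ^ 2 / 2 * Real.log N))⁻¹ := by
    rw [← mul_inv]
    exact inv_anti₀ (by positivity) hZ₁
  have hf₂ : (expMean (P N) (XN N) γ x₂)⁻¹ ≤ c₀⁻¹ * (Real.exp (γ ^ 2 / 2 * Real.log N))⁻¹ := by
    rw [← mul_inv]
    exact inv_anti₀ (by positivity) hZ₂
  have hM2 : M = A * (Real.exp (γ ^ 2 / 2 * Real.log N) ^ 2 * E) := by
    rw [hM, hE, ← Real.exp_nat_mul, ← Real.exp_add]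
    congr 2
    push_cast
    ring
  rw [hM2] at h3
  have hg := gaussMass_nonneg η
  calc _ ≤ ((c₀⁻¹ * (Real.exp (γ ^ 2 / 2 * Real.log N))⁻¹) *
        (c₀⁻¹ * (Real.exp (γ ^ 2 / 2 * Real.log N))⁻¹)) *
        (C₂ * (C₁ * (A * (Real.exp (γ ^ 2 / 2 * Real.log N) ^ 2 * E)) * gaussMass η) *
          gaussMass η) := by
        gcongr
        exact h3
    _ = c₀⁻¹ ^ 2 * A * gaussMass η ^ 2 * (C₁ * C₂) * E := by
        have := (Real.exp_pos (γ ^ 2 / 2 * Real.log N)).ne'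
        field_simp
    _ ≤ c₀⁻¹ ^ 2 * A * (gaussMass η + 1) ^ 2 * (C₁ * C₂) * E := by
        gcongr
        linarith

lemma MesoscopicAssumption.integrable_wt [Nontrivial Ω]
    (hm : MesoscopicAssumption d P vol h ρ XN Ψ) {N : ℕ} (hN : 1 ≤ N)
    (hγ : γ ∈ Icc 0 √(2 * d)) (x : Ω) : Integrable (wt (P N) (XN N) γ x) (P N) :=
  (hm.integrable_exp hN hγ x).div_const _

/-- Central limit theorem under the tilt, uniform in x ∈ K through the filter `atTop ×ˢ 𝓟 K`. The
kernel may depend on x and N as long as its transform converges pointwise. -/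
lemma MesoscopicAssumption.one_point_limit [Nontrivial Ω]
    (hm : MesoscopicAssumption d P vol h ρ XN Ψ)
    (hX : ∀ N x, Measurable fun s => XN N s x)
    (h_cont : Continuous (fun p : Ω × Ω => h p.1 p.2)) {K : Set Ω} (hK : IsCompact K)
    (hγ : γ ∈ Icc 0 √(2 * d)) {k : ℕ × Ω → ℝ → ℂ} {V : ℕ × Ω → ℝ → ℝ} {C R : ℝ} (hC : 0 ≤ C)
    (hR : 0 < R) (hk : ∀ᶠ p in atTop ×ˢ 𝓟 K, IsKernel √(Real.log (p : ℕ × Ω).1) (k p) (V p) C R)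
    {k' : ℝ → ℂ} (hk' : ∀ u, Tendsto (fun p => k p u) (atTop ×ˢ 𝓟 K) (𝓝 (k' u))) :
    Tendsto (fun p : ℕ × Ω => ((∫ s, wt (P p.1) (XN p.1) γ p.2 s *
      V p (XN p.1 s p.2 - γ * Real.log p.1) ∂(P p.1) : ℝ) : ℂ)) (atTop ×ˢ 𝓟 K)
      (𝓝 (∫ u : ℝ, k' u * Real.exp (-u ^ 2 / 2))) := by
  obtain ⟨A, hA, hev⟩ := hm.norm_char_one_le h_cont hK (by norm_num : (0 : ℝ) < 1 / 2) (by norm_num)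
    hR (0 : Fin 0 → ℝ) hγ
  obtain ⟨c₀, hc₀, _, _, hmean⟩ := hm.expMean_bounds hK hγ
  have key := tendsto_integral_mul_kernel (l := atTop ×ˢ 𝓟 K) (ι := ℕ × Ω) (S := fun p => S p.1)
    (P := fun p => P p.1) (σ := fun p => √(Real.log p.1)) hC hk
    (G := fun p s => (wt (P p.1) (XN p.1) γ p.2 s : ℂ))
    (Y := fun p s => XN p.1 s p.2 - γ * Real.log p.1) (η := 1 / 2) (M := c₀⁻¹ * A) ?_
    (fun p => (hX p.1 p.2).sub_const _) (by norm_num) (by positivity) ?_ hk'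
    (fun u => hm.tendsto_char_one hK hγ u)
  · rw [one_mul] at key
    refine key.congr fun p => ?_
    rw [← integral_complex_ofReal]
    push_cast; rfl
  · rw [eventually_prod_principal_iff]
    filter_upwards [eventually_ge_atTop 1] with N hN x _
    exact (hm.integrable_wt hN hγ x).ofReal
  · rw [eventually_prod_principal_iff]
    filter_upwards [hev, hmean] with N hN hNm x hx u hu
    have h1 := hN x hx (fun j => j.elim0) (fun j => j.elim0) (fun j => j.elim0) (fun j => j.elim0)
      (γ * Real.log N) u hu
    rw [covLin_fin_zero, covForm_fin_zero, mul_zero, mul_zero, add_zero, add_zero] at h1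
    have hZ := (hNm x hx).1
    have hZ0 : 0 < expMean (P N) (XN N) γ x := lt_of_lt_of_le (by positivity) hZ
    have h2 : ∀ s, (wt (P N) (XN N) γ x s : ℂ) = ((expMean (P N) (XN N) γ x)⁻¹ : ℝ) *
        (expWeight vol ρ (XN N) γ 0 x x (0 : Fin 0 → ℝ) (fun j => j.elim0) (fun j => j.elim0) s : ℂ) :=
      fun s => by
        rw [wt, expWeight]
        simp [div_eq_inv_mul]
    simp_rw [h2, mul_assoc]
    rw [integral_const_mul, norm_mul, Complex.norm_real, norm_inv, Real.norm_of_nonneg hZ0.le,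
      inv_mul_le_iff₀ hZ0]
    simp_rw [mul_assoc] at h1
    refine h1.trans ?_
    have : A * Real.exp (γ ^ 2 / 2 * Real.log N) ≤ expMean (P N) (XN N) γ x * (c₀⁻¹ * A) := by
      calc A * Real.exp (γ ^ 2 / 2 * Real.log N) =
          (c₀ * Real.exp (γ ^ 2 / 2 * Real.log N)) * (c₀⁻¹ * A) := by field_simp
        _ ≤ _ := by gcongr
    calc _ = A * Real.exp (γ ^ 2 / 2 * Real.log N) * Real.exp (-(1 / 2) * u ^ 2 / 2) := by
          rw [mul_assoc]
      _ ≤ expMean (P N) (XN N) γ x * (c₀⁻¹ * A) * Real.exp (-(1 / 2) * u ^ 2 / 2) := by gcongr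
      _ = _ := by rw [mul_assoc, mul_assoc]

end KernelMoments

/-! ### Asymptotic independence at two distinct points. -/

section TwoPointLimit

variable {d : ℕ} {Ω : Type*} [MetricSpace Ω] [MeasurableSpace Ω] {vol : Measure Ω}
  {h : Ω → Ω → ℝ} {ρ : ℝ → Ω → Ω → ℝ} {S : ℕ → Type*} [∀ N, MeasurableSpace (S N)]
  {P : ∀ N, Measure (S N)} [∀ N, SFinite (P N)] {XN : ∀ N, S N → Ω → ℝ} {Ψ : ℂ → Ω → ℂ} {γ : ℝ}

/-- The argument `γ + iu/√(log N)`. -/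
def tiltArg (γ u : ℝ) (N : ℕ) : ℂ := (γ : ℂ) + (u / √(Real.log N) : ℝ) * Complex.I

lemma tendsto_tiltArg (γ u : ℝ) : Tendsto (tiltArg γ u) atTop (𝓝 (γ : ℂ)) := by
  have h1 : Tendsto (fun N : ℕ => ((u / √(Real.log N) : ℝ) : ℂ)) atTop (𝓝 ((0 : ℝ) : ℂ)) :=
    (Complex.continuous_ofReal.tendsto 0).comp (tendsto_sqrt_log.const_div_atTop u)
  have h2 := (h1.mul_const Complex.I).const_add (γ : ℂ)
  rw [Complex.ofReal_zero, zero_mul, add_zero] at h2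
  exact h2

lemma eventually_tiltArg_mem {d : ℕ} (hγ : γ ∈ Icc 0 √(2 * d)) (u : ℝ) :
    ∀ᶠ N in atTop, tiltArg γ u N ∈ box d 1 := by
  have hlim : Tendsto (fun N : ℕ => u / √(Real.log N)) atTop (𝓝 0) :=
    tendsto_sqrt_log.const_div_atTop u
  filter_upwards [hlim.eventually (Metric.ball_mem_nhds 0 one_pos)] with N hN
  rw [dist_zero_right, Real.norm_eq_abs] at hN
  exact mem_box hγ hN.le

lemma MesoscopicAssumption.tendsto_Psi (hm : MesoscopicAssumption d P vol h ρ XN Ψ)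
    (hγ : γ ∈ Icc 0 √(2 * d)) (u : ℝ) (x : Ω) :
    Tendsto (fun N => Ψ (tiltArg γ u N) x) atTop (𝓝 (Ψ γ x)) := by
  rw [Metric.tendsto_nhds]
  intro ε hε
  filter_upwards [hm.Psi_near (K := {x}) isCompact_singleton hγ u (half_pos hε)] with N hN
  rw [dist_eq_norm]
  exact (hN x rfl).trans_lt (half_lt_self hε)

lemma MesoscopicAssumption.tendsto_momentRatio [Nontrivial Ω]
    (hm : MesoscopicAssumption d P vol h ρ XN Ψ)
    (hγ : γ ∈ Icc 0 √(2 * d)) (x : Ω) :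
    Tendsto (fun N => momentRatio (P N) (XN N) N γ x) atTop (𝓝 (Ψ γ x)) := by
  rw [Metric.tendsto_nhds]
  intro ε hε
  filter_upwards [hm.momentRatio_near' (K := {x}) isCompact_singleton hγ 0 (half_pos hε)] with N hN
  rw [dist_eq_norm]
  have := hN x rfl
  simp only [zero_div, Complex.ofReal_zero, zero_mul, add_zero] at this
  exact this.trans_lt (half_lt_self hε)

lemma MesoscopicAssumption.tendsto_PsiN (hm : MesoscopicAssumption d P vol h ρ XN Ψ)
    (hγ : γ ∈ Icc 0 √(2 * d)) (u₁ u₂ : ℝ) {x₁ x₂ : Ω} (hne : x₁ ≠ x₂) {q : ℕ} (ξ δ : Fin q → ℝ)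
    (z : Fin q → Ω) (hδ : ∀ j, δ j ∈ Ioc (0 : ℝ) 1) :
    Tendsto (fun N => PsiN (P N) vol h ρ (XN N) N (tiltArg γ u₁ N, tiltArg γ u₂ N) x₁ x₂ ξ δ z)
      atTop (𝓝 (Ψ γ x₁ * Ψ γ x₂)) := by
  set K : Set Ω := {x₁, x₂} ∪ range z
  have hK : IsCompact K := ((toFinite _).isCompact).union (finite_range z).isCompact
  have hx₁ : x₁ ∈ K := Or.inl (by simp)
  have hx₂ : x₂ ∈ K := Or.inl (by simp)
  have hlim := (hm.tendsto_Psi hγ u₁ x₁).mul (hm.tendsto_Psi hγ u₂ x₂)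
  have hδev : ∀ᶠ N : ℕ in atTop, ∀ j, (N : ℝ) ^ (-1 + (1 / 2 : ℝ)) ≤ δ j := by
    rw [eventually_all]
    intro j
    filter_upwards [eventually_rpow_le (by norm_num : (1 / 2 : ℝ) < 1) (hδ j).1] with N hN
    rwa [neg_add_eq_sub]
  have hdiff : Tendsto (fun N => PsiN (P N) vol h ρ (XN N) N (tiltArg γ u₁ N, tiltArg γ u₂ N)
      x₁ x₂ ξ δ z - Ψ (tiltArg γ u₁ N) x₁ * Ψ (tiltArg γ u₂ N) x₂) atTop (𝓝 0) := by
    rw [Metric.tendsto_nhds]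
    intro ε hε
    set b := ‖Ψ γ x₁ * Ψ γ x₂‖ + 1 with hb
    have hb0 : 0 < b := by positivity
    filter_upwards [hm.asymptotics K hK (1 / 2) (by norm_num) 1 one_pos q ξ (ε / (2 * b))
      (by positivity), eventually_tiltArg_mem hγ u₁, eventually_tiltArg_mem hγ u₂, hδev,
      eventually_rpow_le (by norm_num : (1 / 2 : ℝ) < 1) (dist_pos.2 hne),
      hlim.norm.eventually (gt_mem_nhds (lt_add_one _))] with N h1 h2 h3 h4 h5 h6
    rw [dist_zero_right]
    refine (h1 _ h2 _ h3 x₁ hx₁ x₂ hx₂ h5 z (fun j => Or.inr (mem_range_self j)) δ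
      (fun j => ⟨hδ j, h4 j⟩)).trans_lt ?_
    calc _ ≤ ε / (2 * b) * b := by gcongr
      _ = ε / 2 := by field_simp
      _ < ε := half_lt_self hε
  simpa using hdiff.add hlim

/-- The square is completed at both points. What remains besides the independent Gaussians and the
normalization depends on u₁, u₂ only through exponents that tend to γ. -/
lemma gaussianFactor_tilt {N : ℕ} (hN : 1 < N) (u₁ u₂ : ℝ) (x₁ x₂ : Ω) {q : ℕ} (ξ δ : Fin q → ℝ)
    (z : Fin q → Ω) :
    Complex.exp (((-(u₁ / √(Real.log N) * (γ * Real.log N) +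
      u₂ / √(Real.log N) * (γ * Real.log N)) : ℝ) : ℂ) * Complex.I) *
      gaussianFactor vol h ρ N (tiltArg γ u₁ N, tiltArg γ u₂ N) x₁ x₂ ξ δ z =
    Real.exp (γ ^ 2 / 2 * Real.log N) ^ 2 * (Real.exp (-u₂ ^ 2 / 2) * Real.exp (-u₁ ^ 2 / 2)) *
      Complex.exp (tiltArg γ u₁ N * tiltArg γ u₂ N * (cov h x₁ x₂ : ℂ)
        + tiltArg γ u₁ N * (covLin vol h ρ ξ δ z x₁ : ℂ)
        + tiltArg γ u₂ N * (covLin vol h ρ ξ δ z x₂ : ℂ)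
        + 1 / 2 * (covForm vol h (mollifierSum ρ ξ δ z) : ℂ)) := by
  have hL : 0 < Real.log N := Real.log_pos (by exact_mod_cast hN)
  have hσ : 0 < √(Real.log N) := Real.sqrt_pos.2 hL
  have hσ2 : √(Real.log N) ^ 2 = Real.log N := Real.sq_sqrt hL.le
  unfold gaussianFactor
  rw [← mul_assoc]
  congr 1
  simp only [tiltArg]
  set σ := √(Real.log N)
  rw [← hσ2]
  have hσc : (σ : ℂ) ≠ 0 := by exact_mod_cast hσ.ne'
  simp only [Complex.ofReal_exp]
  rw [← Complex.exp_nat_mul, ← Complex.exp_add, ← Complex.exp_add, ← Complex.exp_add]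
  congr 1
  push_cast
  field_simp
  ring_nf
  rw [Complex.I_sq]
  ring

/-- The limiting constant in the two-point asymptotics. -/
def pairConst (vol : Measure Ω) (h : Ω → Ω → ℝ) (ρ : ℝ → Ω → Ω → ℝ) (γ : ℝ) (x₁ x₂ : Ω) {q : ℕ}
    (ξ δ : Fin q → ℝ) (z : Fin q → Ω) : ℂ :=
  Complex.exp ((γ : ℂ) * γ * (cov h x₁ x₂ : ℂ) + γ * (covLin vol h ρ ξ δ z x₁ : ℂ)
    + γ * (covLin vol h ρ ξ δ z x₂ : ℂ) + 1 / 2 * (covForm vol h (mollifierSum ρ ξ δ z) : ℂ))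

/-- `wt x₁ * wt x₂ * smoothWeight`. -/
def pairWeight {S : Type*} [MeasurableSpace S] (P : Measure S) (vol : Measure Ω)
    (ρ : ℝ → Ω → Ω → ℝ) (X : S → Ω → ℝ) (γ : ℝ) (x₁ x₂ : Ω) {q : ℕ} (ξ δ : Fin q → ℝ)
    (z : Fin q → Ω) (s : S) : ℝ :=
  wt P X γ x₁ s * wt P X γ x₂ s * smoothWeight vol ρ X ξ δ z s

lemma MesoscopicAssumption.integrable_pairWeight
    (hm : MesoscopicAssumption d P vol h ρ XN Ψ) {N : ℕ} (hN : 1 ≤ N)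
    (hγ : γ ∈ Icc 0 √(2 * d)) {x₁ x₂ : Ω} (hne : x₁ ≠ x₂) {q : ℕ} (ξ δ : Fin q → ℝ)
    (z : Fin q → Ω) (hδ : ∀ j, δ j ∈ Ioc (0 : ℝ) 1) :
    Integrable (pairWeight (P N) vol ρ (XN N) γ x₁ x₂ ξ δ z) (P N) := by
  refine ((hm.integrable_expWeight hN hγ hγ hne ξ δ z hδ).const_mul
    ((expMean (P N) (XN N) γ x₁)⁻¹ * (expMean (P N) (XN N) γ x₂)⁻¹)).congr (ae_of_all _ fun s => ?_)
  simp only [pairWeight, wt_mul_wt_mul_smoothWeight]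

/-- At fixed distinct points the covariance and the contributions of the smoothed fields are bounded
while the variance is log N. On scale σ they therefore enter only through the constant `pairConst`,
and the characteristic function factorizes. -/
lemma MesoscopicAssumption.tendsto_char_two [Nontrivial Ω]
    (hm : MesoscopicAssumption d P vol h ρ XN Ψ)
    (hγ : γ ∈ Icc 0 √(2 * d)) (u₁ u₂ : ℝ) {x₁ x₂ : Ω} (hne : x₁ ≠ x₂) {q : ℕ} (ξ δ : Fin q → ℝ)
    (z : Fin q → Ω) (hδ : ∀ j, δ j ∈ Ioc (0 : ℝ) 1) :
    Tendsto (fun N => ∫ s, (pairWeight (P N) vol ρ (XN N) γ x₁ x₂ ξ δ z s : ℂ) *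
        Complex.exp (u₂ * (((XN N s x₂ - γ * Real.log N) / √(Real.log N) : ℝ) : ℂ) * Complex.I) *
        Complex.exp (u₁ * (((XN N s x₁ - γ * Real.log N) / √(Real.log N) : ℝ) : ℂ) * Complex.I) ∂(P N))
      atTop (𝓝 (pairConst vol h ρ γ x₁ x₂ ξ δ z * Real.exp (-u₂ ^ 2 / 2) *
        Real.exp (-u₁ ^ 2 / 2))) := by
  have hΨ : ∀ x, Ψ γ x ≠ 0 := fun x => by
    obtain ⟨r, hr, hr'⟩ := hm.pos γ hγ.1 hγ.2 x
    rw [hr']; exact_mod_cast hr.ne'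
  have hratio := (hm.tendsto_PsiN hγ u₁ u₂ hne ξ δ z hδ).div
    ((hm.tendsto_momentRatio hγ x₁).mul (hm.tendsto_momentRatio hγ x₂))
    (mul_ne_zero (hΨ x₁) (hΨ x₂))
  rw [div_self (mul_ne_zero (hΨ x₁) (hΨ x₂))] at hratio
  have t₁ := tendsto_tiltArg γ u₁
  have t₂ := tendsto_tiltArg γ u₂
  have hexp := (Complex.continuous_exp.tendsto _).comp
    (((((t₁.mul t₂).mul_const (cov h x₁ x₂ : ℂ)).add
      (t₁.mul_const (covLin vol h ρ ξ δ z x₁ : ℂ))).add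
      (t₂.mul_const (covLin vol h ρ ξ δ z x₂ : ℂ))).add_const
      (1 / 2 * (covForm vol h (mollifierSum ρ ξ δ z) : ℂ)))
  have hall := ((hratio.mul hexp).mul_const ((Real.exp (-u₂ ^ 2 / 2) : ℂ) * Real.exp (-u₁ ^ 2 / 2)))
  rw [one_mul] at hall
  refine (hall.congr' ?_).trans (le_of_eq ?_)
  · obtain ⟨c₀, hc₀, _, _, hmean⟩ := hm.expMean_bounds (K := {x₁, x₂}) (toFinite _).isCompact hγ
    filter_upwards [eventually_gt_atTop 1, hmean] with N hN hNm
    have hZ : ∀ x ∈ ({x₁, x₂} : Set Ω), (expMean (P N) (XN N) γ x : ℂ) ≠ 0 := fun x hx => by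
      have := (hNm x hx).1
      exact_mod_cast (lt_of_lt_of_le (by positivity) this).ne'
    have hZ₁ := hZ x₁ (by simp)
    have hZ₂ := hZ x₂ (by simp)
    have h1 : ∀ s, (pairWeight (P N) vol ρ (XN N) γ x₁ x₂ ξ δ z s : ℂ) *
        Complex.exp (u₂ * (((XN N s x₂ - γ * Real.log N) / √(Real.log N) : ℝ) : ℂ) * Complex.I) *
        Complex.exp (u₁ * (((XN N s x₁ - γ * Real.log N) / √(Real.log N) : ℝ) : ℂ) * Complex.I) =
        ((expMean (P N) (XN N) γ x₁ : ℂ)⁻¹ * (expMean (P N) (XN N) γ x₂ : ℂ)⁻¹) *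
        (Complex.exp (((-(u₁ / √(Real.log N) * (γ * Real.log N) +
          u₂ / √(Real.log N) * (γ * Real.log N)) : ℝ) : ℂ) * Complex.I) *
        expField vol ρ (XN N) (tiltArg γ u₁ N, tiltArg γ u₂ N) x₁ x₂ ξ δ z s) := fun s => by
      rw [pairWeight, wt_mul_wt_mul_smoothWeight]
      unfold tiltArg
      rw [← expWeight_mul_char]
      push_cast
      ring
    simp_rw [h1]
    rw [integral_const_mul, integral_const_mul, integral_expField_eq (h := h), mul_left_comm
      (Complex.exp _), gaussianFactor_tilt hN]
    simp only [Pi.div_apply, Function.comp]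
    rw [momentRatio_ofReal, momentRatio_ofReal,
      Complex.ofReal_div, Complex.ofReal_div]
    have : (Real.exp (γ ^ 2 / 2 * Real.log N) : ℂ) ≠ 0 := by exact_mod_cast (Real.exp_pos _).ne'
    generalize (Real.exp (γ ^ 2 / 2 * Real.log N) : ℂ) = E at this
    generalize PsiN (P N) vol h ρ (XN N) N _ x₁ x₂ ξ δ z = m
    field_simp
  · rw [pairConst]
    congr 1
    ring

/-- Factorized limit: if the Gaussian mass of one of the limiting kernels is 0, the weighted
two-point expectation vanishes for every choice of ξ. This is how the compensation of the kernel is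
used. -/
lemma MesoscopicAssumption.two_point_limit [Nontrivial Ω]
    (hm : MesoscopicAssumption d P vol h ρ XN Ψ)
    (hX : ∀ N x, Measurable fun s => XN N s x)
    (h_cont : Continuous (fun p : Ω × Ω => h p.1 p.2))
    (hγ : γ ∈ Icc 0 √(2 * d)) {x₁ x₂ : Ω} (hne : x₁ ≠ x₂) {q : ℕ} (ξ δ : Fin q → ℝ)
    (z : Fin q → Ω) (hδ : ∀ j, δ j ∈ Ioc (0 : ℝ) 1)
    {k₁ k₂ : ℕ → ℝ → ℂ} {V₁ V₂ : ℕ → ℝ → ℝ} {C R : ℝ} (hC : 0 ≤ C)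
    (hR : 0 < R) (hk₁ : ∀ᶠ N in atTop, IsKernel √(Real.log (N : ℕ)) (k₁ N) (V₁ N) C R)
    (hk₂ : ∀ᶠ N in atTop, IsKernel √(Real.log (N : ℕ)) (k₂ N) (V₂ N) C R)
    {k₁' k₂' : ℝ → ℂ} (hk₁' : ∀ u, Tendsto (fun N => k₁ N u) atTop (𝓝 (k₁' u)))
    (hk₂' : ∀ u, Tendsto (fun N => k₂ N u) atTop (𝓝 (k₂' u))) :
    Tendsto (fun N => ((∫ s, pairWeight (P N) vol ρ (XN N) γ x₁ x₂ ξ δ z s *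
      V₁ N (XN N s x₁ - γ * Real.log N) * V₂ N (XN N s x₂ - γ * Real.log N) ∂(P N) : ℝ) : ℂ)) atTop
      (𝓝 (pairConst vol h ρ γ x₁ x₂ ξ δ z * (∫ u : ℝ, k₁' u * Real.exp (-u ^ 2 / 2)) *
        ∫ u : ℝ, k₂' u * Real.exp (-u ^ 2 / 2))) := by
  set K : Set Ω := {x₁, x₂} ∪ range z with hKdef
  have hK : IsCompact K := ((toFinite _).isCompact).union (finite_range z).isCompact
  have hx₁ : x₁ ∈ K := Or.inl (by simp)
  have hx₂ : x₂ ∈ K := Or.inl (by simp)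
  obtain ⟨A, hA, hev⟩ := hm.norm_char_le h_cont hK (by norm_num : (0 : ℝ) < 1 / 2) (by norm_num)
    hR ξ hγ hγ
  obtain ⟨c₀, hc₀, _, _, hmean⟩ := hm.expMean_bounds hK hγ
  have hδev : ∀ᶠ N : ℕ in atTop, ∀ j, (N : ℝ) ^ (-1 + (1 / 2 : ℝ)) ≤ δ j := by
    rw [eventually_all]
    intro j
    filter_upwards [eventually_rpow_le (by norm_num : (1 / 2 : ℝ) < 1) (hδ j).1] with N hN
    rwa [neg_add_eq_sub]
  set E := Real.exp (γ ^ 2 * cov h x₁ x₂ + γ * covLin vol h ρ ξ δ z x₁ +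
    γ * covLin vol h ρ ξ δ z x₂ + 1 / 2 * covForm vol h (mollifierSum ρ ξ δ z)) with hE
  set M := c₀⁻¹ ^ 2 * A * E with hM
  -- the bound on the normalized characteristic function
  have hbound : ∀ᶠ N : ℕ in atTop, ∀ u₁ u₂ : ℝ, |u₁| ≤ R * √(Real.log N) →
      |u₂| ≤ R * √(Real.log N) →
      ‖∫ s, (pairWeight (P N) vol ρ (XN N) γ x₁ x₂ ξ δ z s : ℂ) *
        Complex.exp (u₂ * (((XN N s x₂ - γ * Real.log N) / √(Real.log N) : ℝ) : ℂ) * Complex.I) *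
        Complex.exp (u₁ * (((XN N s x₁ - γ * Real.log N) / √(Real.log N) : ℝ) : ℂ) * Complex.I) ∂(P N)‖
      ≤ M * Real.exp (-(1 / 2) * u₂ ^ 2 / 2) * Real.exp (-(1 / 2) * u₁ ^ 2 / 2) := by
    filter_upwards [hev, hmean, hδev,
      eventually_rpow_le (by norm_num : (1 / 2 : ℝ) < 1) (dist_pos.2 hne)] with N h1 h2 h3 h4 u₁ u₂ hu₁ hu₂
    have e1 := h1 x₁ hx₁ x₂ hx₂ h4 z (fun j => Or.inr (mem_range_self j)) δ
      (fun j => ⟨hδ j, h3 j⟩) (γ * Real.log N) (γ * Real.log N) u₁ u₂ hu₁ hu₂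
    have hZ₁ := (h2 x₁ hx₁).1
    have hZ₁0 : 0 < expMean (P N) (XN N) γ x₁ := lt_of_lt_of_le (by positivity) hZ₁
    have hZ₂ := (h2 x₂ hx₂).1
    have hZ₂0 : 0 < expMean (P N) (XN N) γ x₂ := lt_of_lt_of_le (by positivity) hZ₂
    have hf₁ : (expMean (P N) (XN N) γ x₁)⁻¹ ≤ c₀⁻¹ * (Real.exp (γ ^ 2 / 2 * Real.log N))⁻¹ := by
      rw [← mul_inv]
      exact inv_anti₀ (by positivity) hZ₁
    have hf₂ : (expMean (P N) (XN N) γ x₂)⁻¹ ≤ c₀⁻¹ * (Real.exp (γ ^ 2 / 2 * Real.log N))⁻¹ := by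
      rw [← mul_inv]
      exact inv_anti₀ (by positivity) hZ₂
    have hM2 : Real.exp ((γ ^ 2 + γ ^ 2) / 2 * Real.log N + γ * γ * cov h x₁ x₂ +
        γ * covLin vol h ρ ξ δ z x₁ + γ * covLin vol h ρ ξ δ z x₂ +
        1 / 2 * covForm vol h (mollifierSum ρ ξ δ z)) =
        (Real.exp (γ ^ 2 / 2 * Real.log N) ^ 2 * E) := by
      rw [hE, ← Real.exp_nat_mul, ← Real.exp_add]
      congr 1
      push_cast
      ring
    rw [hM2] at e1
    simp_rw [pairWeight, wt_mul_wt_mul_smoothWeight, Complex.ofReal_mul, mul_assoc]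
    rw [integral_const_mul, integral_const_mul, norm_mul, norm_mul, Complex.norm_real,
      Complex.norm_real, Real.norm_of_nonneg (inv_nonneg.2 hZ₁0.le),
      Real.norm_of_nonneg (inv_nonneg.2 hZ₂0.le)]
    simp_rw [mul_assoc] at e1
    calc _ ≤ (c₀⁻¹ * (Real.exp (γ ^ 2 / 2 * Real.log N))⁻¹) *
        ((c₀⁻¹ * (Real.exp (γ ^ 2 / 2 * Real.log N))⁻¹) *
        (A * (Real.exp (γ ^ 2 / 2 * Real.log N) ^ 2 * (E *
        (Real.exp (-(1 / 2 * (u₂ ^ 2 / 2))) * Real.exp (-(1 / 2 * (u₁ ^ 2 / 2)))))))) := by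
          gcongr
          refine e1.trans (le_of_eq ?_)
          congr 5 <;> ring_nf
      _ = _ := by
        have := (Real.exp_pos (γ ^ 2 / 2 * Real.log N)).ne'
        rw [hM]
        have e5 : -(1 / 2) * u₂ ^ 2 / 2 = -(1 / 2 * (u₂ ^ 2 / 2)) := by ring
        have e6 : -(1 / 2) * u₁ ^ 2 / 2 = -(1 / 2 * (u₁ ^ 2 / 2)) := by ring
        rw [e5, e6]
        field_simp
  have hint : ∀ᶠ N in atTop, Integrable (fun s => (pairWeight (P N) vol ρ (XN N) γ x₁ x₂ ξ δ z s : ℂ))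
      (P N) := by
    filter_upwards [eventually_ge_atTop 1] with N hN
    exact (hm.integrable_pairWeight hN hγ hne ξ δ z hδ).ofReal
  have hint2 : ∀ u₂ : ℝ, ∀ᶠ N in atTop, Integrable (fun s =>
      (pairWeight (P N) vol ρ (XN N) γ x₁ x₂ ξ δ z s : ℂ) * Complex.exp (u₂ *
        (((XN N s x₂ - γ * Real.log N) / √(Real.log N) : ℝ) : ℂ) * Complex.I)) (P N) := by
    intro u₂
    filter_upwards [hint] with N hN
    have hY := hX N x₂
    exact hN.mul_bdd (c := 1) (Measurable.aestronglyMeasurable (by fun_prop))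
        (ae_of_all _ fun s => by rw [norm_cexp_mul_I])
  have hswap : ∀ (u₂ : ℝ) N s, (pairWeight (P N) vol ρ (XN N) γ x₁ x₂ ξ δ z s : ℂ) *
      Complex.exp (u₂ * (((XN N s x₂ - γ * Real.log N) / √(Real.log N) : ℝ) : ℂ) * Complex.I) *
      (V₁ N (XN N s x₁ - γ * Real.log N) : ℂ) =
      (pairWeight (P N) vol ρ (XN N) γ x₁ x₂ ξ δ z s : ℂ) *
      (V₁ N (XN N s x₁ - γ * Real.log N) : ℂ) * Complex.exp (u₂ *
        (((XN N s x₂ - γ * Real.log N) / √(Real.log N) : ℝ) : ℂ) * Complex.I) := fun u₂ N s => by ring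
  have hR0 : ∀ᶠ N : ℕ in atTop, (0 : ℝ) ≤ R * √(Real.log N) := Eventually.of_forall fun N => by positivity
  -- With u₂ fixed, the limit in the x₁ kernel has the form constant times e^{-u₂²/2}, which is the
  -- hypothesis of the same limit lemma for the x₂ kernel.
  have step1 : ∀ u₂ : ℝ, Tendsto (fun N => ∫ s, (pairWeight (P N) vol ρ (XN N) γ x₁ x₂ ξ δ z s : ℂ) *
      (V₁ N (XN N s x₁ - γ * Real.log N) : ℂ) * Complex.exp (u₂ *
        (((XN N s x₂ - γ * Real.log N) / √(Real.log N) : ℝ) : ℂ) * Complex.I) ∂(P N)) atTop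
      (𝓝 (pairConst vol h ρ γ x₁ x₂ ξ δ z * (∫ u : ℝ, k₁' u * Real.exp (-u ^ 2 / 2)) *
        Real.exp (-u₂ ^ 2 / 2))) := by
    intro u₂
    have hu₂ : ∀ᶠ N : ℕ in atTop, |u₂| ≤ R * √(Real.log N) :=
      (tendsto_sqrt_log.const_mul_atTop hR).eventually_ge_atTop _
    have := tendsto_integral_mul_kernel (σ := fun N : ℕ => √(Real.log N)) hC hk₁ (hint2 u₂)
      (Y := fun N s => XN N s x₁ - γ * Real.log N) (fun N => (hX N x₁).sub_const _)
      (η := 1 / 2) (M := M * Real.exp (-(1 / 2) * u₂ ^ 2 / 2)) (by norm_num) (by positivity)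
      (by filter_upwards [hbound, hu₂] with N h1 h2 u₁ hu₁
          exact h1 u₁ u₂ hu₁ h2) hk₁'
      (fun u₁ => hm.tendsto_char_two hγ u₁ u₂ hne ξ δ z hδ)
    simp_rw [hswap] at this
    rw [mul_right_comm] at this
    exact this
  have := tendsto_integral_mul_kernel (σ := fun N : ℕ => √(Real.log N)) hC hk₂
    (G := fun N s => (pairWeight (P N) vol ρ (XN N) γ x₁ x₂ ξ δ z s : ℂ) *
      (V₁ N (XN N s x₁ - γ * Real.log N) : ℂ))
    (by filter_upwards [hint, hk₁] with N h1 h2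
        exact integrable_mul_kernel h2 h1 ((hX N x₁).sub_const _))
    (Y := fun N s => XN N s x₂ - γ * Real.log N) (fun N => (hX N x₂).sub_const _)
    (η := 1 / 2) (M := C * M * gaussMass (1 / 2)) (by norm_num)
    (by have := gaussMass_nonneg (1 / 2); positivity) ?_ hk₂' step1
  · refine this.congr fun N => ?_
    rw [← integral_complex_ofReal]
    push_cast; rfl
  · filter_upwards [hbound, hint2 0, hint, hk₁] with N h1 h2 h3 h4 u₂ hu₂
    have hY := hX N x₂
    have hG2 : Integrable (fun s => (pairWeight (P N) vol ρ (XN N) γ x₁ x₂ ξ δ z s : ℂ) *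
        Complex.exp (u₂ * (((XN N s x₂ - γ * Real.log N) / √(Real.log N) : ℝ) : ℂ) * Complex.I)) (P N) :=
      h3.mul_bdd (c := 1) (Measurable.aestronglyMeasurable (by fun_prop))
        (ae_of_all _ fun s => by rw [norm_cexp_mul_I])
    have e1 := norm_integral_mul_kernel_le h4 hG2 ((hX N x₁).sub_const (γ * Real.log N))
      (by norm_num : (0 : ℝ) < 1 / 2)
      (M := M * Real.exp (-(1 / 2) * u₂ ^ 2 / 2)) (by positivity) hC
      (fun u₁ hu₁ => h1 u₁ u₂ hu₁ hu₂)
    simp_rw [hswap] at e1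
    refine e1.trans (le_of_eq ?_)
    rw [gaussMass]; ring

end TwoPointLimit

/-! ### The local limit theorem and the compensated kernel. -/

section LocalLimit

variable {d : ℕ} {Ω : Type*} [MetricSpace Ω] [MeasurableSpace Ω] {vol : Measure Ω}
  {h : Ω → Ω → ℝ} {ρ : ℝ → Ω → Ω → ℝ} {S : ℕ → Type*} [∀ N, MeasurableSpace (S N)]
  {P : ∀ N, Measure (S N)} [∀ N, IsProbabilityMeasure (P N)] {XN : ∀ N, S N → Ω → ℝ}
  {Ψ : ℂ → Ω → ℂ} {γ : ℝ}

lemma integral_gaussian_half : ∫ u : ℝ, Real.exp (-u ^ 2 / 2) = √(2 * Real.pi) := by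
  have := integral_gaussian (1 / 2)
  rw [show Real.pi / (1 / 2) = 2 * Real.pi by ring] at this
  rw [← this]
  congr 1
  ext u
  ring_nf

lemma integrable_gaussian_half' : Integrable fun u : ℝ => Real.exp (-u ^ 2 / 2) := by
  have := integrable_gaussian_half (one_pos)
  simpa using this

/-- The Gaussian mass of the global cutoff. -/
def cutoffMass (ε : ℝ) : ℝ := ∫ u : ℝ, tri (u / ε) / ε * Real.exp (-u ^ 2 / 2)

lemma integral_tri : ∫ t, tri t = 1 := by
  have := integral_tri_cos 0
  simpa [fejer] using this

lemma integrable_tri_div {ε : ℝ} (hε : 0 < ε) : Integrable fun u => tri (u / ε) / ε :=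
  (integrable_tri.comp_div hε.ne').div_const _

lemma integral_tri_div {ε : ℝ} (hε : 0 < ε) : ∫ u, tri (u / ε) / ε = 1 := by
  rw [integral_div, Measure.integral_comp_div, integral_tri, abs_of_pos hε, smul_eq_mul, mul_one,
    div_self hε.ne']

/-- tri(u/ε)/ε is a probability density carried by |u| ≤ ε, where e^{-u²/2} ≥ 1 − ε²/2. -/
lemma cutoffMass_mem {ε : ℝ} (hε : 0 < ε) : cutoffMass ε ∈ Icc (1 - ε ^ 2 / 2) 1 := by
  have h1 := integrable_tri_div hε
  have h2 : Integrable fun u => tri (u / ε) / ε * Real.exp (-u ^ 2 / 2) := by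
    refine h1.mul_bdd (c := 1) (by fun_prop) (ae_of_all _ fun u => ?_)
    rw [Real.norm_of_nonneg (Real.exp_pos _).le]
    exact Real.exp_le_one_iff.2 (by nlinarith [sq_nonneg u])
  have hn : ∀ u, 0 ≤ tri (u / ε) / ε := fun u => div_nonneg (tri_nonneg _) hε.le
  constructor
  · have h3 : ∫ u, tri (u / ε) / ε * (1 - ε ^ 2 / 2) ≤ cutoffMass ε := by
      refine integral_mono (h1.mul_const _) h2 fun u => ?_
      rcases le_or_gt 1 |u / ε| with hu | hu
      · simp [tri_eq_zero hu]
      · refine mul_le_mul_of_nonneg_left ?_ (hn u)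
        rw [abs_div, abs_of_pos hε, div_lt_one hε] at hu
        have : u ^ 2 ≤ ε ^ 2 := by
          rw [← sq_abs u]; gcongr
        have := Real.add_one_le_exp (-u ^ 2 / 2)
        linarith
    rwa [integral_mul_const, integral_tri_div hε, one_mul] at h3
  · rw [← integral_tri_div hε]
    refine integral_mono h2 h1 fun u => ?_
    exact mul_le_of_le_one_right (hn u) (Real.exp_le_one_iff.2 (by nlinarith [sq_nonneg u]))

lemma tendsto_sqrt_log_prod {K : Set Ω} :
    Tendsto (fun p : ℕ × Ω => √(Real.log p.1)) (atTop ×ˢ 𝓟 K) atTop :=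
  tendsto_sqrt_log.comp tendsto_fst

lemma eventually_prod_of_atTop {K : Set Ω} {q : ℕ → Prop} (hq : ∀ᶠ N in atTop, q N) :
    ∀ᶠ p : ℕ × Ω in atTop ×ˢ 𝓟 K, q p.1 :=
  tendsto_fst.eventually hq

lemma eventually_mem_prod {K : Set Ω} : ∀ᶠ p : ℕ × Ω in atTop ×ˢ 𝓟 K, p.2 ∈ K := by
  rw [eventually_prod_principal_iff]
  exact Eventually.of_forall fun _ x hx => hx

/-- On scale σ the transform of p flattens to the constant φ(0), and the phase of a bounded shift
disappears. This is why the threshold g does not affect the limit. -/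
lemma tendsto_local_kernel {φ : ℝ → ℂ} (hφ : Continuous φ) {K : Set Ω} {b : Ω → ℝ} {B : ℝ}
    (hb : ∀ x ∈ K, |b x| ≤ B) (u : ℝ) :
    Tendsto (fun p : ℕ × Ω => φ (u / √(Real.log p.1)) *
      Complex.exp ((u / √(Real.log p.1) : ℝ) * (-b p.2 : ℝ) * Complex.I)) (atTop ×ˢ 𝓟 K)
      (𝓝 (φ 0)) := by
  have h0 : Tendsto (fun p : ℕ × Ω => u / √(Real.log p.1)) (atTop ×ˢ 𝓟 K) (𝓝 0) :=
    tendsto_sqrt_log_prod.const_div_atTop u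
  have h1 : Tendsto (fun p : ℕ × Ω => φ (u / √(Real.log p.1))) (atTop ×ˢ 𝓟 K) (𝓝 (φ 0)) :=
    (hφ.tendsto 0).comp h0
  have h2 : Tendsto (fun p : ℕ × Ω => u / √(Real.log p.1) * -b p.2) (atTop ×ˢ 𝓟 K) (𝓝 0) := by
    refine h0.zero_mul_isBoundedUnder_le ?_
    refine ⟨B, ?_⟩
    rw [eventually_map]
    filter_upwards [eventually_mem_prod] with p hp
    simpa using hb _ hp
  have h3 : Tendsto (fun p : ℕ × Ω => Complex.exp (((u / √(Real.log p.1) * -b p.2 : ℝ) : ℂ) *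
      Complex.I)) (atTop ×ˢ 𝓟 K) (𝓝 (Complex.exp (((0 : ℝ) : ℂ) * Complex.I))) :=
    ((Complex.continuous_exp.comp (Complex.continuous_ofReal.mul continuous_const)).tendsto 0).comp h2
  have h4 := h1.mul h3
  simp only [Complex.ofReal_zero, zero_mul, Complex.exp_zero, mul_one, Complex.ofReal_mul] at h4
  exact h4

/-- Local limit theorem: φ(0) times the Gaussian integral √(2π) is a/√(2π), the mass of p times the
standard Gaussian density at 0. -/
lemma MesoscopicAssumption.local_limit [Nontrivial Ω]
    (hm : MesoscopicAssumption d P vol h ρ XN Ψ)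
    (hX : ∀ N x, Measurable fun s => XN N s x)
    (h_cont : Continuous (fun p : Ω × Ω => h p.1 p.2)) {K : Set Ω} (hK : IsCompact K)
    (hγ : γ ∈ Icc 0 √(2 * d)) {p : ℝ → ℝ} {φ : ℝ → ℂ} (hp : BandLimited p φ) {a : ℝ}
    (ha : 2 * Real.pi * φ 0 = a) {b : Ω → ℝ} {B : ℝ} (hb : ∀ x ∈ K, |b x| ≤ B) :
    Tendsto (fun q : ℕ × Ω => ∫ s, wt (P q.1) (XN q.1) γ q.2 s *
      (√(Real.log q.1) * p ((XN q.1 s q.2 - γ * Real.log q.1) - b q.2)) ∂(P q.1)) (atTop ×ˢ 𝓟 K)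
      (𝓝 (a / √(2 * Real.pi))) := by
  obtain ⟨C, R, hC, hR, hφC, hφR⟩ := hp.bounded
  have h1 := hm.one_point_limit hX h_cont hK hγ hC.le hR
    (k := fun q u => φ (u / √(Real.log q.1)) *
      Complex.exp ((u / √(Real.log q.1) : ℝ) * (-b q.2 : ℝ) * Complex.I))
    (V := fun q y => √(Real.log q.1) * p (y - b q.2)) ?_ (tendsto_local_kernel hp.continuous hb)
  · have h2 := (Complex.continuous_re.tendsto _).comp h1
    refine h2.trans (le_of_eq ?_)
    congr 1
    rw [integral_const_mul, integral_complex_ofReal, integral_gaussian_half]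
    have hpi := Real.pi_pos
    have : φ 0 = ((a / (2 * Real.pi) : ℝ) : ℂ) := by
      push_cast
      rw [← ha]
      field_simp
    rw [this, ← Complex.ofReal_mul, Complex.ofReal_re]
    have h3 : √(2 * Real.pi) ^ 2 = 2 * Real.pi := Real.sq_sqrt (by positivity)
    have h4 : 0 < √(2 * Real.pi) := Real.sqrt_pos.2 (by positivity)
    rw [← h3]
    rw [Real.sqrt_sq h4.le]
    field_simp
  · filter_upwards [tendsto_sqrt_log_prod.eventually_gt_atTop 0] with q hq
    exact hp.isKernel_local hφC hφR hq (b q.2)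

lemma MesoscopicAssumption.cutoff_limit [Nontrivial Ω]
    (hm : MesoscopicAssumption d P vol h ρ XN Ψ)
    (hX : ∀ N x, Measurable fun s => XN N s x)
    (h_cont : Continuous (fun p : Ω × Ω => h p.1 p.2)) {K : Set Ω} (hK : IsCompact K)
    (hγ : γ ∈ Icc 0 √(2 * d)) {ε : ℝ} (hε : 0 < ε) :
    Tendsto (fun q : ℕ × Ω => ∫ s, wt (P q.1) (XN q.1) γ q.2 s *
      fejer (ε * (XN q.1 s q.2 - γ * Real.log q.1) / √(Real.log q.1)) ∂(P q.1)) (atTop ×ˢ 𝓟 K)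
      (𝓝 (cutoffMass ε)) := by
  have h1 := hm.one_point_limit hX h_cont hK hγ (C := 1 / ε) (R := ε) (by positivity) hε
    (k := fun q u => ((tri (u / ε) / ε : ℝ) : ℂ))
    (V := fun q y => fejer (ε * y / √(Real.log q.1)))
    (by
      filter_upwards [tendsto_sqrt_log_prod.eventually_ge_atTop 1] with q hq
      exact isKernel_global hε hq) (fun u => tendsto_const_nhds)
  have h2 := (Complex.continuous_re.tendsto _).comp h1
  refine h2.trans (le_of_eq ?_)
  congr 1
  simp_rw [← Complex.ofReal_mul]
  rw [integral_complex_ofReal, Complex.ofReal_re]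
  rfl

lemma MesoscopicAssumption.integral_wt [Nontrivial Ω]
    (hm : MesoscopicAssumption d P vol h ρ XN Ψ) {N : ℕ} (hN : 1 ≤ N)
    (hγ : γ ∈ Icc 0 √(2 * d)) (x : Ω) : ∫ s, wt (P N) (XN N) γ x s ∂(P N) = 1 := by
  simp only [wt]
  rw [integral_div]
  exact div_self (hm.expMean_pos hN hγ x).ne'

lemma wt_nonneg {S : Type*} [MeasurableSpace S] (P : Measure S) (X : S → Ω → ℝ) (γ : ℝ)
    (x : Ω) (s : S) : 0 ≤ wt P X γ x s :=
  div_nonneg (Real.exp_pos _).le (expMean_nonneg _ _ _ _)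

lemma expTail_le_one {γ : ℝ} (hγ : 0 ≤ γ) (y : ℝ) : expTail γ y ≤ 1 := by
  unfold expTail
  split_ifs with hy
  · exact Real.exp_le_one_iff.2 (by nlinarith)
  · exact zero_le_one

lemma MesoscopicAssumption.integrable_wt_mul [Nontrivial Ω]
    (hm : MesoscopicAssumption d P vol h ρ XN Ψ) {N : ℕ} (hN : 1 ≤ N)
    (hγ : γ ∈ Icc 0 √(2 * d)) (x : Ω) {f : S N → ℝ} (hf : Measurable f) {c : ℝ}
    (hfc : ∀ s, |f s| ≤ c) : Integrable (fun s => wt (P N) (XN N) γ x s * f s) (P N) :=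
  (hm.integrable_wt hN hγ x).mul_bdd hf.aestronglyMeasurable (ae_of_all _ hfc)

/-- `√(log N) E[w κ(Y - b)]` for the one-sided exponential `κ`. -/
def tailMass {S : Type*} [MeasurableSpace S] (P : Measure S) (X : S → Ω → ℝ) (γ : ℝ) (N : ℕ)
    (x : Ω) (b : ℝ) : ℝ :=
  ∫ s, wt P X γ x s * (√(Real.log N) * expTail γ ((X s x - γ * Real.log N) - b)) ∂P

lemma BandLimited.abs_le {p : ℝ → ℝ} {φ : ℝ → ℂ} (hp : BandLimited p φ) (y : ℝ) :
    |p y| ≤ ∫ t, ‖φ t‖ := by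
  rw [← Real.norm_eq_abs, ← Complex.norm_real, hp.eq]
  refine (norm_integral_le_integral_norm _).trans (le_of_eq ?_)
  simp only [norm_mul, norm_cexp_mul_I, mul_one]

/-- The jump keeps κ from being band limited. It is squeezed between p − Q and p + Q, both of which
obey the local limit theorem, and Q has arbitrarily small mass. The limit does not depend on b. -/
lemma MesoscopicAssumption.tendsto_tailMass [Nontrivial Ω]
    (hm : MesoscopicAssumption d P vol h ρ XN Ψ)
    (hX : ∀ N x, Measurable fun s => XN N s x)
    (h_cont : Continuous (fun p : Ω × Ω => h p.1 p.2)) {K : Set Ω} (hK : IsCompact K)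
    (hγ : γ ∈ Icc 0 √(2 * d)) (hγ0 : 0 < γ) {b : Ω → ℝ} {B : ℝ} (hb : ∀ x ∈ K, |b x| ≤ B) :
    Tendsto (fun q : ℕ × Ω => tailMass (P q.1) (XN q.1) γ q.1 q.2 (b q.2)) (atTop ×ˢ 𝓟 K)
      (𝓝 (1 / γ / √(2 * Real.pi))) := by
  rw [Metric.tendsto_nhds]
  intro ε hε
  have hs : 1 ≤ √(2 * Real.pi) := by
    rw [Real.one_le_sqrt]; linarith [Real.pi_gt_three]
  obtain ⟨p, φ, Q, Φ, C, a, a', hp, hQ, hpQ, -, -, ha, ha', hab, hbτ⟩ :=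
    exists_bandLimited_expTail hγ0 (by positivity : 0 < ε / 5)
  have l1 := hm.local_limit hX h_cont hK hγ hp ha hb
  have l2 := hm.local_limit hX h_cont hK hγ hQ ha' hb
  filter_upwards [l1.eventually (Metric.ball_mem_nhds _ (by positivity : 0 < ε / 5)),
    l2.eventually (gt_mem_nhds (lt_add_of_pos_right _ (by positivity : 0 < ε / 5))),
    eventually_prod_of_atTop (eventually_ge_atTop 1)] with q h1 h2 hN
  obtain ⟨N, x⟩ := q
  simp only at h1 h2 hN ⊢
  rw [Real.dist_eq] at h1 ⊢
  set σ := √(Real.log N)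
  have hY : Measurable fun s => (XN N s x - γ * Real.log N) - b x :=
    ((hX N x).sub_const _).sub_const _
  have i0 : Integrable (fun s => wt (P N) (XN N) γ x s *
      (σ * expTail γ ((XN N s x - γ * Real.log N) - b x))) (P N) :=
    hm.integrable_wt_mul hN hγ x (((measurable_expTail γ).comp hY).const_mul _) (c := σ) fun s => by
      rw [abs_mul, abs_of_nonneg (Real.sqrt_nonneg _), abs_of_nonneg (expTail_nonneg _ _)]
      exact mul_le_of_le_one_right (Real.sqrt_nonneg _) (expTail_le_one hγ0.le _)
  have ib : ∀ {p : ℝ → ℝ} {φ : ℝ → ℂ}, BandLimited p φ → Integrable (fun s => wt (P N) (XN N) γ x s *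
      (σ * p ((XN N s x - γ * Real.log N) - b x))) (P N) := fun {p φ} hp =>
    hm.integrable_wt_mul hN hγ x ((hp.continuous_self.continuous.measurable.comp hY).const_mul _)
      (c := σ * ∫ t, ‖φ t‖) fun s => by
        rw [abs_mul, abs_of_nonneg (Real.sqrt_nonneg _)]
        gcongr
        exact hp.abs_le _
  have hdiff : |tailMass (P N) (XN N) γ N x (b x) - ∫ s, wt (P N) (XN N) γ x s *
      (σ * p ((XN N s x - γ * Real.log N) - b x)) ∂(P N)| ≤ ∫ s, wt (P N) (XN N) γ x s *
      (σ * Q ((XN N s x - γ * Real.log N) - b x)) ∂(P N) := by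
    rw [tailMass, ← integral_sub i0 (ib hp), ← Real.norm_eq_abs]
    refine norm_integral_le_of_norm_le (ib hQ) (ae_of_all _ fun s => ?_)
    rw [← mul_sub, ← mul_sub, Real.norm_eq_abs, abs_mul, abs_mul, abs_of_nonneg (wt_nonneg _ _ _ _ _),
      abs_of_nonneg (Real.sqrt_nonneg _)]
    have := wt_nonneg (P N) (XN N) γ x s
    gcongr
    exact hpQ _
  have e1 : |a / √(2 * Real.pi) - 1 / γ / √(2 * Real.pi)| ≤ ε / 5 := by
    rw [← sub_div, abs_div, abs_of_pos (by linarith : 0 < √(2 * Real.pi)), div_le_iff₀ (by linarith)]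
    nlinarith
  have e2 : a' / √(2 * Real.pi) ≤ ε / 5 := by
    rw [div_le_iff₀ (by linarith)]
    nlinarith
  rw [abs_le] at hdiff e1
  rw [abs_lt] at h1 ⊢
  constructor <;> linarith [hdiff.1, hdiff.2, e1.1, e1.2, h1.1, h1.2]

/-- The compensated kernel `σ p(y - g) - F(ε y/σ)`, `σ = √(log N)`. -/
def kernelD (p : ℝ → ℝ) (ε : ℝ) (N : ℕ) (b y : ℝ) : ℝ :=
  √(Real.log N) * p (y - b) - fejer (ε * y / √(Real.log N))

/-- The normalized density of thick points with respect to the tilted measure. -/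
def thickRatio {S : Type*} [MeasurableSpace S] (P : Measure S) (X : S → Ω → ℝ) (γ : ℝ) (N : ℕ)
    (x : Ω) (b : ℝ) (s : S) : ℝ :=
  √(Real.log N) * expTail γ ((X s x - γ * Real.log N) - b) / tailMass P X γ N x 0

set_option maxHeartbeats 800000 in
-- The normalization t tends to ℓ = 1/(γ√(2π)), κ is close to p in mass, and F(θY/σ) is close to 1
-- because Y/σ is tight under the tilt. Every error is bounded by a nonnegative combination of
-- quantities with known limits, hence in L¹(w dP) uniformly on K. The equality of Gaussian masses
-- holds exactly and not just approximately, since the second moment needs an exact cancellation.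
lemma MesoscopicAssumption.exists_kernel_approx [Nontrivial Ω]
    (hm : MesoscopicAssumption d P vol h ρ XN Ψ)
    (hX : ∀ N x, Measurable fun s => XN N s x)
    (h_cont : Continuous (fun p : Ω × Ω => h p.1 p.2)) {K : Set Ω} (hK : IsCompact K)
    (hγ : γ ∈ Icc 0 √(2 * d)) (hγ0 : 0 < γ) {g : Ω → ℝ} {B : ℝ} (hg : ∀ x ∈ K, |g x| ≤ B) {τ : ℝ}
    (hτ : 0 < τ) :
    ∃ (p : ℝ → ℝ) (φ : ℝ → ℂ) (C ε : ℝ), BandLimited p φ ∧ 0 < C ∧ 0 < ε ∧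
      (∀ y, |p y| ≤ C * wgt y) ∧ φ 0 * √(2 * Real.pi) = cutoffMass ε ∧
      ∀ᶠ N : ℕ in atTop, ∀ x ∈ K,
        Integrable (fun s => wt (P N) (XN N) γ x s * |thickRatio (P N) (XN N) γ N x (g x) s - 1 -
          kernelD p ε N (g x) (XN N s x - γ * Real.log N)|) (P N) ∧
        ∫ s, wt (P N) (XN N) γ x s * |thickRatio (P N) (XN N) γ N x (g x) s - 1 -
          kernelD p ε N (g x) (XN N s x - γ * Real.log N)| ∂(P N) ≤ τ := by
  set r := √(2 * Real.pi) with hr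
  have hr1 : 1 ≤ r := by
    rw [hr, Real.one_le_sqrt]; linarith [Real.pi_gt_three]
  set ℓ := 1 / γ / r with hℓ
  have hℓ0 : 0 < ℓ := by positivity
  -- the constant in front of the small parameter
  set C₀ := 1 + 2 / ℓ + r * (2 * γ * (γ + 1)) * (ℓ + 3) + 2 with hC₀
  have hC₀0 : 0 < C₀ := by positivity
  obtain ⟨θ, hθ0, hθ1, hθγ, hθτ⟩ : ∃ θ : ℝ, 0 < θ ∧ θ ≤ 1 ∧ θ ≤ 1 / (2 * γ) ∧ C₀ * θ ≤ τ := by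
    refine ⟨min 1 (min (1 / (2 * γ)) (τ / C₀)), by positivity, min_le_left _ _,
      (min_le_right _ _).trans (min_le_left _ _), ?_⟩
    calc _ ≤ C₀ * (τ / C₀) := by
          gcongr; exact (min_le_right _ _).trans (min_le_right _ _)
      _ = τ := by field_simp
  obtain ⟨p, φ, Q, Φ, C, a, a', hp, hQ, hpQ, hC, hpC, ha, ha', hab, hbτ⟩ :=
    exists_bandLimited_expTail hγ0 hθ0
  obtain ⟨hm1, hm2⟩ := cutoffMass_mem hθ0
  set m := cutoffMass θ with hmdef
  have ha_low : 1 / (2 * γ) ≤ a := by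
    have := (abs_le.1 hab).1
    have e : 1 / γ = 1 / (2 * γ) + 1 / (2 * γ) := by field_simp; norm_num
    linarith
  have ha0 : 0 < a := lt_of_lt_of_le (by positivity) ha_low
  have hm0 : 0 < m := by nlinarith
  -- As φ(0) = a/(2π) and r² = 2π, this is the factor for which cφ(0)r equals the Gaussian mass m of
  -- the cutoff. Since a ≈ 1/γ and m ≈ 1, it is close to 1/ℓ.
  set c := m * r / a with hc
  have hc0 : 0 < c := by positivity
  have hcℓ : |1 / ℓ - c| ≤ r * (2 * γ * (γ + 1)) * θ := by
    have e1 : 1 / ℓ - c = r / a * (γ * (a - 1 / γ) + (1 - m)) := by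
      rw [hℓ, hc]; field_simp; ring
    rw [e1, abs_mul, abs_of_pos (by positivity)]
    have e2 : |γ * (a - 1 / γ) + (1 - m)| ≤ (γ + 1) * θ := by
      refine (abs_add_le _ _).trans ?_
      rw [abs_mul, abs_of_pos hγ0, abs_of_nonneg (by linarith : 0 ≤ 1 - m)]
      have : γ * |a - 1 / γ| ≤ γ * θ := by gcongr
      nlinarith
    have e3 : r / a ≤ r * (2 * γ) := by
      rw [div_le_iff₀ ha0]
      have : 1 ≤ 2 * γ * a := by
        rw [div_le_iff₀ (by positivity)] at ha_low; linarith
      nlinarith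
    calc _ ≤ (r * (2 * γ)) * ((γ + 1) * θ) := by gcongr
      _ = _ := by ring
  refine ⟨fun y => c * p y, fun t => c * φ t, c * C, θ, hp.const_mul c, by positivity, hθ0,
    fun y => ?_, ?_, ?_⟩
  · rw [abs_mul, abs_of_pos hc0, mul_assoc]
    gcongr
    exact hpC y
  · have hpi := Real.pi_pos
    have hpc : (Real.pi : ℂ) ≠ 0 := by exact_mod_cast hpi.ne'
    have e1 : φ 0 = ((a / (2 * Real.pi) : ℝ) : ℂ) := by
      push_cast
      rw [← ha]
      field_simp
    change (c : ℂ) * φ 0 * (r : ℂ) = (m : ℂ)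
    rw [e1, ← Complex.ofReal_mul, ← Complex.ofReal_mul]
    congr 1
    have h3 : r ^ 2 = 2 * Real.pi := Real.sq_sqrt (by positivity)
    rw [hc, ← h3]
    field_simp
  have l1 : Tendsto _ _ (𝓝 ℓ) :=
    hm.tendsto_tailMass hX h_cont hK hγ hγ0 (b := fun _ => 0) (B := 0) (by simp)
  have l2 : Tendsto _ _ (𝓝 ℓ) := hm.tendsto_tailMass hX h_cont hK hγ hγ0 hg
  have l3 := hm.local_limit hX h_cont hK hγ hQ ha' hg
  have l4 := hm.cutoff_limit hX h_cont hK hγ hθ0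
  have l5 : Tendsto (fun q : ℕ × Ω => |1 / tailMass (P q.1) (XN q.1) γ q.1 q.2 0 - 1 / ℓ| *
      tailMass (P q.1) (XN q.1) γ q.1 q.2 (g q.2)) (atTop ×ˢ 𝓟 K) (𝓝 0) := by
    have h0 : |1 / ℓ - 1 / ℓ| * ℓ = 0 := by rw [sub_self, abs_zero, zero_mul]
    have := (((tendsto_const_nhds (x := (1 : ℝ))).div l1 hℓ0.ne').sub_const (1 / ℓ)).abs.mul l2
    exact h0 ▸ this
  have key : ∀ᶠ q : ℕ × Ω in atTop ×ˢ 𝓟 K,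
      Integrable (fun s => wt (P q.1) (XN q.1) γ q.2 s * |thickRatio (P q.1) (XN q.1) γ q.1 q.2 (g q.2) s - 1 -
          kernelD (fun y => c * p y) θ q.1 (g q.2) (XN q.1 s q.2 - γ * Real.log q.1)|) (P q.1) ∧
        ∫ s, wt (P q.1) (XN q.1) γ q.2 s * |thickRatio (P q.1) (XN q.1) γ q.1 q.2 (g q.2) s - 1 -
          kernelD (fun y => c * p y) θ q.1 (g q.2) (XN q.1 s q.2 - γ * Real.log q.1)| ∂(P q.1) ≤ τ := by
    filter_upwards [l5.eventually (ge_mem_nhds hθ0),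
      l2.eventually (ge_mem_nhds (lt_add_one _)),
      l3.eventually (ge_mem_nhds (lt_add_of_pos_right _ hθ0)),
      l4.eventually (le_mem_nhds (sub_lt_self m hθ0)),
      l1.eventually (lt_mem_nhds hℓ0),
      eventually_prod_of_atTop (eventually_ge_atTop 1)] with q h5 h2 h3 h4 h1 hN
    obtain ⟨N, x⟩ := q
    simp only at h1 h2 h3 h4 h5 hN ⊢
    set σ := √(Real.log N)
    have hσ0 : 0 ≤ σ := Real.sqrt_nonneg _
    have hY0 : Measurable fun s => XN N s x - γ * Real.log N := (hX N x).sub_const _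
    have hY : Measurable fun s => (XN N s x - γ * Real.log N) - g x := hY0.sub_const _
    have hpm := hp.continuous_self.continuous.measurable
    have i0 : Integrable (fun s => wt (P N) (XN N) γ x s *
        (σ * expTail γ ((XN N s x - γ * Real.log N) - g x))) (P N) :=
      hm.integrable_wt_mul hN hγ x (((measurable_expTail γ).comp hY).const_mul _) (c := σ) fun s => by
        rw [abs_mul, abs_of_nonneg (Real.sqrt_nonneg _), abs_of_nonneg (expTail_nonneg _ _)]
        exact mul_le_of_le_one_right (Real.sqrt_nonneg _) (expTail_le_one hγ0.le _)
    have iQ : Integrable (fun s => wt (P N) (XN N) γ x s *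
        (σ * Q ((XN N s x - γ * Real.log N) - g x))) (P N) :=
      hm.integrable_wt_mul hN hγ x ((hQ.continuous_self.continuous.measurable.comp hY).const_mul _)
        (c := σ * ∫ t, ‖Φ t‖) fun s => by
          rw [abs_mul, abs_of_nonneg (Real.sqrt_nonneg _)]
          gcongr
          exact hQ.abs_le _
    have hFm : Measurable fejer := bandLimited_fejer.continuous_self.continuous.measurable
    have iF : Integrable (fun s => wt (P N) (XN N) γ x s *
        fejer (θ * (XN N s x - γ * Real.log N) / σ)) (P N) :=
      hm.integrable_wt_mul hN hγ x (hFm.comp ((hY0.const_mul θ).div_const σ)) (c := 1) fun s => by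
        rw [abs_of_nonneg (fejer_nonneg _)]
        exact fejer_le_one _
    have iW := hm.integrable_wt hN hγ x
    set t := tailMass (P N) (XN N) γ N x 0 with ht
    -- Obtained from the decomposition (1/t − 1/ℓ)σκ + σ(κ − p)/ℓ + (1/ℓ − c)σp − (1 − F), using |κ
    -- − p| ≤ Q and |p| ≤ κ + Q.
    let maj : S N → ℝ := fun s =>
      (|1 / t - 1 / ℓ| + |1 / ℓ - c|) * (wt (P N) (XN N) γ x s *
          (σ * expTail γ ((XN N s x - γ * Real.log N) - g x))) +
        (1 / ℓ + |1 / ℓ - c|) * (wt (P N) (XN N) γ x s *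
          (σ * Q ((XN N s x - γ * Real.log N) - g x))) +
        (wt (P N) (XN N) γ x s - wt (P N) (XN N) γ x s *
          fejer (θ * (XN N s x - γ * Real.log N) / σ))
    have imaj : Integrable maj (P N) :=
      ((i0.const_mul _).add (iQ.const_mul _)).add (iW.sub iF)
    have hle : ∀ s, wt (P N) (XN N) γ x s * |thickRatio (P N) (XN N) γ N x (g x) s - 1 -
        kernelD (fun y => c * p y) θ N (g x) (XN N s x - γ * Real.log N)| ≤ maj s := by
      intro s
      have hw := wt_nonneg (P N) (XN N) γ x s
      set y := XN N s x - γ * Real.log N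
      have hκ := expTail_nonneg γ (y - g x)
      have hpq := hpQ (y - g x)
      have hpq' : |p (y - g x)| ≤ expTail γ (y - g x) + Q (y - g x) := by
        have := abs_le.1 hpq
        rw [abs_le]; constructor <;> linarith [this.1, this.2]
      have hF := fejer_le_one (θ * y / σ)
      have e : thickRatio (P N) (XN N) γ N x (g x) s - 1 - kernelD (fun y => c * p y) θ N (g x) y =
          (1 / t - 1 / ℓ) * (σ * expTail γ (y - g x)) +
          1 / ℓ * (σ * (expTail γ (y - g x) - p (y - g x))) +
          (1 / ℓ - c) * (σ * p (y - g x)) - (1 - fejer (θ * y / σ)) := by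
        simp only [thickRatio, kernelD]
        ring
      have e2 : |thickRatio (P N) (XN N) γ N x (g x) s - 1 - kernelD (fun y => c * p y) θ N (g x) y| ≤
          |1 / t - 1 / ℓ| * (σ * expTail γ (y - g x)) + 1 / ℓ * (σ * Q (y - g x)) +
          |1 / ℓ - c| * (σ * (expTail γ (y - g x) + Q (y - g x))) + (1 - fejer (θ * y / σ)) := by
        rw [e]
        refine (abs_sub _ _).trans (add_le_add ((abs_add_le _ _).trans (add_le_add
          ((abs_add_le _ _).trans (add_le_add ?_ ?_)) ?_)) ?_)
        · rw [abs_mul, abs_of_nonneg (mul_nonneg hσ0 hκ)]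
        · rw [abs_mul, abs_mul, abs_of_pos (by positivity), abs_of_nonneg hσ0]
          gcongr
        · rw [abs_mul, abs_mul, abs_of_nonneg hσ0]
          gcongr
        · rw [abs_of_nonneg (by linarith)]
      calc _ ≤ wt (P N) (XN N) γ x s * _ := mul_le_mul_of_nonneg_left e2 hw
        _ = maj s := by simp only [maj]; ring
    have hint : Integrable (fun s => wt (P N) (XN N) γ x s * |thickRatio (P N) (XN N) γ N x (g x) s - 1 -
          kernelD (fun y => c * p y) θ N (g x) (XN N s x - γ * Real.log N)|) (P N) := by
      refine imaj.mono' (iW.aestronglyMeasurable.mul (Measurable.aestronglyMeasurable ?_))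
        (ae_of_all _ fun s => ?_)
      · unfold thickRatio kernelD
        have e1 := (measurable_expTail γ).comp hY
        have e2 := hpm.comp hY
        have e3 := hFm.comp ((hY0.const_mul θ).div_const σ)
        exact ((((e1.const_mul σ).div_const t).sub_const 1).sub
          (((e2.const_mul c).const_mul σ).sub e3)).norm
      · rw [Real.norm_of_nonneg (mul_nonneg (wt_nonneg _ _ _ _ _) (abs_nonneg _))]
        exact hle s
    refine ⟨hint, (integral_mono hint imaj hle).trans ?_⟩
    simp only [maj]
    have j1 := i0.const_mul (|1 / t - 1 / ℓ| + |1 / ℓ - c|)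
    have j2 := iQ.const_mul (1 / ℓ + |1 / ℓ - c|)
    have j3 : Integrable (fun s => wt (P N) (XN N) γ x s - wt (P N) (XN N) γ x s *
          fejer (θ * (XN N s x - γ * Real.log N) / σ)) (P N) := iW.sub iF
    rw [integral_add (j1.add j2 : Integrable (fun s => _ + _) (P N)) j3,
      integral_add j1 j2, integral_sub iW iF, integral_const_mul,
      integral_const_mul, hm.integral_wt hN hγ x]
    change (|1 / t - 1 / ℓ| + |1 / ℓ - c|) * tailMass (P N) (XN N) γ N x (g x) + _ + _ ≤ τ
    set I₁ := tailMass (P N) (XN N) γ N x (g x) with hI₁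
    set I₂ := ∫ s, wt (P N) (XN N) γ x s * (σ * Q ((XN N s x - γ * Real.log N) - g x)) ∂(P N)
    set I₃ := ∫ s, wt (P N) (XN N) γ x s * fejer (θ * (XN N s x - γ * Real.log N) / σ) ∂(P N)
    have e1 : a' / r ≤ θ := by
      rw [div_le_iff₀ (by linarith)]; nlinarith
    have hI₂ : I₂ ≤ 2 * θ := h3.trans (by change a' / r + θ ≤ _; linarith)
    have hI₂0 : 0 ≤ I₂ := integral_nonneg fun s => by
      have hw := wt_nonneg (P N) (XN N) γ x s
      have hq : 0 ≤ Q ((XN N s x - γ * Real.log N) - g x) := (abs_nonneg _).trans (hpQ _)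
      positivity
    have hI₁0 : 0 ≤ I₁ := integral_nonneg fun s => by
      have hw := wt_nonneg (P N) (XN N) γ x s
      have hq := expTail_nonneg γ ((XN N s x - γ * Real.log N) - g x)
      positivity
    have e2 : |1 / ℓ - c| * (I₁ + I₂) ≤ r * (2 * γ * (γ + 1)) * θ * (ℓ + 3) :=
      mul_le_mul hcℓ (by linarith) (by linarith) (by positivity)
    have e3 : 1 / ℓ * I₂ ≤ 1 / ℓ * (2 * θ) := by gcongr
    have e4 : 1 - I₃ ≤ 2 * θ := by nlinarith
    calc _ = |1 / t - 1 / ℓ| * I₁ + 1 / ℓ * I₂ + |1 / ℓ - c| * (I₁ + I₂) + (1 - I₃) := by ring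
      _ ≤ θ + 1 / ℓ * (2 * θ) + r * (2 * γ * (γ + 1)) * θ * (ℓ + 3) + 2 * θ := by gcongr
      _ = C₀ * θ := by rw [hC₀]; ring
      _ ≤ τ := hθτ
  rw [eventually_prod_principal_iff] at key
  exact key

end LocalLimit

/-! ### Smooth plateaus -/

/-- A smooth function equal to `1` on `[-r, r]` and vanishing outside `[-2 r, 2 r]`. -/
def plateau (r y : ℝ) : ℝ := Real.smoothTransition ((4 * r ^ 2 - y ^ 2) / (3 * r ^ 2))

lemma plateau_nonneg (r y : ℝ) : 0 ≤ plateau r y := Real.smoothTransition.nonneg _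

lemma plateau_le_one (r y : ℝ) : plateau r y ≤ 1 := Real.smoothTransition.le_one _

lemma contDiff_plateau (r : ℝ) : ContDiff ℝ ∞ (plateau r) :=
  Real.smoothTransition.contDiff.comp (by fun_prop)

lemma plateau_eq_one {r y : ℝ} (hr : 0 < r) (hy : |y| ≤ r) : plateau r y = 1 := by
  refine Real.smoothTransition.one_of_one_le ?_
  rw [one_le_div (by positivity)]
  have : y ^ 2 ≤ r ^ 2 := sq_le_sq' (by linarith [(abs_le.1 hy).1]) (abs_le.1 hy).2
  linarith

lemma plateau_eq_zero {r y : ℝ} (hr : 0 < r) (hy : 2 * r ≤ |y|) : plateau r y = 0 := by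
  refine Real.smoothTransition.zero_of_nonpos (div_nonpos_of_nonpos_of_nonneg ?_ (by positivity))
  have : (2 * r) ^ 2 ≤ |y| ^ 2 := by gcongr
  rw [sq_abs] at this
  linarith

lemma hasCompactSupport_plateau_sub {r : ℝ} (hr : 0 < r) (c : ℝ) :
    HasCompactSupport fun y => plateau r (y - c) := by
  refine HasCompactSupport.intro (isCompact_Icc (a := c - 2 * r) (b := c + 2 * r)) fun y hy => ?_
  refine plateau_eq_zero hr ?_
  by_contra! h
  rw [abs_lt] at h
  exact hy ⟨by linarith [h.1], by linarith [h.2]⟩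

/-- Exponential Markov inequality: where the plateau is not 1 one has |y| > βk, so e^{β|y|} exceeds
e^{β²k}. -/
lemma one_sub_plateau_le {β k y : ℝ} (hβ : 0 < β) (hk : 0 < k) :
    1 - plateau (β * k) y ≤ Real.exp (-β ^ 2 * k) * (Real.exp (β * y) + Real.exp (-β * y)) := by
  rcases le_or_gt |y| (β * k) with h | h
  · rw [plateau_eq_one (by positivity) h, sub_self]
    positivity
  · have h1 : Real.exp (-β ^ 2 * k) * Real.exp (β * |y|) ≤
        Real.exp (-β ^ 2 * k) * (Real.exp (β * y) + Real.exp (-β * y)) := by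
      gcongr
      rcases abs_cases y with ⟨h', _⟩ | ⟨h', _⟩ <;> rw [h']
      · linarith [Real.exp_pos (-β * y)]
      · rw [mul_neg, ← neg_mul]
        linarith [Real.exp_pos (β * y)]
    have h2 : 1 ≤ Real.exp (-β ^ 2 * k) * Real.exp (β * |y|) := by
      rw [← Real.exp_add, Real.one_le_exp_iff]
      nlinarith
    linarith [plateau_nonneg (β * k) y]

/-- On the support |y| < 2r the exponential is at least 1. A barrier factor can thus be traded for a
negative exponential weight in the smoothed field, which is available among the exponential moments.
-/
lemma plateau_le_exp {γ r y : ℝ} (hγ : 0 ≤ γ) (hr : 0 < r) :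
    plateau r y ≤ Real.exp (-γ * y + 2 * r * γ) := by
  rcases le_or_gt (2 * r) |y| with h | h
  · rw [plateau_eq_zero hr h]
    positivity
  · refine (plateau_le_one r y).trans (Real.one_le_exp ?_)
    nlinarith [(abs_lt.1 h).2]

lemma one_sub_prod_le {b : ℕ → ℝ} (hb : ∀ j, b j ∈ Icc 0 1) (n : ℕ) :
    1 - ∏ j ∈ Finset.range n, b j ≤ ∑ j ∈ Finset.range n, (1 - b j) := by
  induction n with
  | zero => simp
  | succ n ih =>
    rw [Finset.prod_range_succ, Finset.sum_range_succ]
    have h0 : 0 ≤ ∏ j ∈ Finset.range n, b j := Finset.prod_nonneg fun j _ => (hb j).1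
    have h1 : ∏ j ∈ Finset.range n, b j ≤ 1 :=
      Finset.prod_le_one (fun j _ => (hb j).1) fun j _ => (hb j).2
    nlinarith [(hb n).2]

/-! ### Kernels -/

lemma IsKernel.const_mul {σ : ℝ} {k : ℝ → ℂ} {V : ℝ → ℝ} {C R : ℝ} (hk : IsKernel σ k V C R)
    (c : ℝ) : IsKernel σ (fun u => c * k u) (fun y => c * V y) (|c| * C) R where
  measurable := hk.measurable.const_mul _
  bound u := by
    rw [norm_mul, Complex.norm_real, Real.norm_eq_abs]
    exact mul_le_mul_of_nonneg_left (hk.bound u) (abs_nonneg c)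
  support u hu := by rw [hk.support u hu, mul_zero]
  eq y := by
    simp only [mul_assoc (c : ℂ)]
    rw [integral_const_mul, ← hk.eq y, Complex.ofReal_mul]

/-- C and R do not depend on b, because a shift only multiplies the transform by a phase. -/
lemma kernelD_isKernel {p : ℝ → ℝ} {φ : ℝ → ℂ} (hp : BandLimited p φ) {ε : ℝ} (hε : 0 < ε) :
    ∃ C > 0, ∃ R > 0, ∀ᶠ N : ℕ in atTop, ∀ b : ℝ, IsKernel √(Real.log N)
      (fun u => φ (u / √(Real.log N)) *
        Complex.exp ((u / √(Real.log N) : ℝ) * (-b : ℝ) * Complex.I) +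
        ((-1 : ℝ) : ℂ) * ((tri (u / ε) / ε : ℝ) : ℂ)) (kernelD p ε N b) C R := by
  obtain ⟨C, R, hC, hR, hφC, hφR⟩ := hp.bounded
  refine ⟨C + |(-1 : ℝ)| * (1 / ε), by positivity, max R ε, by positivity, ?_⟩
  filter_upwards [tendsto_sqrt_log.eventually_ge_atTop 1] with N hN b
  have h1 := hp.isKernel_local hφC hφR (by linarith : 0 < √(Real.log N)) b
  have h2 := h1.add (by linarith) ((isKernel_global hε hN).const_mul (-1))
  convert h2 using 1
  ext y
  simp only [kernelD]
  ring

/-- A nonnegative kernel dominating `kernelD`. -/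
def kernelMaj (C ε : ℝ) (N : ℕ) (b y : ℝ) : ℝ :=
  √(Real.log N) * (C * wgt (y - b)) + fejer (ε * y / √(Real.log N))

lemma kernelMaj_nonneg {C : ℝ} (hC : 0 ≤ C) (ε : ℝ) (N : ℕ) (b y : ℝ) : 0 ≤ kernelMaj C ε N b y :=
  add_nonneg (mul_nonneg (Real.sqrt_nonneg _) (mul_nonneg hC (wgt_nonneg _))) (fejer_nonneg _)

lemma abs_kernelD_le {p : ℝ → ℝ} {C : ℝ} (hp : ∀ y, |p y| ≤ C * wgt y) (ε : ℝ) (N : ℕ) (b y : ℝ) :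
    |kernelD p ε N b y| ≤ kernelMaj C ε N b y := by
  refine (abs_sub _ _).trans (add_le_add ?_ (le_of_eq (abs_of_nonneg (fejer_nonneg _))))
  rw [abs_mul, abs_of_nonneg (Real.sqrt_nonneg _)]
  exact mul_le_mul_of_nonneg_left (hp _) (Real.sqrt_nonneg _)

lemma kernelMaj_le {C : ℝ} (hC : 0 ≤ C) (ε : ℝ) (N : ℕ) (b y : ℝ) :
    kernelMaj C ε N b y ≤ 2 * C * √(Real.log N) + 1 := by
  have h1 := wgt_le_two (y - b)
  have h2 := fejer_le_one (ε * y / √(Real.log N))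
  have h3 : √(Real.log N) * (C * wgt (y - b)) ≤ √(Real.log N) * (C * 2) := by gcongr
  rw [kernelMaj]
  linarith

lemma kernelMaj_isKernel (C₀ : ℝ) {ε : ℝ} (hε : 0 < ε) :
    ∃ C > 0, ∃ R > 0, ∀ᶠ N : ℕ in atTop, ∀ b : ℝ, ∃ k : ℝ → ℂ,
      IsKernel √(Real.log N) k (kernelMaj C₀ ε N b) C R := by
  have hp := bandLimited_wgt.const_mul C₀
  obtain ⟨C, R, hC, hR, hφC, hφR⟩ := hp.bounded
  refine ⟨C + 1 / ε, by positivity, max R ε, by positivity, ?_⟩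
  filter_upwards [tendsto_sqrt_log.eventually_ge_atTop 1] with N hN b
  have h1 := hp.isKernel_local hφC hφR (by linarith : 0 < √(Real.log N)) b
  exact ⟨_, h1.add (by linarith) (isKernel_global hε hN)⟩

lemma measurable_kernelMaj (C ε : ℝ) (N : ℕ) :
    Measurable fun q : ℝ × ℝ => kernelMaj C ε N q.1 q.2 := by
  have h1 : Measurable wgt := bandLimited_wgt.continuous_self.continuous.measurable
  have h2 : Measurable fejer := bandLimited_fejer.continuous_self.continuous.measurable
  unfold kernelMaj
  fun_prop

lemma measurable_kernelD {p : ℝ → ℝ} {φ : ℝ → ℂ} (hp : BandLimited p φ) (ε : ℝ) (N : ℕ) :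
    Measurable fun q : ℝ × ℝ => kernelD p ε N q.1 q.2 := by
  have h1 : Measurable p := hp.continuous_self.continuous.measurable
  have h2 : Measurable fejer := bandLimited_fejer.continuous_self.continuous.measurable
  unfold kernelD
  fun_prop

/-! ### Covariances of the smoothed fields -/

section Covariance

variable {Ω : Type*} [MetricSpace Ω] [MeasurableSpace Ω] {vol : Measure Ω} {h : Ω → Ω → ℝ}
  {ρ : ℝ → Ω → Ω → ℝ}

lemma covLin_one (h_symm : ∀ x y, h x y = h y x) (ξ δ : ℝ) (z x : Ω) :
    covLin vol h ρ (fun _ : Fin 1 => ξ) (fun _ => δ) (fun _ => z) x = ξ * cov₁ vol h ρ δ z x := by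
  rw [covLin, cov₁, ← integral_const_mul]
  congr 1
  ext u
  simp only [mollifierSum, Finset.univ_unique, Finset.sum_const, Finset.card_singleton, one_smul]
  rw [cov, cov, dist_comm, h_symm]
  ring

lemma covForm_one (ξ δ : ℝ) (z : Ω) :
    covForm vol h (mollifierSum ρ (fun _ : Fin 1 => ξ) (fun _ => δ) (fun _ => z)) =
      ξ ^ 2 * cov₂ vol h ρ δ δ z z := by
  rw [covForm, cov₂, ← integral_const_mul]
  congr 1
  ext u
  simp only [mollifierSum, Finset.univ_unique, Finset.sum_const, Finset.card_singleton, one_smul]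
  ring

lemma CovarianceAssumption.exists_bound (hc : CovarianceAssumption vol h ρ) {K : Set Ω}
    (hK : IsCompact K) : ∃ k₀ : ℕ, 0 < k₀ ∧ ∃ B > 0, ∀ k : ℕ, k₀ ≤ k → ∀ x ∈ K, ∀ z ∈ K,
      |cov₁ vol h ρ (Real.exp (-k)) x z + Real.log (max (dist x z) (Real.exp (-k)))| ≤ B ∧
      |cov₁ vol h ρ (Real.exp (-k)) x x - k| ≤ B ∧
      |cov₂ vol h ρ (Real.exp (-k)) (Real.exp (-k)) x x - k| ≤ B := by
  obtain ⟨c, hc0, B, hB⟩ := hc.bound K hK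
  obtain ⟨k₀, hk₀⟩ := exists_nat_ge (-Real.log c)
  refine ⟨k₀ + 1, by omega, |B| + 1, by positivity, fun k hk x hx z hz => ?_⟩
  have hkc : Real.exp (-k) ≤ c := by
    rw [← Real.le_log_iff_exp_le hc0.1]
    have : (k₀ : ℝ) + 1 ≤ k := by exact_mod_cast hk
    linarith
  have hBB : B ≤ |B| + 1 := by linarith [le_abs_self B]
  have h1 := hB x hx z hz _ _ (Real.exp_pos _) le_rfl hkc
  have h2 := hB x hx x hx _ _ (Real.exp_pos _) le_rfl hkc
  rw [dist_self, max_eq_right (Real.exp_pos _).le, Real.log_exp, ← sub_eq_add_neg,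
    ← sub_eq_add_neg] at h2
  exact ⟨h1.1.trans hBB, h2.1.trans hBB, h2.2.trans hBB⟩

/-- The deviation of the field at scale `e^{-k}` from its typical value under the tilted law. -/
def deviation {S : Type*} (vol : Measure Ω) (ρ : ℝ → Ω → Ω → ℝ) (X : S → Ω → ℝ) (γ : ℝ) (k : ℕ)
    (x : Ω) (s : S) : ℝ :=
  smoothed vol ρ X (Real.exp (-k)) x s - γ * k

lemma exp_mul_deviation {S : Type*} (X : S → Ω → ℝ) (γ ξ : ℝ) (k : ℕ) (x : Ω) (s : S) :
    Real.exp (ξ * deviation vol ρ X γ k x s) = Real.exp (-ξ * γ * k) *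
      smoothWeight vol ρ X (fun _ : Fin 1 => ξ) (fun _ => Real.exp (-k)) (fun _ => x) s := by
  rw [smoothWeight, deviation, ← Real.exp_add]
  congr 1
  simp only [Finset.univ_unique, Finset.sum_const, Finset.card_singleton, one_smul]
  ring

end Covariance

/-! ### Exponential moments of the smoothed fields under the tilt, and the barrier. -/

section ScaleEstimates

variable {d : ℕ} {Ω : Type*} [MetricSpace Ω] [MeasurableSpace Ω] {vol : Measure Ω}
  {h : Ω → Ω → ℝ} {ρ : ℝ → Ω → Ω → ℝ} {S : ℕ → Type*} [∀ N, MeasurableSpace (S N)]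
  {P : ∀ N, Measure (S N)} [∀ N, IsProbabilityMeasure (P N)] {XN : ∀ N, S N → Ω → ℝ}
  {Ψ : ℂ → Ω → ℂ} {γ : ℝ}

/-- The covariances of the smoothed fields at the scales `e^{-k}`, `k ≥ k₀`, are logarithmic on `K`
up to an error `B`. -/
def IsScaleBound (vol : Measure Ω) (h : Ω → Ω → ℝ) (ρ : ℝ → Ω → Ω → ℝ) (K : Set Ω) (k₀ : ℕ)
    (B : ℝ) : Prop :=
  ∀ k : ℕ, k₀ ≤ k → ∀ x ∈ K, ∀ z ∈ K,
    |cov₁ vol h ρ (Real.exp (-k)) x z + Real.log (max (dist x z) (Real.exp (-k)))| ≤ B ∧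
    |cov₁ vol h ρ (Real.exp (-k)) x x - k| ≤ B ∧
    |cov₂ vol h ρ (Real.exp (-k)) (Real.exp (-k)) x x - k| ≤ B

lemma exp_neg_mem_Ioc (k : ℕ) : Real.exp (-k) ∈ Ioc (0 : ℝ) 1 :=
  ⟨Real.exp_pos _, Real.exp_le_one_iff.2 (by simp)⟩

lemma rpow_le_exp_neg {N : ℕ} (hN : 1 ≤ N) {η : ℝ} {k : ℕ} (hk : (k : ℝ) ≤ (1 - η) * Real.log N) :
    (N : ℝ) ^ (-1 + η) ≤ Real.exp (-k) := by
  rw [Real.rpow_def_of_pos (by exact_mod_cast hN)]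
  exact Real.exp_le_exp.2 (by linarith)

lemma le_add_of_abs_sub_le {a b c t B : ℝ} (hc : 0 ≤ c) (h : |a - b| ≤ B) (ht : |t| ≤ c) :
    t * a ≤ t * b + c * B := by
  have h1 : |t * (a - b)| ≤ c * B := by
    rw [abs_mul]; exact mul_le_mul ht h (abs_nonneg _) hc
  linarith [(abs_le.1 h1).2]

/-- Girsanov: under the tilt at x the field smoothed at scale e^{-k} has mean γk + O(1) and variance
k + O(1), hence the factor e^{ξ²k/2}. The restriction k ≤ (1 − η) log N keeps the scale above
N^{-1+η}. -/
lemma MesoscopicAssumption.one_point_scale [Nontrivial Ω]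
    (hm : MesoscopicAssumption d P vol h ρ XN Ψ)
    (hX : ∀ N x, Measurable fun s => XN N s x)
    (h_cont : Continuous (fun p : Ω × Ω => h p.1 p.2)) (h_symm : ∀ x y, h x y = h y x)
    {K : Set Ω} (hK : IsCompact K) {k₀ : ℕ} {B : ℝ} (hB : IsScaleBound vol h ρ K k₀ B)
    {η R : ℝ} (hη : 0 < η) (hη1 : η < 1) (hR : 0 < R) (ξ : ℝ) (hγ : γ ∈ Icc 0 √(2 * d)) :
    ∃ A > 0, ∀ᶠ N : ℕ in atTop, ∀ x ∈ K, ∀ k : ℕ, k₀ ≤ k → (k : ℝ) ≤ (1 - η) * Real.log N →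
      ∀ (k' : ℝ → ℂ) (V : ℝ → ℝ) (C c : ℝ), 0 ≤ C → IsKernel √(Real.log N) k' V C R →
      |∫ s, wt (P N) (XN N) γ x s * Real.exp (ξ * deviation vol ρ (XN N) γ k x s) *
        V (XN N s x - c) ∂(P N)| ≤ A * C * Real.exp (ξ ^ 2 / 2 * k) := by
  obtain ⟨A, hA, hev⟩ := hm.one_point_bound hX h_cont hK hη hη1 hR (fun _ : Fin 1 => ξ) hγ
  refine ⟨A * Real.exp (|γ * ξ| * B + ξ ^ 2 / 2 * B), by positivity, ?_⟩
  filter_upwards [hev, eventually_ge_atTop 1] with N hN hN1 x hx k hk hkN k' V C c hC hV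
  have h1 := hN x hx (fun _ => x) (fun _ => hx) (fun _ => Real.exp (-k))
    (fun _ => ⟨exp_neg_mem_Ioc k, rpow_le_exp_neg hN1 hkN⟩) k' V C c hC hV
  rw [covLin_one h_symm, covForm_one] at h1
  obtain ⟨-, h2, h3⟩ := hB k hk x hx x hx
  have h4 := le_add_of_abs_sub_le (abs_nonneg _) h2 (le_refl |γ * ξ|)
  have h5 := le_add_of_abs_sub_le (by positivity) h3 (le_of_eq (abs_of_nonneg
    (by positivity : 0 ≤ ξ ^ 2 / 2)))
  have e1 : ∀ s, wt (P N) (XN N) γ x s * Real.exp (ξ * deviation vol ρ (XN N) γ k x s) *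
      V (XN N s x - c) = Real.exp (-ξ * γ * k) * (wt (P N) (XN N) γ x s *
      smoothWeight vol ρ (XN N) (fun _ : Fin 1 => ξ) (fun _ => Real.exp (-k)) (fun _ => x) s *
      V (XN N s x - c)) := fun s => by rw [exp_mul_deviation]; ring
  simp_rw [e1]
  rw [integral_const_mul, abs_mul, abs_of_pos (Real.exp_pos _)]
  calc _ ≤ Real.exp (-ξ * γ * k) * (A * C * Real.exp (γ * ξ * k + |γ * ξ| * B +
        (ξ ^ 2 / 2 * k + ξ ^ 2 / 2 * B))) := by
        refine mul_le_mul_of_nonneg_left (h1.trans (mul_le_mul_of_nonneg_left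
          (Real.exp_le_exp.2 ?_) (by positivity))) (Real.exp_pos _).le
        linarith
    _ = A * C * Real.exp (-ξ * γ * k + (γ * ξ * k + |γ * ξ| * B +
        (ξ ^ 2 / 2 * k + ξ ^ 2 / 2 * B))) := by rw [Real.exp_add (-ξ * γ * k)]; ring
    _ = A * C * Real.exp ((|γ * ξ| * B + ξ ^ 2 / 2 * B) + ξ ^ 2 / 2 * k) := by
        congr 1; congr 1; ring
    _ = _ := by rw [Real.exp_add]; ring

/-- Tilting at x₁ and x₂ costs |x₁ − x₂|^{-γ²}. The tilt at x₂ moves the mean at x₁ by a further −γ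
log(|x₁ − x₂| ∨ e^{-k}), so a negative ξ gains when the scale is comparable with the distance. -/
lemma MesoscopicAssumption.two_point_scale [Nontrivial Ω]
    (hm : MesoscopicAssumption d P vol h ρ XN Ψ)
    (hX : ∀ N x, Measurable fun s => XN N s x)
    (h_cont : Continuous (fun p : Ω × Ω => h p.1 p.2)) (h_symm : ∀ x y, h x y = h y x)
    {K : Set Ω} (hK : IsCompact K) {k₀ : ℕ} {B : ℝ} (hB : IsScaleBound vol h ρ K k₀ B)
    {η R : ℝ} (hη : 0 < η) (hη1 : η < 1) (hR : 0 < R) (ξ : ℝ) (hγ : γ ∈ Icc 0 √(2 * d)) :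
    ∃ A > 0, ∀ᶠ N : ℕ in atTop, ∀ x₁ ∈ K, ∀ x₂ ∈ K, (N : ℝ) ^ (η - 1) ≤ dist x₁ x₂ →
      ∀ k : ℕ, k₀ ≤ k → (k : ℝ) ≤ (1 - η) * Real.log N →
      ∀ (k₁ k₂ : ℝ → ℂ) (V₁ V₂ : ℝ → ℝ) (C₁ C₂ c₁ c₂ : ℝ), 0 ≤ C₁ → 0 ≤ C₂ →
      IsKernel √(Real.log N) k₁ V₁ C₁ R → IsKernel √(Real.log N) k₂ V₂ C₂ R →
      |∫ s, wt (P N) (XN N) γ x₁ s * wt (P N) (XN N) γ x₂ s *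
        Real.exp (ξ * deviation vol ρ (XN N) γ k x₁ s) *
        V₁ (XN N s x₁ - c₁) * V₂ (XN N s x₂ - c₂) ∂(P N)| ≤
      A * (C₁ * C₂) * Real.exp (-γ ^ 2 * Real.log (dist x₁ x₂) -
        γ * ξ * Real.log (max (dist x₁ x₂) (Real.exp (-k))) + ξ ^ 2 / 2 * k) := by
  obtain ⟨A, hA, hev⟩ := hm.two_point_bound hX h_cont hK hη hη1 hR (fun _ : Fin 1 => ξ) hγ
  obtain ⟨Bh, hBh⟩ := (hK.prod hK).exists_bound_of_continuousOn h_cont.continuousOn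
  refine ⟨A * Real.exp (γ ^ 2 * Bh + 2 * (|γ * ξ| * B) + ξ ^ 2 / 2 * B), by positivity, ?_⟩
  filter_upwards [hev, eventually_ge_atTop 1] with N hN hN1 x₁ hx₁ x₂ hx₂ hd k hk hkN k₁ k₂ V₁ V₂
    C₁ C₂ c₁ c₂ hC₁ hC₂ hV₁ hV₂
  have h1 := hN x₁ hx₁ x₂ hx₂ hd (fun _ => x₁) (fun _ => hx₁) (fun _ => Real.exp (-k))
    (fun _ => ⟨exp_neg_mem_Ioc k, rpow_le_exp_neg hN1 hkN⟩) k₁ k₂ V₁ V₂ C₁ C₂ c₁ c₂ hC₁ hC₂ hV₁ hV₂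
  rw [covLin_one h_symm, covLin_one h_symm, covForm_one] at h1
  obtain ⟨h6, h2, h3⟩ := hB k hk x₁ hx₁ x₂ hx₂
  have h4 := le_add_of_abs_sub_le (abs_nonneg _) h2 (le_refl |γ * ξ|)
  have h5 := le_add_of_abs_sub_le (by positivity) h3 (le_of_eq (abs_of_nonneg
    (by positivity : 0 ≤ ξ ^ 2 / 2)))
  rw [← sub_neg_eq_add] at h6
  have h7 := le_add_of_abs_sub_le (abs_nonneg _) h6 (le_refl |γ * ξ|)
  have h8 : γ ^ 2 * cov h x₁ x₂ ≤ γ ^ 2 * (-Real.log (dist x₁ x₂)) + γ ^ 2 * Bh := by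
    rw [cov, mul_add]
    gcongr
    exact (le_abs_self _).trans (hBh (x₁, x₂) ⟨hx₁, hx₂⟩)
  have e1 : ∀ s, wt (P N) (XN N) γ x₁ s * wt (P N) (XN N) γ x₂ s *
      Real.exp (ξ * deviation vol ρ (XN N) γ k x₁ s) * V₁ (XN N s x₁ - c₁) * V₂ (XN N s x₂ - c₂) =
      Real.exp (-ξ * γ * k) * (wt (P N) (XN N) γ x₁ s * wt (P N) (XN N) γ x₂ s *
      smoothWeight vol ρ (XN N) (fun _ : Fin 1 => ξ) (fun _ => Real.exp (-k)) (fun _ => x₁) s *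
      V₁ (XN N s x₁ - c₁) * V₂ (XN N s x₂ - c₂)) := fun s => by rw [exp_mul_deviation]; ring
  simp_rw [e1]
  rw [integral_const_mul, abs_mul, abs_of_pos (Real.exp_pos _)]
  set m := Real.log (max (dist x₁ x₂) (Real.exp (-k)))
  set E₀ := γ ^ 2 * Bh + 2 * (|γ * ξ| * B) + ξ ^ 2 / 2 * B with hE₀
  set E₁ := -γ ^ 2 * Real.log (dist x₁ x₂) - γ * ξ * m + ξ ^ 2 / 2 * k with hE₁
  calc _ ≤ Real.exp (-ξ * γ * k) * (A * (C₁ * C₂) * Real.exp (ξ * γ * k + (E₀ + E₁))) := by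
        refine mul_le_mul_of_nonneg_left (h1.trans (mul_le_mul_of_nonneg_left
          (Real.exp_le_exp.2 ?_) (by positivity))) (Real.exp_pos _).le
        rw [hE₀, hE₁]
        linarith
    _ = A * (C₁ * C₂) * Real.exp (-ξ * γ * k + (ξ * γ * k + (E₀ + E₁))) := by
        rw [Real.exp_add (-ξ * γ * k)]; ring
    _ = A * (C₁ * C₂) * Real.exp (E₀ + E₁) := by congr 1; congr 1; ring
    _ = _ := by rw [Real.exp_add]; ring

/-! ### The barrier -/

/-- The barrier at the scales `e^{-k}`, `k₀ ≤ k < k₀ + m`. -/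
def barrier {S : Type*} (vol : Measure Ω) (ρ : ℝ → Ω → Ω → ℝ) (X : S → Ω → ℝ) (γ β : ℝ) (k₀ m : ℕ)
    (x : Ω) (s : S) : ℝ :=
  ∏ j ∈ Finset.range m, plateau (β * ((k₀ + j : ℕ) : ℝ)) (deviation vol ρ X γ (k₀ + j) x s)

lemma barrier_mem {S : Type*} (X : S → Ω → ℝ) (γ β : ℝ) (k₀ m : ℕ) (x : Ω) (s : S) :
    barrier vol ρ X γ β k₀ m x s ∈ Icc 0 1 :=
  ⟨Finset.prod_nonneg fun _ _ => plateau_nonneg _ _,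
    Finset.prod_le_one (fun _ _ => plateau_nonneg _ _) fun _ _ => plateau_le_one _ _⟩

lemma barrier_le {S : Type*} (X : S → Ω → ℝ) (γ β : ℝ) {k₀ m k : ℕ} (hk : k₀ ≤ k)
    (hkm : k < k₀ + m) (x : Ω) (s : S) :
    barrier vol ρ X γ β k₀ m x s ≤ plateau (β * k) (deviation vol ρ X γ k x s) := by
  have hmem : k - k₀ ∈ Finset.range m := Finset.mem_range.2 (by omega)
  rw [barrier, ← Finset.mul_prod_erase _ _ hmem, Nat.add_sub_cancel' hk]
  exact mul_le_of_le_one_right (plateau_nonneg _ _)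
    (Finset.prod_le_one (fun _ _ => plateau_nonneg _ _) fun _ _ => plateau_le_one _ _)

lemma one_sub_barrier_le {S : Type*} (X : S → Ω → ℝ) (γ β : ℝ) (k₀ m : ℕ) (x : Ω) (s : S) :
    1 - barrier vol ρ X γ β k₀ m x s ≤ ∑ j ∈ Finset.range m,
      (1 - plateau (β * ((k₀ + j : ℕ) : ℝ)) (deviation vol ρ X γ (k₀ + j) x s)) :=
  one_sub_prod_le (fun _ => ⟨plateau_nonneg _ _, plateau_le_one _ _⟩) _

/-- The number of scales between `k₀` and `(1 - η) log N`. -/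
def scaleCount (η : ℝ) (k₀ N : ℕ) : ℕ := ⌊(1 - η) * Real.log N⌋₊ + 1 - k₀

lemma le_of_lt_scaleCount {η : ℝ} (hη : η < 1) {k₀ N j : ℕ} (hj : j < scaleCount η k₀ N) :
    ((k₀ + j : ℕ) : ℝ) ≤ (1 - η) * Real.log N := by
  have h0 : 0 ≤ (1 - η) * Real.log N :=
    mul_nonneg (by linarith) (Real.log_natCast_nonneg N)
  refine le_trans ?_ (Nat.floor_le h0)
  unfold scaleCount at hj
  exact_mod_cast (by omega : k₀ + j ≤ ⌊(1 - η) * Real.log N⌋₊)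

lemma lt_add_scaleCount {η : ℝ} {k₀ N k : ℕ} (hkN : (k : ℝ) ≤ (1 - η) * Real.log N) :
    k < k₀ + scaleCount η k₀ N := by
  have := Nat.le_floor hkN
  unfold scaleCount
  omega

lemma measurable_deviation (hXs : ∀ N (k : ℕ) x, Measurable fun s => smoothed vol ρ (XN N) (Real.exp (-k)) x s)
    (N k : ℕ) (x : Ω) : Measurable fun s => deviation vol ρ (XN N) γ k x s :=
  (hXs N _ x).sub_const _

lemma measurable_barrier (hXs : ∀ N (k : ℕ) x, Measurable fun s => smoothed vol ρ (XN N) (Real.exp (-k)) x s)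
    (β : ℝ) (N k₀ m : ℕ) (x : Ω) : Measurable fun s => barrier vol ρ (XN N) γ β k₀ m x s :=
  Finset.measurable_prod _ fun _ _ =>
    (contDiff_plateau _).continuous.measurable.comp (measurable_deviation hXs N _ x)

lemma MesoscopicAssumption.integrable_wt_deviation [Nontrivial Ω]
    (hm : MesoscopicAssumption d P vol h ρ XN Ψ) {N : ℕ} (hN : 1 ≤ N)
    (hγ : γ ∈ Icc 0 √(2 * d)) (ξ : ℝ) (k : ℕ) (x : Ω) :
    Integrable (fun s => wt (P N) (XN N) γ x s *
      Real.exp (ξ * deviation vol ρ (XN N) γ k x s)) (P N) := by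
  have := (hm.integrable_expWeight_one hN hγ x (fun _ : Fin 1 => ξ) (fun _ => Real.exp (-k))
    (fun _ => x) (fun _ => exp_neg_mem_Ioc k)).const_mul
    (Real.exp (-ξ * γ * k) * (expMean (P N) (XN N) γ x)⁻¹)
  refine this.congr (ae_of_all _ fun s => ?_)
  simp only
  rw [exp_mul_deviation, mul_assoc, ← wt_mul_smoothWeight]
  ring

lemma MesoscopicAssumption.integrable_wt_wt_deviation
    (hm : MesoscopicAssumption d P vol h ρ XN Ψ) {N : ℕ} (hN : 1 ≤ N)
    (hγ : γ ∈ Icc 0 √(2 * d)) (ξ : ℝ) (k : ℕ) {x₁ x₂ : Ω} (hne : x₁ ≠ x₂) :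
    Integrable (fun s => wt (P N) (XN N) γ x₁ s * wt (P N) (XN N) γ x₂ s *
      Real.exp (ξ * deviation vol ρ (XN N) γ k x₁ s)) (P N) := by
  have := (hm.integrable_pairWeight hN hγ hne (fun _ : Fin 1 => ξ) (fun _ => Real.exp (-k))
    (fun _ => x₁) (fun _ => exp_neg_mem_Ioc k)).const_mul (Real.exp (-ξ * γ * k))
  refine this.congr (ae_of_all _ fun s => ?_)
  simp only [pairWeight]
  rw [exp_mul_deviation]
  ring

lemma MesoscopicAssumption.integrable_wt_wt
    (hm : MesoscopicAssumption d P vol h ρ XN Ψ) {N : ℕ} (hN : 1 ≤ N)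
    (hγ : γ ∈ Icc 0 √(2 * d)) {x₁ x₂ : Ω} (hne : x₁ ≠ x₂) :
    Integrable (fun s => wt (P N) (XN N) γ x₁ s * wt (P N) (XN N) γ x₂ s) (P N) := by
  simpa using hm.integrable_wt_wt_deviation hN hγ 0 0 hne

end ScaleEstimates

/-- The cap `1{y ≤ β log N}`. -/
def cap (β : ℝ) (N : ℕ) (y : ℝ) : ℝ := if y ≤ β * Real.log N then 1 else 0

lemma cap_mem (β : ℝ) (N : ℕ) (y : ℝ) : cap β N y ∈ Icc 0 1 := by
  unfold cap; split_ifs <;> simp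

lemma measurable_cap (β : ℝ) (N : ℕ) : Measurable (cap β N) :=
  Measurable.ite measurableSet_Iic measurable_const measurable_const

lemma one_sub_cap_le {β : ℝ} (hβ : 0 < β) (N : ℕ) (y : ℝ) :
    1 - cap β N y ≤ Real.exp (-β ^ 2 * Real.log N) * Real.exp (β * y) := by
  unfold cap
  split_ifs with hy
  · rw [sub_self]; positivity
  · rw [sub_zero, ← Real.exp_add, Real.one_le_exp_iff]
    nlinarith

lemma eventually_sq_mul_exp_le (C : ℝ) {a τ : ℝ} (ha : 0 < a) (hτ : 0 < τ) :
    ∀ᶠ N : ℕ in atTop, (C * √(Real.log N) + 1) ^ 2 * Real.exp (-a * Real.log N) ≤ τ := by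
  have hL : Tendsto (fun N : ℕ => a * Real.log N) atTop atTop :=
    (Real.tendsto_log_atTop.comp tendsto_natCast_atTop_atTop).const_mul_atTop ha
  have h1 := ((Real.tendsto_pow_mul_exp_neg_atTop_nhds_zero 1).comp hL).const_mul
    ((|C| + 1) ^ 2 / a)
  rw [mul_zero] at h1
  filter_upwards [h1.eventually (ge_mem_nhds hτ), tendsto_sqrt_log.eventually_ge_atTop 1] with N hN h2
  refine le_trans ?_ hN
  simp only [Function.comp_apply, pow_one]
  have hs : √(Real.log N) ^ 2 = Real.log N := Real.sq_sqrt (Real.log_natCast_nonneg N)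
  have h3 : (C * √(Real.log N) + 1) ^ 2 ≤ ((|C| + 1) * √(Real.log N)) ^ 2 := by
    refine sq_le_sq' ?_ ?_
    · nlinarith [neg_abs_le C]
    · nlinarith [le_abs_self C]
  rw [mul_pow, hs] at h3
  calc _ ≤ (|C| + 1) ^ 2 * Real.log N * Real.exp (-a * Real.log N) := by gcongr
    _ = _ := by rw [neg_mul]; field_simp

lemma sum_exp_neg_le {a : ℝ} (ha : 0 < a) (k m : ℕ) :
    ∑ j ∈ Finset.range m, Real.exp (-a * ((k + j : ℕ) : ℝ)) ≤
      Real.exp (-a * k) * (1 - Real.exp (-a))⁻¹ := by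
  have hr : Real.exp (-a) < 1 := Real.exp_lt_one_iff.2 (by linarith)
  have e : ∀ j : ℕ, Real.exp (-a * ((k + j : ℕ) : ℝ)) = Real.exp (-a * k) * Real.exp (-a) ^ j := by
    intro j
    rw [← Real.exp_nat_mul, ← Real.exp_add]
    push_cast
    congr 1; ring
  simp_rw [e]
  rw [← Finset.mul_sum]
  refine mul_le_mul_of_nonneg_left ?_ (Real.exp_pos _).le
  rw [← tsum_geometric_of_lt_one (Real.exp_pos _).le hr]
  exact (summable_geometric_of_lt_one (Real.exp_pos _).le hr).sum_le_tsum _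
    fun _ _ => pow_nonneg (Real.exp_pos _).le _

/-! ### Removing barrier and cap: union bound over the scales. -/

section Removal

variable {Ω : Type*} [MetricSpace Ω] [MeasurableSpace Ω] {vol : Measure Ω} {ρ : ℝ → Ω → Ω → ℝ}

/-- Union bound over the scales. At scale k Markov's inequality gains e^{-β²k} and the moment costs
e^{β²k/2}, so the failure probabilities form a geometric series that is small when the first scale
k₁ is large, regardless of the number m of scales. G is kept general so as to carry one or two tilts
together with kernels. -/
lemma integral_mul_one_sub_barrier_le {S : Type*} [MeasurableSpace S] {P : Measure S}
    {X : S → Ω → ℝ} {γ β A τ : ℝ} (hβ : 0 < β) (hA : 0 ≤ A) {k₁ m : ℕ} (hk₁ : 0 < k₁) {x : Ω}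
    {G c : S → ℝ} (hG : ∀ s, 0 ≤ G s) (hGi : Integrable G P)
    (hdev : ∀ k, Measurable fun s => deviation vol ρ X γ k x s)
    (hc : ∀ s, c s ∈ Icc 0 1) (hcm : Measurable c)
    (hexp : ∀ ξ ∈ ({β, -β} : Set ℝ), ∀ k, k₁ ≤ k → k < k₁ + m →
      Integrable (fun s => G s * Real.exp (ξ * deviation vol ρ X γ k x s)) P ∧
      ∫ s, G s * Real.exp (ξ * deviation vol ρ X γ k x s) ∂P ≤ A * Real.exp (ξ ^ 2 / 2 * k))
    (hcap : ∫ s, G s * (1 - c s) ∂P ≤ τ) :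
    ∫ s, G s * (1 - barrier vol ρ X γ β k₁ m x s * c s) ∂P ≤
      2 * A * (Real.exp (-(β ^ 2 / 2) * k₁) * (1 - Real.exp (-(β ^ 2 / 2)))⁻¹) + τ := by
  have hci : Integrable (fun s => G s * (1 - c s)) P :=
    hGi.mul_bdd (c := 1) (hcm.const_sub 1).aestronglyMeasurable (ae_of_all _ fun s => by
      rw [Real.norm_of_nonneg (by linarith [(hc s).2])]; linarith [(hc s).1])
  have hbm : Measurable fun s => barrier vol ρ X γ β k₁ m x s :=
    Finset.measurable_prod _ fun _ _ => (contDiff_plateau _).continuous.measurable.comp (hdev _)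
  let T : ℕ → S → ℝ := fun k s => Real.exp (-β ^ 2 * k) *
    (G s * Real.exp (β * deviation vol ρ X γ k x s) +
      G s * Real.exp (-β * deviation vol ρ X γ k x s))
  have hTi : ∀ k, k₁ ≤ k → k < k₁ + m → Integrable (T k) P := fun k hk hkm =>
    (((hexp β (by simp) k hk hkm).1).add ((hexp (-β) (by simp) k hk hkm).1)).const_mul _
  have hT : ∀ k, k₁ ≤ k → k < k₁ + m → ∫ s, T k s ∂P ≤ 2 * A * Real.exp (-(β ^ 2 / 2) * k) := by
    intro k hk hkm
    have h1 := hexp β (by simp) k hk hkm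
    have h2 := hexp (-β) (by simp) k hk hkm
    simp only [T]
    rw [integral_const_mul, integral_add h1.1 h2.1]
    calc _ ≤ Real.exp (-β ^ 2 * k) * (A * Real.exp (β ^ 2 / 2 * k) +
          A * Real.exp ((-β) ^ 2 / 2 * k)) := by
          gcongr
          · exact h1.2
          · exact h2.2
      _ = 2 * A * (Real.exp (-β ^ 2 * k) * Real.exp (β ^ 2 / 2 * k)) := by rw [neg_sq]; ring
      _ = _ := by rw [← Real.exp_add]; congr 2; ring
  have hmaj : ∀ s, G s * (1 - barrier vol ρ X γ β k₁ m x s * c s) ≤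
      ∑ j ∈ Finset.range m, T (k₁ + j) s + G s * (1 - c s) := by
    intro s
    have hb := barrier_mem (vol := vol) (ρ := ρ) X γ β k₁ m x s
    have hcs := hc s
    have h1 : 1 - barrier vol ρ X γ β k₁ m x s * c s ≤
        (1 - barrier vol ρ X γ β k₁ m x s) + (1 - c s) := by
      nlinarith [hb.1, hb.2, hcs.1, hcs.2]
    have h2 : G s * (1 - barrier vol ρ X γ β k₁ m x s) ≤ ∑ j ∈ Finset.range m, T (k₁ + j) s := by
      refine (mul_le_mul_of_nonneg_left (one_sub_barrier_le X γ β k₁ m x s) (hG s)).trans ?_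
      rw [Finset.mul_sum]
      refine Finset.sum_le_sum fun j _ => ?_
      refine (mul_le_mul_of_nonneg_left (one_sub_plateau_le hβ (by exact_mod_cast (by omega)))
        (hG s)).trans (le_of_eq ?_)
      simp only [T]
      ring
    calc _ ≤ G s * ((1 - barrier vol ρ X γ β k₁ m x s) + (1 - c s)) :=
          mul_le_mul_of_nonneg_left h1 (hG s)
      _ ≤ _ := by rw [mul_add]; linarith
  have hsumi : Integrable (fun s => ∑ j ∈ Finset.range m, T (k₁ + j) s) P :=
    integrable_finsetSum _ fun j hj => hTi _ (by omega) (by have := Finset.mem_range.1 hj; omega)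
  have hi : Integrable (fun s => G s * (1 - barrier vol ρ X γ β k₁ m x s * c s)) P :=
    hGi.mul_bdd (c := 1) ((hbm.mul hcm).const_sub 1).aestronglyMeasurable (ae_of_all _ fun s => by
      have hb := barrier_mem (vol := vol) (ρ := ρ) X γ β k₁ m x s
      have h1 := mul_le_one₀ hb.2 (hc s).1 (hc s).2
      have h2 := mul_nonneg hb.1 (hc s).1
      rw [Real.norm_of_nonneg (by linarith)]; linarith)
  refine (integral_mono hi (hsumi.add hci) hmaj).trans ?_
  have e : ∫ s, ∑ j ∈ Finset.range m, T (k₁ + j) s + G s * (1 - c s) ∂P =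
      ∑ j ∈ Finset.range m, ∫ s, T (k₁ + j) s ∂P + ∫ s, G s * (1 - c s) ∂P := by
    rw [integral_add hsumi hci, integral_finsetSum _ fun j hj => hTi _ (by omega)
      (by have := Finset.mem_range.1 hj; omega)]
  refine (le_of_eq e).trans (add_le_add ?_ hcap)
  calc _ ≤ ∑ j ∈ Finset.range m, 2 * A * Real.exp (-(β ^ 2 / 2) * ((k₁ + j : ℕ) : ℝ)) :=
        Finset.sum_le_sum fun j hj => hT _ (by omega) (by have := Finset.mem_range.1 hj; omega)
    _ ≤ _ := by
        rw [← Finset.mul_sum]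
        exact mul_le_mul_of_nonneg_left (sum_exp_neg_le (by positivity) _ _) (by positivity)

lemma exists_exp_neg_le (A : ℝ) {a τ : ℝ} (ha : 0 < a) (hτ : 0 < τ) : ∃ k₁ : ℕ, ∀ k : ℕ, k₁ ≤ k →
    A * Real.exp (-a * k) ≤ τ := by
  have h1 : Tendsto (fun k : ℕ => A * Real.exp (-a * k)) atTop (𝓝 (A * 0)) := by
    refine Tendsto.const_mul _ (Real.tendsto_exp_atBot.comp ?_)
    exact tendsto_natCast_atTop_atTop.const_mul_atTop_of_neg (by linarith)
  rw [mul_zero] at h1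
  exact eventually_atTop.1 (h1.eventually (ge_mem_nhds hτ))

end Removal

/-! ### The cap on the field itself. -/

section ScaleEstimates

variable {d : ℕ} {Ω : Type*} [MetricSpace Ω] [MeasurableSpace Ω] {vol : Measure Ω}
  {h : Ω → Ω → ℝ} {ρ : ℝ → Ω → Ω → ℝ} {S : ℕ → Type*} [∀ N, MeasurableSpace (S N)]
  {P : ∀ N, Measure (S N)} [∀ N, IsProbabilityMeasure (P N)] {XN : ∀ N, S N → Ω → ℝ}
  {Ψ : ℂ → Ω → ℂ} {γ : ℝ}

/-- Markov with e^{βY}, that is, the exponential moment at γ + β, which must lie in the strip. The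
exponents −β² − βγ − γ²/2 + (γ + β)²/2 add up to −β²/2. -/
lemma MesoscopicAssumption.cap_one_point [Nontrivial Ω]
    (hm : MesoscopicAssumption d P vol h ρ XN Ψ) (hX : ∀ N x, Measurable fun s => XN N s x)
    {K : Set Ω} (hK : IsCompact K) {β : ℝ} (hβ : 0 < β)
    (hγ : γ ∈ Icc 0 √(2 * d)) (hγβ : γ + β ∈ Icc 0 √(2 * d)) :
    ∃ A > 0, ∀ᶠ N : ℕ in atTop, ∀ x ∈ K,
      ∫ s, wt (P N) (XN N) γ x s * (1 - cap β N (XN N s x - γ * Real.log N)) ∂(P N) ≤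
        A * Real.exp (-(β ^ 2 / 2) * Real.log N) := by
  obtain ⟨c₀, hc₀, _, _, h1⟩ := hm.expMean_bounds hK hγ
  obtain ⟨_, _, C₀, hC₀, h2⟩ := hm.expMean_bounds hK hγβ
  refine ⟨C₀ / c₀, by positivity, ?_⟩
  filter_upwards [h1, h2, eventually_ge_atTop 1] with N hN1 hN2 hN x hx
  set L := Real.log N
  have hZ := (hN1 x hx).1
  have hZ0 : 0 < expMean (P N) (XN N) γ x := lt_of_lt_of_le (by positivity) hZ
  have hint := hm.integrable_exp hN hγβ x
  have e : ∀ s, wt (P N) (XN N) γ x s * (Real.exp (-β ^ 2 * L) *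
      Real.exp (β * (XN N s x - γ * L))) = (Real.exp (-β ^ 2 * L - β * γ * L) /
      expMean (P N) (XN N) γ x) * Real.exp ((γ + β) * XN N s x) := by
    intro s
    rw [wt, div_mul_eq_mul_div, div_mul_eq_mul_div, ← Real.exp_add, ← Real.exp_add, ← Real.exp_add]
    congr 2
    ring
  have hi := hm.integrable_wt_mul hN hγ x (((measurable_cap β N).comp
    ((hX N x).sub_const (γ * L))).const_sub 1) (c := 1) fun s => by
      have := cap_mem β N (XN N s x - γ * L)
      simp only [Function.comp_apply]
      rw [abs_of_nonneg (by linarith [this.2])]; linarith [this.1]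
  calc _ ≤ ∫ s, (Real.exp (-β ^ 2 * L - β * γ * L) /
      expMean (P N) (XN N) γ x) * Real.exp ((γ + β) * XN N s x) ∂(P N) := by
        refine integral_mono hi (hint.const_mul _) fun s => ?_
        simp only
        rw [← e s]
        exact mul_le_mul_of_nonneg_left (one_sub_cap_le hβ N _) (wt_nonneg _ _ _ _ _)
    _ = Real.exp (-β ^ 2 * L - β * γ * L) / expMean (P N) (XN N) γ x *
        expMean (P N) (XN N) (γ + β) x := by rw [integral_const_mul]; rfl
    _ ≤ Real.exp (-β ^ 2 * L - β * γ * L) / (c₀ * Real.exp (γ ^ 2 / 2 * L)) *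
        (C₀ * Real.exp ((γ + β) ^ 2 / 2 * L)) := by
        gcongr
        · exact expMean_nonneg _ _ _ _
        · exact (hN2 x hx).2
    _ = C₀ / c₀ * (Real.exp (-β ^ 2 * L - β * γ * L) * (Real.exp (γ ^ 2 / 2 * L))⁻¹ *
        Real.exp ((γ + β) ^ 2 / 2 * L)) := by field_simp
    _ = _ := by
        rw [← Real.exp_neg, ← Real.exp_add, ← Real.exp_add]
        congr 2
        ring

/-- The same Markov bound with a second tilt at x₂. The distance is fixed, so the covariance only
enters the constant. -/
lemma MesoscopicAssumption.cap_two_point [Nontrivial Ω]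
    (hm : MesoscopicAssumption d P vol h ρ XN Ψ) (hX : ∀ N x, Measurable fun s => XN N s x)
    (h_cont : Continuous (fun p : Ω × Ω => h p.1 p.2)) {β : ℝ} (hβ : 0 < β)
    (hγ : γ ∈ Icc 0 √(2 * d)) (hγβ : γ + β ∈ Icc 0 √(2 * d)) {x₁ x₂ : Ω} (hne : x₁ ≠ x₂) :
    ∃ A > 0, ∀ᶠ N : ℕ in atTop,
      ∫ s, wt (P N) (XN N) γ x₁ s * wt (P N) (XN N) γ x₂ s *
        (1 - cap β N (XN N s x₁ - γ * Real.log N)) ∂(P N) ≤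
        A * Real.exp (-(β ^ 2 / 2) * Real.log N) := by
  have hK : IsCompact ({x₁, x₂} : Set Ω) := (toFinite _).isCompact
  obtain ⟨c₀, hc₀, _, _, h1⟩ := hm.expMean_bounds hK hγ
  obtain ⟨A, hA, h2⟩ := hm.norm_char_le h_cont hK (by norm_num : (0 : ℝ) < 1 / 2) (by norm_num)
    one_pos (0 : Fin 0 → ℝ) hγβ hγ
  refine ⟨A / c₀ ^ 2 * Real.exp ((γ + β) * γ * cov h x₁ x₂), by positivity, ?_⟩
  filter_upwards [h1, h2, eventually_ge_atTop 1,
    eventually_rpow_le (by norm_num : (1 / 2 : ℝ) < 1) (dist_pos.2 hne)] with N hN1 hN2 hN hd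
  set L := Real.log N with hL
  have hZ₁ := (hN1 x₁ (by simp)).1
  have hZ₂ := (hN1 x₂ (by simp)).1
  have hZ₁0 : 0 < expMean (P N) (XN N) γ x₁ := lt_of_lt_of_le (by positivity) hZ₁
  have hZ₂0 : 0 < expMean (P N) (XN N) γ x₂ := lt_of_lt_of_le (by positivity) hZ₂
  have h3 := hN2 x₁ (by simp) x₂ (by simp) hd (fun j => j.elim0) (fun j => j.elim0)
    (fun j => j.elim0) (fun j => j.elim0) 0 0 0 0 (by rw [abs_zero]; positivity)
    (by rw [abs_zero]; positivity)
  rw [covLin_fin_zero, covLin_fin_zero, covForm_fin_zero] at h3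
  simp only [Complex.ofReal_zero, zero_mul, Complex.exp_zero, mul_one, mul_zero, add_zero, ne_eq,
    OfNat.ofNat_ne_zero, not_false_eq_true, zero_pow, zero_div, Real.exp_zero] at h3
  have hint := hm.integrable_expWeight hN hγβ hγ hne (0 : Fin 0 → ℝ) (fun j => j.elim0)
    (fun j => j.elim0) (fun j => j.elim0)
  rw [integral_complex_ofReal, Complex.norm_real] at h3
  replace h3 := (le_abs_self _).trans h3
  have e : ∀ s, wt (P N) (XN N) γ x₁ s * wt (P N) (XN N) γ x₂ s * (Real.exp (-β ^ 2 * L) *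
      Real.exp (β * (XN N s x₁ - γ * L))) = (Real.exp (-β ^ 2 * L - β * γ * L) /
      (expMean (P N) (XN N) γ x₁ * expMean (P N) (XN N) γ x₂)) *
      expWeight vol ρ (XN N) (γ + β) γ x₁ x₂ (0 : Fin 0 → ℝ) (fun j => j.elim0)
        (fun j => j.elim0) s := by
    intro s
    rw [wt, wt, expWeight, div_mul_div_comm, div_mul_eq_mul_div, div_mul_eq_mul_div, ← Real.exp_add,
      ← Real.exp_add, ← Real.exp_add, ← Real.exp_add]
    congr 2
    simp
    ring
  have hcm : Measurable fun s => 1 - cap β N (XN N s x₁ - γ * L) :=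
    ((measurable_cap β N).comp ((hX N x₁).sub_const (γ * L))).const_sub 1
  have hi := (hm.integrable_wt_wt hN hγ hne).mul_bdd (c := 1) hcm.aestronglyMeasurable
    (ae_of_all _ fun s => by
      have := cap_mem β N (XN N s x₁ - γ * L)
      rw [Real.norm_of_nonneg (by linarith [this.2])]; linarith [this.1])
  calc _ ≤ ∫ s, (Real.exp (-β ^ 2 * L - β * γ * L) /
      (expMean (P N) (XN N) γ x₁ * expMean (P N) (XN N) γ x₂)) *
      expWeight vol ρ (XN N) (γ + β) γ x₁ x₂ (0 : Fin 0 → ℝ) (fun j => j.elim0)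
        (fun j => j.elim0) s ∂(P N) := by
        refine integral_mono hi (hint.const_mul _) fun s => ?_
        simp only
        rw [← e s]
        exact mul_le_mul_of_nonneg_left (one_sub_cap_le hβ N _)
          (mul_nonneg (wt_nonneg _ _ _ _ _) (wt_nonneg _ _ _ _ _))
    _ ≤ Real.exp (-β ^ 2 * L - β * γ * L) / ((c₀ * Real.exp (γ ^ 2 / 2 * L)) *
        (c₀ * Real.exp (γ ^ 2 / 2 * L))) *
        (A * Real.exp (((γ + β) ^ 2 + γ ^ 2) / 2 * L + (γ + β) * γ * cov h x₁ x₂)) := by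
        rw [integral_const_mul]
        have hn : 0 ≤ ∫ s, expWeight vol ρ (XN N) (γ + β) γ x₁ x₂ (0 : Fin 0 → ℝ)
            (fun j => j.elim0) (fun j => j.elim0) s ∂(P N) :=
          integral_nonneg fun s => (Real.exp_pos _).le
        gcongr
    _ = A / c₀ ^ 2 * (Real.exp (-β ^ 2 * L - β * γ * L) * (Real.exp (γ ^ 2 / 2 * L))⁻¹ *
        (Real.exp (γ ^ 2 / 2 * L))⁻¹ *
        Real.exp (((γ + β) ^ 2 + γ ^ 2) / 2 * L + (γ + β) * γ * cov h x₁ x₂)) := by field_simp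
    _ = _ := by
        rw [← Real.exp_neg, ← Real.exp_add, ← Real.exp_add, ← Real.exp_add, mul_assoc (A / c₀ ^ 2),
          ← Real.exp_add]
        congr 2
        ring

end ScaleEstimates

/-! ### Cost of the barrier, and second moments with the barrier. -/

section BarrierBounds

variable {d : ℕ} {Ω : Type*} [MetricSpace Ω] [MeasurableSpace Ω] {vol : Measure Ω}
  {h : Ω → Ω → ℝ} {ρ : ℝ → Ω → Ω → ℝ} {S : ℕ → Type*} [∀ N, MeasurableSpace (S N)]
  {P : ∀ N, Measure (S N)} [∀ N, IsProbabilityMeasure (P N)] {XN : ∀ N, S N → Ω → ℝ}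
  {Ψ : ℂ → Ω → ℂ} {γ : ℝ}

lemma measurable_kernelMaj_field (hX : ∀ N x, Measurable fun s => XN N s x) (C ε : ℝ) (N : ℕ)
    (b : ℝ) (x : Ω) : Measurable fun s => kernelMaj C ε N b (XN N s x - γ * Real.log N) :=
  (measurable_kernelMaj C ε N).comp (measurable_const.prodMk ((hX N x).sub_const _))

lemma measurable_cap_field (hX : ∀ N x, Measurable fun s => XN N s x) (β : ℝ) (N : ℕ) (x : Ω) :
    Measurable fun s => cap β N (XN N s x - γ * Real.log N) :=
  (measurable_cap β N).comp ((hX N x).sub_const _)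

lemma norm_kernelMaj_le {C : ℝ} (hC : 0 ≤ C) (ε : ℝ) (N : ℕ) (b y : ℝ) :
    ‖kernelMaj C ε N b y‖ ≤ 2 * C * √(Real.log N) + 1 := by
  rw [Real.norm_of_nonneg (kernelMaj_nonneg hC _ _ _ _)]
  exact kernelMaj_le hC _ _ _ _

lemma norm_one_sub_cap_le (β : ℝ) (N : ℕ) (y : ℝ) : ‖1 - cap β N y‖ ≤ 1 := by
  have := cap_mem β N y
  rw [Real.norm_of_nonneg (by linarith [this.2])]
  linarith [this.1]

/-- k₁ is chosen before N, from the geometric tail of the barrier. The kernel is of size σ but has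
bounded tilted moments, so it costs only a constant in the barrier term. For the cap it is bounded
trivially by its supremum, which N^{-β²/2} absorbs. -/
lemma MesoscopicAssumption.one_point_removal [Nontrivial Ω]
    (hm : MesoscopicAssumption d P vol h ρ XN Ψ)
    (hX : ∀ N x, Measurable fun s => XN N s x)
    (hXs : ∀ N (k : ℕ) x, Measurable fun s => smoothed vol ρ (XN N) (Real.exp (-k)) x s)
    (h_cont : Continuous (fun p : Ω × Ω => h p.1 p.2)) (h_symm : ∀ x y, h x y = h y x)
    {K : Set Ω} (hK : IsCompact K) {κ : ℕ} (hκ : 0 < κ) {B : ℝ} (hB : IsScaleBound vol h ρ K κ B)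
    {η β : ℝ} (hη : 0 < η) (hη1 : η < 1) (hβ : 0 < β) (hγ : γ ∈ Icc 0 √(2 * d))
    (hγβ : γ + β ∈ Icc 0 √(2 * d)) {C ε : ℝ} (hC : 0 ≤ C) (hε : 0 < ε) (g : Ω → ℝ)
    {τ : ℝ} (hτ : 0 < τ) :
    ∃ k₁ : ℕ, ∀ k₀, k₁ ≤ k₀ → ∀ᶠ N : ℕ in atTop, ∀ x ∈ K,
      ∫ s, wt (P N) (XN N) γ x s * kernelMaj C ε N (g x) (XN N s x - γ * Real.log N) *
        (1 - barrier vol ρ (XN N) γ β k₀ (scaleCount η k₀ N) x s *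
          cap β N (XN N s x - γ * Real.log N)) ∂(P N) ≤ τ := by
  obtain ⟨C', hC', R, hR, hker⟩ := kernelMaj_isKernel C hε
  obtain ⟨A₁, hA₁, h1⟩ := hm.one_point_scale hX h_cont h_symm hK hB hη hη1 hR β hγ
  obtain ⟨A₂, hA₂, h2⟩ := hm.one_point_scale hX h_cont h_symm hK hB hη hη1 hR (-β) hγ
  obtain ⟨A₃, hA₃, h3⟩ := hm.cap_one_point hX hK hβ hγ hγβ
  set A := max A₁ A₂ * C'
  have hA : 0 < A := by positivity
  obtain ⟨k₁, hk₁⟩ := exists_exp_neg_le (2 * A * (1 - Real.exp (-(β ^ 2 / 2)))⁻¹)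
    (by positivity : 0 < β ^ 2 / 2) (half_pos hτ)
  refine ⟨max κ k₁, fun k₀ hk₀ => ?_⟩
  filter_upwards [hker, h1, h2, h3, eventually_ge_atTop 1,
    eventually_sq_mul_exp_le (2 * C) (by positivity : 0 < β ^ 2 / 2)
      (by positivity : 0 < τ / 2 / A₃)] with N hkN h1N h2N h3N hN hsmall x hx
  obtain ⟨k', hk'⟩ := hkN (g x)
  have hVm := measurable_kernelMaj_field (γ := γ) hX C ε N (g x) x
  have hcm := measurable_cap_field (γ := γ) hX β N x
  have hV0 := fun s => kernelMaj_nonneg hC ε N (g x) (XN N s x - γ * Real.log N)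
  have hw0 := wt_nonneg (P N) (XN N) γ x
  have hVb := fun s => norm_kernelMaj_le hC ε N (g x) (XN N s x - γ * Real.log N)
  have hwi := hm.integrable_wt hN hγ x
  set V := fun s => kernelMaj C ε N (g x) (XN N s x - γ * Real.log N) with hV
  have hexp : ∀ ξ ∈ ({β, -β} : Set ℝ), ∀ k, k₀ ≤ k → k < k₀ + scaleCount η k₀ N →
      Integrable (fun s => wt (P N) (XN N) γ x s * V s *
        Real.exp (ξ * deviation vol ρ (XN N) γ k x s)) (P N) ∧
      ∫ s, wt (P N) (XN N) γ x s * V s * Real.exp (ξ * deviation vol ρ (XN N) γ k x s) ∂(P N) ≤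
        A * Real.exp (ξ ^ 2 / 2 * k) := by
    intro ξ hξ k hk hkm
    have hkκ : κ ≤ k := ((le_max_left _ _).trans hk₀).trans hk
    have hkL : (k : ℝ) ≤ (1 - η) * Real.log N := by
      have := le_of_lt_scaleCount hη1 (j := k - k₀) (by omega : k - k₀ < scaleCount η k₀ N)
      rwa [Nat.add_sub_cancel' hk] at this
    have e : (fun s => wt (P N) (XN N) γ x s * V s * Real.exp (ξ * deviation vol ρ (XN N) γ k x s)) =
        fun s => wt (P N) (XN N) γ x s * Real.exp (ξ * deviation vol ρ (XN N) γ k x s) * V s := by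
      ext s; ring
    rw [e]
    refine ⟨(hm.integrable_wt_deviation hN hγ ξ k x).mul_bdd hVm.aestronglyMeasurable
      (ae_of_all _ hVb), ?_⟩
    refine (le_abs_self _).trans ?_
    rcases hξ with rfl | hξ
    · refine (h1N x hx k hkκ hkL k' _ C' (γ * Real.log N) hC'.le hk').trans ?_
      simp only [A]
      gcongr
      exact le_max_left _ _
    · rw [mem_singleton_iff] at hξ
      subst hξ
      refine (h2N x hx k hkκ hkL k' _ C' (γ * Real.log N) hC'.le hk').trans ?_
      simp only [A]
      gcongr
      exact le_max_right _ _
  have hcap : ∫ s, wt (P N) (XN N) γ x s * V s *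
      (1 - cap β N (XN N s x - γ * Real.log N)) ∂(P N) ≤ τ / 2 := by
    have hci : Integrable (fun s => wt (P N) (XN N) γ x s *
        (1 - cap β N (XN N s x - γ * Real.log N))) (P N) :=
      hwi.mul_bdd (hcm.const_sub 1).aestronglyMeasurable
        (ae_of_all _ fun s => norm_one_sub_cap_le _ _ _)
    have hci2 : Integrable (fun s => wt (P N) (XN N) γ x s * V s *
        (1 - cap β N (XN N s x - γ * Real.log N))) (P N) :=
      (hwi.mul_bdd hVm.aestronglyMeasurable (ae_of_all _ hVb)).mul_bdd
        (hcm.const_sub 1).aestronglyMeasurable (ae_of_all _ fun s => norm_one_sub_cap_le _ _ _)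
    have hσ : 1 ≤ 2 * C * √(Real.log N) + 1 := by
      have := Real.sqrt_nonneg (Real.log N)
      nlinarith [mul_nonneg hC this]
    calc _ ≤ ∫ s, (2 * C * √(Real.log N) + 1) * (wt (P N) (XN N) γ x s *
          (1 - cap β N (XN N s x - γ * Real.log N))) ∂(P N) := by
          refine integral_mono hci2 (hci.const_mul _) fun s => ?_
          simp only
          have h5 := kernelMaj_le hC ε N (g x) (XN N s x - γ * Real.log N)
          have h6 : 0 ≤ wt (P N) (XN N) γ x s * (1 - cap β N (XN N s x - γ * Real.log N)) :=
            mul_nonneg (hw0 s) (by linarith [(cap_mem β N (XN N s x - γ * Real.log N)).2])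
          calc _ = V s * (wt (P N) (XN N) γ x s *
                (1 - cap β N (XN N s x - γ * Real.log N))) := by ring
            _ ≤ _ := mul_le_mul_of_nonneg_right h5 h6
      _ ≤ (2 * C * √(Real.log N) + 1) ^ 2 *
          (A₃ * Real.exp (-(β ^ 2 / 2) * Real.log N)) := by
          rw [integral_const_mul]
          refine mul_le_mul (by nlinarith) (h3N x hx) ?_ (by positivity)
          exact integral_nonneg fun s => mul_nonneg (hw0 s)
            (by linarith [(cap_mem β N (XN N s x - γ * Real.log N)).2])
      _ = A₃ * ((2 * C * √(Real.log N) + 1) ^ 2 *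
          Real.exp (-(β ^ 2 / 2) * Real.log N)) := by ring
      _ ≤ A₃ * (τ / 2 / A₃) := by gcongr
      _ = τ / 2 := by field_simp
  have key := integral_mul_one_sub_barrier_le (vol := vol) (ρ := ρ) (X := XN N) (γ := γ) hβ hA.le
    (m := scaleCount η k₀ N) (k₁ := k₀) (lt_of_lt_of_le hκ ((le_max_left _ _).trans hk₀))
    (fun s => mul_nonneg (hw0 s) (hV0 s))
    (hwi.mul_bdd hVm.aestronglyMeasurable (ae_of_all _ hVb))
    (fun k => measurable_deviation hXs N k x) (fun s => cap_mem β N _) hcm hexp hcap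
  refine key.trans ?_
  have := hk₁ k₀ ((le_max_right _ _).trans hk₀)
  linarith

/-- At a fixed pair of distinct points the extra mean caused by x₂ stays bounded at all fine scales,
so the one-point argument applies with a constant depending on the distance. No uniformity in the
pair is claimed or needed, since only a pointwise limit is drawn from it. -/
lemma MesoscopicAssumption.two_point_removal [Nontrivial Ω]
    (hm : MesoscopicAssumption d P vol h ρ XN Ψ)
    (hX : ∀ N x, Measurable fun s => XN N s x)
    (hXs : ∀ N (k : ℕ) x, Measurable fun s => smoothed vol ρ (XN N) (Real.exp (-k)) x s)
    (h_cont : Continuous (fun p : Ω × Ω => h p.1 p.2)) (h_symm : ∀ x y, h x y = h y x)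
    {K : Set Ω} (hK : IsCompact K) {κ : ℕ} (hκ : 0 < κ) {B : ℝ} (hB : IsScaleBound vol h ρ K κ B)
    {η β : ℝ} (hη : 0 < η) (hη1 : η < 1) (hβ : 0 < β) (hγ : γ ∈ Icc 0 √(2 * d))
    (hγβ : γ + β ∈ Icc 0 √(2 * d)) {C ε : ℝ} (hC : 0 ≤ C) (hε : 0 < ε) (g : Ω → ℝ)
    {x₁ x₂ : Ω} (hx₁ : x₁ ∈ K) (hx₂ : x₂ ∈ K) (hne : x₁ ≠ x₂) {τ : ℝ} (hτ : 0 < τ) :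
    ∃ k₁ : ℕ, ∀ k₀, k₁ ≤ k₀ → ∀ᶠ N : ℕ in atTop,
      ∫ s, wt (P N) (XN N) γ x₁ s * wt (P N) (XN N) γ x₂ s *
        kernelMaj C ε N (g x₁) (XN N s x₁ - γ * Real.log N) *
        kernelMaj C ε N (g x₂) (XN N s x₂ - γ * Real.log N) *
        (1 - barrier vol ρ (XN N) γ β k₀ (scaleCount η k₀ N) x₁ s *
          cap β N (XN N s x₁ - γ * Real.log N)) ∂(P N) ≤ τ := by
  obtain ⟨C', hC', R, hR, hker⟩ := kernelMaj_isKernel C hε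
  obtain ⟨A₁, hA₁, h1⟩ := hm.two_point_scale hX h_cont h_symm hK hB hη hη1 hR β hγ
  obtain ⟨A₂, hA₂, h2⟩ := hm.two_point_scale hX h_cont h_symm hK hB hη hη1 hR (-β) hγ
  obtain ⟨A₃, hA₃, h3⟩ := hm.cap_two_point hX h_cont hβ hγ hγβ hne
  have hd0 : 0 < dist x₁ x₂ := dist_pos.2 hne
  set r := Real.log (dist x₁ x₂) with hr
  set A := max A₁ A₂ * (C' * C') * Real.exp (-γ ^ 2 * r + |γ * β * r|)
  have hA : 0 < A := by positivity
  obtain ⟨k₁, hk₁⟩ := exists_exp_neg_le (2 * A * (1 - Real.exp (-(β ^ 2 / 2)))⁻¹)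
    (by positivity : 0 < β ^ 2 / 2) (half_pos hτ)
  -- From k₂ on the scale e^{-k} is below the distance, and the maximum in the covariance bound is
  -- the distance itself.
  obtain ⟨k₂, hk₂⟩ := exists_exp_neg_le 1 one_pos hd0
  refine ⟨max κ (max k₁ k₂), fun k₀ hk₀ => ?_⟩
  have hκ₀ : κ ≤ k₀ := (le_max_left _ _).trans hk₀
  have hk₁₀ : k₁ ≤ k₀ := ((le_max_left _ _).trans (le_max_right _ _)).trans hk₀
  have hk₂₀ : k₂ ≤ k₀ := ((le_max_right _ _).trans (le_max_right _ _)).trans hk₀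
  filter_upwards [hker, h1, h2, h3, eventually_ge_atTop 1,
    eventually_sq_mul_exp_le (2 * C) (by positivity : 0 < β ^ 2 / 2)
      (by positivity : 0 < τ / 2 / A₃), eventually_rpow_le hη1 hd0] with N hkN h1N h2N h3N hN hsmall hd
  obtain ⟨k', hk'⟩ := hkN (g x₁)
  obtain ⟨k'', hk''⟩ := hkN (g x₂)
  have hVm := measurable_kernelMaj_field (γ := γ) hX C ε N (g x₁) x₁
  have hVm' := measurable_kernelMaj_field (γ := γ) hX C ε N (g x₂) x₂
  have hcm := measurable_cap_field (γ := γ) hX β N x₁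
  have hV0 := fun s => kernelMaj_nonneg hC ε N (g x₁) (XN N s x₁ - γ * Real.log N)
  have hV0' := fun s => kernelMaj_nonneg hC ε N (g x₂) (XN N s x₂ - γ * Real.log N)
  have hw0 := fun s => mul_nonneg (wt_nonneg (P N) (XN N) γ x₁ s) (wt_nonneg (P N) (XN N) γ x₂ s)
  have hVb := fun s => norm_kernelMaj_le hC ε N (g x₁) (XN N s x₁ - γ * Real.log N)
  have hVb' := fun s => norm_kernelMaj_le hC ε N (g x₂) (XN N s x₂ - γ * Real.log N)
  have hwi := hm.integrable_wt_wt hN hγ hne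
  set W := fun s => wt (P N) (XN N) γ x₁ s * wt (P N) (XN N) γ x₂ s with hW
  set V := fun s => kernelMaj C ε N (g x₁) (XN N s x₁ - γ * Real.log N) with hV
  set V' := fun s => kernelMaj C ε N (g x₂) (XN N s x₂ - γ * Real.log N) with hV'
  have hexp : ∀ ξ ∈ ({β, -β} : Set ℝ), ∀ k, k₀ ≤ k → k < k₀ + scaleCount η k₀ N →
      Integrable (fun s => W s * V s * V' s *
        Real.exp (ξ * deviation vol ρ (XN N) γ k x₁ s)) (P N) ∧
      ∫ s, W s * V s * V' s * Real.exp (ξ * deviation vol ρ (XN N) γ k x₁ s) ∂(P N) ≤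
        A * Real.exp (ξ ^ 2 / 2 * k) := by
    intro ξ hξ k hk hkm
    have hkκ : κ ≤ k := hκ₀.trans hk
    have hkL : (k : ℝ) ≤ (1 - η) * Real.log N := by
      have := le_of_lt_scaleCount hη1 (j := k - k₀) (by omega : k - k₀ < scaleCount η k₀ N)
      rwa [Nat.add_sub_cancel' hk] at this
    have hmax : max (dist x₁ x₂) (Real.exp (-k)) = dist x₁ x₂ := by
      refine max_eq_left ?_
      have := hk₂ k (hk₂₀.trans hk)
      rwa [one_mul, neg_one_mul] at this
    have e : (fun s => W s * V s * V' s * Real.exp (ξ * deviation vol ρ (XN N) γ k x₁ s)) =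
        fun s => wt (P N) (XN N) γ x₁ s * wt (P N) (XN N) γ x₂ s *
          Real.exp (ξ * deviation vol ρ (XN N) γ k x₁ s) * V s * V' s := by
      ext s; simp only [hW]; ring
    rw [e]
    refine ⟨((hm.integrable_wt_wt_deviation hN hγ ξ k hne).mul_bdd hVm.aestronglyMeasurable
      (ae_of_all _ hVb)).mul_bdd hVm'.aestronglyMeasurable (ae_of_all _ hVb'), ?_⟩
    refine (le_abs_self _).trans ?_
    have hexp_le : ∀ ξ : ℝ, |ξ| = β → Real.exp (-γ ^ 2 * r - γ * ξ * r + ξ ^ 2 / 2 * k) ≤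
        Real.exp (-γ ^ 2 * r + |γ * β * r|) * Real.exp (ξ ^ 2 / 2 * k) := by
      intro ξ hξ
      rw [← Real.exp_add]
      refine Real.exp_le_exp.2 ?_
      have : |γ * β * r| = |γ * ξ * r| := by
        rw [abs_mul, abs_mul, abs_mul, abs_mul, hξ, abs_of_pos hβ]
      rw [this]
      linarith [neg_abs_le (γ * ξ * r)]
    rcases hξ with rfl | hξ
    · refine (h1N x₁ hx₁ x₂ hx₂ hd k hkκ hkL k' k'' _ _ C' C' (γ * Real.log N) (γ * Real.log N)
        hC'.le hC'.le hk' hk'').trans ?_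
      rw [hmax, ← hr]
      refine (mul_le_mul_of_nonneg_left (hexp_le _ (abs_of_pos hβ)) (by positivity)).trans ?_
      simp only [A]
      rw [← mul_assoc]
      gcongr
      exact le_max_left _ _
    · rw [mem_singleton_iff] at hξ
      subst hξ
      refine (h2N x₁ hx₁ x₂ hx₂ hd k hkκ hkL k' k'' _ _ C' C' (γ * Real.log N) (γ * Real.log N)
        hC'.le hC'.le hk' hk'').trans ?_
      rw [hmax, ← hr]
      refine (mul_le_mul_of_nonneg_left (hexp_le _ (by rw [abs_neg, abs_of_pos hβ]))
        (by positivity)).trans ?_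
      simp only [A]
      rw [← mul_assoc]
      gcongr
      exact le_max_right _ _
  have hWVi : Integrable (fun s => W s * V s * V' s) (P N) :=
    (hwi.mul_bdd hVm.aestronglyMeasurable (ae_of_all _ hVb)).mul_bdd hVm'.aestronglyMeasurable
      (ae_of_all _ hVb')
  have hcap : ∫ s, W s * V s * V' s *
      (1 - cap β N (XN N s x₁ - γ * Real.log N)) ∂(P N) ≤ τ / 2 := by
    have hci : Integrable (fun s => W s *
        (1 - cap β N (XN N s x₁ - γ * Real.log N))) (P N) :=
      hwi.mul_bdd (hcm.const_sub 1).aestronglyMeasurable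
        (ae_of_all _ fun s => norm_one_sub_cap_le _ _ _)
    have hci2 : Integrable (fun s => W s * V s * V' s *
        (1 - cap β N (XN N s x₁ - γ * Real.log N))) (P N) :=
      hWVi.mul_bdd
        (hcm.const_sub 1).aestronglyMeasurable (ae_of_all _ fun s => norm_one_sub_cap_le _ _ _)
    calc _ ≤ ∫ s, (2 * C * √(Real.log N) + 1) ^ 2 * (W s *
          (1 - cap β N (XN N s x₁ - γ * Real.log N))) ∂(P N) := by
          refine integral_mono hci2 (hci.const_mul _) fun s => ?_
          simp only
          have h5 := kernelMaj_le hC ε N (g x₁) (XN N s x₁ - γ * Real.log N)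
          have h5' := kernelMaj_le hC ε N (g x₂) (XN N s x₂ - γ * Real.log N)
          have h6 : 0 ≤ W s * (1 - cap β N (XN N s x₁ - γ * Real.log N)) :=
            mul_nonneg (hw0 s) (by linarith [(cap_mem β N (XN N s x₁ - γ * Real.log N)).2])
          calc _ = V s * V' s * (W s *
                (1 - cap β N (XN N s x₁ - γ * Real.log N))) := by ring
            _ ≤ _ := by
                refine mul_le_mul_of_nonneg_right ?_ h6
                rw [pow_two]
                exact mul_le_mul h5 h5' (hV0' s) ((hV0 s).trans h5)
      _ ≤ (2 * C * √(Real.log N) + 1) ^ 2 *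
          (A₃ * Real.exp (-(β ^ 2 / 2) * Real.log N)) := by
          rw [integral_const_mul]
          exact mul_le_mul_of_nonneg_left h3N (by positivity)
      _ = A₃ * ((2 * C * √(Real.log N) + 1) ^ 2 *
          Real.exp (-(β ^ 2 / 2) * Real.log N)) := by ring
      _ ≤ A₃ * (τ / 2 / A₃) := by gcongr
      _ = τ / 2 := by field_simp
  have key := integral_mul_one_sub_barrier_le (vol := vol) (ρ := ρ) (X := XN N) (γ := γ) hβ hA.le
    (m := scaleCount η k₀ N) (k₁ := k₀) (lt_of_lt_of_le hκ hκ₀)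
    (fun s => mul_nonneg (mul_nonneg (hw0 s) (hV0 s)) (hV0' s)) hWVi
    (fun k => measurable_deviation hXs N k x₁) (fun s => cap_mem β N _) hcm hexp hcap
  refine key.trans ?_
  have := hk₁ k₀ hk₁₀
  linarith

/-- Second moments restricted by the barrier, at mesoscopic distances. -/
lemma MesoscopicAssumption.two_point_barrier_bound [Nontrivial Ω]
    (hm : MesoscopicAssumption d P vol h ρ XN Ψ)
    (hX : ∀ N x, Measurable fun s => XN N s x)
    (hXs : ∀ N (k : ℕ) x, Measurable fun s => smoothed vol ρ (XN N) (Real.exp (-k)) x s)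
    (h_cont : Continuous (fun p : Ω × Ω => h p.1 p.2)) (h_symm : ∀ x y, h x y = h y x)
    {K : Set Ω} (hK : IsCompact K) {k₀ : ℕ} (hk₀ : 0 < k₀) {B : ℝ}
    (hB : IsScaleBound vol h ρ K k₀ B)
    {η β : ℝ} (hη : 0 < η) (hη1 : η < 1) (hβ : 0 < β) (hγ : γ ∈ Icc 0 √(2 * d))
    {C ε : ℝ} (hC : 0 ≤ C) (hε : 0 < ε) (g : Ω → ℝ) :
    ∃ A > 0, ∀ᶠ N : ℕ in atTop, ∀ x₁ ∈ K, ∀ x₂ ∈ K, (N : ℝ) ^ (η - 1) ≤ dist x₁ x₂ →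
      ∫ s, wt (P N) (XN N) γ x₁ s * wt (P N) (XN N) γ x₂ s *
        kernelMaj C ε N (g x₁) (XN N s x₁ - γ * Real.log N) *
        kernelMaj C ε N (g x₂) (XN N s x₂ - γ * Real.log N) *
        barrier vol ρ (XN N) γ β k₀ (scaleCount η k₀ N) x₁ s ∂(P N) ≤
      A * (1 + (dist x₁ x₂) ^ (-(γ ^ 2 / 2 + 2 * β * γ))) := by
  obtain ⟨C', hC', R, hR, hker⟩ := kernelMaj_isKernel C hε
  obtain ⟨A₁, hA₁, h1⟩ := hm.two_point_scale hX h_cont h_symm hK hB hη hη1 hR (-γ) hγ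
  obtain ⟨A₂, hA₂, h2⟩ := hm.two_point_scale hX h_cont h_symm hK hB hη hη1 hR 0 hγ
  set E₁ := A₁ * (C' * C') * Real.exp (γ ^ 2) with hE₁
  set E₂ := A₂ * (C' * C') * Real.exp (γ ^ 2 * k₀) with hE₂
  have hLtop : Tendsto (fun N : ℕ => (1 - η) * Real.log N) atTop atTop :=
    (Real.tendsto_log_atTop.comp tendsto_natCast_atTop_atTop).const_mul_atTop (by linarith)
  refine ⟨E₁ + E₂, by positivity, ?_⟩
  filter_upwards [hker, h1, h2, eventually_ge_atTop 1, eventually_rpow_pos,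
    hLtop.eventually_ge_atTop (k₀ : ℝ)] with N hkN h1N h2N hN hpos hk₀L x₁ hx₁ x₂ hx₂ hd
  have hd0 : 0 < dist x₁ x₂ := (hpos _).trans_le hd
  have hne : x₁ ≠ x₂ := dist_pos.1 hd0
  obtain ⟨k', hk'⟩ := hkN (g x₁)
  obtain ⟨k'', hk''⟩ := hkN (g x₂)
  have hVm := measurable_kernelMaj_field (γ := γ) hX C ε N (g x₁) x₁
  have hVm' := measurable_kernelMaj_field (γ := γ) hX C ε N (g x₂) x₂
  have hV0 := fun s => kernelMaj_nonneg hC ε N (g x₁) (XN N s x₁ - γ * Real.log N)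
  have hV0' := fun s => kernelMaj_nonneg hC ε N (g x₂) (XN N s x₂ - γ * Real.log N)
  have hw0 := fun s => mul_nonneg (wt_nonneg (P N) (XN N) γ x₁ s) (wt_nonneg (P N) (XN N) γ x₂ s)
  have hVb := fun s => norm_kernelMaj_le hC ε N (g x₁) (XN N s x₁ - γ * Real.log N)
  have hVb' := fun s => norm_kernelMaj_le hC ε N (g x₂) (XN N s x₂ - γ * Real.log N)
  set V := fun s => kernelMaj C ε N (g x₁) (XN N s x₁ - γ * Real.log N) with hV
  set V' := fun s => kernelMaj C ε N (g x₂) (XN N s x₂ - γ * Real.log N) with hV'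
  have hWVi : ∀ ξ k, Integrable (fun s => wt (P N) (XN N) γ x₁ s * wt (P N) (XN N) γ x₂ s *
      Real.exp (ξ * deviation vol ρ (XN N) γ k x₁ s) * V s * V' s) (P N) := fun ξ k =>
    ((hm.integrable_wt_wt_deviation hN hγ ξ k hne).mul_bdd hVm.aestronglyMeasurable
      (ae_of_all _ hVb)).mul_bdd hVm'.aestronglyMeasurable (ae_of_all _ hVb')
  have hbi : Integrable (fun s => wt (P N) (XN N) γ x₁ s * wt (P N) (XN N) γ x₂ s * V s * V' s *
      barrier vol ρ (XN N) γ β k₀ (scaleCount η k₀ N) x₁ s) (P N) := by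
    refine Integrable.mul_bdd (c := 1) ?_ (measurable_barrier hXs β N k₀ _ x₁).aestronglyMeasurable
      (ae_of_all _ fun s => ?_)
    · simpa using hWVi 0 0
    · have := barrier_mem (vol := vol) (ρ := ρ) (XN N) γ β k₀ (scaleCount η k₀ N) x₁ s
      rw [Real.norm_of_nonneg this.1]
      exact this.2
  set r := Real.log (dist x₁ x₂) with hr
  have hrpow : dist x₁ x₂ ^ (-(γ ^ 2 / 2 + 2 * β * γ)) =
      Real.exp (r * (-(γ ^ 2 / 2 + 2 * β * γ))) := Real.rpow_def_of_pos hd0 _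
  rw [hrpow]
  have hE₁0 : 0 < E₁ := by positivity
  have hE₂0 : 0 < E₂ := by positivity
  have hr_low : -r ≤ (1 - η) * Real.log N := by
    have := Real.log_le_log (hpos _) hd
    rw [Real.log_rpow (by exact_mod_cast hN)] at this
    linarith
  rcases le_or_gt (k₀ : ℝ) (-r) with hc | hc
  · -- the barrier at the scale of the distance
    set k := ⌊-r⌋₊ with hkdef
    have hr0 : 0 ≤ -r := le_trans (by positivity) hc
    have hk : k₀ ≤ k := Nat.le_floor hc
    have hk1 : (k : ℝ) ≤ -r := Nat.floor_le hr0
    have hk2 : -r < k + 1 := Nat.lt_floor_add_one _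
    have hkL : (k : ℝ) ≤ (1 - η) * Real.log N := hk1.trans hr_low
    have hmax : Real.log (max (dist x₁ x₂) (Real.exp (-k))) = -k := by
      rw [max_eq_right, Real.log_exp]
      rw [← Real.log_le_iff_le_exp hd0]
      linarith
    have hkpos : (0 : ℝ) < k := by exact_mod_cast (by omega : 0 < k)
    -- Here ξ = −γ, the minimizer: with k ≈ −r the exponent −γ²r + γξk + ξ²k/2 drops from γ²|r| to
    -- γ²|r|/2. Trading the barrier for this weight costs 2βγk, and rounding −r down to k costs at
    -- most e^{γ²}.
    have h3 := h1N x₁ hx₁ x₂ hx₂ hd k hk hkL k' k'' _ _ C' C' (γ * Real.log N) (γ * Real.log N)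
        hC'.le hC'.le hk' hk''
    rw [hmax, ← hr] at h3
    replace h3 := (le_abs_self _).trans h3
    calc _ ≤ ∫ s, Real.exp (2 * (β * k) * γ) * (wt (P N) (XN N) γ x₁ s * wt (P N) (XN N) γ x₂ s *
          Real.exp (-γ * deviation vol ρ (XN N) γ k x₁ s) * V s * V' s) ∂(P N) := by
          refine integral_mono hbi ((hWVi _ _).const_mul _) fun s => ?_
          simp only
          have h4 : barrier vol ρ (XN N) γ β k₀ (scaleCount η k₀ N) x₁ s ≤
              Real.exp (2 * (β * k) * γ) * Real.exp (-γ * deviation vol ρ (XN N) γ k x₁ s) := by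
            refine ((barrier_le (XN N) γ β hk (lt_add_scaleCount hkL) x₁ s).trans
              (plateau_le_exp hγ.1 (by positivity))).trans (le_of_eq ?_)
            rw [Real.exp_add, mul_comm]
          calc _ ≤ wt (P N) (XN N) γ x₁ s * wt (P N) (XN N) γ x₂ s * V s * V' s *
              (Real.exp (2 * (β * k) * γ) * Real.exp (-γ * deviation vol ρ (XN N) γ k x₁ s)) :=
                mul_le_mul_of_nonneg_left h4 (mul_nonneg (mul_nonneg (hw0 s) (hV0 s)) (hV0' s))
            _ = _ := by ring
      _ ≤ Real.exp (2 * (β * k) * γ) * (A₁ * (C' * C') *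
          Real.exp (-γ ^ 2 * r - γ * -γ * -k + (-γ) ^ 2 / 2 * k)) := by
          rw [integral_const_mul]
          exact mul_le_mul_of_nonneg_left h3 (Real.exp_pos _).le
      _ = A₁ * (C' * C') * Real.exp (2 * (β * k) * γ +
          (-γ ^ 2 * r - γ * -γ * -k + (-γ) ^ 2 / 2 * k)) := by
          rw [Real.exp_add (2 * (β * k) * γ)]; ring
      _ ≤ A₁ * (C' * C') * Real.exp (γ ^ 2 + r * (-(γ ^ 2 / 2 + 2 * β * γ))) := by
          refine mul_le_mul_of_nonneg_left (Real.exp_le_exp.2 ?_) (by positivity)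
          have e1 : γ ^ 2 * (-r - k) ≤ γ ^ 2 * 1 := by gcongr; linarith
          have e2 : (γ ^ 2 / 2 + 2 * (β * γ)) * k ≤ (γ ^ 2 / 2 + 2 * (β * γ)) * -r := by
            have := hγ.1
            gcongr
          nlinarith
      _ = E₁ * Real.exp (r * (-(γ ^ 2 / 2 + 2 * β * γ))) := by rw [hE₁, Real.exp_add]; ring
      _ ≤ _ := by
          have := Real.exp_pos (r * (-(γ ^ 2 / 2 + 2 * β * γ)))
          nlinarith
  -- If the distance exceeds e^{-k₀} there is no barrier at that scale, but |x₁ − x₂|^{-γ²} is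
  -- bounded; ξ = 0 and the barrier is bounded by 1.
  · have h3 := h2N x₁ hx₁ x₂ hx₂ hd k₀ le_rfl hk₀L k' k'' _ _ C' C' (γ * Real.log N)
      (γ * Real.log N) hC'.le hC'.le hk' hk''
    replace h3 := (le_abs_self _).trans h3
    calc _ ≤ ∫ s, wt (P N) (XN N) γ x₁ s * wt (P N) (XN N) γ x₂ s *
          Real.exp (0 * deviation vol ρ (XN N) γ k₀ x₁ s) * V s * V' s ∂(P N) := by
          refine integral_mono hbi (hWVi _ _) fun s => ?_
          simp only
          rw [zero_mul, Real.exp_zero, mul_one]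
          exact mul_le_of_le_one_right (mul_nonneg (mul_nonneg (hw0 s) (hV0 s)) (hV0' s))
            (barrier_mem (vol := vol) (ρ := ρ) (XN N) γ β k₀ (scaleCount η k₀ N) x₁ s).2
      _ ≤ _ := h3
      _ ≤ A₂ * (C' * C') * Real.exp (γ ^ 2 * k₀) := by
          refine mul_le_mul_of_nonneg_left (Real.exp_le_exp.2 ?_) (by positivity)
          rw [← hr]
          have : γ ^ 2 * -r ≤ γ ^ 2 * k₀ := by gcongr
          simp only [mul_zero, zero_mul, sub_zero, ne_eq, OfNat.ofNat_ne_zero, not_false_eq_true,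
            zero_pow, zero_div, add_zero]
          linarith
      _ ≤ _ := by
          rw [← hE₂]
          have := Real.exp_pos (r * (-(γ ^ 2 / 2 + 2 * β * γ)))
          nlinarith

end BarrierBounds

/-! ### Vanishing correlations of the compensated kernel. -/

section PairLimit

variable {d : ℕ} {Ω : Type*} [MetricSpace Ω] [MeasurableSpace Ω] {vol : Measure Ω}
  {h : Ω → Ω → ℝ} {ρ : ℝ → Ω → Ω → ℝ} {S : ℕ → Type*} [∀ N, MeasurableSpace (S N)]
  {P : ∀ N, Measure (S N)} [∀ N, IsProbabilityMeasure (P N)] {XN : ∀ N, S N → Ω → ℝ}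
  {Ψ : ℂ → Ω → ℂ} {γ : ℝ}

lemma measurable_kernelD_field (hX : ∀ N x, Measurable fun s => XN N s x) {p : ℝ → ℝ} {φ : ℝ → ℂ}
    (hp : BandLimited p φ) (ε : ℝ) (N : ℕ) (b : ℝ) (x : Ω) :
    Measurable fun s => kernelD p ε N b (XN N s x - γ * Real.log N) :=
  (measurable_kernelD hp ε N).comp (measurable_const.prodMk ((hX N x).sub_const _))

lemma norm_kernelD_le {p : ℝ → ℝ} {C : ℝ} (hC : 0 ≤ C) (hp : ∀ y, |p y| ≤ C * wgt y) (ε : ℝ) (N : ℕ)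
    (b y : ℝ) : ‖kernelD p ε N b y‖ ≤ 2 * C * √(Real.log N) + 1 :=
  (abs_kernelD_le hp ε N b y).trans (kernelMaj_le hC ε N b y)

/-- The exact cancellation for which the multiple of p was chosen: the local term contributes
φ(0)√(2π) and the cutoff its own Gaussian mass. -/
lemma gaussian_integral_kernelD {φ : ℝ → ℂ} {ε : ℝ} (hε : 0 < ε)
    (h0 : φ 0 * √(2 * Real.pi) = cutoffMass ε) :
    ∫ u : ℝ, (φ 0 + ((-1 : ℝ) : ℂ) * ((tri (u / ε) / ε : ℝ) : ℂ)) * Real.exp (-u ^ 2 / 2) = 0 := by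
  have h1 : Integrable fun u : ℝ => φ 0 * ((Real.exp (-u ^ 2 / 2) : ℝ) : ℂ) :=
    (integrable_gaussian_half'.ofReal (𝕜 := ℂ)).const_mul _
  have h2 : Integrable fun u : ℝ => tri (u / ε) / ε * Real.exp (-u ^ 2 / 2) := by
    refine (integrable_tri_div hε).mul_bdd (c := 1) (by fun_prop) (ae_of_all _ fun u => ?_)
    rw [Real.norm_of_nonneg (Real.exp_pos _).le]
    exact Real.exp_le_one_iff.2 (by nlinarith [sq_nonneg u])
  have e : ∀ u : ℝ, (φ 0 + ((-1 : ℝ) : ℂ) * ((tri (u / ε) / ε : ℝ) : ℂ)) * Real.exp (-u ^ 2 / 2) =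
      φ 0 * ((Real.exp (-u ^ 2 / 2) : ℝ) : ℂ) -
        ((tri (u / ε) / ε * Real.exp (-u ^ 2 / 2) : ℝ) : ℂ) := by
    intro u
    push_cast
    ring
  simp_rw [e]
  have h3 : Integrable fun u : ℝ => ((tri (u / ε) / ε * Real.exp (-u ^ 2 / 2) : ℝ) : ℂ) := h2.ofReal
  rw [integral_sub h1 h3, integral_const_mul, integral_complex_ofReal,
    integral_complex_ofReal, integral_gaussian_half, h0, cutoffMass, sub_self]

/-- For a number m of scales that does not grow with N, the barriers are products of smooth
compactly supported functions of 2m smoothed fields. Against every real exponential of these fields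
w₁w₂D₁D₂ has vanishing expectation, because the Gaussian mass of the compensated kernel is 0; the
Fourier argument extends this to the barriers. -/
lemma MesoscopicAssumption.tendsto_finite_barrier [Nontrivial Ω]
    (hm : MesoscopicAssumption d P vol h ρ XN Ψ)
    (hX : ∀ N x, Measurable fun s => XN N s x)
    (hXs : ∀ N (k : ℕ) x, Measurable fun s => smoothed vol ρ (XN N) (Real.exp (-k)) x s)
    (h_cont : Continuous (fun p : Ω × Ω => h p.1 p.2)) (hγ : γ ∈ Icc 0 √(2 * d))
    {p : ℝ → ℝ} {φ : ℝ → ℂ} {C ε : ℝ} (hp : BandLimited p φ) (hC : 0 ≤ C) (hε : 0 < ε)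
    (hpC : ∀ y, |p y| ≤ C * wgt y) (h0 : φ 0 * √(2 * Real.pi) = cutoffMass ε) (g : Ω → ℝ)
    {β : ℝ} (hβ : 0 < β) {k₀ : ℕ} (hk₀ : 0 < k₀) (m : ℕ) {x₁ x₂ : Ω} (hne : x₁ ≠ x₂) :
    Tendsto (fun N : ℕ => ∫ s, wt (P N) (XN N) γ x₁ s * wt (P N) (XN N) γ x₂ s *
        kernelD p ε N (g x₁) (XN N s x₁ - γ * Real.log N) *
        kernelD p ε N (g x₂) (XN N s x₂ - γ * Real.log N) *
        (barrier vol ρ (XN N) γ β k₀ m x₁ s * barrier vol ρ (XN N) γ β k₀ m x₂ s) ∂(P N))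
      atTop (𝓝 0) := by
  -- The smoothed fields at x₁ and at x₂ are listed one after the other with the same scales, so
  -- that both barriers form a single product.
  let J : Fin (m + m) → ℕ := Fin.append (fun j : Fin m => k₀ + j) (fun j : Fin m => k₀ + j)
  let z : Fin (m + m) → Ω := Fin.append (fun _ => x₁) (fun _ => x₂)
  have hJ : ∀ j, 0 < J j := fun j => by
    refine Fin.addCases (fun i => ?_) (fun i => ?_) j
    · simp only [J, Fin.append_left]; omega
    · simp only [J, Fin.append_right]; omega
  have hz : ∀ j, z j ∈ ({x₁, x₂} : Set Ω) := fun j => by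
    refine Fin.addCases (fun i => ?_) (fun i => ?_) j
    · simp only [z, Fin.append_left]; simp
    · simp only [z, Fin.append_right]; simp
  let δ : Fin (m + m) → ℝ := fun j => Real.exp (-(J j))
  have hδ : ∀ j, δ j ∈ Ioc (0 : ℝ) 1 := fun j => exp_neg_mem_Ioc _
  let b : Fin (m + m) → ℝ → ℝ := fun j y => plateau (β * J j) (y - γ * J j)
  let D : ∀ N, S N → ℝ := fun N s => wt (P N) (XN N) γ x₁ s * wt (P N) (XN N) γ x₂ s *
        kernelD p ε N (g x₁) (XN N s x₁ - γ * Real.log N) *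
        kernelD p ε N (g x₂) (XN N s x₂ - γ * Real.log N)
  have hK : IsCompact ({x₁, x₂} : Set Ω) := (toFinite _).isCompact
  have hDe : ∀ N (ξ : Fin (m + m) → ℝ) s,
      D N s * Real.exp (∑ j, ξ j * smoothed vol ρ (XN N) (δ j) (z j) s) =
      pairWeight (P N) vol ρ (XN N) γ x₁ x₂ ξ δ z s *
        kernelD p ε N (g x₁) (XN N s x₁ - γ * Real.log N) *
        kernelD p ε N (g x₂) (XN N s x₂ - γ * Real.log N) := by
    intro N ξ s
    simp only [D, pairWeight, smoothWeight]
    ring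
  have key := tendsto_integral_mul_prod_of_tendsto_exp (P := P) (D := D)
    (Z := fun N j s => smoothed vol ρ (XN N) (δ j) (z j) s) (b := b) (fun N j => hXs N _ _)
    ?_ ?_ ?_ (fun j => ?_) (fun j => ?_)
  · refine key.congr fun N => integral_congr_ae (ae_of_all _ fun s => ?_)
    simp only [D]
    congr 1
    rw [Fin.prod_univ_add]
    simp only [b, δ, J, z, Fin.append_left, Fin.append_right]
    rw [barrier, barrier, Finset.prod_range, Finset.prod_range]
    rfl
  · filter_upwards [eventually_ge_atTop 1] with N hN ξ
    simp_rw [hDe]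
    exact ((hm.integrable_pairWeight hN hγ hne ξ δ z hδ).mul_bdd
      (measurable_kernelD_field hX hp ε N _ x₁).aestronglyMeasurable
      (ae_of_all _ fun s => norm_kernelD_le hC hpC ε N _ _)).mul_bdd
      (measurable_kernelD_field hX hp ε N _ x₂).aestronglyMeasurable
      (ae_of_all _ fun s => norm_kernelD_le hC hpC ε N _ _)
  · intro ξ
    obtain ⟨C', hC', R, hR, hker⟩ := kernelMaj_isKernel C hε
    obtain ⟨A, hA, hev⟩ := hm.two_point_bound hX h_cont hK (by norm_num : (0 : ℝ) < 1 / 2)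
      (by norm_num) hR ξ hγ
    have hδev : ∀ᶠ N : ℕ in atTop, ∀ j, (N : ℝ) ^ (-1 + (1 / 2 : ℝ)) ≤ δ j := by
      rw [eventually_all]
      intro j
      filter_upwards [eventually_rpow_le (by norm_num : (1 / 2 : ℝ) < 1) (hδ j).1] with N hN
      rwa [neg_add_eq_sub]
    refine ⟨A * (C' * C') * Real.exp (γ ^ 2 * cov h x₁ x₂ + γ * covLin vol h ρ ξ δ z x₁ +
        γ * covLin vol h ρ ξ δ z x₂ + 1 / 2 * covForm vol h (mollifierSum ρ ξ δ z)), ?_⟩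
    filter_upwards [hker, hev, hδev, eventually_ge_atTop 1,
      eventually_rpow_le (by norm_num : (1 / 2 : ℝ) < 1) (dist_pos.2 hne)] with N hkN hN hδN hN1 hd
    obtain ⟨k', hk'⟩ := hkN (g x₁)
    obtain ⟨k'', hk''⟩ := hkN (g x₂)
    have h1 := hN x₁ (by simp) x₂ (by simp) hd z hz δ (fun j => ⟨hδ j, hδN j⟩) k' k'' _ _ C' C'
      (γ * Real.log N) (γ * Real.log N) hC'.le hC'.le hk' hk''
    refine le_trans ?_ ((le_abs_self _).trans h1)
    have hpi := hm.integrable_pairWeight hN1 hγ hne ξ δ z hδ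
    have hpn : ∀ s, 0 ≤ pairWeight (P N) vol ρ (XN N) γ x₁ x₂ ξ δ z s := fun s =>
      mul_nonneg (mul_nonneg (wt_nonneg _ _ _ _ _) (wt_nonneg _ _ _ _ _)) (Real.exp_pos _).le
    have e : ∀ s, |D N s| * Real.exp (∑ j, ξ j * smoothed vol ρ (XN N) (δ j) (z j) s) =
        pairWeight (P N) vol ρ (XN N) γ x₁ x₂ ξ δ z s *
        |kernelD p ε N (g x₁) (XN N s x₁ - γ * Real.log N)| *
        |kernelD p ε N (g x₂) (XN N s x₂ - γ * Real.log N)| := by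
      intro s
      rw [← abs_of_pos (Real.exp_pos (∑ j, ξ j * smoothed vol ρ (XN N) (δ j) (z j) s)), ← abs_mul,
        hDe, abs_mul, abs_mul, abs_of_nonneg (hpn s)]
    simp_rw [e]
    refine integral_mono_of_nonneg (ae_of_all _ fun s => mul_nonneg (mul_nonneg (hpn s)
      (abs_nonneg _)) (abs_nonneg _)) ?_ (ae_of_all _ fun s => ?_)
    · exact (hpi.mul_bdd
        (measurable_kernelMaj_field (γ := γ) hX C ε N (g x₁) x₁).aestronglyMeasurable
        (ae_of_all _ fun s => norm_kernelMaj_le hC ε N _ _)).mul_bdd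
        (measurable_kernelMaj_field (γ := γ) hX C ε N (g x₂) x₂).aestronglyMeasurable
        (ae_of_all _ fun s => norm_kernelMaj_le hC ε N _ _)
    · exact mul_le_mul (mul_le_mul_of_nonneg_left (abs_kernelD_le hpC _ _ _ _) (hpn s))
        (abs_kernelD_le hpC _ _ _ _) (abs_nonneg _)
        (mul_nonneg (hpn s) (kernelMaj_nonneg hC _ _ _ _))
  · intro ξ
    simp_rw [hDe]
    obtain ⟨C', hC', R, hR, hker⟩ := kernelD_isKernel hp hε
    have hlimk : ∀ c u : ℝ, Tendsto (fun N : ℕ => φ (u / √(Real.log N)) *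
        Complex.exp ((u / √(Real.log N) : ℝ) * (-c : ℝ) * Complex.I) +
        ((-1 : ℝ) : ℂ) * ((tri (u / ε) / ε : ℝ) : ℂ)) atTop
        (𝓝 (φ 0 + ((-1 : ℝ) : ℂ) * ((tri (u / ε) / ε : ℝ) : ℂ))) := by
      intro c u
      have h1 : Tendsto (fun N : ℕ => u / √(Real.log N)) atTop (𝓝 0) :=
        tendsto_sqrt_log.const_div_atTop u
      have hcont : Continuous fun t : ℝ => φ t * Complex.exp ((t : ℂ) * (-c : ℝ) * Complex.I) +
          ((-1 : ℝ) : ℂ) * ((tri (u / ε) / ε : ℝ) : ℂ) := by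
        have := hp.continuous
        fun_prop
      have h2 := (hcont.tendsto 0).comp h1
      simp only [Function.comp_def, Complex.ofReal_zero, zero_mul, Complex.exp_zero, mul_one] at h2
      exact h2
    have h1 := hm.two_point_limit hX h_cont hγ hne ξ δ z hδ hC'.le hR
      (hker.mono fun N hN => hN (g x₁)) (hker.mono fun N hN => hN (g x₂))
      (hlimk (g x₁)) (hlimk (g x₂))
    rw [gaussian_integral_kernelD hε h0, mul_zero] at h1
    have h2 := (Complex.continuous_re.tendsto _).comp h1
    exact h2
  · exact (contDiff_plateau _).comp (contDiff_id.sub contDiff_const)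
  · exact hasCompactSupport_plateau_sub (by have := hJ j; positivity) _

lemma scaleCount_split {η : ℝ} {k₀ k₁ N : ℕ} (h01 : k₀ ≤ k₁)
    (hN : (k₁ : ℝ) ≤ (1 - η) * Real.log N) :
    scaleCount η k₀ N = (k₁ - k₀) + scaleCount η k₁ N := by
  have := Nat.le_floor hN
  unfold scaleCount
  omega

lemma barrier_split {S : Type*} (X : S → Ω → ℝ) (γ β : ℝ) {k₀ k₁ : ℕ} (h01 : k₀ ≤ k₁) (n : ℕ)
    (x : Ω) (s : S) : barrier vol ρ X γ β k₀ ((k₁ - k₀) + n) x s =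
      barrier vol ρ X γ β k₀ (k₁ - k₀) x s * barrier vol ρ X γ β k₁ n x s := by
  rw [barrier, Finset.prod_range_add]
  congr 1
  refine Finset.prod_congr rfl fun j _ => ?_
  rw [← add_assoc, Nat.add_sub_cancel' h01]

/-- The second moment of the compensated, barrier restricted density vanishes pointwise. -/
lemma MesoscopicAssumption.tendsto_barrier_pair [Nontrivial Ω]
    (hm : MesoscopicAssumption d P vol h ρ XN Ψ)
    (hX : ∀ N x, Measurable fun s => XN N s x)
    (hXs : ∀ N (k : ℕ) x, Measurable fun s => smoothed vol ρ (XN N) (Real.exp (-k)) x s)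
    (h_cont : Continuous (fun p : Ω × Ω => h p.1 p.2)) (h_symm : ∀ x y, h x y = h y x)
    {K : Set Ω} (hK : IsCompact K) {κ : ℕ} (hκ : 0 < κ) {B : ℝ} (hB : IsScaleBound vol h ρ K κ B)
    {η β : ℝ} (hη : 0 < η) (hη1 : η < 1) (hβ : 0 < β) (hγ : γ ∈ Icc 0 √(2 * d))
    (hγβ : γ + β ∈ Icc 0 √(2 * d))
    {p : ℝ → ℝ} {φ : ℝ → ℂ} {C ε : ℝ} (hp : BandLimited p φ) (hC : 0 ≤ C) (hε : 0 < ε)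
    (hpC : ∀ y, |p y| ≤ C * wgt y) (h0 : φ 0 * √(2 * Real.pi) = cutoffMass ε) (g : Ω → ℝ)
    {k₀ : ℕ} (hk₀ : 0 < k₀) {x₁ x₂ : Ω} (hx₁ : x₁ ∈ K) (hx₂ : x₂ ∈ K) (hne : x₁ ≠ x₂) :
    Tendsto (fun N : ℕ => ∫ s, wt (P N) (XN N) γ x₁ s * wt (P N) (XN N) γ x₂ s *
        kernelD p ε N (g x₁) (XN N s x₁ - γ * Real.log N) *
        kernelD p ε N (g x₂) (XN N s x₂ - γ * Real.log N) *
        ((barrier vol ρ (XN N) γ β k₀ (scaleCount η k₀ N) x₁ s *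
          cap β N (XN N s x₁ - γ * Real.log N)) *
         (barrier vol ρ (XN N) γ β k₀ (scaleCount η k₀ N) x₂ s *
          cap β N (XN N s x₂ - γ * Real.log N))) ∂(P N))
      atTop (𝓝 0) := by
  rw [Metric.tendsto_nhds]
  intro τ hτ
  obtain ⟨k₁, hk₁⟩ := hm.two_point_removal hX hXs h_cont h_symm hK hκ hB hη hη1 hβ hγ hγβ hC hε g
    hx₁ hx₂ hne (by positivity : 0 < τ / 4)
  obtain ⟨k₂, hk₂⟩ := hm.two_point_removal hX hXs h_cont h_symm hK hκ hB hη hη1 hβ hγ hγβ hC hε g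
    hx₂ hx₁ hne.symm (by positivity : 0 < τ / 4)
  -- The barriers are split at k: the fixed number of scales from k₀ to k is kept, and all finer
  -- scales together with the caps are removed at a cost of τ/4 for each point.
  set k := max k₀ (max k₁ k₂) with hk
  have hkk₀ : k₀ ≤ k := le_max_left _ _
  have hfin := hm.tendsto_finite_barrier hX hXs h_cont hγ hp hC hε hpC h0 g hβ hk₀ (k - k₀) hne
  have hLtop : Tendsto (fun N : ℕ => (1 - η) * Real.log N) atTop atTop :=
    (Real.tendsto_log_atTop.comp tendsto_natCast_atTop_atTop).const_mul_atTop (by linarith)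
  filter_upwards [hk₁ k ((le_max_left _ _).trans (le_max_right _ _)),
    hk₂ k ((le_max_right _ _).trans (le_max_right _ _)),
    hfin.eventually (Metric.ball_mem_nhds _ (by positivity : 0 < τ / 4)),
    hLtop.eventually_ge_atTop (k : ℝ), eventually_ge_atTop 1] with N h1 h2 h3 hkL hN
  rw [Real.dist_eq, sub_zero] at h3 ⊢
  have hVm₁ := measurable_kernelMaj_field (γ := γ) hX C ε N (g x₁) x₁
  have hVm₂ := measurable_kernelMaj_field (γ := γ) hX C ε N (g x₂) x₂
  have hDm₁ := measurable_kernelD_field (γ := γ) hX hp ε N (g x₁) x₁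
  have hDm₂ := measurable_kernelD_field (γ := γ) hX hp ε N (g x₂) x₂
  have hcm₁ := measurable_cap_field (γ := γ) hX β N x₁
  have hcm₂ := measurable_cap_field (γ := γ) hX β N x₂
  have hw0 := fun s => mul_nonneg (wt_nonneg (P N) (XN N) γ x₁ s) (wt_nonneg (P N) (XN N) γ x₂ s)
  have hWi := hm.integrable_wt_wt hN hγ hne
  have hWi' := hm.integrable_wt_wt hN hγ hne.symm
  let V₁ := fun s => kernelMaj C ε N (g x₁) (XN N s x₁ - γ * Real.log N)
  let V₂ := fun s => kernelMaj C ε N (g x₂) (XN N s x₂ - γ * Real.log N)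
  let D₁ := fun s => kernelD p ε N (g x₁) (XN N s x₁ - γ * Real.log N)
  let D₂ := fun s => kernelD p ε N (g x₂) (XN N s x₂ - γ * Real.log N)
  let c₁ := fun s => barrier vol ρ (XN N) γ β k (scaleCount η k N) x₁ s *
    cap β N (XN N s x₁ - γ * Real.log N)
  let c₂ := fun s => barrier vol ρ (XN N) γ β k (scaleCount η k N) x₂ s *
    cap β N (XN N s x₂ - γ * Real.log N)
  let b := fun s => barrier vol ρ (XN N) γ β k₀ (k - k₀) x₁ s *
    barrier vol ρ (XN N) γ β k₀ (k - k₀) x₂ s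
  let W := fun s => wt (P N) (XN N) γ x₁ s * wt (P N) (XN N) γ x₂ s
  have hcm₁' : Measurable c₁ := (measurable_barrier hXs β N k _ x₁).mul hcm₁
  have hcm₂' : Measurable c₂ := (measurable_barrier hXs β N k _ x₂).mul hcm₂
  have hbm : Measurable b := (measurable_barrier hXs β N k₀ _ x₁).mul (measurable_barrier hXs β N k₀ _ x₂)
  have mem_mul : ∀ {a b : ℝ}, a ∈ Icc (0 : ℝ) 1 → b ∈ Icc (0 : ℝ) 1 → a * b ∈ Icc (0 : ℝ) 1 :=
    fun ha hb => ⟨mul_nonneg ha.1 hb.1, mul_le_one₀ ha.2 hb.1 hb.2⟩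
  have hc₁ : ∀ s, c₁ s ∈ Icc (0 : ℝ) 1 := fun s => mem_mul (barrier_mem _ _ _ _ _ _ _) (cap_mem _ _ _)
  have hc₂ : ∀ s, c₂ s ∈ Icc (0 : ℝ) 1 := fun s => mem_mul (barrier_mem _ _ _ _ _ _ _) (cap_mem _ _ _)
  have hb : ∀ s, b s ∈ Icc (0 : ℝ) 1 := fun s =>
    mem_mul (barrier_mem _ _ _ _ _ _ _) (barrier_mem _ _ _ _ _ _ _)
  have habs : ∀ {a : ℝ}, a ∈ Icc (0 : ℝ) 1 → ‖a‖ ≤ 1 := fun ha => by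
    rw [Real.norm_of_nonneg ha.1]; exact ha.2
  have hsub : ∀ {a : ℝ}, a ∈ Icc (0 : ℝ) 1 → 1 - a ∈ Icc (0 : ℝ) 1 := fun ha =>
    ⟨by linarith [ha.2], by linarith [ha.1]⟩
  have hVi : Integrable (fun s => W s * V₁ s * V₂ s) (P N) :=
    (hWi.mul_bdd hVm₁.aestronglyMeasurable (ae_of_all _ fun s => norm_kernelMaj_le hC ε N _ _)).mul_bdd
      hVm₂.aestronglyMeasurable (ae_of_all _ fun s => norm_kernelMaj_le hC ε N _ _)
  have hDi : Integrable (fun s => W s * D₁ s * D₂ s) (P N) :=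
    (hWi.mul_bdd hDm₁.aestronglyMeasurable
      (ae_of_all _ fun s => norm_kernelD_le hC hpC ε N _ _)).mul_bdd
      hDm₂.aestronglyMeasurable (ae_of_all _ fun s => norm_kernelD_le hC hpC ε N _ _)
  have hV1i : Integrable (fun s => W s * V₁ s * V₂ s * (1 - c₁ s)) (P N) :=
    hVi.mul_bdd (hcm₁'.const_sub 1).aestronglyMeasurable (ae_of_all _ fun s => habs (hsub (hc₁ s)))
  have hV2i : Integrable (fun s => W s * V₁ s * V₂ s * (1 - c₂ s)) (P N) :=
    hVi.mul_bdd (hcm₂'.const_sub 1).aestronglyMeasurable (ae_of_all _ fun s => habs (hsub (hc₂ s)))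
  have hDbi : Integrable (fun s => W s * D₁ s * D₂ s * b s) (P N) :=
    hDi.mul_bdd hbm.aestronglyMeasurable (ae_of_all _ fun s => habs (hb s))
  have hDbci : Integrable (fun s => W s * D₁ s * D₂ s * b s * (c₁ s * c₂ s)) (P N) :=
    hDbi.mul_bdd (hcm₁'.mul hcm₂').aestronglyMeasurable
      (ae_of_all _ fun s => habs (mem_mul (hc₁ s) (hc₂ s)))
  have e1 : ∫ s, wt (P N) (XN N) γ x₁ s * wt (P N) (XN N) γ x₂ s *
        kernelD p ε N (g x₁) (XN N s x₁ - γ * Real.log N) *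
        kernelD p ε N (g x₂) (XN N s x₂ - γ * Real.log N) *
        ((barrier vol ρ (XN N) γ β k₀ (scaleCount η k₀ N) x₁ s *
          cap β N (XN N s x₁ - γ * Real.log N)) *
         (barrier vol ρ (XN N) γ β k₀ (scaleCount η k₀ N) x₂ s *
          cap β N (XN N s x₂ - γ * Real.log N))) ∂(P N) =
      ∫ s, W s * D₁ s * D₂ s * b s * (c₁ s * c₂ s) ∂(P N) := by
    refine integral_congr_ae (ae_of_all _ fun s => ?_)
    simp only [W, D₁, D₂, b, c₁, c₂]
    rw [scaleCount_split hkk₀ hkL, barrier_split _ _ _ hkk₀, barrier_split _ _ _ hkk₀]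
    ring
  have e2 : ∫ s, W s * V₁ s * V₂ s * (1 - c₂ s) ∂(P N) ≤ τ / 4 := by
    refine le_trans (le_of_eq ?_) h2
    refine integral_congr_ae (ae_of_all _ fun s => ?_)
    simp only [W, V₁, V₂, c₂]
    ring
  have h3' : |∫ s, W s * D₁ s * D₂ s * b s ∂(P N)| < τ / 4 := h3
  have h1' : ∫ s, W s * V₁ s * V₂ s * (1 - c₁ s) ∂(P N) ≤ τ / 4 := h1
  have hdiff : |∫ s, W s * D₁ s * D₂ s * b s * (c₁ s * c₂ s) ∂(P N) -
      ∫ s, W s * D₁ s * D₂ s * b s ∂(P N)| ≤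
      ∫ s, W s * V₁ s * V₂ s * (1 - c₁ s) + W s * V₁ s * V₂ s * (1 - c₂ s) ∂(P N) := by
    rw [← integral_sub hDbci hDbi, ← Real.norm_eq_abs]
    refine norm_integral_le_of_norm_le (hV1i.add hV2i) (ae_of_all _ fun s => ?_)
    have hWs : 0 ≤ W s := hw0 s
    have hd₁ : |D₁ s| ≤ V₁ s := abs_kernelD_le hpC _ _ _ _
    have hd₂ : |D₂ s| ≤ V₂ s := abs_kernelD_le hpC _ _ _ _
    have hV₁0 : 0 ≤ V₁ s := (abs_nonneg _).trans hd₁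
    -- Removing both factors costs at most the sum of removing each, so the removal estimate at x₁
    -- and the one with the points exchanged suffice.
    have h4 : |b s * (c₁ s * c₂ s - 1)| ≤ (1 - c₁ s) + (1 - c₂ s) := by
      have hb' := hb s
      have hc₁' := hc₁ s
      have hc₂' := hc₂ s
      have hm := mem_mul hc₁' hc₂'
      rw [abs_mul, abs_of_nonneg hb'.1, abs_of_nonpos (by linarith [hm.2])]
      nlinarith [hb'.2, hb'.1, hm.2, hm.1, hc₁'.1, hc₁'.2, hc₂'.1, hc₂'.2,
        mul_nonneg (sub_nonneg.2 hc₁'.2) (sub_nonneg.2 hc₂'.2)]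
    calc ‖W s * D₁ s * D₂ s * b s * (c₁ s * c₂ s) - W s * D₁ s * D₂ s * b s‖
        = W s * |D₁ s| * |D₂ s| * |b s * (c₁ s * c₂ s - 1)| := by
          rw [show W s * D₁ s * D₂ s * b s * (c₁ s * c₂ s) - W s * D₁ s * D₂ s * b s =
            W s * D₁ s * D₂ s * (b s * (c₁ s * c₂ s - 1)) by ring, Real.norm_eq_abs, abs_mul,
            abs_mul, abs_mul, abs_of_nonneg hWs]
      _ ≤ W s * V₁ s * V₂ s * ((1 - c₁ s) + (1 - c₂ s)) := by
          gcongr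
          exact mul_nonneg (mul_nonneg hWs hV₁0) ((abs_nonneg _).trans hd₂)
      _ = _ := by ring
  rw [integral_add hV1i hV2i] at hdiff
  rw [e1]
  rw [abs_le] at hdiff
  rw [abs_lt] at h3' ⊢
  constructor <;> linarith [hdiff.1, hdiff.2, h3'.1, h3'.2]

end PairLimit

/-! ### Volumes of balls -/

section Volume

variable {d : ℕ} {H : Type*} [TopologicalSpace H]
  {Ω : Type*} [MetricSpace Ω] [MeasurableSpace Ω] [BorelSpace Ω] [ChartedSpace H Ω]
  {I : ModelWithCorners ℝ (EuclideanSpace ℝ (Fin d)) H} {vol : Measure Ω}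

/-- In the chart a ball of radius r lies in a Euclidean ball of radius r/a, and the volume is at
most b times Lebesgue measure. -/
lemma IsLocallyEuclidean.local_ball_bound (hΩ : IsLocallyEuclidean I vol) (x₀ : Ω) :
    ∃ C > 0, ∃ ε > 0, ∀ x ∈ Metric.ball x₀ ε, ∀ r : ℝ, 0 < r → r < ε →
      vol (Metric.closedBall x r) ≤ ENNReal.ofReal (C * r ^ d) := by
  obtain ⟨U, hU, a, ha, b, hb, -, hdist, hvol⟩ := hΩ.comparable x₀
  obtain ⟨ε, hε, hεU⟩ := Metric.mem_nhds_iff.1 hU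
  set v := (volume (Metric.ball (0 : EuclideanSpace ℝ (Fin d)) 1)).toReal with hv
  have hv0 : 0 ≤ v := ENNReal.toReal_nonneg
  have hvfin : volume (Metric.ball (0 : EuclideanSpace ℝ (Fin d)) 1) = ENNReal.ofReal v :=
    (ENNReal.ofReal_toReal measure_ball_lt_top.ne).symm
  refine ⟨b * v / a ^ d + 1, by positivity, ε / 2, by positivity, fun x hx r hr hrε => ?_⟩
  have hsub : Metric.closedBall x r ⊆ U := by
    refine subset_trans (fun y hy => ?_) hεU
    rw [Metric.mem_closedBall] at hy
    rw [Metric.mem_ball] at hx ⊢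
    linarith [dist_triangle y x x₀]
  have hxU : x ∈ U := hsub (Metric.mem_closedBall_self hr.le)
  have himg : extChartAt I x₀ '' Metric.closedBall x r ⊆
      Metric.closedBall (extChartAt I x₀ x) (r / a) := by
    rintro _ ⟨y, hy, rfl⟩
    rw [Metric.mem_closedBall, le_div_iff₀ ha, mul_comm]
    exact ((hdist y (hsub hy) x hxU).1).trans hy
  refine ((hvol _ hsub Metric.isClosed_closedBall.measurableSet).2.trans
    (mul_le_mul_right (measure_mono himg) _)).trans ?_
  rw [Measure.addHaar_closedBall _ _ (by positivity), finrank_euclideanSpace_fin, hvfin,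
    ← ENNReal.ofReal_mul (by positivity), ← ENNReal.ofReal_mul hb.le]
  refine ENNReal.ofReal_le_ofReal ?_
  have e : b * ((r / a) ^ d * v) = b * v / a ^ d * r ^ d := by
    rw [div_pow]; field_simp
  rw [e, add_mul]
  have : 0 ≤ r ^ d := by positivity
  linarith

lemma IsLocallyEuclidean.isLocallyFiniteMeasure (hΩ : IsLocallyEuclidean I vol) :
    IsLocallyFiniteMeasure vol := by
  refine ⟨fun x => ?_⟩
  obtain ⟨C, hC, ε, hε, h⟩ := hΩ.local_ball_bound x
  exact ⟨_, Metric.closedBall_mem_nhds x (half_pos hε),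
    (h x (Metric.mem_ball_self hε) _ (half_pos hε) (half_lt_self hε)).trans_lt ENNReal.ofReal_lt_top⟩

lemma IsLocallyEuclidean.ball_bound (hΩ : IsLocallyEuclidean I vol) {K : Set Ω} (hK : IsCompact K) :
    ∃ C > 0, ∀ x ∈ K, ∀ r : ℝ, 0 < r →
      vol.restrict K (Metric.closedBall x r) ≤ ENNReal.ofReal (C * r ^ d) := by
  have := hΩ.isLocallyFiniteMeasure
  have hloc : ∃ C > 0, ∃ ε > 0, ∀ x ∈ K, ∀ r : ℝ, 0 < r → r < ε →
      vol (Metric.closedBall x r) ≤ ENNReal.ofReal (C * r ^ d) := by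
    refine hK.induction_on (p := fun K => ∃ C > 0, ∃ ε > 0, ∀ x ∈ K, ∀ r : ℝ, 0 < r → r < ε →
      vol (Metric.closedBall x r) ≤ ENNReal.ofReal (C * r ^ d)) ?_ ?_ ?_ ?_
    · exact ⟨1, one_pos, 1, one_pos, fun x hx => hx.elim⟩
    · rintro s t hst ⟨C, hC, ε, hε, h⟩
      exact ⟨C, hC, ε, hε, fun x hx => h x (hst hx)⟩
    · rintro s t ⟨C, hC, ε, hε, h⟩ ⟨C', hC', ε', hε', h'⟩
      refine ⟨max C C', by positivity, min ε ε', by positivity, ?_⟩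
      rintro x (hx | hx) r hr hrε
      · refine (h x hx r hr (hrε.trans_le (min_le_left _ _))).trans (ENNReal.ofReal_le_ofReal ?_)
        gcongr
        exact le_max_left _ _
      · refine (h' x hx r hr (hrε.trans_le (min_le_right _ _))).trans (ENNReal.ofReal_le_ofReal ?_)
        gcongr
        exact le_max_right _ _
    · intro x _
      obtain ⟨C, hC, ε, hε, h⟩ := hΩ.local_ball_bound x
      exact ⟨_, mem_nhdsWithin_of_mem_nhds (Metric.ball_mem_nhds x hε), C, hC, ε, hε, h⟩
  obtain ⟨C, hC, ε, hε, h⟩ := hloc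
  have hKfin : vol K < ⊤ := hK.measure_lt_top
  -- The second summand covers radii r ≥ ε, where the bound on the restricted measure is just its
  -- total mass.
  refine ⟨C + (vol K).toReal / ε ^ d, by positivity, fun x hx r hr => ?_⟩
  rcases lt_or_ge r ε with hrε | hrε
  · refine ((Measure.restrict_apply_le _ _).trans (h x hx r hr hrε)).trans
      (ENNReal.ofReal_le_ofReal ?_)
    have : 0 ≤ (vol K).toReal / ε ^ d := by positivity
    gcongr
    linarith
  · calc vol.restrict K (Metric.closedBall x r) ≤ vol.restrict K univ := measure_mono (subset_univ _)
      _ = ENNReal.ofReal (vol K).toReal := by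
          rw [Measure.restrict_apply_univ, ENNReal.ofReal_toReal hKfin.ne]
      _ ≤ _ := by
          refine ENNReal.ofReal_le_ofReal ?_
          have h1 : ε ^ d ≤ r ^ d := by gcongr
          have h2 : (vol K).toReal = (vol K).toReal / ε ^ d * ε ^ d := by field_simp
          calc (vol K).toReal = (vol K).toReal / ε ^ d * ε ^ d := h2
            _ ≤ (vol K).toReal / ε ^ d * r ^ d := by gcongr
            _ ≤ _ := by
                have : 0 ≤ C * r ^ d := by positivity
                rw [add_mul]; linarith

end Volume

/-! ### Finiteness of Riesz energies. -/

section RieszKernel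

variable {Ω : Type*} [MetricSpace Ω] [MeasurableSpace Ω] [BorelSpace Ω] [SecondCountableTopology Ω]
  {m : Measure Ω} [IsFiniteMeasure m] {C : ℝ} {d : ℕ}

lemma measure_prod_dist_le (hC : ∀ᵐ x ∂m, ∀ r : ℝ, 0 < r →
      m (Metric.closedBall x r) ≤ ENNReal.ofReal (C * r ^ d)) {r : ℝ} (hr : 0 < r) :
    (m.prod m) {q : Ω × Ω | dist q.1 q.2 ≤ r} ≤ ENNReal.ofReal (C * r ^ d) * m univ := by
  rw [Measure.prod_apply (measurableSet_le (measurable_fst.dist measurable_snd) measurable_const)]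
  calc _ ≤ ∫⁻ _, ENNReal.ofReal (C * r ^ d) ∂m := by
        refine lintegral_mono_ae ?_
        filter_upwards [hC] with x hx
        refine (measure_mono fun y hy => ?_).trans (hx r hr)
        rw [Metric.mem_closedBall, dist_comm]
        exact hy
    _ = _ := by rw [lintegral_const]

/-- For r < 1 the single term with k = ⌊−log r⌋ already dominates r^{-α}. -/
lemma rpow_neg_le_tsum {α r : ℝ} (hα : 0 ≤ α) (hr : 0 < r) :
    ENNReal.ofReal (r ^ (-α)) ≤ 1 + ∑' k : ℕ, ENNReal.ofReal (Real.exp (α * (k + 1))) *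
      (Iic (Real.exp (-k))).indicator 1 r := by
  rcases le_or_gt 1 r with h | h
  · refine le_add_of_le_of_nonneg ?_ zero_le
    rw [ENNReal.ofReal_le_one]
    exact Real.rpow_le_one_of_one_le_of_nonpos h (by linarith)
  · refine le_add_of_nonneg_of_le zero_le ?_
    have hl : 0 ≤ -Real.log r := by linarith [Real.log_nonpos hr.le h.le]
    refine le_trans ?_ (ENNReal.le_tsum ⌊-Real.log r⌋₊)
    have h1 : (⌊-Real.log r⌋₊ : ℝ) ≤ -Real.log r := Nat.floor_le hl
    have h2 : -Real.log r < ⌊-Real.log r⌋₊ + 1 := Nat.lt_floor_add_one _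
    have hmem : r ∈ Iic (Real.exp (-(⌊-Real.log r⌋₊ : ℝ))) := by
      rw [mem_Iic, ← Real.log_le_iff_le_exp hr]
      linarith
    rw [indicator_of_mem hmem, Pi.one_apply, mul_one, Real.rpow_def_of_pos hr]
    refine ENNReal.ofReal_le_ofReal (Real.exp_le_exp.2 ?_)
    nlinarith

/-- On pairs at distance about e^{-k} the kernel is of order e^{αk} and the measure of order
e^{-dk}, so the energy is dominated by a geometric series of ratio e^{α−d}. -/
lemma lintegral_dist_rpow_neg_lt_top (hC0 : 0 ≤ C) (hC : ∀ᵐ x ∂m, ∀ r : ℝ, 0 < r →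
      m (Metric.closedBall x r) ≤ ENNReal.ofReal (C * r ^ d)) {α : ℝ} (hα : 0 ≤ α) (hαd : α < d) :
    ∫⁻ q : Ω × Ω, ENNReal.ofReal ((dist q.1 q.2) ^ (-α)) ∂(m.prod m) < ⊤ := by
  have hdm : Measurable fun q : Ω × Ω => dist q.1 q.2 := measurable_fst.dist measurable_snd
  have hmeas : ∀ k : ℕ, Measurable fun q : Ω × Ω => ENNReal.ofReal (Real.exp (α * (k + 1))) *
      (Iic (Real.exp (-k))).indicator 1 (dist q.1 q.2) := fun k =>
    ((measurable_one.indicator measurableSet_Iic).comp hdm).const_mul _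
  have hle : ∀ q : Ω × Ω, ENNReal.ofReal ((dist q.1 q.2) ^ (-α)) ≤
      1 + ∑' k : ℕ, ENNReal.ofReal (Real.exp (α * (k + 1))) *
      (Iic (Real.exp (-k))).indicator 1 (dist q.1 q.2) := by
    intro q
    rcases dist_nonneg.eq_or_lt (a := (0 : ℝ)) (b := dist q.1 q.2) with h0 | h0
    -- On the diagonal a real power of 0 is 0, or 1 when α = 0, so the diagonal causes no
    -- divergence.
    · rw [← h0]
      refine le_add_of_le_of_nonneg ?_ zero_le
      rw [ENNReal.ofReal_le_one]
      rcases hα.eq_or_lt with h1 | h1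
      · rw [← h1, neg_zero, Real.rpow_zero]
      · rw [Real.zero_rpow (by linarith)]; exact zero_le_one
    · exact rpow_neg_le_tsum hα h0
  refine (lintegral_mono hle).trans_lt ?_
  rw [lintegral_add_left measurable_const, lintegral_const, one_mul,
    lintegral_tsum fun k => (hmeas k).aemeasurable]
  refine ENNReal.add_lt_top.2 ⟨measure_lt_top _ _, ?_⟩
  have hterm : ∀ k : ℕ, ∫⁻ q : Ω × Ω, ENNReal.ofReal (Real.exp (α * (k + 1))) *
      (Iic (Real.exp (-k))).indicator 1 (dist q.1 q.2) ∂(m.prod m) ≤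
      ENNReal.ofReal (Real.exp α * C * Real.exp (α - d) ^ k) * m univ := by
    intro k
    have hmI : Measurable fun q : Ω × Ω =>
        (Iic (Real.exp (-(k : ℝ)))).indicator (1 : ℝ → ENNReal) (dist q.1 q.2) :=
      (measurable_one.indicator measurableSet_Iic).comp hdm
    rw [lintegral_const_mul _ hmI]
    have e : ∫⁻ q : Ω × Ω, (Iic (Real.exp (-k))).indicator 1 (dist q.1 q.2) ∂(m.prod m) =
        (m.prod m) {q : Ω × Ω | dist q.1 q.2 ≤ Real.exp (-k)} := by
      rw [← lintegral_indicator_one (measurableSet_le hdm measurable_const)]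
      rfl
    rw [e]
    refine (mul_le_mul_right (measure_prod_dist_le hC (Real.exp_pos _)) _).trans (le_of_eq ?_)
    rw [← mul_assoc, ← ENNReal.ofReal_mul (Real.exp_pos _).le]
    congr 2
    rw [← Real.exp_nat_mul, ← Real.exp_nat_mul]
    have : Real.exp (α * (k + 1)) * Real.exp (d * -k) = Real.exp α * Real.exp (k * (α - d)) := by
      rw [← Real.exp_add, ← Real.exp_add]; congr 1; ring
    linear_combination C * this
  refine (ENNReal.tsum_le_tsum hterm).trans_lt ?_
  rw [ENNReal.tsum_mul_right]
  refine ENNReal.mul_lt_top ?_ (measure_lt_top _ _)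
  have hs : Summable fun k : ℕ => Real.exp α * C * Real.exp (α - d) ^ k :=
    (summable_geometric_of_lt_one (Real.exp_pos _).le (Real.exp_lt_one_iff.2 (by linarith))).mul_left _
  rw [← ENNReal.ofReal_tsum_of_nonneg (fun k => by positivity) hs]
  exact ENNReal.ofReal_lt_top

end RieszKernel

/-! ### From pair correlations to convergence in L¹. -/

section SecondMoment

variable {Ω : Type*} [MeasurableSpace Ω] {m : Measure Ω} [IsFiniteMeasure m]
  {S : ℕ → Type*} [∀ N, MeasurableSpace (S N)] {P : ∀ N, Measure (S N)}
  [∀ N, IsProbabilityMeasure (P N)]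

/-- The square of a spatial integral is a double integral, and Fubini moves the expectation inside.
The bound M may depend on N in applications; it only provides integrability. -/
lemma integral_sq_le_lintegral_pair {T : Type*} [MeasurableSpace T] {Q : Measure T}
    [IsProbabilityMeasure Q] {G : T → Ω → ℝ} (hG : Measurable fun q : T × Ω => G q.1 q.2) {M : ℝ}
    (hM : ∀ s x, |G s x| ≤ M) :
    ENNReal.ofReal (∫ s, (∫ x, G s x ∂m) ^ 2 ∂Q) ≤
      ∫⁻ q : Ω × Ω, ‖∫ s, G s q.1 * G s q.2 ∂Q‖ₑ ∂(m.prod m) := by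
  have hm3 : Measurable fun t : T × (Ω × Ω) => G t.1 t.2.1 * G t.1 t.2.2 :=
    (hG.comp (measurable_fst.prodMk (measurable_fst.comp measurable_snd))).mul
      (hG.comp (measurable_fst.prodMk (measurable_snd.comp measurable_snd)))
  have hi : Integrable (fun t : T × (Ω × Ω) => G t.1 t.2.1 * G t.1 t.2.2) (Q.prod (m.prod m)) := by
    refine Integrable.of_bound hm3.aestronglyMeasurable (M * M) (ae_of_all _ fun t => ?_)
    rw [norm_mul]
    exact mul_le_mul (hM _ _) (hM _ _) (norm_nonneg _) ((abs_nonneg _).trans (hM t.1 t.2.1))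
  have e : ∫ s, (∫ x, G s x ∂m) ^ 2 ∂Q = ∫ q : Ω × Ω, ∫ s, G s q.1 * G s q.2 ∂Q ∂(m.prod m) := by
    rw [← integral_integral_swap (f := fun s (q : Ω × Ω) => G s q.1 * G s q.2) hi]
    refine integral_congr_ae (ae_of_all _ fun s => ?_)
    simp only
    rw [integral_prod_mul, pow_two]
  rw [e]
  refine (ENNReal.ofReal_le_ofReal (le_abs_self _)).trans ?_
  rw [← Real.norm_eq_abs, ofReal_norm]
  exact enorm_integral_le_lintegral_enorm _

lemma tendsto_lintegral_enorm_of_pair {G : ∀ N, S N → Ω → ℝ}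
    (hG : ∀ N, Measurable fun q : S N × Ω => G N q.1 q.2)
    (hM : ∀ᶠ N in atTop, ∃ M, ∀ s x, |G N s x| ≤ M)
    (hlim : Tendsto (fun N => ∫⁻ q : Ω × Ω, ‖∫ s, G N s q.1 * G N s q.2 ∂(P N)‖ₑ ∂(m.prod m))
      atTop (𝓝 0)) :
    Tendsto (fun N => ∫⁻ s, ‖∫ x, G N s x ∂m‖ₑ ∂(P N)) atTop (𝓝 0) := by
  rw [ENNReal.tendsto_nhds_zero] at hlim ⊢
  intro τ hτ
  obtain ⟨t, ht, htτ⟩ : ∃ t : ℝ, 0 < t ∧ ENNReal.ofReal (2 * t) ≤ τ := by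
    rcases eq_or_ne τ ⊤ with rfl | hτt
    · exact ⟨1, one_pos, le_top⟩
    · refine ⟨τ.toReal / 2, half_pos (ENNReal.toReal_pos hτ.ne' hτt), ?_⟩
      rw [mul_div_cancel₀ _ two_ne_zero, ENNReal.ofReal_toReal hτt]
  filter_upwards [hlim (ENNReal.ofReal (t ^ 2)) (by simpa using by positivity), hM] with N h1 hMN
  obtain ⟨M, hMN⟩ := hMN
  have h2 := (integral_sq_le_lintegral_pair (m := m) (Q := P N) (hG N) hMN).trans h1
  rw [ENNReal.ofReal_le_ofReal_iff (by positivity)] at h2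
  have hAm : Measurable fun s => ∫ x, G N s x ∂m :=
    ((hG N).stronglyMeasurable.integral_prod_right' (ν := m)).measurable
  have hAb : ∀ s, ‖∫ x, G N s x ∂m‖ ≤ M * m.real univ := fun s =>
    norm_integral_le_of_norm_le_const (ae_of_all _ fun x => hMN s x)
  have hAi : Integrable (fun s => ∫ x, G N s x ∂m) (P N) :=
    Integrable.of_bound hAm.aestronglyMeasurable _ (ae_of_all _ hAb)
  have hA2i : Integrable (fun s => (∫ x, G N s x ∂m) ^ 2) (P N) := by
    refine Integrable.of_bound (hAm.pow_const 2).aestronglyMeasurable ((M * m.real univ) ^ 2)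
      (ae_of_all _ fun s => ?_)
    rw [norm_pow]
    exact pow_le_pow_left₀ (norm_nonneg _) (hAb s) 2
  rw [← ofReal_integral_norm_eq_lintegral_enorm hAi]
  refine (ENNReal.ofReal_le_ofReal ?_).trans htτ
  -- |a| ≤ t + a²/t takes the place of Cauchy–Schwarz: a second moment at most t² gives a first
  -- moment at most 2t.
  calc ∫ s, ‖∫ x, G N s x ∂m‖ ∂(P N) ≤ ∫ s, (t + t⁻¹ * (∫ x, G N s x ∂m) ^ 2) ∂(P N) := by
        refine integral_mono hAi.norm ((integrable_const t).add (hA2i.const_mul _)) fun s => ?_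
        simp only [Real.norm_eq_abs]
        set a := ∫ x, G N s x ∂m
        rw [← sq_abs a, ← mul_le_mul_iff_right₀ ht]
        have e : t * (t + t⁻¹ * |a| ^ 2) = t ^ 2 + |a| ^ 2 := by field_simp
        rw [e]
        nlinarith [sq_nonneg (t - |a|), abs_nonneg a]
    _ = t + t⁻¹ * ∫ s, (∫ x, G N s x ∂m) ^ 2 ∂(P N) := by
        rw [integral_add (integrable_const t) (hA2i.const_mul _), integral_const_mul]
        simp
    _ ≤ t + t⁻¹ * t ^ 2 := by gcongr
    _ = 2 * t := by field_simp; ring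

end SecondMoment

/-! ### Joint measurability -/

section Measurability

variable {Ω : Type*} [MetricSpace Ω] [MeasurableSpace Ω] [BorelSpace Ω] [SecondCountableTopology Ω]
  {vol : Measure Ω} [SFinite vol] {ρ : ℝ → Ω → Ω → ℝ}
  {S : Type*} [MeasurableSpace S] {P : Measure S} [SFinite P] {X : S → Ω → ℝ} {γ : ℝ}

lemma measurable_smoothed (hρ : IsApproximateIdentity vol ρ)
    (hX : Measurable fun q : S × Ω => X q.1 q.2) {δ : ℝ} (hδ : δ ∈ Ioc (0 : ℝ) 1) :
    Measurable fun q : S × Ω => smoothed vol ρ X δ q.2 q.1 := by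
  have hc : Continuous fun q : Ω × Ω => ρ δ q.1 q.2 := by
    have h1 : Continuous fun q : Ω × Ω => (δ, q) := by fun_prop
    exact hρ.continuousOn.comp_continuous h1 fun q => ⟨hδ, mem_univ _⟩
  have hm : Measurable fun t : (S × Ω) × Ω => X t.1.1 t.2 * ρ δ t.1.2 t.2 :=
    (hX.comp ((measurable_fst.comp measurable_fst).prodMk measurable_snd)).mul
      (hc.measurable.comp ((measurable_snd.comp measurable_fst).prodMk measurable_snd))
  exact (hm.stronglyMeasurable.integral_prod_right' (ν := vol)).measurable

lemma measurable_expMean (hX : Measurable fun q : S × Ω => X q.1 q.2) :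
    Measurable fun x => expMean P X γ x := by
  have hm : Measurable fun q : S × Ω => Real.exp (γ * X q.1 q.2) := (hX.const_mul γ).exp
  exact (hm.stronglyMeasurable.integral_prod_left' (μ := P)).measurable

lemma measurable_wt (hX : Measurable fun q : S × Ω => X q.1 q.2) :
    Measurable fun q : S × Ω => wt P X γ q.2 q.1 :=
  (hX.const_mul γ).exp.div ((measurable_expMean hX).comp measurable_snd)

lemma measurable_tailMass (hX : Measurable fun q : S × Ω => X q.1 q.2) (N : ℕ) (b : ℝ) :
    Measurable fun x => tailMass P X γ N x b := by
  have hm : Measurable fun q : S × Ω => wt P X γ q.2 q.1 *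
      (√(Real.log N) * expTail γ ((X q.1 q.2 - γ * Real.log N) - b)) :=
    (measurable_wt hX).mul (((measurable_expTail γ).comp
      ((hX.sub_const _).sub_const _)).const_mul _)
  exact (hm.stronglyMeasurable.integral_prod_left' (μ := P)).measurable

lemma measurable_thickRatio (hX : Measurable fun q : S × Ω => X q.1 q.2) (N : ℕ) {g : Ω → ℝ}
    (hg : Measurable g) : Measurable fun q : S × Ω => thickRatio P X γ N q.2 (g q.2) q.1 :=
  (((measurable_expTail γ).comp
      ((hX.sub_const _).sub (hg.comp measurable_snd))).const_mul _).div
      ((measurable_tailMass hX N 0).comp measurable_snd)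

lemma measurable_barrier_joint (hρ : IsApproximateIdentity vol ρ)
    (hX : Measurable fun q : S × Ω => X q.1 q.2) (β : ℝ) (k₀ m : ℕ) :
    Measurable fun q : S × Ω => barrier vol ρ X γ β k₀ m q.2 q.1 :=
  Finset.measurable_prod _ fun _ _ => (contDiff_plateau _).continuous.measurable.comp
    ((measurable_smoothed hρ hX (exp_neg_mem_Ioc _)).sub_const _)

/-- The compensated density restricted by barrier and cap. -/
def barrierDensity {S : Type*} [MeasurableSpace S] (P : Measure S) (vol : Measure Ω)
    (ρ : ℝ → Ω → Ω → ℝ) (X : S → Ω → ℝ) (γ β : ℝ) (p : ℝ → ℝ) (ε : ℝ) (g : Ω → ℝ) (k₀ n N : ℕ)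
    (x : Ω) (s : S) : ℝ :=
  wt P X γ x s * kernelD p ε N (g x) (X s x - γ * Real.log N) *
    (barrier vol ρ X γ β k₀ n x s * cap β N (X s x - γ * Real.log N))

lemma measurable_barrierDensity (hρ : IsApproximateIdentity vol ρ)
    (hX : Measurable fun q : S × Ω => X q.1 q.2) (β : ℝ) {p : ℝ → ℝ} {φ : ℝ → ℂ}
    (hp : BandLimited p φ) (ε : ℝ) {g : Ω → ℝ} (hg : Measurable g) (k₀ n N : ℕ) :
    Measurable fun q : S × Ω => barrierDensity P vol ρ X γ β p ε g k₀ n N q.2 q.1 :=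
  ((measurable_wt hX).mul ((measurable_kernelD hp ε N).comp
    ((hg.comp measurable_snd).prodMk (hX.sub_const _)))).mul
    ((measurable_barrier_joint hρ hX β k₀ n).mul ((measurable_cap β N).comp (hX.sub_const _)))

end Measurability

/-! ### Second moments of the barrier restricted density -/

section Density

variable {d : ℕ} {Ω : Type*} [MetricSpace Ω] [MeasurableSpace Ω] [BorelSpace Ω]
  [SecondCountableTopology Ω] {vol : Measure Ω} [SFinite vol]
  {h : Ω → Ω → ℝ} {ρ : ℝ → Ω → Ω → ℝ} {S : ℕ → Type*} [∀ N, MeasurableSpace (S N)]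
  {P : ∀ N, Measure (S N)} [∀ N, IsProbabilityMeasure (P N)] {XN : ∀ N, S N → Ω → ℝ}
  {Ψ : ℂ → Ω → ℂ} {γ : ℝ}

lemma measurable_apply (hX : ∀ N, Measurable fun q : S N × Ω => XN N q.1 q.2) (N : ℕ) (x : Ω) :
    Measurable fun s => XN N s x := (hX N).comp (measurable_id.prodMk measurable_const)

/-- Under the cap X ≤ (γ + β) log N, so e^{γX} ≤ N^{γ²+γβ}, and the normalization is of order
N^{γ²/2}. -/
lemma MesoscopicAssumption.wt_mul_cap_le [Nontrivial Ω]
    (hm : MesoscopicAssumption d P vol h ρ XN Ψ)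
    {K : Set Ω} (hK : IsCompact K) {β : ℝ} (hγ : γ ∈ Icc 0 √(2 * d)) :
    ∃ A > 0, ∀ᶠ N : ℕ in atTop, ∀ x ∈ K, ∀ s,
      wt (P N) (XN N) γ x s * cap β N (XN N s x - γ * Real.log N) ≤
        A * Real.exp ((γ ^ 2 / 2 + γ * β) * Real.log N) := by
  obtain ⟨c₀, hc₀, _, _, h1⟩ := hm.expMean_bounds hK hγ
  refine ⟨c₀⁻¹, by positivity, ?_⟩
  filter_upwards [h1] with N hN x hx s
  unfold cap
  split_ifs with hy
  · have hZ := (hN x hx).1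
    rw [mul_one, wt, div_eq_mul_inv]
    calc _ ≤ Real.exp (γ * (γ * Real.log N + β * Real.log N)) *
          (c₀ * Real.exp (γ ^ 2 / 2 * Real.log N))⁻¹ := by
          refine mul_le_mul (Real.exp_le_exp.2 (mul_le_mul_of_nonneg_left (by linarith) hγ.1))
            (inv_anti₀ (by positivity) hZ) (inv_nonneg.2 (expMean_nonneg _ _ _ _))
            (Real.exp_pos _).le
      _ = c₀⁻¹ * (Real.exp (γ * (γ * Real.log N + β * Real.log N)) *
          (Real.exp (γ ^ 2 / 2 * Real.log N))⁻¹) := by rw [mul_inv]; ring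
      _ = _ := by
          rw [← Real.exp_neg, ← Real.exp_add]
          congr 2
          ring
  · rw [mul_zero]
    positivity

variable {β C ε : ℝ} {p : ℝ → ℝ}

lemma abs_barrierDensity_le (hC : 0 ≤ C) (hpC : ∀ y, |p y| ≤ C * wgt y) (g : Ω → ℝ) (k₀ n N : ℕ)
    (x : Ω) (s : S N) :
    |barrierDensity (P N) vol ρ (XN N) γ β p ε g k₀ n N x s| ≤ (2 * C * √(Real.log N) + 1) *
      (wt (P N) (XN N) γ x s * cap β N (XN N s x - γ * Real.log N)) := by
  have hw := wt_nonneg (P N) (XN N) γ x s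
  have hc := cap_mem β N (XN N s x - γ * Real.log N)
  have hb := barrier_mem (vol := vol) (ρ := ρ) (XN N) γ β k₀ n x s
  have hD : |kernelD p ε N (g x) (XN N s x - γ * Real.log N)| ≤ 2 * C * √(Real.log N) + 1 :=
    norm_kernelD_le hC hpC ε N _ _
  rw [barrierDensity, abs_mul, abs_mul, abs_mul, abs_of_nonneg hw, abs_of_nonneg hb.1,
    abs_of_nonneg hc.1]
  calc _ ≤ wt (P N) (XN N) γ x s * (2 * C * √(Real.log N) + 1) *
        (1 * cap β N (XN N s x - γ * Real.log N)) := by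
        have := (abs_nonneg _).trans hD
        have := hc.1
        gcongr
        · exact mul_nonneg hb.1 hc.1
        · exact hb.2
    _ = _ := by ring

lemma MesoscopicAssumption.exists_bound_barrierDensity [Nontrivial Ω]
    (hm : MesoscopicAssumption d P vol h ρ XN Ψ) {K : Set Ω} (hK : IsCompact K)
    (hγ : γ ∈ Icc 0 √(2 * d)) (hC : 0 ≤ C) (hpC : ∀ y, |p y| ≤ C * wgt y) (g : Ω → ℝ) (k₀ : ℕ)
    (n : ℕ → ℕ) :
    ∃ A > 0, ∀ᶠ N : ℕ in atTop, ∀ x ∈ K, ∀ s,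
      |barrierDensity (P N) vol ρ (XN N) γ β p ε g k₀ (n N) N x s| ≤
      A * ((2 * C * √(Real.log N) + 1) * Real.exp ((γ ^ 2 / 2 + γ * β) * Real.log N)) := by
  obtain ⟨A, hA, hev⟩ := hm.wt_mul_cap_le (β := β) hK hγ
  refine ⟨A, hA, ?_⟩
  filter_upwards [hev] with N hN x hx s
  refine (abs_barrierDensity_le hC hpC g k₀ (n N) N x s).trans ?_
  rw [mul_left_comm A]
  exact mul_le_mul_of_nonneg_left (hN x hx s) (by positivity)

/-- Where nothing is known about the joint law, one density is bounded by its supremum under the cap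
and the other by w, whose mean is 1. -/
lemma MesoscopicAssumption.near_diagonal_bound [Nontrivial Ω]
    (hm : MesoscopicAssumption d P vol h ρ XN Ψ) {K : Set Ω} (hK : IsCompact K)
    (hγ : γ ∈ Icc 0 √(2 * d)) (hC : 0 ≤ C) (hpC : ∀ y, |p y| ≤ C * wgt y) (g : Ω → ℝ) (k₀ : ℕ)
    (n : ℕ → ℕ) :
    ∃ A > 0, ∀ᶠ N : ℕ in atTop, ∀ x₁ ∈ K, ∀ x₂ ∈ K,
      |∫ s, barrierDensity (P N) vol ρ (XN N) γ β p ε g k₀ (n N) N x₁ s *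
        barrierDensity (P N) vol ρ (XN N) γ β p ε g k₀ (n N) N x₂ s ∂(P N)| ≤
      A * ((2 * C * √(Real.log N) + 1) ^ 2 * Real.exp ((γ ^ 2 / 2 + γ * β) * Real.log N)) := by
  obtain ⟨A, hA, hev⟩ := hm.exists_bound_barrierDensity (β := β) (ε := ε) hK hγ hC hpC g k₀ n
  refine ⟨A, hA, ?_⟩
  filter_upwards [hev, eventually_ge_atTop 1] with N hN hN1 x₁ hx₁ x₂ hx₂
  set E := A * ((2 * C * √(Real.log N) + 1) * Real.exp ((γ ^ 2 / 2 + γ * β) * Real.log N))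
  set F := 2 * C * √(Real.log N) + 1
  have hF : 0 ≤ F := by positivity
  have hi := hm.integrable_wt hN1 hγ x₁
  rw [← Real.norm_eq_abs]
  refine (norm_integral_le_of_norm_le (hi.const_mul (F * E)) (ae_of_all _ fun s => ?_)).trans ?_
  · rw [norm_mul, Real.norm_eq_abs, Real.norm_eq_abs]
    have h1 := abs_barrierDensity_le (P := P) (vol := vol) (ρ := ρ) (XN := XN) (γ := γ) (β := β)
      (ε := ε) hC hpC g k₀ (n N) N x₁ s
    have h2 : wt (P N) (XN N) γ x₁ s * cap β N (XN N s x₁ - γ * Real.log N) ≤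
        wt (P N) (XN N) γ x₁ s :=
      mul_le_of_le_one_right (wt_nonneg _ _ _ _ _) (cap_mem _ _ _).2
    calc _ ≤ (F * wt (P N) (XN N) γ x₁ s) * E :=
          mul_le_mul (h1.trans (mul_le_mul_of_nonneg_left h2 hF)) (hN x₂ hx₂ s) (abs_nonneg _)
            (mul_nonneg hF (wt_nonneg _ _ _ _ _))
      _ = _ := by ring
  · rw [integral_const_mul, hm.integral_wt hN1 hγ x₁, mul_one]
    apply le_of_eq
    simp only [E]
    ring

/-- Only the barrier at x₁ is kept; the barrier at x₂ and both caps are bounded by 1. -/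
lemma MesoscopicAssumption.mesoscopic_bound [Nontrivial Ω]
    (hm : MesoscopicAssumption d P vol h ρ XN Ψ)
    (hX : ∀ N, Measurable fun q : S N × Ω => XN N q.1 q.2)
    (hXs : ∀ N (k : ℕ) x, Measurable fun s => smoothed vol ρ (XN N) (Real.exp (-k)) x s)
    (h_cont : Continuous (fun p : Ω × Ω => h p.1 p.2)) (h_symm : ∀ x y, h x y = h y x)
    {K : Set Ω} (hK : IsCompact K) {k₀ : ℕ} (hk₀ : 0 < k₀) {B : ℝ}
    (hB : IsScaleBound vol h ρ K k₀ B)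
    {η : ℝ} (hη : 0 < η) (hη1 : η < 1) (hβ : 0 < β) (hγ : γ ∈ Icc 0 √(2 * d))
    (hC : 0 ≤ C) (hε : 0 < ε) (hpC : ∀ y, |p y| ≤ C * wgt y) (g : Ω → ℝ) :
    ∃ A > 0, ∀ᶠ N : ℕ in atTop, ∀ x₁ ∈ K, ∀ x₂ ∈ K, (N : ℝ) ^ (η - 1) ≤ dist x₁ x₂ →
      |∫ s, barrierDensity (P N) vol ρ (XN N) γ β p ε g k₀ (scaleCount η k₀ N) N x₁ s *
        barrierDensity (P N) vol ρ (XN N) γ β p ε g k₀ (scaleCount η k₀ N) N x₂ s ∂(P N)| ≤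
      A * (1 + (dist x₁ x₂) ^ (-(γ ^ 2 / 2 + 2 * β * γ))) := by
  have hX' := measurable_apply hX
  obtain ⟨A, hA, hev⟩ := hm.two_point_barrier_bound hX' hXs h_cont h_symm hK hk₀ hB hη hη1 hβ hγ hC
    hε g
  refine ⟨A, hA, ?_⟩
  filter_upwards [hev, eventually_ge_atTop 1, eventually_rpow_pos] with N hN hN1 hpos x₁ hx₁ x₂ hx₂ hd
  have hne : x₁ ≠ x₂ := dist_pos.1 ((hpos _).trans_le hd)
  refine le_trans ?_ (hN x₁ hx₁ x₂ hx₂ hd)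
  have hVi := (((hm.integrable_wt_wt hN1 hγ hne).mul_bdd
    (measurable_kernelMaj_field (γ := γ) hX' C ε N (g x₁) x₁).aestronglyMeasurable
    (ae_of_all _ fun s => norm_kernelMaj_le hC ε N _ _)).mul_bdd
    (measurable_kernelMaj_field (γ := γ) hX' C ε N (g x₂) x₂).aestronglyMeasurable
    (ae_of_all _ fun s => norm_kernelMaj_le hC ε N _ _)).mul_bdd (c := 1)
    (measurable_barrier (γ := γ) hXs β N k₀ (scaleCount η k₀ N) x₁).aestronglyMeasurable
    (ae_of_all _ fun s => by
      have := barrier_mem (vol := vol) (ρ := ρ) (XN N) γ β k₀ (scaleCount η k₀ N) x₁ s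
      rw [Real.norm_of_nonneg this.1]; exact this.2)
  rw [← Real.norm_eq_abs]
  refine norm_integral_le_of_norm_le hVi (ae_of_all _ fun s => ?_)
  have hw₁ := wt_nonneg (P N) (XN N) γ x₁ s
  have hw₂ := wt_nonneg (P N) (XN N) γ x₂ s
  have hc₁ := cap_mem β N (XN N s x₁ - γ * Real.log N)
  have hc₂ := cap_mem β N (XN N s x₂ - γ * Real.log N)
  have hb₁ := barrier_mem (vol := vol) (ρ := ρ) (XN N) γ β k₀ (scaleCount η k₀ N) x₁ s
  have hb₂ := barrier_mem (vol := vol) (ρ := ρ) (XN N) γ β k₀ (scaleCount η k₀ N) x₂ s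
  have hd₁ := abs_kernelD_le hpC ε N (g x₁) (XN N s x₁ - γ * Real.log N)
  have hd₂ := abs_kernelD_le hpC ε N (g x₂) (XN N s x₂ - γ * Real.log N)
  have hv₁ := kernelMaj_nonneg hC ε N (g x₁) (XN N s x₁ - γ * Real.log N)
  have hv₂ := kernelMaj_nonneg hC ε N (g x₂) (XN N s x₂ - γ * Real.log N)
  rw [barrierDensity, barrierDensity, Real.norm_eq_abs]
  simp only [abs_mul, abs_of_nonneg hw₁, abs_of_nonneg hw₂, abs_of_nonneg hc₁.1,
    abs_of_nonneg hc₂.1, abs_of_nonneg hb₁.1, abs_of_nonneg hb₂.1]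
  have h3 : barrier vol ρ (XN N) γ β k₀ (scaleCount η k₀ N) x₁ s *
      cap β N (XN N s x₁ - γ * Real.log N) ≤
      barrier vol ρ (XN N) γ β k₀ (scaleCount η k₀ N) x₁ s :=
    mul_le_of_le_one_right hb₁.1 hc₁.2
  have h4 : barrier vol ρ (XN N) γ β k₀ (scaleCount η k₀ N) x₂ s *
      cap β N (XN N s x₂ - γ * Real.log N) ≤ 1 := mul_le_one₀ hb₂.2 hc₂.1 hc₂.2
  calc _ ≤ wt (P N) (XN N) γ x₁ s * kernelMaj C ε N (g x₁) (XN N s x₁ - γ * Real.log N) *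
        barrier vol ρ (XN N) γ β k₀ (scaleCount η k₀ N) x₁ s *
        (wt (P N) (XN N) γ x₂ s * kernelMaj C ε N (g x₂) (XN N s x₂ - γ * Real.log N) * 1) := by
        have := mul_nonneg hb₁.1 hc₁.1
        have := mul_nonneg hb₂.1 hc₂.1
        have := hb₁.1
        gcongr
    _ = _ := by ring

/-- The second moment is split at distance N^{η−1}. Above it, the pair correlation tends to 0
pointwise and is dominated by a multiple of 1 + |x₁ − x₂|^{-(γ²/2+2βγ)}, which is integrable as the
exponent is below d. Below it, the bound under the cap is multiplied by the measure of the near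
diagonal. -/
lemma lintegral_pair_tendsto [Nontrivial Ω]
    (hm : MesoscopicAssumption d P vol h ρ XN Ψ) (hρ : IsApproximateIdentity vol ρ)
    (hX : ∀ N, Measurable fun q : S N × Ω => XN N q.1 q.2)
    (h_cont : Continuous (fun p : Ω × Ω => h p.1 p.2)) (h_symm : ∀ x y, h x y = h y x)
    {K : Set Ω} (hK : IsCompact K) [IsFiniteMeasure (vol.restrict K)] {k₀ : ℕ} (hk₀ : 0 < k₀) {B : ℝ}
    (hB : IsScaleBound vol h ρ K k₀ B)
    {η : ℝ} (hη : 0 < η) (hη1 : η < 1) (hβ : 0 < β) (hγ : γ ∈ Icc 0 √(2 * d))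
    (hγβ : γ + β ∈ Icc 0 √(2 * d)) (hα : γ ^ 2 / 2 + 2 * β * γ < d)
    (hαη : γ ^ 2 / 2 + γ * β + η * d < d) {Cv : ℝ} (hCv : 0 < Cv)
    (hvol : ∀ x ∈ K, ∀ r : ℝ, 0 < r →
      vol.restrict K (Metric.closedBall x r) ≤ ENNReal.ofReal (Cv * r ^ d))
    {φ : ℝ → ℂ} (hp : BandLimited p φ) (hC : 0 ≤ C) (hε : 0 < ε)
    (hpC : ∀ y, |p y| ≤ C * wgt y) (h0 : φ 0 * √(2 * Real.pi) = cutoffMass ε) {g : Ω → ℝ}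
    (hg : Measurable g) :
    Tendsto (fun N : ℕ => ∫⁻ q : Ω × Ω, ‖∫ s,
        barrierDensity (P N) vol ρ (XN N) γ β p ε g k₀ (scaleCount η k₀ N) N q.1 s *
        barrierDensity (P N) vol ρ (XN N) γ β p ε g k₀ (scaleCount η k₀ N) N q.2 s ∂(P N)‖ₑ
        ∂((vol.restrict K).prod (vol.restrict K))) atTop (𝓝 0) := by
  set m := vol.restrict K with hmdef
  have hX' := measurable_apply hX
  have hXs : ∀ N (k : ℕ) x, Measurable fun s => smoothed vol ρ (XN N) (Real.exp (-k)) x s :=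
    fun N k x => (measurable_smoothed hρ (hX N) (exp_neg_mem_Ioc k)).comp
      (measurable_id.prodMk measurable_const)
  have hKm : MeasurableSet K := hK.isClosed.measurableSet
  have haeK : ∀ᵐ x ∂m, x ∈ K := ae_restrict_mem hKm
  have haeKK : ∀ᵐ q ∂(m.prod m), q.1 ∈ K ∧ q.2 ∈ K := by
    have : ∀ᵐ q ∂((vol.prod vol).restrict (K ×ˢ K)), q ∈ K ×ˢ K := ae_restrict_mem (hKm.prod hKm)
    rwa [← Measure.prod_restrict] at this
  obtain ⟨A₁, hA₁, h1⟩ := hm.near_diagonal_bound (β := β) (ε := ε) hK hγ hC hpC g k₀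
    (fun N => scaleCount η k₀ N)
  obtain ⟨A₂, hA₂, h2⟩ := hm.mesoscopic_bound hX hXs h_cont h_symm hK hk₀ hB hη hη1 hβ hγ hC hε
    hpC g
  set α := γ ^ 2 / 2 + 2 * β * γ with hαdef
  have hα0 : 0 ≤ α := by have := hγ.1; positivity
  let Φ : ℕ → Ω × Ω → ℝ := fun N q => ∫ s,
        barrierDensity (P N) vol ρ (XN N) γ β p ε g k₀ (scaleCount η k₀ N) N q.1 s *
        barrierDensity (P N) vol ρ (XN N) γ β p ε g k₀ (scaleCount η k₀ N) N q.2 s ∂(P N)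
  have hΦm : ∀ N, Measurable (Φ N) := by
    intro N
    have hG := measurable_barrierDensity (P := P N) (γ := γ) hρ (hX N) β hp ε hg k₀
      (scaleCount η k₀ N) N
    have h3 := (hG.comp (measurable_fst.prodMk (measurable_fst.comp measurable_snd))).mul
      (hG.comp (measurable_fst.prodMk ((measurable_snd (α := Ω) (β := Ω)).comp measurable_snd)))
    exact (h3.stronglyMeasurable.integral_prod_left' (μ := P N)).measurable
  have hdm : Measurable fun q : Ω × Ω => dist q.1 q.2 := measurable_fst.dist measurable_snd
  let U : ℕ → Set (Ω × Ω) := fun N => {q | (N : ℝ) ^ (η - 1) ≤ dist q.1 q.2}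
  have hU : ∀ N, MeasurableSet (U N) := fun N => measurableSet_le measurable_const hdm
  have hsplit : ∀ N, ∫⁻ q, ‖Φ N q‖ₑ ∂(m.prod m) =
      ∫⁻ q, (U N).indicator (fun q => ‖Φ N q‖ₑ) q ∂(m.prod m) +
      ∫⁻ q in (U N)ᶜ, ‖Φ N q‖ₑ ∂(m.prod m) := fun N => by
    rw [lintegral_indicator (hU N), lintegral_add_compl _ (hU N)]
  change Tendsto (fun N => ∫⁻ q, ‖Φ N q‖ₑ ∂(m.prod m)) atTop (𝓝 0)
  simp_rw [hsplit]
  rw [← add_zero (0 : ENNReal)]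
  refine Tendsto.add ?_ ?_
  · -- mesoscopic distances
    have hbound : ∫⁻ q : Ω × Ω, ENNReal.ofReal A₂ *
        (1 + ENNReal.ofReal (dist q.1 q.2 ^ (-α))) ∂(m.prod m) ≠ ⊤ := by
      have hmeas : Measurable fun q : Ω × Ω => ENNReal.ofReal (dist q.1 q.2 ^ (-α)) :=
        (hdm.pow_const _).ennreal_ofReal
      have hmeas' : Measurable fun q : Ω × Ω => 1 + ENNReal.ofReal (dist q.1 q.2 ^ (-α)) :=
        measurable_const.add hmeas
      rw [lintegral_const_mul _ hmeas', lintegral_add_left measurable_const,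
        lintegral_const, one_mul]
      refine (ENNReal.mul_lt_top ENNReal.ofReal_lt_top (ENNReal.add_lt_top.2
        ⟨measure_lt_top _ _, lintegral_dist_rpow_neg_lt_top hCv.le ?_ hα0 hα⟩)).ne
      filter_upwards [haeK] with x hx using hvol x hx
    have := tendsto_lintegral_filter_of_dominated_convergence (μ := m.prod m) (l := atTop)
      (F := fun N => (U N).indicator (fun q => ‖Φ N q‖ₑ)) (f := fun _ => 0) _
      (Eventually.of_forall fun N => ((hΦm N).enorm.indicator (hU N))) ?_ hbound ?_
    · simpa using this
    · filter_upwards [h2] with N hN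
      filter_upwards [haeKK] with q hq
      by_cases hqU : q ∈ U N
      · rw [indicator_of_mem hqU, ← ofReal_norm]
        refine (ENNReal.ofReal_le_ofReal (hN q.1 hq.1 q.2 hq.2 hqU)).trans (le_of_eq ?_)
        rw [ENNReal.ofReal_mul hA₂.le, ENNReal.ofReal_add zero_le_one
          (Real.rpow_nonneg dist_nonneg _), ENNReal.ofReal_one]
      · rw [indicator_of_notMem hqU]; exact zero_le
    · filter_upwards [haeKK] with q hq
      -- A point of the diagonal has distance 0 < N^{η−1} and is excluded by the indicator, so no
      -- pointwise limit is required there.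
      rcases eq_or_ne q.1 q.2 with he | hne
      · refine tendsto_const_nhds.congr' ?_
        filter_upwards [eventually_rpow_pos] with N hpos
        rw [indicator_of_notMem]
        simp only [U, mem_ofPred_eq, he, dist_self, not_le]
        exact hpos _
      · have h3 := hm.tendsto_barrier_pair hX' hXs h_cont h_symm hK hk₀ hB hη hη1 hβ hγ hγβ hp hC hε
          hpC h0 g hk₀ hq.1 hq.2 hne
        have h4 : Tendsto (fun N => Φ N q) atTop (𝓝 0) := by
          refine h3.congr fun N => integral_congr_ae (ae_of_all _ fun s => ?_)
          simp only [barrierDensity]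
          ring
        have h5 : Tendsto (fun N => ‖Φ N q‖ₑ) atTop (𝓝 0) := by
          have := (continuous_enorm.tendsto _).comp h4
          rwa [enorm_zero] at this
        refine tendsto_of_tendsto_of_tendsto_of_le_of_le tendsto_const_nhds h5
          (fun N => zero_le) fun N => ?_
        exact indicator_le_self _ _ _
  · -- near the diagonal
    rw [ENNReal.tendsto_nhds_zero]
    intro τ hτ
    -- The net exponent: N^{γ²/2+γβ} from the capped densities against N^{-(1−η)d} from the volume.
    -- The factor σ² from the kernels is absorbed.
    have ha : 0 < d - η * d - (γ ^ 2 / 2 + γ * β) := by linarith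
    set c := A₁ * Cv * (m.real univ + 1)
    have hc : 0 < c := by positivity
    obtain ⟨t, ht, htτ⟩ : ∃ t : ℝ, 0 < t ∧ ENNReal.ofReal t ≤ τ := by
      rcases eq_or_ne τ ⊤ with rfl | hτt
      · exact ⟨1, one_pos, le_top⟩
      · exact ⟨τ.toReal, ENNReal.toReal_pos hτ.ne' hτt, (ENNReal.ofReal_toReal hτt).le⟩
    filter_upwards [h1, eventually_sq_mul_exp_le (2 * C) ha (by positivity : 0 < t / c),
      eventually_ge_atTop 1, eventually_rpow_pos] with N hN hsmall hN1 hpos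
    refine le_trans ?_ htτ
    set E := (2 * C * √(Real.log N) + 1) ^ 2 * Real.exp ((γ ^ 2 / 2 + γ * β) * Real.log N)
    have hE : 0 ≤ E := by positivity
    have hr : ((N : ℝ) ^ (η - 1)) ^ d = Real.exp ((η - 1) * d * Real.log N) := by
      rw [Real.rpow_def_of_pos (by exact_mod_cast hN1), ← Real.exp_nat_mul]
      congr 1; ring
    calc ∫⁻ q in (U N)ᶜ, ‖Φ N q‖ₑ ∂(m.prod m) ≤
        ∫⁻ q in (U N)ᶜ, ENNReal.ofReal (A₁ * E) ∂(m.prod m) := by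
          refine lintegral_mono_ae (ae_restrict_of_ae ?_)
          filter_upwards [haeKK] with q hq
          rw [← ofReal_norm]
          exact ENNReal.ofReal_le_ofReal (hN q.1 hq.1 q.2 hq.2)
      _ = ENNReal.ofReal (A₁ * E) * (m.prod m) (U N)ᶜ := by
          rw [lintegral_const, Measure.restrict_apply_univ]
      _ ≤ ENNReal.ofReal (A₁ * E) *
          (ENNReal.ofReal (Cv * ((N : ℝ) ^ (η - 1)) ^ d) * m univ) := by
          gcongr
          refine (measure_mono fun q hq => ?_).trans (measure_prod_dist_le (m := m) (C := Cv)
            (d := d) (by filter_upwards [haeK] with x hx using hvol x hx) (hpos (η - 1)))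
          simp only [U, mem_compl_iff, mem_ofPred_eq, not_le] at hq
          exact hq.le
      _ = ENNReal.ofReal (A₁ * E * (Cv * ((N : ℝ) ^ (η - 1)) ^ d * m.real univ)) := by
          have e : m univ = ENNReal.ofReal (m.real univ) := by
            rw [Measure.real, ENNReal.ofReal_toReal (measure_ne_top _ _)]
          rw [e, ← ENNReal.ofReal_mul (by positivity), ← ENNReal.ofReal_mul (by positivity)]
      _ ≤ ENNReal.ofReal t := by
          refine ENNReal.ofReal_le_ofReal ?_
          have e : E * Real.exp ((η - 1) * d * Real.log N) = (2 * C * √(Real.log N) + 1) ^ 2 *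
              Real.exp (-(d - η * d - (γ ^ 2 / 2 + γ * β)) * Real.log N) := by
            simp only [E]
            rw [mul_assoc, ← Real.exp_add]
            congr 2; ring
          calc A₁ * E * (Cv * ((N : ℝ) ^ (η - 1)) ^ d * m.real univ) =
              (E * Real.exp ((η - 1) * d * Real.log N)) * (A₁ * Cv * m.real univ) := by
                rw [hr]; ring
            _ ≤ (t / c) * c := by
                rw [e]
                have : 0 ≤ m.real univ := measureReal_nonneg
                refine mul_le_mul hsmall ?_ (by positivity) (by positivity)
                simp only [c]
                gcongr
                linarith
            _ = t := by field_simp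

end Density

lemma exists_pos_ofReal_le {τ : ENNReal} (hτ : 0 < τ) : ∃ t : ℝ, 0 < t ∧ ENNReal.ofReal t ≤ τ := by
  rcases eq_or_ne τ ⊤ with rfl | hτt
  · exact ⟨1, one_pos, le_top⟩
  · exact ⟨τ.toReal, ENNReal.toReal_pos hτ.ne' hτt, (ENNReal.ofReal_toReal hτt).le⟩

lemma enorm_integral_le_add {Ω : Type*} [MeasurableSpace Ω] {m : Measure Ω} {a b : Ω → ℝ}
    (hb : Integrable b m) : ‖∫ x, a x ∂m‖ₑ ≤ ‖∫ x, b x ∂m‖ₑ + ∫⁻ x, ‖a x - b x‖ₑ ∂m := by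
  by_cases ha : Integrable a m
  · have h1 : ∫ x, a x ∂m = ∫ x, b x ∂m + ∫ x, (a x - b x) ∂m := by
      rw [integral_sub ha hb]; ring
    rw [h1]
    exact (enorm_add_le _ _).trans (add_le_add_right (enorm_integral_le_lintegral_enorm _) _)
  -- An integral that does not exist is 0 by convention, so the estimate needs no integrability of
  -- a.
  · rw [integral_undef ha, enorm_zero]
    exact zero_le

/-! ### The L¹ estimate for the density of thick points. -/

section Main

variable {d : ℕ} {H : Type*} [TopologicalSpace H] {I : ModelWithCorners ℝ (EuclideanSpace ℝ (Fin d)) H}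
  {Ω : Type*} [MetricSpace Ω] [MeasurableSpace Ω] [BorelSpace Ω] [SecondCountableTopology Ω]
  [ChartedSpace H Ω] {vol : Measure Ω}
  {h : Ω → Ω → ℝ} {ρ : ℝ → Ω → Ω → ℝ} {S : ℕ → Type*} [∀ N, MeasurableSpace (S N)]
  {P : ∀ N, Measure (S N)} [∀ N, IsProbabilityMeasure (P N)] {XN : ∀ N, S N → Ω → ℝ}
  {Ψ : ℂ → Ω → ℂ} {γ : ℝ}

lemma IsScaleBound.mono {K : Set Ω} {κ k₀ : ℕ} {B : ℝ} (hB : IsScaleBound vol h ρ K κ B)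
    (hk : κ ≤ k₀) : IsScaleBound vol h ρ K k₀ B := fun k hk₀ => hB k (hk.trans hk₀)

/-- This is where γ < √(2d) enters: the gap e = d − γ²/2 is positive, and with βγ ≤ e/4 and ηd = e/4
both exponents exceed γ²/2 by at most e/2. The other bound on β keeps γ + β in the strip. -/
lemma exists_exponents (hγ : γ ∈ Ioo 0 √(2 * d)) : ∃ β η : ℝ, 0 < β ∧ 0 < η ∧ η < 1 ∧
    γ + β ∈ Icc 0 √(2 * d) ∧ γ ^ 2 / 2 + 2 * β * γ < d ∧ γ ^ 2 / 2 + γ * β + η * d < d := by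
  obtain ⟨hγ0, hγ1⟩ := hγ
  have hsq : γ ^ 2 < 2 * d := by
    have := Real.lt_sqrt hγ0.le |>.1 hγ1
    exact this
  have hd : (0 : ℝ) < d := by nlinarith [sq_nonneg γ]
  set e := d - γ ^ 2 / 2 with he
  have he0 : 0 < e := by linarith
  have h1 : min (√(2 * d) - γ) (e / (4 * γ)) * γ ≤ e / 4 := by
    calc _ ≤ e / (4 * γ) * γ := by gcongr; exact min_le_right _ _
      _ = e / 4 := by field_simp
  have h2 : e / (4 * d) * d = e / 4 := by field_simp
  have hmin : 0 < min (√(2 * d) - γ) (e / (4 * γ)) := lt_min (by linarith) (by positivity)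
  refine ⟨min (√(2 * d) - γ) (e / (4 * γ)), e / (4 * d), hmin, by positivity, ?_,
    ⟨by linarith, by linarith [min_le_left (√(2 * d) - γ) (e / (4 * γ))]⟩, ?_, ?_⟩
  · rw [div_lt_one (by positivity)]
    nlinarith [sq_nonneg γ]
  · linarith
  · linarith

/-- The main estimate: the compensated density of thick points is negligible in `L¹` when tested
against a bounded function of compact support. -/
theorem MesoscopicAssumption.tendsto_lintegral_thick [Nontrivial Ω]
    (hm : MesoscopicAssumption d P vol h ρ XN Ψ) (hΩ : IsLocallyEuclidean I vol)
    (hρ : IsApproximateIdentity vol ρ) (h_cov : CovarianceAssumption vol h ρ)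
    (hX : ∀ N, Measurable fun q : S N × Ω => XN N q.1 q.2)
    (h_cont : Continuous (fun p : Ω × Ω => h p.1 p.2)) (h_symm : ∀ x y, h x y = h y x)
    (hγ : γ ∈ Ioo 0 √(2 * d)) {g : Ω → ℝ} (hg : Continuous g) {K : Set Ω} (hK : IsCompact K)
    {F : Ω → ℝ} (hF : Measurable F) {M : ℝ} (hFM : ∀ x, |F x| ≤ M) (hF0 : ∀ x ∉ K, F x = 0) :
    Tendsto (fun N : ℕ => ∫⁻ s, ‖∫ x in K, F x * (wt (P N) (XN N) γ x s *
      (thickRatio (P N) (XN N) γ N x (g x) s - 1)) ∂vol‖ₑ ∂(P N)) atTop (𝓝 0) := by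
  have := hΩ.isLocallyFiniteMeasure
  obtain ⟨β, η, hβ, hη, hη1, hγβ, hα, hαη⟩ := exists_exponents hγ
  have hγ' : γ ∈ Icc 0 √(2 * d) := Ioo_subset_Icc_self hγ
  obtain ⟨κ, hκ, B, -, hB⟩ := h_cov.exists_bound hK
  replace hB : IsScaleBound vol h ρ K κ B := hB
  obtain ⟨Cv, hCv, hvol⟩ := hΩ.ball_bound hK
  have hKm : MeasurableSet K := hK.isClosed.measurableSet
  have hfin : IsFiniteMeasure (vol.restrict K) := ⟨by
    rw [Measure.restrict_apply_univ]; exact hK.measure_lt_top⟩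
  set m := vol.restrict K with hmdef
  have hX' := measurable_apply hX
  have hXs : ∀ N (k : ℕ) x, Measurable fun s => smoothed vol ρ (XN N) (Real.exp (-k)) x s :=
    fun N k x => (measurable_smoothed hρ (hX N) (exp_neg_mem_Ioc k)).comp
      (measurable_id.prodMk measurable_const)
  obtain ⟨Bg, hBg⟩ := hK.exists_bound_of_continuousOn hg.continuousOn
  have hgm : Measurable g := hg.measurable
  rcases isEmpty_or_nonempty Ω with hE | ⟨⟨x₀⟩⟩
  · simp [Measure.eq_zero_of_isEmpty]
  have hM0 : 0 ≤ M := (abs_nonneg _).trans (hFM x₀)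
  rw [ENNReal.tendsto_nhds_zero]
  intro τ' hτ'
  obtain ⟨t, ht, htτ⟩ := exists_pos_ofReal_le hτ'
  -- the tolerance
  obtain ⟨τ, hτ, hττ⟩ : ∃ τ > 0, M * (τ + τ) * m.real univ ≤ t / 2 := by
    have hv : 0 ≤ m.real univ := measureReal_nonneg
    refine ⟨t / 2 / (2 * (M * m.real univ + 1)), by positivity, ?_⟩
    rw [← add_div, ← two_mul, mul_div_mul_left _ _ two_ne_zero]
    have : M * m.real univ / (M * m.real univ + 1) ≤ 1 := by
      rw [div_le_one (by positivity)]; linarith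
    calc _ = t / 2 * (M * m.real univ / (M * m.real univ + 1)) := by ring
      _ ≤ t / 2 := mul_le_of_le_one_right (by positivity) this
  obtain ⟨p, φ, C, ε, hp, hC, hε, hpC, h0, hker⟩ :=
    hm.exists_kernel_approx hX' h_cont hK hγ' hγ.1 hBg hτ
  obtain ⟨k₁, hk₁⟩ := hm.one_point_removal hX' hXs h_cont h_symm hK hκ hB hη hη1 hβ hγ' hγβ hC.le hε
    g hτ
  set k₀ := max κ k₁ with hk₀def
  have hk₀ : 0 < k₀ := lt_of_lt_of_le hκ (le_max_left _ _)
  -- The order of choices matters: the tolerance fixes the kernel, the kernel fixes the first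
  -- barrier scale k₀, and only then does N tend to infinity.
  have hpair := lintegral_pair_tendsto hm hρ hX h_cont h_symm hK hk₀ (hB.mono (le_max_left κ k₁)) hη
    hη1 hβ hγ' hγβ hα hαη hCv hvol hp hC.le hε hpC h0 hgm
  let D : ∀ N, S N → Ω → ℝ := fun N s x =>
    barrierDensity (P N) vol ρ (XN N) γ β p ε g k₀ (scaleCount η k₀ N) N x s
  have hDm : ∀ N, Measurable fun q : S N × Ω => D N q.1 q.2 := fun N =>
    measurable_barrierDensity hρ (hX N) β hp ε hgm k₀ _ N
  have hGm : ∀ N, Measurable fun q : S N × Ω => F q.2 * D N q.1 q.2 := fun N =>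
    (hF.comp measurable_snd).mul (hDm N)
  obtain ⟨A, hA, hbd⟩ := hm.exists_bound_barrierDensity (β := β) (ε := ε) hK hγ' hC.le hpC g k₀
    (fun N => scaleCount η k₀ N)
  have hGb : ∀ᶠ N in atTop, ∃ M', ∀ s x, |F x * D N s x| ≤ M' := by
    filter_upwards [hbd] with N hN
    refine ⟨M * (A * ((2 * C * √(Real.log N) + 1) *
      Real.exp ((γ ^ 2 / 2 + γ * β) * Real.log N))), fun s x => ?_⟩
    by_cases hx : x ∈ K
    · rw [abs_mul]
      exact mul_le_mul (hFM x) (hN x hx s) (abs_nonneg _) hM0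
    · rw [hF0 x hx, zero_mul, abs_zero]
      positivity
  have hmain : Tendsto (fun N => ∫⁻ s, ‖∫ x, F x * D N s x ∂m‖ₑ ∂(P N)) atTop (𝓝 0) := by
    refine tendsto_lintegral_enorm_of_pair hGm hGb ?_
    have hM2 : Tendsto (fun N => ENNReal.ofReal (M * M) * ∫⁻ q : Ω × Ω,
        ‖∫ s, D N s q.1 * D N s q.2 ∂(P N)‖ₑ ∂(m.prod m)) atTop (𝓝 0) := by
      have := ENNReal.Tendsto.const_mul (a := ENNReal.ofReal (M * M)) hpair
        (Or.inr ENNReal.ofReal_ne_top)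
      rwa [mul_zero] at this
    refine tendsto_of_tendsto_of_tendsto_of_le_of_le tendsto_const_nhds hM2 (fun N => zero_le)
      fun N => ?_
    rw [← lintegral_const_mul' _ _ ENNReal.ofReal_ne_top]
    refine lintegral_mono fun q => ?_
    have e : ∫ s, F q.1 * D N s q.1 * (F q.2 * D N s q.2) ∂(P N) =
        F q.1 * F q.2 * ∫ s, D N s q.1 * D N s q.2 ∂(P N) := by
      rw [← integral_const_mul]
      congr 1; ext s; ring
    rw [e, enorm_mul]
    gcongr
    rw [← ofReal_norm, norm_mul]
    exact ENNReal.ofReal_le_ofReal (mul_le_mul (hFM _) (hFM _) (norm_nonneg _) hM0)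
  rw [ENNReal.tendsto_nhds_zero] at hmain
  filter_upwards [hmain (ENNReal.ofReal (t / 2)) (by simpa using ht), hker,
    hk₁ k₀ (le_max_right _ _), hGb, eventually_ge_atTop 1] with N h1 h2 h3 h4 hN
  obtain ⟨M', h4⟩ := h4
  refine le_trans ?_ htτ
  -- the two error terms
  let R : S N → Ω → ℝ := fun s x => wt (P N) (XN N) γ x s *
    |thickRatio (P N) (XN N) γ N x (g x) s - 1 -
      kernelD p ε N (g x) (XN N s x - γ * Real.log N)|
  let R' : S N → Ω → ℝ := fun s x => wt (P N) (XN N) γ x s *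
    kernelMaj C ε N (g x) (XN N s x - γ * Real.log N) *
      (1 - barrier vol ρ (XN N) γ β k₀ (scaleCount η k₀ N) x s *
        cap β N (XN N s x - γ * Real.log N))
  have hBc : ∀ s x, barrier vol ρ (XN N) γ β k₀ (scaleCount η k₀ N) x s *
        cap β N (XN N s x - γ * Real.log N) ∈ Icc (0 : ℝ) 1 := fun s x => by
    have hb := barrier_mem (vol := vol) (ρ := ρ) (XN N) γ β k₀ (scaleCount η k₀ N) x s
    have hc := cap_mem β N (XN N s x - γ * Real.log N)
    exact ⟨mul_nonneg hb.1 hc.1, mul_le_one₀ hb.2 hc.1 hc.2⟩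
  have hR0 : ∀ s x, 0 ≤ R s x := fun s x => mul_nonneg (wt_nonneg _ _ _ _ _) (abs_nonneg _)
  have hR'0 : ∀ s x, 0 ≤ R' s x := fun s x => mul_nonneg (mul_nonneg (wt_nonneg _ _ _ _ _)
    (kernelMaj_nonneg hC.le _ _ _ _)) (by linarith [(hBc s x).2])
  let a : S N → Ω → ℝ := fun s x => F x * (wt (P N) (XN N) γ x s *
      (thickRatio (P N) (XN N) γ N x (g x) s - 1))
  have ham : Measurable fun q : S N × Ω => a q.1 q.2 :=
    (hF.comp measurable_snd).mul ((measurable_wt (hX N)).mul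
      ((measurable_thickRatio (hX N) N hgm).sub_const 1))
  have hab : ∀ s x, ‖a s x - F x * D N s x‖ₑ ≤ ENNReal.ofReal (M * (R s x + R' s x)) := by
    intro s x
    rw [← ofReal_norm]
    refine ENNReal.ofReal_le_ofReal ?_
    -- The difference is the kernel approximation error plus the part removed by barrier and cap;
    -- each has tilted mean at most τ, uniformly on K.
    have e : a s x - F x * D N s x = F x * (wt (P N) (XN N) γ x s *
        (thickRatio (P N) (XN N) γ N x (g x) s - 1 -
          kernelD p ε N (g x) (XN N s x - γ * Real.log N)) +
        wt (P N) (XN N) γ x s * kernelD p ε N (g x) (XN N s x - γ * Real.log N) *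
          (1 - barrier vol ρ (XN N) γ β k₀ (scaleCount η k₀ N) x s *
            cap β N (XN N s x - γ * Real.log N))) := by
      simp only [a, D, barrierDensity]
      ring
    rw [e, norm_mul]
    refine mul_le_mul (hFM x) ((norm_add_le _ _).trans (add_le_add ?_ ?_)) (norm_nonneg _) hM0
    · rw [norm_mul, Real.norm_of_nonneg (wt_nonneg _ _ _ _ _), Real.norm_eq_abs]
    · rw [norm_mul, norm_mul, Real.norm_of_nonneg (wt_nonneg _ _ _ _ _), Real.norm_eq_abs,
        Real.norm_of_nonneg (by linarith [(hBc s x).2] : 0 ≤ 1 - barrier vol ρ (XN N) γ β k₀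
          (scaleCount η k₀ N) x s * cap β N (XN N s x - γ * Real.log N))]
      have h5 := abs_kernelD_le hpC ε N (g x) (XN N s x - γ * Real.log N)
      have h6 := wt_nonneg (P N) (XN N) γ x s
      have h7 := (hBc s x).2
      exact mul_le_mul_of_nonneg_right (mul_le_mul_of_nonneg_left h5 h6) (by linarith)
  have hR'i : ∀ x, Integrable (fun s => R' s x) (P N) := by
    intro x
    have hbm := (measurable_barrier (γ := γ) hXs β N k₀ (scaleCount η k₀ N) x).mul
      (measurable_cap_field (γ := γ) hX' β N x)
    refine ((hm.integrable_wt hN hγ' x).mul_bdd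
      (measurable_kernelMaj_field (γ := γ) hX' C ε N (g x) x).aestronglyMeasurable
      (ae_of_all _ fun s => norm_kernelMaj_le hC.le ε N _ _)).mul_bdd (c := 1)
      (hbm.const_sub 1).aestronglyMeasurable (ae_of_all _ fun s => ?_)
    have := hBc s x
    rw [Real.norm_of_nonneg (by linarith [this.2])]
    linarith [this.1]
  have hinner : ∀ x ∈ K, ∫⁻ s, ‖a s x - F x * D N s x‖ₑ ∂(P N) ≤ ENNReal.ofReal (M * (τ + τ)) := by
    intro x hx
    obtain ⟨hi, hle⟩ := h2 x hx
    refine (lintegral_mono fun s => hab s x).trans ?_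
    have hRi : Integrable (fun s => M * (R s x + R' s x)) (P N) := (hi.add (hR'i x)).const_mul M
    rw [← ofReal_integral_eq_lintegral_ofReal hRi
      (ae_of_all _ fun s => mul_nonneg hM0 (add_nonneg (hR0 s x) (hR'0 s x)))]
    refine ENNReal.ofReal_le_ofReal ?_
    rw [integral_const_mul]
    refine mul_le_mul_of_nonneg_left ?_ hM0
    refine (le_of_eq (integral_add hi (hR'i x))).trans (add_le_add hle (h3 x hx))
  calc ∫⁻ s, ‖∫ x, a s x ∂m‖ₑ ∂(P N)
      ≤ ∫⁻ s, (‖∫ x, F x * D N s x ∂m‖ₑ + ∫⁻ x, ‖a s x - F x * D N s x‖ₑ ∂m) ∂(P N) := by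
        refine lintegral_mono fun s => enorm_integral_le_add ?_
        exact Integrable.of_bound ((hGm N).comp
          (measurable_const.prodMk measurable_id)).aestronglyMeasurable M' (ae_of_all _ fun x => h4 s x)
    _ = ∫⁻ s, ‖∫ x, F x * D N s x ∂m‖ₑ ∂(P N) +
        ∫⁻ x, ∫⁻ s, ‖a s x - F x * D N s x‖ₑ ∂(P N) ∂m := by
        have h5 : Measurable fun s => ∫ x, F x * D N s x ∂m :=
          ((hGm N).stronglyMeasurable.integral_prod_right' (ν := m)).measurable
        rw [lintegral_add_left h5.enorm, lintegral_lintegral_swap]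
        exact ((ham.sub (hGm N)).enorm).aemeasurable
    _ ≤ ENNReal.ofReal (t / 2) + ENNReal.ofReal (t / 2) := by
        refine add_le_add h1 ?_
        calc _ ≤ ∫⁻ x, ENNReal.ofReal (M * (τ + τ)) ∂m := by
              refine lintegral_mono_ae ?_
              filter_upwards [ae_restrict_mem hKm] with x hx using hinner x hx
          _ = ENNReal.ofReal (M * (τ + τ) * m.real univ) := by
              rw [lintegral_const, ENNReal.ofReal_mul (p := M * (τ + τ)) (by positivity),
                Measure.real, ENNReal.ofReal_toReal (measure_ne_top _ _)]
          _ ≤ _ := ENNReal.ofReal_le_ofReal hττ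
    _ = ENNReal.ofReal t := by
        rw [← ENNReal.ofReal_add (by positivity) (by positivity), add_halves]

end Main

/-! ### The densities of the two measures -/

section OnePoint

variable {Ω : Type*} {S : Type*} [MeasurableSpace S] {P : Measure S} {X : S → Ω → ℝ} {γ : ℝ}

lemma ofReal_exp_div_lintegral {x : Ω} (hi : Integrable (fun s => Real.exp (γ * X s x)) P)
    (hZ : 0 < expMean P X γ x) (s : S) :
    ENNReal.ofReal (Real.exp (γ * X s x)) / ∫⁻ s', ENNReal.ofReal (Real.exp (γ * X s' x)) ∂P =
      ENNReal.ofReal (wt P X γ x s) := by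
  rw [← ofReal_integral_eq_lintegral_ofReal hi (ae_of_all _ fun _ => (Real.exp_pos _).le), wt,
    ENNReal.ofReal_div_of_pos hZ, expMean]

/-- On the event, insert e^{γX}e^{-γX} = 1 and write X = γ log N + b + (Y − b). This produces e^{-γ²
log N} e^{-γb} κ(Y − b) and is the source of the factor e^{-γg} in the limit. -/
lemma indicator_eq_wt {x : Ω} (hZ : 0 < expMean P X γ x) (N : ℕ) (b : ℝ) (s : S) :
    (if γ * Real.log N + b ≤ X s x then (1 : ℝ) else 0) =
      expMean P X γ x * Real.exp (-(γ ^ 2 * Real.log N)) * (Real.exp (-γ * b) *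
        (wt P X γ x s * expTail γ ((X s x - γ * Real.log N) - b))) := by
  unfold wt expTail
  by_cases hc : γ * Real.log N + b ≤ X s x
  · rw [if_pos hc, if_pos (by linarith)]
    have e : Real.exp (-(γ ^ 2 * Real.log N)) * Real.exp (-γ * b) * Real.exp (γ * X s x) *
        Real.exp (-γ * ((X s x - γ * Real.log N) - b)) = 1 := by
      rw [← Real.exp_add, ← Real.exp_add, ← Real.exp_add, Real.exp_eq_one_iff]
      ring
    calc (1 : ℝ) = Real.exp (-(γ ^ 2 * Real.log N)) * Real.exp (-γ * b) * Real.exp (γ * X s x) *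
        Real.exp (-γ * ((X s x - γ * Real.log N) - b)) := e.symm
      _ = _ := by field_simp
  · rw [if_neg hc, if_neg (by linarith)]
    ring

lemma sqrt_log_mul_measure_thick [IsFiniteMeasure P] {x : Ω} (hX : Measurable fun s => X s x)
    (hZ : 0 < expMean P X γ x) (N : ℕ) :
    √(Real.log N) * P.real {s | γ * Real.log N ≤ X s x} =
      expMean P X γ x * Real.exp (-(γ ^ 2 * Real.log N)) * tailMass P X γ N x 0 := by
  have h1 : P.real {s | γ * Real.log N ≤ X s x} =
      ∫ s, (if γ * Real.log N + 0 ≤ X s x then (1 : ℝ) else 0) ∂P := by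
    have hm : MeasurableSet {s | γ * Real.log N ≤ X s x} := measurableSet_le measurable_const hX
    rw [← integral_indicator_one hm]
    simp only [indicator, mem_ofPred_eq, add_zero, Pi.one_apply]
  rw [h1, ← integral_const_mul, tailMass, ← integral_const_mul]
  refine integral_congr_ae (ae_of_all _ fun s => ?_)
  simp only [indicator_eq_wt hZ]
  simp only [mul_zero, Real.exp_zero]
  ring

/-- The same identity with b = 0, integrated, gives the denominator, so the factor E[e^{γX}] e^{-γ²
log N} cancels. -/
lemma indicator_div_measure_thick [IsFiniteMeasure P] {x : Ω} (hX : Measurable fun s => X s x)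
    (hZ : 0 < expMean P X γ x) {N : ℕ} (hT : 0 < tailMass P X γ N x 0) (g : Ω → ℝ) (s : S) :
    {y | γ * Real.log N + g y ≤ X s y}.indicator (1 : Ω → ENNReal) x /
        P {s' | γ * Real.log N ≤ X s' x} =
      ENNReal.ofReal (Real.exp (-γ * g x) * (wt P X γ x s * thickRatio P X γ N x (g x) s)) := by
  have h2 := sqrt_log_mul_measure_thick hX hZ N
  set E := expMean P X γ x * Real.exp (-(γ ^ 2 * Real.log N)) with hE
  have hE0 : 0 < E := by positivity
  have hp0 : 0 < √(Real.log N) * P.real {s | γ * Real.log N ≤ X s x} := by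
    rw [h2]; positivity
  have hp : 0 < P.real {s | γ * Real.log N ≤ X s x} := by
    by_contra hcon
    nlinarith [Real.sqrt_nonneg (Real.log N), measureReal_nonneg (μ := P)
      (s := {s | γ * Real.log N ≤ X s x})]
  have hs : √(Real.log N) ≠ 0 := fun h0 => by rw [h0, zero_mul] at hp0; exact hp0.false
  have e1 : P {s' | γ * Real.log N ≤ X s' x} =
      ENNReal.ofReal (P.real {s | γ * Real.log N ≤ X s x}) :=
    (ofReal_measureReal (measure_ne_top _ _)).symm
  have e2 : {y | γ * Real.log N + g y ≤ X s y}.indicator (1 : Ω → ENNReal) x =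
      ENNReal.ofReal (if γ * Real.log N + g x ≤ X s x then (1 : ℝ) else 0) := by
    simp only [indicator, mem_ofPred_eq, Pi.one_apply]
    split_ifs <;> simp
  rw [e1, e2, ← ENNReal.ofReal_div_of_pos hp]
  congr 1
  rw [indicator_eq_wt hZ, ← hE, thickRatio]
  have h3 : P.real {s | γ * Real.log N ≤ X s x} = E * tailMass P X γ N x 0 / √(Real.log N) := by
    rw [← h2]; field_simp
  rw [h3]
  field_simp

end OnePoint

lemma toRadon_of_isLocallyFinite {Ω : Type*} [TopologicalSpace Ω] [MeasurableSpace Ω]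
    {m : Measure Ω} (hm : IsLocallyFiniteMeasure m) : (toRadon m).1 = m := by
  have h1 : toRadon m = ⟨m, hm⟩ := dif_pos hm
  exact congrArg Subtype.val h1

lemma toRadon_of_not_isLocallyFinite {Ω : Type*} [TopologicalSpace Ω] [MeasurableSpace Ω]
    {m : Measure Ω} (hm : ¬ IsLocallyFiniteMeasure m) : (toRadon m).1 = 0 := by
  have h1 : toRadon m = ⟨0, inferInstance⟩ := dif_neg hm
  exact congrArg Subtype.val h1

lemma isLocallyFiniteMeasure_iff_compactExhaustion {Ω : Type*} [TopologicalSpace Ω]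
    [MeasurableSpace Ω] (E : CompactExhaustion Ω) (m : Measure Ω) :
    IsLocallyFiniteMeasure m ↔ ∀ n, m (E n) < ⊤ := by
  refine ⟨fun _ n => (E.isCompact n).measure_lt_top, fun hm => ⟨fun x => ?_⟩⟩
  obtain ⟨n, hn⟩ := E.exists_mem_nhds x
  exact ⟨E n, hn, hm n⟩

lemma integral_tilt {Ω : Type*} [TopologicalSpace Ω] [MeasurableSpace Ω] [OpensMeasurableSpace Ω]
    (m : RadonMeasure Ω) (γ : ℝ) {g : Ω → ℝ} (hg : Continuous g) (f : Ω → ℝ) :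
    ∫ x, f x ∂(m.tilt γ hg).1 = ∫ x, f x * Real.exp (-γ * g x) ∂m.1 := by
  have hc : Continuous fun x => Real.exp (-γ * g x) :=
    Real.continuous_exp.comp (continuous_const.mul hg)
  rw [RadonMeasure.tilt, integral_withDensity_eq_integral_toReal_smul
    hc.measurable.ennreal_ofReal (ae_of_all _ fun _ => ENNReal.ofReal_lt_top)]
  refine integral_congr_ae (ae_of_all _ fun x => ?_)
  simp only [ENNReal.toReal_ofReal (Real.exp_pos _).le, smul_eq_mul, mul_comm]

/-! ### The difference of the two measures against a test function. -/

section Densities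

variable {d : ℕ} {H : Type*} [TopologicalSpace H] {I : ModelWithCorners ℝ (EuclideanSpace ℝ (Fin d)) H}
  {Ω : Type*} [MetricSpace Ω] [MeasurableSpace Ω] [BorelSpace Ω] [SecondCountableTopology Ω]
  [ChartedSpace H Ω] {vol : Measure Ω}
  {h : Ω → Ω → ℝ} {ρ : ℝ → Ω → Ω → ℝ} {S : ℕ → Type*} [∀ N, MeasurableSpace (S N)]
  {P : ∀ N, Measure (S N)} [∀ N, IsProbabilityMeasure (P N)] {XN : ∀ N, S N → Ω → ℝ}
  {Ψ : ℂ → Ω → ℂ} {γ : ℝ}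

lemma MesoscopicAssumption.exponentialMeasure_eq [Nontrivial Ω]
    (hm : MesoscopicAssumption d P vol h ρ XN Ψ) {N : ℕ} (hN : 1 ≤ N) (hγ : γ ∈ Icc 0 √(2 * d))
    (s : S N) : exponentialMeasure (P N) vol (XN N) γ s =
      vol.withDensity fun x => ENNReal.ofReal (wt (P N) (XN N) γ x s) := by
  rw [exponentialMeasure]
  congr 1
  ext x
  exact ofReal_exp_div_lintegral (hm.integrable_exp hN hγ x) (hm.expMean_pos hN hγ x) s

lemma MesoscopicAssumption.ae_setLIntegral_wt_lt_top [Nontrivial Ω] [SFinite vol]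
    (hm : MesoscopicAssumption d P vol h ρ XN Ψ)
    (hX : ∀ N, Measurable fun q : S N × Ω => XN N q.1 q.2) {N : ℕ} (hN : 1 ≤ N)
    (hγ : γ ∈ Icc 0 √(2 * d)) {K : Set Ω} (hK : vol K ≠ ⊤) :
    ∀ᵐ s ∂(P N), ∫⁻ x in K, ENNReal.ofReal (wt (P N) (XN N) γ x s) ∂vol < ⊤ := by
  have hw : Measurable fun q : S N × Ω => ENNReal.ofReal (wt (P N) (XN N) γ q.2 q.1) :=
    (measurable_wt (hX N)).ennreal_ofReal
  refine ae_lt_top hw.lintegral_prod_right' ?_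
  rw [lintegral_lintegral_swap hw.aemeasurable]
  have h1 : ∀ x, ∫⁻ s, ENNReal.ofReal (wt (P N) (XN N) γ x s) ∂(P N) = 1 := fun x => by
    rw [← ofReal_integral_eq_lintegral_ofReal (hm.integrable_wt hN hγ x)
      (ae_of_all _ fun s => wt_nonneg _ _ _ _ s), hm.integral_wt hN hγ x, ENNReal.ofReal_one]
  simp_rw [h1]
  simpa using hK

/-- Each w has mean 1, so Fubini makes the mass of a compact set almost surely finite; a compact
exhaustion reduces local finiteness to countably many compacts. -/
lemma MesoscopicAssumption.ae_isLocallyFinite_exponentialMeasure [Nontrivial Ω]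
    [LocallyCompactSpace Ω] [IsLocallyFiniteMeasure vol]
    (hm : MesoscopicAssumption d P vol h ρ XN Ψ)
    (hX : ∀ N, Measurable fun q : S N × Ω => XN N q.1 q.2) {N : ℕ} (hN : 1 ≤ N)
    (hγ : γ ∈ Icc 0 √(2 * d)) :
    ∀ᵐ s ∂(P N), IsLocallyFiniteMeasure (exponentialMeasure (P N) vol (XN N) γ s) := by
  set E : CompactExhaustion Ω := default
  have h1 : ∀ᵐ s ∂(P N), ∀ n : ℕ, ∫⁻ x in E n, ENNReal.ofReal (wt (P N) (XN N) γ x s) ∂vol < ⊤ :=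
    ae_all_iff.2 fun n => hm.ae_setLIntegral_wt_lt_top hX hN hγ (E.isCompact n).measure_ne_top
  filter_upwards [h1] with s hs
  rw [isLocallyFiniteMeasure_iff_compactExhaustion E, hm.exponentialMeasure_eq hN hγ]
  intro n
  rw [withDensity_apply _ (E.isCompact n).isClosed.measurableSet]
  exact hs n

/-- Against a compactly supported function, the measures of thick points differ from the tilted
exponential measures by the integral of the compensated density. -/
lemma MesoscopicAssumption.ae_integral_thick_sub [Nontrivial Ω]
    [LocallyCompactSpace Ω] [IsLocallyFiniteMeasure vol]
    (hm : MesoscopicAssumption d P vol h ρ XN Ψ)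
    (hX : ∀ N, Measurable fun q : S N × Ω => XN N q.1 q.2)
    (h_cont : Continuous (fun p : Ω × Ω => h p.1 p.2)) (hγ : γ ∈ Ioo 0 √(2 * d))
    {g : Ω → ℝ} (hg : Continuous g)
    (hν : ∀ᶠ N in atTop, ∀ᵐ s ∂(P N),
      IsLocallyFiniteMeasure (thickMeasure (P N) vol (XN N) γ g N s)) (f : C_c(Ω, ℝ)) :
    ∀ᶠ N : ℕ in atTop, ∀ᵐ s ∂(P N),
      ∫ x, f x ∂(toRadon (thickMeasure (P N) vol (XN N) γ g N s)).1 -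
        ∫ x, f x ∂((toRadon (exponentialMeasure (P N) vol (XN N) γ s)).tilt γ hg).1 =
      ∫ x in tsupport f, f x * Real.exp (-γ * g x) *
        (wt (P N) (XN N) γ x s * (thickRatio (P N) (XN N) γ N x (g x) s - 1)) ∂vol := by
  set K := tsupport f with hKdef
  have hK : IsCompact K := f.hasCompactSupport
  have hKm : MeasurableSet K := hK.isClosed.measurableSet
  have hγ' : γ ∈ Icc 0 √(2 * d) := ⟨hγ.1.le, hγ.2.le⟩
  have hf0 : ∀ x ∉ K, f x = 0 := fun x hx => image_eq_zero_of_notMem_tsupport hx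
  set τ := 1 / γ / √(2 * Real.pi) with hτ
  have hτ0 : 0 < τ := by have := hγ.1; positivity
  have hT := hm.tendsto_tailMass (measurable_apply hX) h_cont hK hγ' hγ.1 (b := fun _ => 0) (B := 0)
    (fun _ _ => by simp)
  -- The normalization exceeds half its limit uniformly on the support of f, hence the density ratio
  -- is well defined and, for each such N, bounded there.
  have hT' := eventually_prod_principal_iff.1 (hT.eventually (lt_mem_nhds (half_lt_self hτ0)))
  filter_upwards [hν, hT', eventually_ge_atTop 1] with N hνN hTN hN
  filter_upwards [hνN, hm.ae_isLocallyFinite_exponentialMeasure hX hN hγ',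
    hm.ae_setLIntegral_wt_lt_top hX hN hγ' hK.measure_ne_top] with s hs1 hs2 hs3
  rw [toRadon_of_isLocallyFinite hs1, integral_tilt, toRadon_of_isLocallyFinite hs2,
    hm.exponentialMeasure_eq hN hγ', thickMeasure]
  have hwm : Measurable fun x => wt (P N) (XN N) γ x s :=
    (measurable_wt (hX N)).comp measurable_prodMk_left
  have htm : Measurable fun x => thickRatio (P N) (XN N) γ N x (g x) s :=
    (measurable_thickRatio (hX N) N hg.measurable).comp measurable_prodMk_left
  have hem : Measurable fun x => Real.exp (-γ * g x) := (hg.measurable.const_mul _).exp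
  have hwi : IntegrableOn (fun x => wt (P N) (XN N) γ x s) K vol :=
    ⟨hwm.aestronglyMeasurable, by
      rw [hasFiniteIntegral_iff_ofReal (ae_of_all _ fun x => wt_nonneg _ _ _ x s)]; exact hs3⟩
  obtain ⟨M, hM⟩ := hK.exists_bound_of_continuousOn
    (f.continuous.mul (Real.continuous_exp.comp (continuous_const.mul hg) :
      Continuous fun x => Real.exp (-γ * g x))).continuousOn
  have hFi : IntegrableOn (fun x => f x * Real.exp (-γ * g x) * wt (P N) (XN N) γ x s) K vol :=
    hwi.bdd_mul (c := M) (f.continuous.measurable.mul hem).aestronglyMeasurable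
      ((ae_restrict_mem hKm).mono fun x hx => hM x hx)
  have htb : ∀ x ∈ K, ‖thickRatio (P N) (XN N) γ N x (g x) s‖ ≤ √(Real.log N) / (τ / 2) := by
    intro x hx
    have h1 := hTN x hx
    have h2 := expTail_nonneg γ ((XN N s x - γ * Real.log N) - g x)
    have h3 := expTail_le_one hγ.1.le ((XN N s x - γ * Real.log N) - g x)
    rw [thickRatio, Real.norm_of_nonneg (div_nonneg (mul_nonneg (Real.sqrt_nonneg _) h2)
      ((half_pos hτ0).trans h1).le)]
    exact div_le_div₀ (Real.sqrt_nonneg _) (mul_le_of_le_one_right (Real.sqrt_nonneg _) h3)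
      (half_pos hτ0) h1.le
  have hFti : IntegrableOn (fun x => f x * Real.exp (-γ * g x) * wt (P N) (XN N) γ x s *
      thickRatio (P N) (XN N) γ N x (g x) s) K vol :=
    hFi.mul_bdd (c := √(Real.log N) / (τ / 2)) htm.aestronglyMeasurable
      ((ae_restrict_mem hKm).mono fun x hx => htb x hx)
  have e1 : ∫ x, f x * Real.exp (-γ * g x) ∂(vol.withDensity fun x =>
      ENNReal.ofReal (wt (P N) (XN N) γ x s)) =
      ∫ x in K, f x * Real.exp (-γ * g x) * wt (P N) (XN N) γ x s ∂vol := by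
    rw [integral_withDensity_eq_integral_toReal_smul hwm.ennreal_ofReal
      (ae_of_all _ fun _ => ENNReal.ofReal_lt_top), ← setIntegral_eq_integral_of_forall_compl_eq_zero
      (s := K) (fun x hx => by simp [hf0 x hx])]
    refine integral_congr_ae (ae_of_all _ fun x => ?_)
    simp only [ENNReal.toReal_ofReal (wt_nonneg _ _ _ x s), smul_eq_mul, mul_comm]
  have hdm : Measurable fun x => ENNReal.ofReal
      (Real.exp (-γ * g x) * (wt (P N) (XN N) γ x s * thickRatio (P N) (XN N) γ N x (g x) s)) :=
    (hem.mul (hwm.mul htm)).ennreal_ofReal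
  have e2 : ∫ x, f x ∂(vol.withDensity fun x =>
      {y | γ * Real.log N + g y ≤ XN N s y}.indicator 1 x / P N {s' | γ * Real.log N ≤ XN N s' x}) =
      ∫ x in K, f x * Real.exp (-γ * g x) * wt (P N) (XN N) γ x s *
        thickRatio (P N) (XN N) γ N x (g x) s ∂vol := by
    rw [← setIntegral_eq_integral_of_forall_compl_eq_zero (s := K) (fun x hx => hf0 x hx),
      restrict_withDensity hKm, withDensity_congr_ae (g := fun x => ENNReal.ofReal
        (Real.exp (-γ * g x) * (wt (P N) (XN N) γ x s * thickRatio (P N) (XN N) γ N x (g x) s)))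
        ((ae_restrict_mem hKm).mono fun x hx => indicator_div_measure_thick
          (measurable_apply hX N x) (hm.expMean_pos hN hγ' x) ((half_pos hτ0).trans (hTN x hx)) g s),
      integral_withDensity_eq_integral_toReal_smul hdm
      (ae_of_all _ fun _ => ENNReal.ofReal_lt_top)]
    refine integral_congr_ae ((ae_restrict_mem hKm).mono fun x hx => ?_)
    have hT0 := (half_pos hτ0).trans (hTN x hx)
    have : 0 ≤ thickRatio (P N) (XN N) γ N x (g x) s :=
      div_nonneg (mul_nonneg (Real.sqrt_nonneg _) (expTail_nonneg _ _)) hT0.le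
    simp only [smul_eq_mul]
    rw [ENNReal.toReal_ofReal (mul_nonneg (Real.exp_pos _).le
      (mul_nonneg (wt_nonneg _ _ _ x s) this))]
    ring
  rw [e1, e2, ← integral_sub hFti hFi]
  refine integral_congr_ae (ae_of_all _ fun x => ?_)
  simp only []
  ring

/-- A point is Lebesgue null in positive dimension. The moment assumptions concern pairs of distinct
points and say nothing about a one-point space, which must be treated separately. -/
lemma IsLocallyEuclidean.eq_zero_of_subsingleton [Subsingleton Ω] (hΩ : IsLocallyEuclidean I vol)
    (hd : 0 < d) : vol = 0 := by
  rcases isEmpty_or_nonempty Ω with hE | ⟨⟨x₀⟩⟩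
  · exact Measure.eq_zero_of_isEmpty vol
  obtain ⟨U, hU, a, -, b, -, -, -, hvol⟩ := hΩ.comparable x₀
  have hUu : U = univ := Subsingleton.eq_univ_of_nonempty ⟨x₀, mem_of_mem_nhds hU⟩
  have : Nonempty (Fin d) := ⟨⟨0, hd⟩⟩
  have h1 := (hvol U subset_rfl (hUu ▸ MeasurableSet.univ)).2
  rw [(subsingleton_of_subsingleton (s := U)).image _ |>.measure_zero, mul_zero, hUu] at h1
  exact Measure.measure_univ_eq_zero.1 (le_antisymm h1 zero_le)

theorem MesoscopicAssumption.tendsto_lintegral_integral_sub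
    (hm : MesoscopicAssumption d P vol h ρ XN Ψ) (hΩ : IsLocallyEuclidean I vol)
    (hρ : IsApproximateIdentity vol ρ) (h_cov : CovarianceAssumption vol h ρ)
    (hX : ∀ N, Measurable fun q : S N × Ω => XN N q.1 q.2)
    (h_cont : Continuous (fun p : Ω × Ω => h p.1 p.2)) (h_symm : ∀ x y, h x y = h y x)
    (hγ : γ ∈ Ioo 0 √(2 * d)) {g : Ω → ℝ} (hg : Continuous g)
    (hν : ∀ᶠ N in atTop, ∀ᵐ s ∂(P N),
      IsLocallyFiniteMeasure (thickMeasure (P N) vol (XN N) γ g N s)) (f : C_c(Ω, ℝ)) :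
    Tendsto (fun N : ℕ => ∫⁻ s, ‖∫ x, f x ∂(toRadon (thickMeasure (P N) vol (XN N) γ g N s)).1 -
        ∫ x, f x ∂((toRadon (exponentialMeasure (P N) vol (XN N) γ s)).tilt γ hg).1‖ₑ ∂(P N))
      atTop (𝓝 0) := by
  have := hΩ.isLocallyFiniteMeasure
  have : LocallyCompactSpace Ω :=
    have : LocallyCompactSpace H := I.locallyCompactSpace
    ChartedSpace.locallyCompactSpace H Ω
  rcases subsingleton_or_nontrivial Ω with hs | hn
  -- If d were 0 the interval (0, √(2d)) containing γ would be empty. With at most one point the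
  -- volume is 0 and both measures vanish.
  · have hd : 0 < d := by
      rcases Nat.eq_zero_or_pos d with rfl | hd
      · have := hγ.1.trans hγ.2
        simp at this
      · exact hd
    have h0 := hΩ.eq_zero_of_subsingleton hd
    refine tendsto_const_nhds.congr fun N => ?_
    have h2 : (toRadon (0 : Measure Ω)).1 = 0 := toRadon_of_isLocallyFinite inferInstance
    simp [thickMeasure, exponentialMeasure, h0, integral_tilt, h2]
  · have hF : Continuous fun x => f x * Real.exp (-γ * g x) :=
      f.continuous.mul (Real.continuous_exp.comp (continuous_const.mul hg))
    have hf0 : ∀ x ∉ tsupport f, f x * Real.exp (-γ * g x) = 0 := fun x hx => by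
      rw [image_eq_zero_of_notMem_tsupport hx, zero_mul]
    obtain ⟨M, hM⟩ := f.hasCompactSupport.isCompact.exists_bound_of_continuousOn hF.continuousOn
    have hFM : ∀ x, |f x * Real.exp (-γ * g x)| ≤ max M 0 := fun x => by
      by_cases hx : x ∈ tsupport f
      · exact (hM x hx).trans (le_max_left _ _)
      · rw [hf0 x hx, abs_zero]; exact le_max_right _ _
    refine (hm.tendsto_lintegral_thick hΩ hρ h_cov hX h_cont h_symm hγ hg
      f.hasCompactSupport.isCompact hF.measurable hFM hf0).congr' ?_
    filter_upwards [hm.ae_integral_thick_sub hX h_cont hγ hg hν f] with N hN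
    exact lintegral_congr_ae (hN.mono fun s hs => congrArg enorm hs.symm)

end Densities

/-! ### Convergence in distribution under small perturbations -/

section Perturbation

variable {S : ℕ → Type*} [∀ N, MeasurableSpace (S N)] {P : ∀ N, Measure (S N)}
  [∀ N, IsProbabilityMeasure (P N)] {T : Type*} [MeasurableSpace T] {Q : Measure T}
  [IsProbabilityMeasure Q]

/-- A form of Slutsky's theorem for random elements on varying probability spaces. -/
theorem tendstoInDistribution_of_tendsto_lintegral_edist {E : Type*} [t : TopologicalSpace E]
    [MeasurableSpace E] [BorelSpace E] (m : PseudoEMetricSpace E)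
    (ht : t = m.toUniformSpace.toTopologicalSpace) {X Y : ∀ N, S N → E} {Z : T → E}
    (h : TendstoInDistribution X atTop Z P Q) (hY : ∀ N, AEMeasurable (Y N) (P N))
    (hXY : Tendsto (fun N => ∫⁻ s, edist (Y N s) (X N s) ∂(P N)) atTop (𝓝 0)) :
    TendstoInDistribution Y atTop Z P Q := by
  -- The topology of E is given in advance and the metric is auxiliary; identifying the two allows
  -- Lipschitz test functions to be used.
  subst ht
  refine ⟨hY, h.aemeasurable_limit, ?_⟩
  refine tendsto_iff_forall_lipschitz_integral_tendsto.2 ?_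
  rintro F ⟨C, hC⟩ ⟨L, hL⟩
  have h1 := tendsto_iff_forall_lipschitz_integral_tendsto.1 h.tendsto F ⟨C, hC⟩ ⟨L, hL⟩
  have hFm : Measurable F := hL.continuous.measurable
  have hFb : ∃ B, ∀ x, ‖F x‖ ≤ B := by
    rcases isEmpty_or_nonempty E with hE | ⟨⟨x₀⟩⟩
    · exact ⟨0, fun x => isEmptyElim x⟩
    · refine ⟨C + ‖F x₀‖, fun x => ?_⟩
      have h2 := hC x x₀
      rw [dist_eq_norm] at h2
      linarith [norm_le_norm_sub_add (F x) (F x₀)]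
  obtain ⟨B, hB⟩ := hFb
  have hi : ∀ (W : ∀ N, S N → E), (∀ N, AEMeasurable (W N) (P N)) → ∀ N,
      Integrable (fun s => F (W N s)) (P N) := fun W hW N =>
    Integrable.of_bound (hFm.comp_aemeasurable (hW N)).aestronglyMeasurable B
      (ae_of_all _ fun s => hB _)
  have h3 : Tendsto (fun N => ∫ s, (F (Y N s) - F (X N s)) ∂(P N)) atTop (𝓝 0) := by
    rw [tendsto_iff_edist_tendsto_0]
    have h4 : Tendsto (fun N => (L : ENNReal) * ∫⁻ s, edist (Y N s) (X N s) ∂(P N)) atTop (𝓝 0) := by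
      simpa using ENNReal.Tendsto.const_mul hXY (Or.inr ENNReal.coe_ne_top)
    refine tendsto_of_tendsto_of_tendsto_of_le_of_le tendsto_const_nhds h4 (fun _ => zero_le)
      fun N => ?_
    simp only [edist_zero_right]
    refine (enorm_integral_le_lintegral_enorm _).trans ?_
    rw [← lintegral_const_mul' _ _ ENNReal.coe_ne_top]
    refine lintegral_mono fun s => ?_
    rw [← edist_eq_enorm_sub]
    exact hL _ _
  have h5 := h1.add h3
  rw [add_zero] at h5
  refine h5.congr fun N => ?_
  simp only [ProbabilityMeasure.coe_mk]
  rw [integral_map (hY N) hFm.aestronglyMeasurable,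
    integral_map (h.forall_aemeasurable N) hFm.aestronglyMeasurable,
    integral_sub (hi Y hY N) (hi X h.forall_aemeasurable N)]
  ring

end Perturbation

/-! ### The vague topology is induced by countably many test functions -/

section VagueTopology

variable {Ω : Type*} [TopologicalSpace Ω] [MeasurableSpace Ω] [OpensMeasurableSpace Ω]

lemma RadonMeasure.integrable (m : RadonMeasure Ω) (f : C_c(Ω, ℝ)) : Integrable f m.1 :=
  have := m.2
  f.continuous.integrable_of_hasCompactSupport f.hasCompactSupport

lemma continuous_integral_vague (f : C_c(Ω, ℝ)) :
    Continuous fun m : RadonMeasure Ω => ∫ x, f x ∂m.1 := by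
  have h1 : Continuous fun (m : RadonMeasure Ω) (f : C_c(Ω, ℝ)) => ∫ x, f x ∂m.1 :=
    continuous_induced_dom
  exact (continuous_apply f).comp h1

lemma measurable_integral_vague (f : C_c(Ω, ℝ)) :
    Measurable fun m : RadonMeasure Ω => ∫ x, f x ∂m.1 :=
  (continuous_integral_vague f).measurable

lemma nhds_vague (m : RadonMeasure Ω) : 𝓝 m =
    comap (fun (m : RadonMeasure Ω) (f : C_c(Ω, ℝ)) => ∫ x, f x ∂m.1) (𝓝 fun f => ∫ x, f x ∂m.1) :=
  nhds_induced _ _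

/-- The product of a compactly supported continuous function and a continuous function. -/
def cutoffMul {Ω : Type*} [TopologicalSpace Ω] (χ : C_c(Ω, ℝ)) (f : C(Ω, ℝ)) : C_c(Ω, ℝ) :=
  ⟨χ.toContinuousMap * f, χ.hasCompactSupport.mul_right⟩

lemma cutoffMul_apply {Ω : Type*} [TopologicalSpace Ω] (χ : C_c(Ω, ℝ)) (f : C(Ω, ℝ)) (x : Ω) :
    cutoffMul χ f x = χ x * f x := rfl

lemma abs_integral_sub_le {χ f g : C_c(Ω, ℝ)} {δ : ℝ} (hfg : ∀ x, |f x - g x| ≤ δ * χ x)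
    (m : RadonMeasure Ω) : |∫ x, f x ∂m.1 - ∫ x, g x ∂m.1| ≤ δ * ∫ x, χ x ∂m.1 := by
  rw [← integral_sub (m.integrable f) (m.integrable g), ← integral_const_mul, ← Real.norm_eq_abs]
  exact norm_integral_le_of_norm_le ((m.integrable χ).const_mul δ) (ae_of_all _ hfg)

/-- The family consists of cutoffs χ_n along a compact exhaustion and the products χ_n D_k with D_k
dense in C(Ω) for the compact-open topology. A test function f supported where χ_n = 1 satisfies |f
− χ_n D_k| ≤ δχ_n for some k, and the error δ∫χ_n dm is controlled because ∫χ_n dm is itself one of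
the coordinates. -/
theorem exists_seq_isInducing_vague [T2Space Ω] [LocallyCompactSpace Ω]
    [SecondCountableTopology Ω] : ∃ φ : ℕ → C_c(Ω, ℝ),
      IsInducing fun (m : RadonMeasure Ω) (n : ℕ) => ∫ x, φ n x ∂m.1 := by
  set E : CompactExhaustion Ω := default
  have hχ : ∀ n, ∃ χ : C_c(Ω, ℝ), (∀ x ∈ E n, χ x = 1) ∧ ∀ x, 0 ≤ χ x := fun n => by
    obtain ⟨f, hf1, hf2, -, hf3⟩ := exists_continuousMap_one_of_isCompact_subset_isOpen
      (E.isCompact n) isOpen_univ (subset_univ _)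
    exact ⟨⟨f, hf2⟩, fun x hx => hf1 hx, fun x => (hf3 x).1⟩
  choose χ hχ1 hχ0 using hχ
  set D : ℕ → C(Ω, ℝ) := TopologicalSpace.denseSeq C(Ω, ℝ)
  obtain ⟨e, he⟩ := exists_surjective_nat (ℕ × Option ℕ)
  -- The value `none` stands for the cutoff itself, `some k` for its product with the k-th dense
  -- function.
  set φ' : ℕ × Option ℕ → C_c(Ω, ℝ) := fun i => i.2.elim (χ i.1) fun k => cutoffMul (χ i.1) (D k)
  refine ⟨fun n => φ' (e n), isInducing_iff_nhds.2 fun m₀ => le_antisymm ?_ ?_⟩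
  · refine (Continuous.tendsto ?_ m₀).le_comap
    exact continuous_pi fun n => continuous_integral_vague _
  rw [nhds_vague m₀, ← tendsto_iff_comap, tendsto_pi_nhds]
  intro f
  set l := comap (fun (m : RadonMeasure Ω) (n : ℕ) => ∫ x, φ' (e n) x ∂m.1)
    (𝓝 fun n => ∫ x, φ' (e n) x ∂m₀.1) with hl
  have hφ : ∀ i, Tendsto (fun m : RadonMeasure Ω => ∫ x, φ' i x ∂m.1) l
      (𝓝 (∫ x, φ' i x ∂m₀.1)) := by
    intro i
    obtain ⟨n, rfl⟩ := he i
    exact tendsto_pi_nhds.1 (tendsto_comap (f := fun (m : RadonMeasure Ω) (n : ℕ) => ∫ x, φ' (e n) x ∂m.1)) n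
  obtain ⟨n, hn⟩ := E.exists_superset_of_isCompact f.hasCompactSupport.isCompact
  set c := ∫ x, χ n x ∂m₀.1 with hc
  have hc0 : 0 ≤ c := integral_nonneg (hχ0 n)
  rw [Metric.tendsto_nhds]
  intro ε hε
  set δ := ε / (2 * c + 2) with hδ
  have hδ0 : 0 < δ := by positivity
  obtain ⟨k, hk⟩ : ∃ k, ∀ x ∈ tsupport (χ n), |f x - D k x| < δ := by
    have ho : IsOpen {u : C(Ω, ℝ) | MapsTo (f.toContinuousMap - u) (tsupport (χ n))
        (Metric.ball 0 δ)} :=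
      (ContinuousMap.isOpen_setOfPred_mapsTo (χ n).hasCompactSupport Metric.isOpen_ball).preimage
        (continuous_const.sub continuous_id)
    obtain ⟨k, hk⟩ := (TopologicalSpace.denseRange_denseSeq C(Ω, ℝ)).exists_mem_open ho
      ⟨f.toContinuousMap, fun x _ => by simpa using hδ0⟩
    exact ⟨k, fun x hx => by simpa using hk hx⟩
  have hfg : ∀ x, |f x - cutoffMul (χ n) (D k) x| ≤ δ * χ n x := by
    intro x
    have h1 : f x = χ n x * f x := by
      by_cases hx : x ∈ tsupport f
      · rw [hχ1 n x (hn hx), one_mul]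
      · rw [image_eq_zero_of_notMem_tsupport hx, mul_zero]
    rw [cutoffMul_apply, h1, ← mul_sub, abs_mul, abs_of_nonneg (hχ0 n x), mul_comm]
    by_cases hx : x ∈ tsupport (χ n)
    · exact mul_le_mul_of_nonneg_right (hk x hx).le (hχ0 n x)
    · simp [image_eq_zero_of_notMem_tsupport hx]
  filter_upwards [Metric.tendsto_nhds.1 (hφ (n, none)) 1 one_pos,
    Metric.tendsto_nhds.1 (hφ (n, some k)) δ hδ0] with m h1 h2
  rw [Real.dist_eq] at h1 h2 ⊢
  simp only [φ', Option.elim] at h1 h2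
  have h3 := abs_integral_sub_le hfg m
  have h4 := abs_integral_sub_le hfg m₀
  have h5 : δ * ∫ x, χ n x ∂m.1 ≤ δ * (c + 1) :=
    mul_le_mul_of_nonneg_left (by linarith [(abs_lt.1 h1).2]) hδ0.le
  have h6 : δ * (2 * c + 2) = ε := by rw [hδ]; field_simp
  rw [abs_le] at h3 h4
  rw [abs_lt] at h2 ⊢
  constructor <;> nlinarith

/-- Every vaguely open set is the preimage of an open set of ℕ → ℝ under countably many integrals,
and there the Borel and product σ-algebras agree. -/
theorem measurable_of_measurable_integral [T2Space Ω] [LocallyCompactSpace Ω]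
    [SecondCountableTopology Ω] {S : Type*} [MeasurableSpace S] {Y : S → RadonMeasure Ω}
    (hY : ∀ f : C_c(Ω, ℝ), Measurable fun s => ∫ x, f x ∂(Y s).1) : Measurable Y := by
  obtain ⟨φ, hφ⟩ := exists_seq_isInducing_vague (Ω := Ω)
  have h2 : Measurable fun s (n : ℕ) => ∫ x, φ n x ∂(Y s).1 := measurable_pi_lambda _ fun n => hY _
  refine measurable_of_isOpen fun U hU => ?_
  obtain ⟨V, hV, rfl⟩ := hφ.isOpen_iff.1 hU
  exact h2 hV.measurableSet

variable {S : ℕ → Type*} [∀ N, MeasurableSpace (S N)] {P : ∀ N, Measure (S N)}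
  [∀ N, IsProbabilityMeasure (P N)] {T : Type*} [MeasurableSpace T] {Q : Measure T}
  [IsProbabilityMeasure Q]

/-- Random Radon measures that agree asymptotically in `L¹` against test functions have the same
limits in distribution. -/
theorem tendstoInDistribution_vague_of_lintegral_sub [T2Space Ω] [LocallyCompactSpace Ω]
    [SecondCountableTopology Ω] {X Y : ∀ N, S N → RadonMeasure Ω} {Z : T → RadonMeasure Ω}
    (h : TendstoInDistribution X atTop Z P Q) (hY : ∀ N, AEMeasurable (Y N) (P N))
    (hXY : ∀ f : C_c(Ω, ℝ), Tendsto (fun N => ∫⁻ s, ‖∫ x, f x ∂(Y N s).1 - ∫ x, f x ∂(X N s).1‖ₑ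
      ∂(P N)) atTop (𝓝 0)) :
    TendstoInDistribution Y atTop Z P Q := by
  obtain ⟨φ, hφ⟩ := exists_seq_isInducing_vague (Ω := Ω)
  -- This distance is a sum of terms capped at 2^{-n}, so its expectation converges by dominated
  -- convergence in n once each coordinate difference vanishes in L¹.
  let m₀ : PseudoEMetricSpace (ℕ → ℝ) := PiCountable.pseudoEMetricSpace
  let m : PseudoEMetricSpace (RadonMeasure Ω) := PseudoEMetricSpace.induced
    (fun (m : RadonMeasure Ω) (n : ℕ) => ∫ x, φ n x ∂m.1) m₀
  refine tendstoInDistribution_of_tendsto_lintegral_edist m hφ.eq_induced h hY ?_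
  have e : ∀ N s, m.edist (Y N s) (X N s) = ∑' n, min (2⁻¹ ^ n)
      ‖∫ x, φ n x ∂(Y N s).1 - ∫ x, φ n x ∂(X N s).1‖ₑ := fun N s => by
    simp only [← edist_eq_enorm_sub]
    rfl
  have hm : ∀ N n, AEMeasurable (fun s => min ((2⁻¹ : ENNReal) ^ n)
      ‖∫ x, φ n x ∂(Y N s).1 - ∫ x, φ n x ∂(X N s).1‖ₑ) (P N) := fun N n =>
    aemeasurable_const.min (((measurable_integral_vague (φ n)).comp_aemeasurable (hY N)).sub
      ((measurable_integral_vague (φ n)).comp_aemeasurable (h.forall_aemeasurable N))).enorm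
  change Tendsto (fun N => ∫⁻ s, m.edist (Y N s) (X N s) ∂(P N)) atTop (𝓝 0)
  simp_rw [e]
  simp_rw [lintegral_tsum (hm _), ← lintegral_count]
  have h0 : ∫⁻ _ : ℕ, (0 : ENNReal) ∂Measure.count = 0 := lintegral_zero
  rw [← h0]
  refine tendsto_lintegral_of_dominated_convergence (fun n => 2⁻¹ ^ n) (fun N => measurable_of_countable _)
    (fun N => ae_of_all _ fun n => ?_) ?_ (ae_of_all _ fun n => ?_)
  · refine (lintegral_mono fun s => min_le_left _ _).trans ?_
    simp
  · rw [lintegral_count, ENNReal.tsum_geometric]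
    simp
  · exact tendsto_of_tendsto_of_tendsto_of_le_of_le tendsto_const_nhds (hXY (φ n))
      (fun _ => zero_le) fun N => lintegral_mono fun s => min_le_right _ _

end VagueTopology

/-! ### Random Radon measures with a density -/

section RandomMeasures

variable {Ω : Type*} [MetricSpace Ω] [MeasurableSpace Ω] [BorelSpace Ω] [SecondCountableTopology Ω]
  [LocallyCompactSpace Ω] {vol : Measure Ω} [SFinite vol]

lemma cutoffMul_exp_eq (f : C_c(Ω, ℝ)) (m : RadonMeasure Ω) (γ : ℝ) {g : Ω → ℝ} (hg : Continuous g) :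
    ∫ x, f x ∂(m.tilt γ hg).1 = ∫ x, cutoffMul f ⟨fun x => Real.exp (-γ * g x),
      Real.continuous_exp.comp (continuous_const.mul hg)⟩ x ∂m.1 :=
  integral_tilt m γ hg f

/-- Testing the tilted measure against f is testing the original one against f e^{-γg}, again a test
function. -/
lemma continuous_tilt (γ : ℝ) {g : Ω → ℝ} (hg : Continuous g) :
    Continuous fun m : RadonMeasure Ω => m.tilt γ hg := by
  refine continuous_induced_rng.2 (continuous_pi fun f => ?_)
  exact (continuous_integral_vague _).congr fun m => (cutoffMul_exp_eq f m γ hg).symm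

/-- The parameters for which the measure is locally finite form a measurable set, cut out by a
compact exhaustion. Off this set the default measure 0 is used; on it the integral of f is a
difference of measurable Lebesgue integrals. -/
lemma measurable_toRadon_withDensity {S : Type*} [MeasurableSpace S] {D : S × Ω → ENNReal}
    (hD : Measurable D) : Measurable fun s => toRadon (vol.withDensity fun x => D (s, x)) := by
  refine measurable_of_measurable_integral fun f => ?_
  have hDs : ∀ s, Measurable fun x => D (s, x) := fun s => hD.comp measurable_prodMk_left
  set E : CompactExhaustion Ω := default
  set A : Set S := {s | ∀ n, ∫⁻ x in E n, D (s, x) ∂vol < ⊤} with hA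
  have hAm : MeasurableSet A := by
    have : A = ⋂ n, {s | ∫⁻ x in E n, D (s, x) ∂vol < ⊤} := by ext; simp [A]
    rw [this]
    exact MeasurableSet.iInter fun n =>
      measurableSet_lt (hD.lintegral_prod_right' (ν := vol.restrict (E n))) measurable_const
  have hAiff : ∀ s, s ∈ A ↔ IsLocallyFiniteMeasure (vol.withDensity fun x => D (s, x)) := fun s => by
    rw [isLocallyFiniteMeasure_iff_compactExhaustion E]
    refine forall_congr' fun n => ?_
    rw [withDensity_apply _ (E.isCompact n).isClosed.measurableSet]
  have hL : ∀ u : Ω → ENNReal, Measurable u →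
      Measurable fun s => ∫⁻ x, u x ∂(vol.withDensity fun x => D (s, x)) := fun u hu => by
    have h1 : Measurable fun p : S × Ω => D p * u p.2 := hD.mul (hu.comp measurable_snd)
    simp_rw [lintegral_withDensity_eq_lintegral_mul _ (hDs _) hu]
    exact h1.lintegral_prod_right' (ν := vol)
  have hf := f.continuous.measurable
  have h2 : (fun s => ∫ x, f x ∂(toRadon (vol.withDensity fun x => D (s, x))).1) =
      A.indicator fun s =>
        (∫⁻ x, ENNReal.ofReal (f x) ∂(vol.withDensity fun x => D (s, x))).toReal -
        (∫⁻ x, ENNReal.ofReal (-f x) ∂(vol.withDensity fun x => D (s, x))).toReal := by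
    ext s
    by_cases hs : s ∈ A
    · have hlf := (hAiff s).1 hs
      rw [indicator_of_mem hs]
      exact (congrArg (fun m => ∫ x, f x ∂m) (toRadon_of_isLocallyFinite hlf)).trans
        (integral_eq_lintegral_pos_part_sub_lintegral_neg_part
          (f.continuous.integrable_of_hasCompactSupport f.hasCompactSupport))
    · have h3 := toRadon_of_not_isLocallyFinite fun hc => hs ((hAiff s).2 hc)
      rw [indicator_of_notMem hs]
      exact (congrArg (fun m => ∫ x, f x ∂m) h3).trans (integral_zero_measure _)
  rw [h2]
  exact ((hL _ hf.ennreal_ofReal).ennreal_toReal.sub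
    (hL _ hf.neg.ennreal_ofReal).ennreal_toReal).indicator hAm

variable {S : Type*} [MeasurableSpace S] {P : Measure S} [SFinite P] {X : S → Ω → ℝ} {γ : ℝ}

lemma measurable_toRadon_thickMeasure (hX : Measurable fun q : S × Ω => X q.1 q.2) {g : Ω → ℝ}
    (hg : Measurable g) (N : ℕ) : Measurable fun s => toRadon (thickMeasure P vol X γ g N s) := by
  have h1 : MeasurableSet {q : S × Ω | γ * Real.log N + g q.2 ≤ X q.1 q.2} :=
    measurableSet_le (measurable_const.add (hg.comp measurable_snd)) hX
  have h2 : MeasurableSet {q : S × Ω | γ * Real.log N ≤ X q.1 q.2} :=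
    measurableSet_le measurable_const hX
  have h3 : Measurable fun x => P {s | γ * Real.log N ≤ X s x} := measurable_measure_prodMk_right h2
  have h4 : Measurable fun q : S × Ω =>
      {y | γ * Real.log N + g y ≤ X q.1 y}.indicator (1 : Ω → ENNReal) q.2 /
        P {s | γ * Real.log N ≤ X s q.2} := by
    refine Measurable.div ?_ (h3.comp measurable_snd)
    simp only [indicator, mem_ofPred_eq, Pi.one_apply]
    exact Measurable.ite h1 measurable_const measurable_const
  have h5 := measurable_toRadon_withDensity (vol := vol) h4
  have e : (fun s => toRadon (thickMeasure P vol X γ g N s)) = fun s => toRadon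
      (vol.withDensity fun x => {y | γ * Real.log N + g y ≤ X s y}.indicator (1 : Ω → ENNReal) x /
        P {s | γ * Real.log N ≤ X s x}) := rfl
  rw [e]
  exact h5

lemma measurable_toRadon_exponentialMeasure (hX : Measurable fun q : S × Ω => X q.1 q.2) :
    Measurable fun s => toRadon (exponentialMeasure P vol X γ s) := by
  have h1 : Measurable fun q : S × Ω => ENNReal.ofReal (Real.exp (γ * X q.1 q.2)) :=
    (hX.const_mul γ).exp.ennreal_ofReal
  have h2 : Measurable fun x => ∫⁻ s, ENNReal.ofReal (Real.exp (γ * X s x)) ∂P :=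
    h1.lintegral_prod_left' (μ := P)
  have h3 : Measurable fun q : S × Ω => ENNReal.ofReal (Real.exp (γ * X q.1 q.2)) /
      ∫⁻ s, ENNReal.ofReal (Real.exp (γ * X s q.2)) ∂P := h1.div (h2.comp measurable_snd)
  have h4 := measurable_toRadon_withDensity (vol := vol) h3
  have e : (fun s => toRadon (exponentialMeasure P vol X γ s)) = fun s => toRadon
      (vol.withDensity fun x => ENNReal.ofReal (Real.exp (γ * X s x)) /
        ∫⁻ s, ENNReal.ofReal (Real.exp (γ * X s x)) ∂P) := rfl
  rw [e]
  exact h4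

end RandomMeasures

/-- Convergence in probability is stable under perturbations that are small in `L¹`. -/
lemma tendstoInMeasure_of_lintegral_sub {S : ℕ → Type*} [∀ N, MeasurableSpace (S N)]
    {P : ∀ N, Measure (S N)} {T : Type*} [MeasurableSpace T] {Q : Measure T} {π : ∀ N, T → S N}
    (hπ : ∀ N, MeasurePreserving (π N) Q (P N)) {a b : ∀ N, S N → ℝ} {c : T → ℝ}
    (ha : ∀ N, Measurable (a N)) (hb : ∀ N, Measurable (b N))
    (hab : Tendsto (fun N => ∫⁻ s, ‖a N s - b N s‖ₑ ∂(P N)) atTop (𝓝 0))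
    (hbc : TendstoInMeasure Q (fun N t => b N (π N t)) atTop c) :
    TendstoInMeasure Q (fun N t => a N (π N t)) atTop c := by
  have hm : ∀ N, Measurable fun s => ‖a N s - b N s‖ₑ := fun N => ((ha N).sub (hb N)).enorm
  refine tendstoInMeasure_of_ne_top fun ε hε hεt => ?_
  have hε2 : ε / 2 ≠ 0 := (ENNReal.half_pos hε.ne').ne'
  have hε2t : ε / 2 ≠ ⊤ := ENNReal.div_ne_top hεt two_ne_zero
  -- The deviation ε is halved: Markov's inequality handles a − b, and convergence in probability
  -- handles b − c.
  have h1 : Tendsto (fun N => (∫⁻ s, ‖a N s - b N s‖ₑ ∂(P N)) / (ε / 2) +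
      Q {t | ε / 2 ≤ edist (b N (π N t)) (c t)}) atTop (𝓝 0) := by
    have h2 := (ENNReal.Tendsto.div_const hab (Or.inr hε2)).add
      (hbc (ε / 2) (ENNReal.half_pos hε.ne'))
    simpa using h2
  refine tendsto_of_tendsto_of_tendsto_of_le_of_le tendsto_const_nhds h1 (fun _ => zero_le)
    fun N => ?_
  rw [← (hπ N).lintegral_comp (hm N)]
  have h3 := meas_ge_le_lintegral_div ((hm N).comp (hπ N).measurable).aemeasurable (μ := Q) hε2 hε2t
  refine le_trans ?_ (add_le_add_left h3 _)
  refine (measure_mono fun t ht => ?_).trans (measure_union_le _ _)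
  by_contra hcon
  simp only [mem_union, mem_ofPred_eq, not_or, not_le, Function.comp_apply] at hcon ht
  have h4 := ht.trans (edist_triangle (a N (π N t)) (b N (π N t)) (c t))
  rw [edist_eq_enorm_sub (a N (π N t))] at h4
  have h5 := h4.trans_lt (ENNReal.add_lt_add hcon.1 hcon.2)
  rw [ENNReal.add_halves] at h5
  exact h5.false

/-! ### The two modes of convergence. -/

section Conclusion

variable {d : ℕ} {H : Type*} [TopologicalSpace H] {I : ModelWithCorners ℝ (EuclideanSpace ℝ (Fin d)) H}
  {Ω : Type*} [MetricSpace Ω] [MeasurableSpace Ω] [BorelSpace Ω] [SecondCountableTopology Ω]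
  [ChartedSpace H Ω] {vol : Measure Ω}
  {h : Ω → Ω → ℝ} {ρ : ℝ → Ω → Ω → ℝ} {S : ℕ → Type*} [∀ N, MeasurableSpace (S N)]
  {P : ∀ N, Measure (S N)} [∀ N, IsProbabilityMeasure (P N)] {XN : ∀ N, S N → Ω → ℝ}
  {Ψ : ℂ → Ω → ℂ} {γ : ℝ} {T : Type*} [MeasurableSpace T] {Q : Measure T} [IsProbabilityMeasure Q]
  {M : T → RadonMeasure Ω}

theorem MesoscopicAssumption.tendstoInDistribution_thickMeasure
    (hm : MesoscopicAssumption d P vol h ρ XN Ψ) (hΩ : IsLocallyEuclidean I vol)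
    (hρ : IsApproximateIdentity vol ρ) (h_cov : CovarianceAssumption vol h ρ)
    (hX : ∀ N, Measurable fun q : S N × Ω => XN N q.1 q.2)
    (h_cont : Continuous (fun p : Ω × Ω => h p.1 p.2)) (h_symm : ∀ x y, h x y = h y x)
    (hγ : γ ∈ Ioo 0 √(2 * d)) {g : Ω → ℝ} (hg : Continuous g)
    (hν : ∀ᶠ N in atTop, ∀ᵐ s ∂(P N),
      IsLocallyFiniteMeasure (thickMeasure (P N) vol (XN N) γ g N s))
    (hμ : TendstoInDistribution (fun N s => toRadon (exponentialMeasure (P N) vol (XN N) γ s)) atTop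
      M P Q) :
    TendstoInDistribution (fun N s => toRadon (thickMeasure (P N) vol (XN N) γ g N s)) atTop
      (fun t => (M t).tilt γ hg) P Q := by
  have := hΩ.isLocallyFiniteMeasure
  have : LocallyCompactSpace Ω :=
    have : LocallyCompactSpace H := I.locallyCompactSpace
    ChartedSpace.locallyCompactSpace H Ω
  exact tendstoInDistribution_vague_of_lintegral_sub (hμ.continuous_comp (continuous_tilt γ hg))
    (fun N => (measurable_toRadon_thickMeasure (hX N) hg.measurable N).aemeasurable)
    fun f => hm.tendsto_lintegral_integral_sub hΩ hρ h_cov hX h_cont h_symm hγ hg hν f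

theorem MesoscopicAssumption.tendstoInProbabilityVaguely_thickMeasure
    (hm : MesoscopicAssumption d P vol h ρ XN Ψ) (hΩ : IsLocallyEuclidean I vol)
    (hρ : IsApproximateIdentity vol ρ) (h_cov : CovarianceAssumption vol h ρ)
    (hX : ∀ N, Measurable fun q : S N × Ω => XN N q.1 q.2)
    (h_cont : Continuous (fun p : Ω × Ω => h p.1 p.2)) (h_symm : ∀ x y, h x y = h y x)
    (hγ : γ ∈ Ioo 0 √(2 * d)) {g : Ω → ℝ} (hg : Continuous g)
    (hν : ∀ᶠ N in atTop, ∀ᵐ s ∂(P N),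
      IsLocallyFiniteMeasure (thickMeasure (P N) vol (XN N) γ g N s))
    {π : ∀ N, T → S N} (hπ : ∀ N, MeasurePreserving (π N) Q (P N))
    (hμ : TendstoInProbabilityVaguely Q
      (fun N t => toRadon (exponentialMeasure (P N) vol (XN N) γ (π N t))) M) :
    TendstoInProbabilityVaguely Q
      (fun N t => toRadon (thickMeasure (P N) vol (XN N) γ g N (π N t)))
      (fun t => (M t).tilt γ hg) := by
  have := hΩ.isLocallyFiniteMeasure
  have : LocallyCompactSpace Ω :=
    have : LocallyCompactSpace H := I.locallyCompactSpace
    ChartedSpace.locallyCompactSpace H Ω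
  intro f
  have h1 := hμ (cutoffMul f ⟨fun x => Real.exp (-γ * g x),
      Real.continuous_exp.comp (continuous_const.mul hg)⟩)
  have h2 : TendstoInMeasure Q (fun N t => ∫ x, f x ∂((toRadon (exponentialMeasure (P N) vol (XN N) γ
      (π N t))).tilt γ hg).1) atTop (fun t => ∫ x, f x ∂((M t).tilt γ hg).1) := by
    simp_rw [cutoffMul_exp_eq]
    exact h1
  exact tendstoInMeasure_of_lintegral_sub hπ
    (a := fun N s => ∫ x, f x ∂(toRadon (thickMeasure (P N) vol (XN N) γ g N s)).1)
    (b := fun N s => ∫ x, f x ∂((toRadon (exponentialMeasure (P N) vol (XN N) γ s)).tilt γ hg).1)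
    (fun N => (measurable_integral_vague f).comp
      (measurable_toRadon_thickMeasure (hX N) hg.measurable N))
    (fun N => (measurable_integral_vague f).comp ((continuous_tilt γ hg).measurable.comp
      (measurable_toRadon_exponentialMeasure (hX N))))
    (hm.tendsto_lintegral_integral_sub hΩ hρ h_cov hX h_cont h_symm hγ hg hν f) h2

end Conclusion

end ThickPoints

end

theorem corollary1p4
    -- the space with its distance and volume
    {d : ℕ} {H : Type*} [TopologicalSpace H] (I : ModelWithCorners ℝ (EuclideanSpace ℝ (Fin d)) H)
    {Ω : Type*} [MetricSpace Ω] [MeasurableSpace Ω] [BorelSpace Ω] [SecondCountableTopology Ω]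
    [ChartedSpace H Ω] [IsManifold I ∞ Ω] (vol : Measure Ω) (hΩ : IsLocallyEuclidean I vol)
    -- the log-correlated field
    (h : Ω → Ω → ℝ) (h_cont : Continuous (fun p : Ω × Ω => h p.1 p.2))
    (h_symm : ∀ x y, h x y = h y x)
    {S' : Type*} [MeasurableSpace S'] (P' : Measure S') [IsProbabilityMeasure P']
    (X : (Ω → ℝ) → S' → ℝ) (hX : IsLogCorrelatedField I vol h P' X)
    -- its approximations
    (ρ : ℝ → Ω → Ω → ℝ) (hρ : IsApproximateIdentity vol ρ)
    {S : ℕ → Type*} [∀ N, MeasurableSpace (S N)] (P : ∀ N, Measure (S N))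
    [∀ N, IsProbabilityMeasure (P N)] (XN : ∀ N, S N → Ω → ℝ)
    (hXN : IsApproximation I vol ρ P XN P' X)
    -- the three assumptions
    (h_cov : CovarianceAssumption vol h ρ)
    (Ψ : ℂ → Ω → ℂ)
    (h_meso : MesoscopicAssumption d P vol h ρ XN Ψ)
    (h_macro : MacroscopicAssumption d P vol h ρ XN Ψ)
    (γ : ℝ) (hγ : γ ∈ Ioo 0 √(2 * d)) (g : Ω → ℝ) (hg : Continuous g)
    -- the measures of thick points are random Radon measures
    (hν : ∀ᶠ N in atTop, ∀ᵐ s ∂(P N),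
      IsLocallyFiniteMeasure (thickMeasure (P N) vol (XN N) γ g N s))
    -- the limiting random measure, on a probability space `T`
    {T : Type*} [MeasurableSpace T] (Q : Measure T) [IsProbabilityMeasure Q]
    (M : T → RadonMeasure Ω) (hM : AEMeasurable M Q) :
    -- convergence in distribution
    (TendstoInDistribution (fun N s => toRadon (exponentialMeasure (P N) vol (XN N) γ s)) atTop M P Q →
      TendstoInDistribution (fun N s => toRadon (thickMeasure (P N) vol (XN N) γ g N s)) atTop
        (fun t => (M t).tilt γ hg) P Q) ∧
    -- convergence in probability, all fields being realized on the probability space `T`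
    (∀ π : ∀ N, T → S N, (∀ N, MeasurePreserving (π N) Q (P N)) →
      TendstoInProbabilityVaguely Q
        (fun N t => toRadon (exponentialMeasure (P N) vol (XN N) γ (π N t))) M →
      TendstoInProbabilityVaguely Q
        (fun N t => toRadon (thickMeasure (P N) vol (XN N) γ g N (π N t)))
        (fun t => (M t).tilt γ hg)) := by
  exact ⟨fun hμ => h_meso.tendstoInDistribution_thickMeasure hΩ hρ h_cov hXN.measurable h_cont h_symm
      hγ hg hν hμ,
    fun _ hπ hμ => h_meso.tendstoInProbabilityVaguely_thickMeasure hΩ hρ h_cov hXN.measurable h_cont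
      h_symm hγ hg hν hπ hμ⟩
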